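/- Let $n\in\{3,4,5,6\}$ and $T=\mathbb R^n$. **Exceptional data.** Put $E_0=T\oplus\Lambda^2T^*\oplus\Lambda^5T^*$ and $N_0=T^*\oplus\Lambda^4T^*\oplus(T^*\otimes\Lambda^6T^*)$, with the symmetric bilinear map $(u,v)\mapsto(u\otimes v)_N$ from $E_0\times E_0$ to $N_0$ determined, for $u=X+\sigma_2+\sigma_5$, by $$(u\otimes u)_N=2\,i_X\sigma_2+(2\,i_X\sigma_5-\sigma_2\wedge\sigma_2)+2\,j\sigma_2\wedge\sigma_5,\qquad (j\sigma_2\wedge\sigma_5)(Y)=(i_Y\sigma_2)\wedge\sigma_5 .$$ The map $(\xi,k)\mapsto(\xi\otimes k)_E$ from $E_0^*\times N_0$ to $E_0$ is defined by $\langle(\xi\otimes k)_E,\zeta\rangle=\langle k,(\xi\otimes\zeta)_{N^*}\rangle$ for $\zeta\in E_0^*$, where $E_0^*\times E_0^*\to N_0^*$ is given by the same formula with $T$ and $T^*$ interchanged. Let $\mathsf G=\mathsf E_{n(n)}\times\mathbb R^+\subset \mathsf{GL}(E_0)$ be the connected subgroup with Lie algebra $\mathfrak g=\mathfrak e_{n(n)}\oplus\mathbb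 R=\mathbb R\oplus\mathfrak{gl}(T)\oplus\Lambda^3T^*\oplus\Lambda^6T^*\oplus\Lambda^3T\oplus\Lambda^6T$, where $\mathbb R$ acts by scalars, $\mathfrak{gl}(T)$ acts naturally, and $a_3\cdot u=i_Xa_3+a_3\wedge\sigma_2$, $a_6\cdot u=i_Xa_6$, $w_3\cdot u=\iota_{w_3}(\sigma_2+\sigma_5)$, $w_6\cdot u=-\iota_{w_6}\sigma_5$. The group $\mathsf G$ acts on $N_0$ by $g(u\otimes v)_N=(gu\otimes gv)_N$. **Elgebroids.** An elgebroid over a smooth manifold $M$ consists of a principal $\mathsf G$-bundle over $M$ with associated vector bundles $E,N\to M$ (fibres $E_0,N_0$), an $\mathbb R$-bilinear bracket $[\cdot,\cdot]$ on $\Gamma(E)$, a vector bundle map $\rho\colon E\to TM$ and an $\mathbb R$-linear operator $\mathcal D\colon\Gamma(N)\to\Gamma(E)$ such that for all $u,v,w\in\Gamma(E)$, $k\in\Gamma(N)$, $f\in C^\infty(M)$ $$[u,[v,w]]=[[u,v],w]+[v,[u,w]],\qquad [u,fv]=f[u,v]+(\rho(u)f)v,$$ $$[u,v]+[v,u]=\mathcal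 D(u\otimes v)_N,\qquad \mathcal D(fk)=f\mathcal Dk+(\rho^t df\otimes k)_E,$$ and such that $[u,\cdot]$ preserves the $\mathsf G$-structure, i.e. in any local trivialisation of $E$ by a $\mathsf G$-frame, $[u,\cdot]-\rho(u)$ acts at every point as an element of $\mathfrak g$. It is M-exact if $\dim M=n$ and the sequence $$T^*M\otimes N\to E\xrightarrow{\ \rho\ }TM\to0,\qquad \alpha\otimes k\mapsto(\rho^t\alpha\otimes k)_E,$$ is exact at $E$ and at $TM$. **Exceptional tangent bundle.** Over an open set $W\subset\mathbb R^n$ it is $E=TW\oplus\Lambda^2T^*W\oplus\Lambda^5T^*W$, $N=T^*W\oplus\Lambda^4T^*W\oplus(T^*W\otimes\Lambda^6T^*W)$, with the $\mathsf G$-structure given by the coordinate trivialisation, with $\rho$ the projection to $TW$, with the bracket $$[X+\sigma_2+\sigma_5,X'+\sigma_2'+\sigma_5']=\mathcal L_XX'+(\mathcal L_X\sigma_2'-i_{X'}d\sigma_2)+(\mathcal L_X\sigma_5'-i_{X'}d\sigma_5-\sigma_2'\wedge d\sigma_2),$$ and with $\mathcal D$ equal to $d$ on the first two summands of $N$ and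 zero on the third. **Theorem.** Every M-exact elgebroid is locally isomorphic to the exceptional tangent bundle: every point of $M$ has an open neighbourhood $U$ with a diffeomorphism $U\to W$ onto an open set $W\subset\mathbb R^n$, covered by smooth vector bundle isomorphisms from $E|_U$ and $N|_U$ to the bundles $E$ and $N$ of the exceptional tangent bundle over $W$, which map $\mathsf G$-frames to $\mathsf G$-frames and intertwine the anchors, the brackets and the operators $\mathcal D$. -/

import Mathlib

open Bundle
open scoped Manifold ContDiff Topology TensorProduct

noncomputable section

namespace Elg

/-! ## Exterior algebra on `T = ℝⁿ` -/

/-- `T = ℝⁿ`. -/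
abbrev T (n : ℕ) : Type := EuclideanSpace ℝ (Fin n)

/-- `Λᵏ T*`, as alternating `k`-linear forms on `T`. -/
abbrev Form (n k : ℕ) : Type := T n [⋀^Fin k]→L[ℝ] ℝ

/-- The wedge product of forms (the sum over shuffles, so that
`(e¹ ∧ ⋯ ∧ eᵏ)(e₁, …, eₖ) = 1`). -/
def wedge {n k l : ℕ} (a : Form n k) (b : Form n l) : Form n (k + l) :=
  { ((LinearMap.mul' ℝ ℝ).compAlternatingMap
      (a.toAlternatingMap.domCoprod b.toAlternatingMap)).domDomCongr finSumFinEquiv with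
    cont := by
      have h : ∀ v : Fin (k + l) → T n,
          ((LinearMap.mul' ℝ ℝ).compAlternatingMap
            (a.toAlternatingMap.domCoprod b.toAlternatingMap)).domDomCongr finSumFinEquiv v
          = ∑ σ : Equiv.Perm.ModSumCongr (Fin k) (Fin l), LinearMap.mul' ℝ ℝ
            (AlternatingMap.domCoprod.summand a.toAlternatingMap b.toAlternatingMap σ
              (fun i => v (finSumFinEquiv i))) := by
        intro v
        simp [AlternatingMap.domCoprod_apply]
        rfl
      show Continuous fun v => ((LinearMap.mul' ℝ ℝ).compAlternatingMap
            (a.toAlternatingMap.domCoprod b.toAlternatingMap)).domDomCongr finSumFinEquiv v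
      simp only [h]
      refine continuous_finsetSum _ fun σ _ => ?_
      induction σ using Quotient.inductionOn' with
      | h σ =>
        have hc : Continuous fun v : Fin (k + l) → T n =>
            a (fun i => v (finSumFinEquiv (σ (Sum.inl i)))) *
              b (fun i => v (finSumFinEquiv (σ (Sum.inr i)))) :=
          (a.cont.comp (by fun_prop)).mul (b.cont.comp (by fun_prop))
        rcases Int.units_eq_one_or (Equiv.Perm.sign σ) with hs | hs
        · simpa [AlternatingMap.domCoprod.summand_mk'', hs] using hc
        · have hc' : Continuous fun v : Fin (k + l) → T n =>
              -(a (fun i => v (finSumFinEquiv (σ (Sum.inl i)))) *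
                b (fun i => v (finSumFinEquiv (σ (Sum.inr i))))) := hc.neg
          simpa [AlternatingMap.domCoprod.summand_mk'', hs, -continuous_neg_iff] using hc' }

theorem wedge_apply {n k l : ℕ} (a : Form n k) (b : Form n l) (v : Fin (k + l) → T n) :
    wedge a b v = LinearMap.mul' ℝ ℝ (AlternatingMap.domCoprod' (R' := ℝ)
      (a.toAlternatingMap ⊗ₜ[ℝ] b.toAlternatingMap) (fun i => v (finSumFinEquiv i))) :=
  rfl

theorem wedge_add_left {n k l : ℕ} (a a₁ : Form n k) (b : Form n l) :
    wedge (a + a₁) b = wedge a b + wedge a₁ b := by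
  ext v
  simp only [wedge_apply, ContinuousAlternatingMap.add_apply,
    ContinuousAlternatingMap.toAlternatingMap_add, TensorProduct.add_tmul, map_add,
    AlternatingMap.add_apply]

theorem wedge_smul_left {n k l : ℕ} (c : ℝ) (a : Form n k) (b : Form n l) :
    wedge (c • a) b = c • wedge a b := by
  ext v
  simp only [wedge_apply, ContinuousAlternatingMap.smul_apply,
    ContinuousAlternatingMap.toAlternatingMap_smul, ← TensorProduct.smul_tmul', map_smul,
    AlternatingMap.smul_apply]

/-- The interior product `i_X σ` (`X` is inserted into the first slot of `σ`). -/
def ins {n k : ℕ} (X : T n) (σ : Form n (k + 1)) : Form n k := σ.curryLeft X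

/-- A covector as a 1-form. -/
def oneForm {n : ℕ} (a : T n →L[ℝ] ℝ) : Form n 1 :=
  ContinuousAlternatingMap.ofSubsingleton ℝ (T n) ℝ 0 a

/-- The standard basis vector `eᵢ` of `T`. -/
def vec {n : ℕ} (i : Fin n) : T n := EuclideanSpace.single i 1

/-- The dual basis covector `eⁱ`, as a 1-form. -/
def covec {n : ℕ} (i : Fin n) : Form n 1 := oneForm (EuclideanSpace.proj i)

/-! ## The exceptional group data set -/

/-- The representation space `E = T ⊕ Λ²T* ⊕ Λ⁵T*`. -/
abbrev EMod (n : ℕ) : Type := T n × Form n 2 × Form n 5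

/-- The representation space `N = T* ⊕ Λ⁴T* ⊕ (T* ⊗ Λ⁶T*)`; an element of the last summand is
viewed as a linear map `T → Λ⁶T*`. -/
abbrev NMod (n : ℕ) : Type := Form n 1 × Form n 4 × (T n →L[ℝ] Form n 6)

/-- The map `T → Λ⁶T*`, `Y ↦ (i_Y σ₂) ∧ σ₅`. -/
def jWedge {n : ℕ} (s : Form n 2) (t : Form n 5) : T n →L[ℝ] Form n 6 :=
  LinearMap.toContinuousLinearMap
    { toFun := fun Y => (wedge (ins Y s) t : Form n 6)
      map_add' := fun Y Z => by simp only [ins, map_add, wedge_add_left]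
      map_smul' := fun c Y => by simp only [ins, map_smul, wedge_smul_left, RingHom.id_apply] }

/-- The symmetric bilinear map `E × E → N`, `(u, v) ↦ (u ⊗ v)_N`, i.e. the polarisation of
`u ⊗ u ↦ 2 i_X σ₂ + (2 i_X σ₅ - σ₂ ∧ σ₂) + 2 j σ₂ ∧ σ₅`. -/
def prodN {n : ℕ} (u v : EMod n) : NMod n :=
  (ins u.1 v.2.1 + ins v.1 u.2.1,
   ins u.1 v.2.2 + ins v.1 u.2.2 - (wedge u.2.1 v.2.1 : Form n 4),
   jWedge u.2.1 v.2.2 + jWedge v.2.1 u.2.2)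

/-- The map `E* × N → E`, `(ξ, k) ↦ (ξ ⊗ k)_E`, obtained from `N → S²E`. The dual map
`S²E* → N*` is given on `E* = T* ⊕ Λ²T ⊕ Λ⁵T` by the same formula as `prodN`,
`ζ ⊗ ζ ↦ 2 i_α w₂ + (2 i_α w₅ - w₂ ∧ w₂) + 2 j w₂ ∧ w₅` for `ζ = α + w₂ + w₅`, and `(ξ ⊗ k)_E` is
determined by `⟨(ξ ⊗ k)_E, ζ⟩ = ⟨k, (ξ ⊗ ζ)_{N*}⟩`; this is the normalisation for which
`v ↦ ⟨ξ, v⟩ u - (ξ ⊗ (u ⊗ v)_N)_E` lies in the Lie algebra below for all `ξ ∈ E*`, `u ∈ E`.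
Here `α`, `w₂`, `w₅` are the restrictions of `ξ` to the three summands of `E`. -/
def prodE {n : ℕ} (ξ : EMod n →L[ℝ] ℝ) (k : NMod n) : EMod n :=
  let α : Form n 1 := oneForm (ξ.comp (ContinuousLinearMap.inl ℝ (T n) (Form n 2 × Form n 5)))
  let w₂ : Form n 2 → ℝ := fun σ => ξ (0, σ, 0)
  let w₅ : Form n 5 → ℝ := fun σ => ξ (0, 0, σ)
  (∑ i, (w₂ (wedge (covec i) k.1) + w₅ (wedge (covec i) k.2.1)) • vec i,
   (wedge α k.1 : Form n 2)
     - (1 / 2 : ℝ) • ∑ i, ∑ j,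
        w₂ (ins (vec j) (ins (vec i) k.2.1)) • (wedge (covec i) (covec j) : Form n 2)
     + ∑ i, ∑ j, w₅ (ins (vec j) (k.2.2 (vec i))) • (wedge (covec i) (covec j) : Form n 2),
   (wedge α k.2.1 : Form n 5)
     + ∑ i, ∑ j, w₂ (wedge (covec i) (covec j)) • (ins (vec j) (k.2.2 (vec i)) : Form n 5))

/-- The natural action of `A ∈ gl(T)` on forms: minus the derivative at the identity of the
pullback, `(A · σ)(v₁, …, vₖ) = - ∑ᵢ σ(v₁, …, A vᵢ, …, vₖ)`. -/
def glAct {n k : ℕ} (A : T n →L[ℝ] T n) (σ : Form n k) : Form n k :=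
  -(σ.fderivCompContinuousLinearMap (ContinuousLinearMap.id ℝ (T n)) A)

/-- The Lie algebra `𝔢ₙ₍ₙ₎ ⊕ ℝ = ℝ ⊕ gl(T) ⊕ Λ³T* ⊕ Λ⁶T* ⊕ Λ³T ⊕ Λ⁶T`, as a subspace of `End E`.
The summands act on `u = X + σ₂ + σ₅` by scalars, naturally, by
`a₃ · u = i_X a₃ + a₃ ∧ σ₂`, `a₆ · u = i_X a₆`, `w₃ · u = ι_{w₃} (σ₂ + σ₅)` and
`w₆ · u = - ι_{w₆} σ₅`; as decomposable multivectors span, only those are listed. -/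
def excLieAlg (n : ℕ) : Submodule ℝ (EMod n →L[ℝ] EMod n) :=
  Submodule.span ℝ
    ({ContinuousLinearMap.id ℝ (EMod n)}
    ∪ {x | ∃ A : T n →L[ℝ] T n, ∀ u, x u = (A u.1, glAct A u.2.1, glAct A u.2.2)}
    ∪ {x | ∃ a : Form n 3, ∀ u, x u = (0, ins u.1 a, (wedge a u.2.1 : Form n 5))}
    ∪ {x | ∃ a : Form n 6, ∀ u, x u = (0, 0, ins u.1 a)}
    ∪ {x | ∃ w : Fin 3 → T n, ∀ u, x u =
        (u.2.1 ![w 1, w 2] • w 0 + u.2.1 ![w 2, w 0] • w 1 + u.2.1 ![w 0, w 1] • w 2,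
          ins (w 2) (ins (w 1) (ins (w 0) u.2.2)), 0)}
    ∪ {x | ∃ w : Fin 6 → T n, ∀ u, x u =
        (-∑ i : Fin 6, ((-1 : ℝ) ^ (i : ℕ) * u.2.2 (i.removeNth w)) • w i, 0, 0)})

instance instIsTopologicalRingEnd (n : ℕ) : IsTopologicalRing (EMod n →L[ℝ] EMod n) :=
  NonUnitalSeminormedRing.toIsTopologicalRing (α := EMod n →L[ℝ] EMod n)

/-- The group `E_{n(n)} × ℝ⁺ ⊆ GL(E)`: the connected subgroup with Lie algebra `excLieAlg n`, that
is, the subgroup generated by the exponentials of its elements. -/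
def excGroup (n : ℕ) : Subgroup (EMod n ≃L[ℝ] EMod n) :=
  Subgroup.closure {g | ∃ x ∈ excLieAlg n, (g : EMod n →L[ℝ] EMod n) = NormedSpace.exp x}

/-- The group acting on `E` and `N` simultaneously: pairs `(g, h)` with `g ∈ E_{n(n)} × ℝ⁺` and `h`
the action of `g` on `N`, which is determined by `h (u ⊗ v)_N = (g u ⊗ g v)_N`. -/
def excPairs (n : ℕ) : Set ((EMod n ≃L[ℝ] EMod n) × (NMod n ≃L[ℝ] NMod n)) :=
  {p | p.1 ∈ excGroup n ∧ ∀ u v, p.2 (prodN u v) = prodN (p.1 u) (p.1 v)}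

/-! ## Elgebroids -/

section Bundles

variable {n m : ℕ} {M : Type*} [TopologicalSpace M] [ChartedSpace (EuclideanSpace ℝ (Fin m)) M]

/-- The derivative of `f` at `x` in the direction `X`. -/
def dirDeriv {V : Type*} [NormedAddCommGroup V] [NormedSpace ℝ V] (f : M → V) (x : M)
    (X : TangentSpace (𝓡 m) x) : V :=
  mfderiv (𝓡 m) 𝓘(ℝ, V) f x X

/-- The covector `d f` at `x`. -/
def covDeriv (f : M → ℝ) (x : M) : TangentSpace (𝓡 m) x →L[ℝ] ℝ :=
  mfderiv (𝓡 m) 𝓘(ℝ, ℝ) f x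

/-- Smooth sections. -/
abbrev Sec (m : ℕ) {M : Type*} [TopologicalSpace M] [ChartedSpace (EuclideanSpace ℝ (Fin m)) M]
    (F : Type*) [NormedAddCommGroup F] [NormedSpace ℝ F] (V : M → Type*)
    [TopologicalSpace (TotalSpace F V)] [∀ x, TopologicalSpace (V x)] [FiberBundle F V] : Type _ :=
  ContMDiffSection (𝓡 m) F ∞ V

/-- The product `f s` of a smooth function and a smooth section. -/
def smulSec {F : Type*} [NormedAddCommGroup F] [NormedSpace ℝ F] {V : M → Type*}
    [TopologicalSpace (TotalSpace F V)] [∀ x, TopologicalSpace (V x)] [FiberBundle F V]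
    [∀ x, AddCommGroup (V x)] [∀ x, Module ℝ (V x)] [VectorBundle ℝ F V]
    (f : C^∞⟮𝓡 m, M; 𝓘(ℝ, ℝ), ℝ⟯) (s : Sec m F V) : Sec m F V :=
  ⟨fun x => f x • s x, f.contMDiff.smul_section s.contMDiff⟩

variable {E : M → Type*} [∀ x, AddCommGroup (E x)] [∀ x, Module ℝ (E x)]
  [∀ x, TopologicalSpace (E x)] {N : M → Type*} [∀ x, AddCommGroup (N x)] [∀ x, Module ℝ (N x)]
  [∀ x, TopologicalSpace (N x)]

/-- A frame at `x`: identifications of `E_x` and `N_x` with the model spaces. -/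
abbrev Frame (n : ℕ) {M : Type*} (E N : M → Type*)
    [∀ x, AddCommGroup (E x)] [∀ x, Module ℝ (E x)] [∀ x, TopologicalSpace (E x)]
    [∀ x, AddCommGroup (N x)] [∀ x, Module ℝ (N x)] [∀ x, TopologicalSpace (N x)] (x : M) : Type _ :=
  (EMod n ≃L[ℝ] E x) × (NMod n ≃L[ℝ] N x)

/-- `(u ⊗ v)_N`, computed in a frame. -/
def Frame.prodN {x : M} (F : Frame n E N x) (u v : E x) : N x :=
  F.2 (Elg.prodN (F.1.symm u) (F.1.symm v))

/-- `(ξ ⊗ k)_E`, computed in a frame. -/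
def Frame.prodE {x : M} (F : Frame n E N x) (ξ : E x →L[ℝ] ℝ) (k : N x) : E x :=
  F.1 (Elg.prodE (ξ.comp (F.1 : EMod n →L[ℝ] E x)) (F.2.symm k))

variable [TopologicalSpace (TotalSpace (EMod n) E)] [FiberBundle (EMod n) E]
  [TopologicalSpace (TotalSpace (NMod n) N)] [FiberBundle (NMod n) N]

/-- The family `F` of frames is smooth over `U`. -/
def IsSmoothFrameOn (m : ℕ) {M : Type*} [TopologicalSpace M]
    [ChartedSpace (EuclideanSpace ℝ (Fin m)) M]
    {E : M → Type*} [∀ x, AddCommGroup (E x)] [∀ x, Module ℝ (E x)] [∀ x, TopologicalSpace (E x)]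
    {N : M → Type*} [∀ x, AddCommGroup (N x)] [∀ x, Module ℝ (N x)] [∀ x, TopologicalSpace (N x)]
    [TopologicalSpace (TotalSpace (EMod n) E)] [FiberBundle (EMod n) E]
    [TopologicalSpace (TotalSpace (NMod n) N)] [FiberBundle (NMod n) N]
    (U : Set M) (F : ∀ x, Frame n E N x) : Prop :=
  (∀ a : EMod n, ContMDiffOn (𝓡 m) ((𝓡 m).prod 𝓘(ℝ, EMod n)) ∞
    (fun x => (⟨x, (F x).1 a⟩ : TotalSpace (EMod n) E)) U) ∧
  (∀ b : NMod n, ContMDiffOn (𝓡 m) ((𝓡 m).prod 𝓘(ℝ, NMod n)) ∞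
    (fun x => (⟨x, (F x).2 b⟩ : TotalSpace (NMod n) N)) U)

end Bundles

/-- An elgebroid (an `E_{n(n)} × ℝ⁺`-algebroid) over the `m`-dimensional manifold `M`, on vector
bundles `E` and `N` with typical fibres `EMod n` and `NMod n`. The principal bundle is given as a
smooth bundle of frames of `(E, N)`, to which `E` and `N` are then associated. -/
structure Elgebroid (n m : ℕ) (M : Type*) [TopologicalSpace M]
    [ChartedSpace (EuclideanSpace ℝ (Fin m)) M] [IsManifold (𝓡 m) ∞ M]
    (E : M → Type*) [∀ x, AddCommGroup (E x)] [∀ x, Module ℝ (E x)] [∀ x, TopologicalSpace (E x)]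
    [TopologicalSpace (TotalSpace (EMod n) E)] [FiberBundle (EMod n) E] [VectorBundle ℝ (EMod n) E]
    [ContMDiffVectorBundle ∞ (EMod n) E (𝓡 m)]
    (N : M → Type*) [∀ x, AddCommGroup (N x)] [∀ x, Module ℝ (N x)] [∀ x, TopologicalSpace (N x)]
    [TopologicalSpace (TotalSpace (NMod n) N)] [FiberBundle (NMod n) N] [VectorBundle ℝ (NMod n) N]
    [ContMDiffVectorBundle ∞ (NMod n) N (𝓡 m)] where
  /-- the fibre of the principal bundle over `x`, as a set of frames (`G`-frames) -/
  frames : ∀ x, Set (Frame n E N x)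
  /-- each fibre is a single orbit of the group -/
  frames_orbit : ∀ x, ∃ F ∈ frames x,
    frames x = {F' | ∃ p ∈ excPairs n, F' = (p.1.trans F.1, p.2.trans F.2)}
  /-- there are smooth local sections -/
  frames_smooth : ∀ x, ∃ U : Set M, IsOpen U ∧ x ∈ U ∧ ∃ F : ∀ y, Frame n E N y,
    IsSmoothFrameOn m U F ∧ ∀ y ∈ U, F y ∈ frames y
  /-- the bracket on `Γ(E)` -/
  bracket : Sec m (EMod n) E →ₗ[ℝ] Sec m (EMod n) E →ₗ[ℝ] Sec m (EMod n) E
  /-- the anchor `ρ : E → TM` -/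
  anchor : ∀ x, E x →L[ℝ] TangentSpace (𝓡 m) x
  anchor_smooth : ContMDiff ((𝓡 m).prod 𝓘(ℝ, EMod n)) (𝓡 m).tangent ∞
    (fun z : TotalSpace (EMod n) E => (⟨z.1, anchor z.1 z.2⟩ : TangentBundle (𝓡 m) M))
  /-- the operator `𝓓 : Γ(N) → Γ(E)` -/
  D : Sec m (NMod n) N →ₗ[ℝ] Sec m (EMod n) E
  jacobi : ∀ u v w, bracket u (bracket v w) = bracket (bracket u v) w + bracket v (bracket u w)
  /-- `[u, f v] = f [u, v] + (ρ(u) f) v` -/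
  leibniz : ∀ (u v : Sec m (EMod n) E) (f : C^∞⟮𝓡 m, M; 𝓘(ℝ, ℝ), ℝ⟯) (x : M),
    bracket u (smulSec f v) x = f x • bracket u v x + dirDeriv f x (anchor x (u x)) • v x
  /-- `[u, v] + [v, u] = 𝓓 (u ⊗ v)_N` -/
  symm : ∀ (u v : Sec m (EMod n) E) (k : Sec m (NMod n) N),
    (∀ x, ∀ F ∈ frames x, k x = F.prodN (u x) (v x)) → bracket u v + bracket v u = D k
  /-- `𝓓 (f k) = f 𝓓 k + (ρᵗ df ⊗ k)_E` -/
  diff : ∀ (f : C^∞⟮𝓡 m, M; 𝓘(ℝ, ℝ), ℝ⟯) (k : Sec m (NMod n) N) (x : M), ∀ F ∈ frames x,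
    D (smulSec f k) x = f x • D k x + F.prodE ((covDeriv f x).comp (anchor x)) (k x)
  /-- `[u, ·]` preserves the structure: in every local trivialisation by a smooth `G`-frame, its
  vertical part is at each point an element of the Lie algebra -/
  preserves : ∀ (U : Set M) (F : ∀ y, Frame n E N y), IsOpen U → IsSmoothFrameOn m U F →
    (∀ y ∈ U, F y ∈ frames y) → ∀ (u : Sec m (EMod n) E), ∀ x ∈ U, ∃ A ∈ excLieAlg n,
      ∀ v : Sec m (EMod n) E, (F x).1.symm (bracket u v x) =
        dirDeriv (fun y => (F y).1.symm (v y)) x (anchor x (u x)) + A ((F x).1.symm (v x))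

section Exactness

variable {n m : ℕ} {M : Type*} [TopologicalSpace M]
  [ChartedSpace (EuclideanSpace ℝ (Fin m)) M] [IsManifold (𝓡 m) ∞ M]
  {E : M → Type*} [∀ x, AddCommGroup (E x)] [∀ x, Module ℝ (E x)] [∀ x, TopologicalSpace (E x)]
  [TopologicalSpace (TotalSpace (EMod n) E)] [FiberBundle (EMod n) E] [VectorBundle ℝ (EMod n) E]
  [ContMDiffVectorBundle ∞ (EMod n) E (𝓡 m)]
  {N : M → Type*} [∀ x, AddCommGroup (N x)] [∀ x, Module ℝ (N x)] [∀ x, TopologicalSpace (N x)]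
  [TopologicalSpace (TotalSpace (NMod n) N)] [FiberBundle (NMod n) N] [VectorBundle ℝ (NMod n) N]
  [ContMDiffVectorBundle ∞ (NMod n) N (𝓡 m)]

/-- The image of the map `T_x*M ⊗ N_x → E_x`, `α ⊗ k ↦ (ρᵗ α ⊗ k)_E`. -/
def Elgebroid.imageAt (A : Elgebroid n m M E N) (x : M) : Submodule ℝ (E x) :=
  Submodule.span ℝ {e | ∃ F ∈ A.frames x, ∃ (α : TangentSpace (𝓡 m) x →L[ℝ] ℝ) (k : N x),
    e = F.prodE (α.comp (A.anchor x)) k}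

/-- Exactness of `T*M ⊗ N → E → TM → 0` at `E` and at `TM`. -/
def Elgebroid.IsExact (A : Elgebroid n m M E N) : Prop :=
  ∀ x, A.imageAt x = LinearMap.ker (A.anchor x : E x →ₗ[ℝ] TangentSpace (𝓡 m) x) ∧
    Function.Surjective (A.anchor x)

/-- An elgebroid is M-exact if it is exact and `dim M = n`. -/
def Elgebroid.IsMExact (A : Elgebroid n m M E N) : Prop := A.IsExact ∧ m = n

end Exactness

/-! ## The exceptional tangent bundle of an open subset of `ℝⁿ`

The bundles are trivialised by the coordinates, so that sections over an open subset `W ⊆ ℝⁿ` are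
(the restrictions to `W` of) functions on `ℝⁿ`, the anchor is the projection `E → T`, and the
`G`-frames of the fibres are the elements of `excPairs n`. -/

/-- The Lie derivative `L_X σ = d i_X σ + i_X dσ`. -/
def lieD {n k : ℕ} (X : T n → T n) (σ : T n → Form n (k + 1)) (x : T n) : Form n (k + 1) :=
  extDeriv (fun y => ins (X y) (σ y)) x + ins (X x) (extDeriv σ x)

/-- The bracket of the exceptional tangent bundle,
`[X + σ₂ + σ₅, X' + σ₂' + σ₅'] = L_X X' + (L_X σ₂' - i_{X'} dσ₂)
  + (L_X σ₅' - i_{X'} dσ₅ - σ₂' ∧ dσ₂)`. -/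
def etbBracket {n : ℕ} (u v : T n → EMod n) (x : T n) : EMod n :=
  let X : T n → T n := fun y => (u y).1
  let Y : T n → T n := fun y => (v y).1
  let σ : T n → Form n 2 := fun y => (u y).2.1
  let τ : T n → Form n 2 := fun y => (v y).2.1
  let σ₅ : T n → Form n 5 := fun y => (u y).2.2
  let τ₅ : T n → Form n 5 := fun y => (v y).2.2
  (VectorField.lieBracket ℝ X Y x,
   lieD X τ x - ins (Y x) (extDeriv σ x),
   lieD X τ₅ x - ins (Y x) (extDeriv σ₅ x) - (wedge (τ x) (extDeriv σ x) : Form n 5))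

/-- The operator `𝓓` of the exceptional tangent bundle: the exterior derivative on 1- and 4-forms,
and zero on the third summand of `N`. -/
def etbD {n : ℕ} (k : T n → NMod n) (x : T n) : EMod n :=
  (0, extDeriv (fun y => (k y).1) x, extDeriv (fun y => (k y).2.1) x)

section Iso

variable {n m : ℕ} {M : Type*} [TopologicalSpace M]
  [ChartedSpace (EuclideanSpace ℝ (Fin m)) M] [IsManifold (𝓡 m) ∞ M]
  {E : M → Type*} [∀ x, AddCommGroup (E x)] [∀ x, Module ℝ (E x)] [∀ x, TopologicalSpace (E x)]
  [TopologicalSpace (TotalSpace (EMod n) E)] [FiberBundle (EMod n) E] [VectorBundle ℝ (EMod n) E]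
  [ContMDiffVectorBundle ∞ (EMod n) E (𝓡 m)]
  {N : M → Type*} [∀ x, AddCommGroup (N x)] [∀ x, Module ℝ (N x)] [∀ x, TopologicalSpace (N x)]
  [TopologicalSpace (TotalSpace (NMod n) N)] [FiberBundle (NMod n) N] [VectorBundle ℝ (NMod n) N]
  [ContMDiffVectorBundle ∞ (NMod n) N (𝓡 m)]

/-- The function on `e.target ⊆ ℝⁿ` corresponding to the section `s` over `e.source` under the
fibrewise identifications `Φ` over `e`. -/
def push {W : Type*} {V : M → Type*} (e : OpenPartialHomeomorph M (T n)) (Φ : ∀ x, V x → W)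
    (s : ∀ x, V x) : T n → W :=
  fun y => Φ (e.symm y) (s (e.symm y))

/-- The maps `Φ x : E_x → EMod n` and `Ψ x : N_x → NMod n`, for `x ∈ e.source`, form an isomorphism,
covering the diffeomorphism `e`, of the restriction of `A` to `e.source` with the exceptional
tangent bundle of the open set `e.target ⊆ ℝⁿ`. (The bracket and `𝓓` are local operators and local
sections extend from smaller open sets to global ones, so it suffices to compare them on the
restrictions of global sections.) -/
structure IsEtbIso (A : Elgebroid n m M E N) (e : OpenPartialHomeomorph M (T n))
    (Φ : ∀ x, E x ≃L[ℝ] EMod n) (Ψ : ∀ x, N x ≃L[ℝ] NMod n) : Prop where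
  smooth : ContMDiffOn (𝓡 m) (𝓡 n) ∞ e e.source
  smooth_symm : ContMDiffOn (𝓡 n) (𝓡 m) ∞ e.symm e.target
  smooth_fiber : IsSmoothFrameOn m e.source (fun x => ((Φ x).symm, (Ψ x).symm))
  frames : ∀ x ∈ e.source, ∀ F : Frame n E N x,
    F ∈ A.frames x ↔ (F.1.trans (Φ x), F.2.trans (Ψ x)) ∈ excPairs n
  anchor : ∀ x ∈ e.source, ∀ a : E x, dirDeriv e x (A.anchor x a) = (Φ x a).1
  bracket : ∀ u v : Sec m (EMod n) E, ∀ x ∈ e.source,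
    Φ x (A.bracket u v x) =
      etbBracket (push e (fun y => Φ y) u) (push e (fun y => Φ y) v) (e x)
  map_D : ∀ k : Sec m (NMod n) N, ∀ x ∈ e.source,
    Φ x (A.D k x) = etbD (push e (fun y => Ψ y) k) (e x)

end Iso

end Elg

end

noncomputable section

set_option maxSynthPendingDepth 3
set_option synthInstance.maxHeartbeats 200000
set_option linter.unusedSectionVars false

namespace Elg

section

/-! ## Exterior calculus -/

/-! The structure is normalised in two stages: the anchor by pointwise linear algebra followed by a
smooth correction, then the bracket by removing two closed forms.

Anchor. In a chart and a G-frame the anchor at a point is a linear map l from E₀ to T. Exactness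
makes it surjective, and makes its transpose isotropic in every frame: l kills all (lᵗα ⊗ k)_E
(`IsGoodAnchor`). Such an l can be moved by the group to a map that factors through the projection
E₀ → T. Call a covector α straight if lᵗα lies in T* ⊆ E₀*. While some covector is not straight, a
group element strictly enlarges the space of straight ones (`IsGoodAnchor.exists_straight_lt`). If
the T*-part of lᵗα is not the T*-part of a straight covector, a trivector and a 6-vector erase the
form parts of lᵗα and leave the straight covectors alone. Otherwise a straight covector is
subtracted so that the T*-part vanishes, and the action of 3-forms turns a 5-form part into a 2-form
part and a 2-form part into a new T*-part. This needs at least three free dimensions in T, which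
isotropy and surjectivity guarantee (`IsGoodAnchor.corankThree`). The argument is used at one point
only: nearby, l restricted to T stays invertible, and explicit smooth elements of gl(T), Λ³T and Λ⁶T
make l equal to the projection (`Elgebroid.exists_isNormalFrame`).

Bracket. In such a normal frame the axioms determine all derivative terms, so that the bracket is
that of the exceptional tangent bundle plus a tensor Γ (`IsNormalFrame.compE_bracket`). The Jacobi
identity makes the anchor a homomorphism, whence Γ takes values in Λ²T* ⊕ Λ⁵T*. Each Γ(u, ·) lies in
the Lie algebra and the symmetric part of Γ factors through N. These algebraic conditions leave only
a covector γ and a 4-form F; when both vanish so do Γ and the zeroth order part of 𝓓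
(`IsPointTwist.exists_connection`). A 7-form could enter in the same way as F, but Λ⁷T* = 0.

The Jacobi identity gives dγ = 0, and dF = 0 once γ = 0. Locally γ = df and -F = dC. The frame
change exp(-f · deg), with deg the grading element, removes γ, and then exp(C) removes F
(`IsConnection.gauge`, `IsNormalAt.exists_flat`, `IsNormalAt.exists_trivial`). What remains is the
untwisted bracket and 𝓓 written in components. -/

theorem ins_apply {n k : ℕ} (X : T n) (σ : Form n (k + 1)) (v : Fin k → T n) :
    ins X σ v = σ (Fin.cons X v) := rfl

theorem form_ext_ins {n k : ℕ} {σ τ : Form n (k + 1)} (h : ∀ X, ins X σ = ins X τ) : σ = τ := by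
  ext v
  have := congrArg (fun f : Form n k => f (Fin.tail v)) (h (v 0))
  simpa [ins_apply, Fin.cons_self_tail] using this

instance instFiniteDimensionalForm (n k : ℕ) : FiniteDimensional ℝ (Form n k) :=
  FiniteDimensional.of_injective
    ((AlternatingMap.toMultilinearMapLM (S := ℝ) : (T n [⋀^Fin k]→ₗ[ℝ] ℝ) →ₗ[ℝ] _).comp
      (ContinuousAlternatingMap.toAlternatingMapLinear (R := ℝ) (A := ℝ)
        : Form n k →ₗ[ℝ] (T n [⋀^Fin k]→ₗ[ℝ] ℝ)))
    (fun _ _ h => ContinuousAlternatingMap.toAlternatingMap_injective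
      (AlternatingMap.coe_multilinearMap_injective h))

/-- The product `α₁ ∧ ⋯ ∧ αₖ` of covectors. -/
def detForm {n k : ℕ} (α : Fin k → T n →L[ℝ] ℝ) : Form n k :=
  { (Matrix.detRowAlternating (R := ℝ) (n := Fin k)).compLinearMap
      (LinearMap.pi fun i => (α i : T n →ₗ[ℝ] ℝ)) with
    cont := by
      show Continuous fun v : Fin k → T n => Matrix.det (fun j i => α i (v j))
      refine Continuous.matrix_det ?_
      exact continuous_pi fun j => continuous_pi fun i => (α i).continuous.comp (continuous_apply j) }

theorem detForm_apply {n k : ℕ} (α : Fin k → T n →L[ℝ] ℝ) (v : Fin k → T n) :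
    detForm α v = Matrix.det (Matrix.of fun i j => α i (v j)) := by
  rw [← Matrix.det_transpose]; rfl

/-- The Leibniz formula for the determinant. It identifies products of covectors with alternatised
tensor products. -/
theorem alternatization_prod_apply {ι V : Type*} [Fintype ι] [DecidableEq ι] [AddCommGroup V]
    [Module ℝ V] (α : ι → V →ₗ[ℝ] ℝ) (v : ι → V) :
    MultilinearMap.alternatization ((MultilinearMap.mkPiAlgebra ℝ ι ℝ).compLinearMap α) v
      = Matrix.det (Matrix.of fun i j => α i (v j)) := by
  rw [MultilinearMap.alternatization_apply, ← Matrix.det_transpose, Matrix.det_apply]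
  rfl

theorem alternatization_sum_smul_apply {ι κ V : Type*} [Fintype ι] [DecidableEq ι] [Fintype κ]
    [AddCommGroup V] [Module ℝ V] (c : κ → ℝ) (m : κ → MultilinearMap ℝ (fun _ : ι => V) ℝ)
    (v : ι → V) : MultilinearMap.alternatization (∑ i, c i • m i) v
      = ∑ i, c i * MultilinearMap.alternatization (m i) v := by
  simp only [MultilinearMap.alternatization_apply, MultilinearMap.domDomCongr_apply, sum_apply,
    smul_apply, Finset.smul_sum, Finset.mul_sum, smul_eq_mul]
  rw [Finset.sum_comm]
  exact Finset.sum_congr rfl fun i _ => Finset.sum_congr rfl fun σ _ => by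
    rw [mul_smul_comm]

theorem toAlternatingMap_detForm {n k : ℕ} (α : Fin k → T n →L[ℝ] ℝ) :
    (detForm α).toAlternatingMap = MultilinearMap.alternatization
      ((MultilinearMap.mkPiAlgebra ℝ (Fin k) ℝ).compLinearMap fun i => (α i : T n →ₗ[ℝ] ℝ)) := by
  ext v
  rw [alternatization_prod_apply]
  exact detForm_apply α v

/-- The shuffle product of two alternatisations is the alternatisation of the tensor product, so the
wedge of two determinants is again a determinant. All identities for the wedge product are reduced
to this one. -/
theorem wedge_detForm {n k l : ℕ} (α : Fin k → T n →L[ℝ] ℝ) (β : Fin l → T n →L[ℝ] ℝ) :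
    wedge (detForm α) (detForm β) = detForm (Fin.append α β) := by
  ext v
  rw [wedge_apply, toAlternatingMap_detForm, toAlternatingMap_detForm,
    AlternatingMap.domCoprod'_apply, ← MultilinearMap.domCoprod_alternization, detForm_apply,
    ← LinearMap.compAlternatingMap_apply, ← LinearMap.compMultilinearMap_alternatization]
  have : (LinearMap.mul' ℝ ℝ).compMultilinearMap
      (MultilinearMap.domCoprod
        ((MultilinearMap.mkPiAlgebra ℝ (Fin k) ℝ).compLinearMap fun i => (α i : T n →ₗ[ℝ] ℝ))
        ((MultilinearMap.mkPiAlgebra ℝ (Fin l) ℝ).compLinearMap fun i => (β i : T n →ₗ[ℝ] ℝ)))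
      = (MultilinearMap.mkPiAlgebra ℝ (Fin k ⊕ Fin l) ℝ).compLinearMap
        (fun i => ((Fin.append α β (finSumFinEquiv i) : T n →L[ℝ] ℝ) : T n →ₗ[ℝ] ℝ)) := by
    ext w
    simp [MultilinearMap.domCoprod_apply, Fintype.prod_sum_type]
  rw [this, alternatization_prod_apply]
  rw [← Matrix.det_submatrix_equiv_self finSumFinEquiv]
  rfl

/-- A `k`-form is a combination of products of coordinate covectors. -/
theorem form_eq_sum_detForm {n k : ℕ} (σ : Form n k) :
    σ = ∑ I : Fin k → Fin n, (((k.factorial : ℝ))⁻¹ * σ (fun j => vec (I j))) •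
      detForm (fun j => EuclideanSpace.proj (I j)) := by
  -- As a multilinear map, σ is a combination of products of coordinates. Alternatising turns the
  -- left side into k! σ, since σ is already alternating, and each product into a determinant.
  have hm : (σ.toAlternatingMap : MultilinearMap ℝ (fun _ : Fin k => T n) ℝ)
      = ∑ I : Fin k → Fin n, σ (fun j => vec (I j)) •
        (MultilinearMap.mkPiAlgebra ℝ (Fin k) ℝ).compLinearMap
          (fun j => ((EuclideanSpace.proj (I j) : T n →L[ℝ] ℝ) : T n →ₗ[ℝ] ℝ)) := by
    refine Module.Basis.ext_multilinear (fun _ => (EuclideanSpace.basisFun (Fin n) ℝ).toBasis) ?_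
    intro J
    simp only [sum_apply, smul_apply, MultilinearMap.compLinearMap_apply,
      MultilinearMap.mkPiAlgebra_apply]
    rw [Finset.sum_eq_single J]
    · simp [vec]
    · intro I _ hI
      obtain ⟨j, hj⟩ := Function.ne_iff.1 hI
      rw [Finset.prod_eq_zero (Finset.mem_univ j), smul_zero]
      simp [hj]
    · simp
  ext v
  have h := congrArg (fun f : T n [⋀^Fin k]→ₗ[ℝ] ℝ => f v)
    (AlternatingMap.coe_alternatization σ.toAlternatingMap)
  dsimp only at h
  have hm' : (σ.toMultilinearMap : MultilinearMap ℝ (fun _ : Fin k => T n) ℝ) = _ := hm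
  rw [hm', alternatization_sum_smul_apply] at h
  simp only [alternatization_prod_apply, Fintype.card_fin] at h
  have hk : (k.factorial : ℝ) ≠ 0 := by positivity
  rw [← mul_right_inj' hk]
  simp only [ContinuousAlternatingMap.sum_apply, ContinuousAlternatingMap.smul_apply, detForm_apply,
    Finset.mul_sum]
  refine Eq.trans ?_ (h.symm.trans (Finset.sum_congr rfl fun I _ => ?_))
  · simp [AlternatingMap.smul_apply]
  · simp only [smul_eq_mul]
    field_simp
    rfl

/-- Products of covectors span, so an identity linear in a form need only be checked on
determinants. -/
theorem form_induction {n k : ℕ} {p : Form n k → Prop} (σ : Form n k)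
    (hadd : ∀ a b, p a → p b → p (a + b)) (hsmul : ∀ (c : ℝ) a, p a → p (c • a))
    (hdet : ∀ α, p (detForm α)) : p σ := by
  have h0 : p 0 := by simpa using hsmul 0 _ (hdet fun _ => 0)
  rw [form_eq_sum_detForm σ]
  exact Finset.sum_induction _ p hadd h0 fun I _ => hsmul _ _ (hdet _)

theorem wedge_add_right {n k l : ℕ} (a : Form n k) (b b₁ : Form n l) :
    wedge a (b + b₁) = wedge a b + wedge a b₁ := by
  ext v
  simp only [wedge_apply, ContinuousAlternatingMap.add_apply,
    ContinuousAlternatingMap.toAlternatingMap_add, TensorProduct.tmul_add, map_add,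
    AlternatingMap.add_apply]

theorem wedge_smul_right {n k l : ℕ} (c : ℝ) (a : Form n k) (b : Form n l) :
    wedge a (c • b) = c • wedge a b := by
  ext v
  simp only [wedge_apply, ContinuousAlternatingMap.smul_apply,
    ContinuousAlternatingMap.toAlternatingMap_smul, TensorProduct.tmul_smul, map_smul,
    AlternatingMap.smul_apply]

/-- The wedge product as a bilinear map. -/
def wedgeL (n k l : ℕ) : Form n k →ₗ[ℝ] Form n l →ₗ[ℝ] Form n (k + l) :=
  LinearMap.mk₂ ℝ wedge wedge_add_left wedge_smul_left wedge_add_right wedge_smul_right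

theorem wedgeL_apply {n k l : ℕ} (a : Form n k) (b : Form n l) : wedgeL n k l a b = wedge a b := rfl

/-- The interior product as a bilinear map. -/
def insL (n k : ℕ) : T n →ₗ[ℝ] Form n (k + 1) →ₗ[ℝ] Form n k :=
  LinearMap.mk₂ ℝ ins (fun X Y σ => by simp [ins]) (fun c X σ => by simp [ins])
    (fun X σ τ => by ext; simp [ins]) (fun c X σ => by ext; simp [ins])

theorem insL_apply {n k : ℕ} (X : T n) (σ : Form n (k + 1)) : insL n k X σ = ins X σ := rfl

/-- Laplace expansion along the first column, which is the column of the inserted vector. -/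
theorem detForm_cons {n k : ℕ} (α : Fin (k + 1) → T n →L[ℝ] ℝ) (X : T n) :
    ins X (detForm α) = ∑ i : Fin (k + 1), ((-1 : ℝ) ^ (i : ℕ) * α i X) •
      detForm (fun j => α (i.succAbove j)) := by
  ext v
  rw [ins_apply, detForm_apply, Matrix.det_succ_column_zero]
  simp only [ContinuousAlternatingMap.sum_apply, ContinuousAlternatingMap.smul_apply, detForm_apply]
  rfl

theorem detForm_cast {n k l : ℕ} (h : k = l) (α : Fin l → T n →L[ℝ] ℝ) (v : Fin l → T n) :
    detForm (fun i => α (Fin.cast h i)) (fun i => v (Fin.cast h i)) = detForm α v := by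
  subst h; rfl

theorem append_eq_dite {A : Type*} {k l : ℕ} (α : Fin k → A) (β : Fin l → A) (p : Fin (k + l)) :
    Fin.append α β p = if h : (p : ℕ) < k then α ⟨p, h⟩ else β ⟨p - k, by omega⟩ := by
  refine Fin.addCases (fun i => ?_) (fun i => ?_) p
  · simp
  · simp

theorem coe_succAbove {k : ℕ} (p : Fin (k + 1)) (j : Fin k) :
    (p.succAbove j : ℕ) = if (j : ℕ) < p then (j : ℕ) else j + 1 := by
  simp only [Fin.succAbove, Fin.lt_def, Fin.val_castSucc]
  split_ifs <;> rfl

theorem append_castAdd_succAbove {A : Type*} {k l : ℕ} (α : Fin (k + 1) → A)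
    (β : Fin (l + 1) → A) (i : Fin (k + 1)) (j : Fin (k + 1 + l)) :
    Fin.append α β ((Fin.castAdd (l + 1) i).succAbove j) =
      Fin.append (fun q => α (i.succAbove q)) β (Fin.cast (by omega) j) := by
  have e := coe_succAbove (k := k + 1 + l) (Fin.castAdd (l + 1) i) j
  generalize (Fin.castAdd (l + 1) i).succAbove j = q at e ⊢
  rw [append_eq_dite, append_eq_dite]
  rw [Fin.val_castAdd] at e
  simp only [Fin.val_cast]
  have hi := i.2
  by_cases h : (j : ℕ) < k
  · have hq : (q : ℕ) < k + 1 := by split_ifs at e <;> omega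
    rw [dif_pos hq, dif_pos h]
    congr 1
    exact Fin.ext (by rw [coe_succAbove]; exact e)
  · have hq : ¬ (q : ℕ) < k + 1 := by split_ifs at e <;> omega
    rw [dif_neg hq, dif_neg h]
    congr 1
    exact Fin.ext (show (q : ℕ) - (k + 1) = j - k by split_ifs at e <;> omega)

theorem append_natAdd_succAbove {A : Type*} {k l : ℕ} (α : Fin k → A)
    (β : Fin (l + 1) → A) (i : Fin (l + 1)) (j : Fin (k + l)) :
    Fin.append α β ((Fin.natAdd k i).succAbove j) =
      Fin.append α (fun q => β (i.succAbove q)) j := by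
  have e := coe_succAbove (k := k + l) (Fin.natAdd k i) j
  generalize (Fin.natAdd k i).succAbove j = q at e ⊢
  rw [append_eq_dite, append_eq_dite]
  rw [Fin.val_natAdd] at e
  by_cases h : (j : ℕ) < k
  · have hq : (q : ℕ) < k := by split_ifs at e <;> omega
    rw [dif_pos hq, dif_pos h]
    congr 1
    exact Fin.ext (show (q : ℕ) = j by split_ifs at e <;> omega)
  · have hq : ¬ (q : ℕ) < k := by split_ifs at e <;> omega
    rw [dif_neg hq, dif_neg h]
    congr 1
    exact Fin.ext (by
      rw [coe_succAbove]
      show (q : ℕ) - k = if (j : ℕ) - k < i then (j : ℕ) - k else j - k + 1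
      split_ifs at e ⊢ <;> omega)

/-- The interior product is an antiderivation. -/
theorem ins_wedge_apply {n k l : ℕ} (X : T n) (a : Form n (k + 1)) (b : Form n (l + 1))
    (v : Fin (k + 1 + l) → T n) :
    ins (k := k + 1 + l) X (wedge (k := k + 1) (l := l + 1) a b) v =
      wedge (ins X a) b (fun i => v (Fin.cast (by omega) i))
        + (-1) ^ (k + 1) * wedge a (ins X b) v := by
  induction a using form_induction with
  | hadd a a' h h' =>
    simp only [wedge_add_left, ← insL_apply, map_add,
      ContinuousAlternatingMap.add_apply] at h h' ⊢
    rw [h, h']; ring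
  | hsmul c a h =>
    simp only [wedge_smul_left, ← insL_apply, map_smul,
      ContinuousAlternatingMap.smul_apply, smul_eq_mul] at h ⊢
    rw [h]; ring
  | hdet α =>
  induction b using form_induction with
  | hadd a a' h h' =>
    simp only [wedge_add_right, ← insL_apply, map_add,
      ContinuousAlternatingMap.add_apply] at h h' ⊢
    rw [h, h']; ring
  | hsmul c a h =>
    simp only [wedge_smul_right, ← insL_apply, map_smul,
      ContinuousAlternatingMap.smul_apply, smul_eq_mul] at h ⊢
    rw [h]; ring
  | hdet β =>
  rw [wedge_detForm, detForm_cons, detForm_cons]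
  erw [detForm_cons]
  simp only [← wedgeL_apply, map_sum, map_smul, LinearMap.sum_apply, LinearMap.smul_apply]
  simp only [wedgeL_apply, wedge_detForm, ContinuousAlternatingMap.sum_apply,
    ContinuousAlternatingMap.smul_apply, smul_eq_mul]
  -- The Laplace expansion of the joint determinant splits into the rows of α and those of β; the
  -- offset k + 1 of the second block is the sign of the antiderivation rule.
  refine (Fin.sum_univ_add (a := k + 1) (b := l + 1) _).trans ?_
  simp only [append_castAdd_succAbove, append_natAdd_succAbove, Fin.append_left, Fin.append_right,
    Finset.mul_sum]
  congr 1
  · refine Finset.sum_congr rfl fun i _ => ?_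
    rw [← detForm_cast (show k + 1 + l = k + (l + 1) by omega)]
    simp
  · refine Finset.sum_congr rfl fun i _ => ?_
    rw [Fin.val_natAdd, pow_add]
    ring

theorem wedge_assoc_apply {n k l m : ℕ} (a : Form n k) (b : Form n l) (c : Form n m)
    (v : Fin (k + l + m) → T n) :
    wedge (wedge a b) c v = wedge a (wedge b c) (fun i => v (Fin.cast (by omega) i)) := by
  induction a using form_induction with
  | hadd a a' h h' =>
    simp only [wedge_add_left, ContinuousAlternatingMap.add_apply, h, h']
  | hsmul r a h =>
    simp only [wedge_smul_left, ContinuousAlternatingMap.smul_apply, h]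
  | hdet α =>
  induction b using form_induction with
  | hadd a a' h h' =>
    simp only [wedge_add_left, wedge_add_right, ContinuousAlternatingMap.add_apply, h, h']
  | hsmul r a h =>
    simp only [wedge_smul_left, wedge_smul_right, ContinuousAlternatingMap.smul_apply, h]
  | hdet β =>
  induction c using form_induction with
  | hadd a a' h h' =>
    simp only [wedge_add_right, ContinuousAlternatingMap.add_apply, h, h']
  | hsmul r a h =>
    simp only [wedge_smul_right, ContinuousAlternatingMap.smul_apply, h]
  | hdet γ =>
  rw [wedge_detForm, wedge_detForm, wedge_detForm, wedge_detForm, Fin.append_assoc,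
    ← detForm_cast (show k + (l + m) = k + l + m by omega)]
  rfl

theorem zeroForm_eq {n : ℕ} (a : Form n 0) : a = a ![] • detForm Fin.elim0 := by
  ext v
  rw [ContinuousAlternatingMap.smul_apply, detForm_apply, Matrix.det_isEmpty, smul_eq_mul, mul_one]
  exact congrArg a (Subsingleton.elim _ _)

theorem wedge_zeroForm_left {n l : ℕ} (a : Form n 0) (b : Form n l) (v : Fin (0 + l) → T n) :
    wedge a b v = a ![] * b (fun i => v (Fin.cast (by omega) i)) := by
  induction b using form_induction with
  | hadd a a' h h' =>
    simp only [wedge_add_right, ContinuousAlternatingMap.add_apply, h, h', mul_add]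
  | hsmul r a h =>
    simp only [wedge_smul_right, ContinuousAlternatingMap.smul_apply, h, smul_eq_mul]
    ring
  | hdet β =>
  have e : (Fin.append Fin.elim0 β : Fin (0 + l) → _) = fun i => β (Fin.cast (by omega) i) := by
    funext i
    rw [append_eq_dite, dif_neg (by simp)]
    congr 1
  rw [zeroForm_eq a, wedge_smul_left, wedge_detForm, e]
  simp only [ContinuousAlternatingMap.smul_apply, smul_eq_mul, detForm_apply (n := n) Fin.elim0,
    Matrix.det_isEmpty, mul_one]
  congr 1
  exact detForm_cast (show 0 + l = l by omega) β (fun i => v (Fin.cast (by omega) i))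

theorem wedge_zeroForm_right {n k : ℕ} (a : Form n k) (b : Form n 0) (v : Fin (k + 0) → T n) :
    wedge a b v = b ![] * a v := by
  induction a using form_induction with
  | hadd a a' h h' =>
    simp only [wedge_add_left, ContinuousAlternatingMap.add_apply, h, h', mul_add]
  | hsmul r a h =>
    simp only [wedge_smul_left, ContinuousAlternatingMap.smul_apply, h, smul_eq_mul]
    ring
  | hdet β =>
  rw [zeroForm_eq b, wedge_smul_right, wedge_detForm]
  simp only [ContinuousAlternatingMap.smul_apply, smul_eq_mul, detForm_apply (n := n) Fin.elim0,
    Matrix.det_isEmpty, mul_one]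
  congr 2
  congr 1
  funext i
  rw [append_eq_dite, dif_pos (by exact i.2)]
  rfl

theorem cons_cast {V : Type*} {N N' : ℕ} (h : N + 1 = N' + 1) (X : V) (v : Fin N' → V) :
    (fun i => (Fin.cons X v : Fin (N' + 1) → V) (Fin.cast h i))
      = Fin.cons X (fun i => v (Fin.cast (by omega) i)) := by
  obtain rfl : N = N' := by omega
  rfl

/-- Induction on the total degree: inserting a vector lowers the degree of one factor by the
antiderivation rule, and the signs for the two smaller products combine to the required one. -/
theorem wedge_comm_apply {n : ℕ} : ∀ {k l : ℕ} (a : Form n k) (b : Form n l)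
    (v : Fin (k + l) → T n),
    wedge a b v = (-1) ^ (k * l) * wedge b a (fun i => v (Fin.cast (by omega) i))
  | 0, l, a, b, v => by
    rw [wedge_zeroForm_left, wedge_zeroForm_right]; simp
  | k + 1, 0, a, b, v => by
    rw [wedge_zeroForm_left, wedge_zeroForm_right]; simp
  | k + 1, l + 1, a, b, v => by
    obtain ⟨X, w, rfl⟩ : ∃ (X : T n) (w : Fin (k + 1 + l) → T n),
        v = (Fin.cons X w : Fin (k + 1 + l + 1) → T n) :=
      ⟨v 0, _, (Fin.cons_self_tail (n := k + 1 + l) v).symm⟩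
    have h1 := ins_wedge_apply X a b w
    have h2 := ins_wedge_apply X b a (fun i => w (Fin.cast (by omega) i))
    rw [ins_apply] at h1 h2
    refine h1.trans ?_
    refine Eq.trans ?_ (congrArg (fun z => (-1 : ℝ) ^ ((k + 1) * (l + 1)) * wedge b a z)
      (cons_cast (N := l + 1 + k) (N' := k + 1 + l) (by omega) X w).symm)
    rw [h2, wedge_comm_apply (ins X a) b, wedge_comm_apply a (ins X b)]
    simp only [Fin.cast_cast]
    have e1 : ((-1 : ℝ)) ^ ((k + 1) * (l + 1)) * (-1) ^ (l + 1) = (-1) ^ (k * (l + 1)) := by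
      rw [add_mul, pow_add, mul_assoc, ← pow_add]; simp
    have e2 : ((-1 : ℝ)) ^ ((k + 1) * (l + 1)) = (-1) ^ (k + 1) * (-1) ^ ((k + 1) * l) := by
      rw [← pow_add]; congr 1; ring
    rw [← e1, e2]
    ring

end

/-! ### Top degree, covectors, and multiplication by a covector -/

section

/-- Any k > n basis vectors contain a repetition. The bound n ≤ 6 enters the proof through the
vanishing of 7-forms that this gives. -/
theorem form_eq_zero_of_lt {n k : ℕ} (h : n < k) (σ : Form n k) : σ = 0 := by
  rw [form_eq_sum_detForm σ]
  refine Finset.sum_eq_zero fun I _ => ?_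
  obtain ⟨i, j, hij, hI⟩ := Fintype.exists_ne_map_eq_of_card_lt I (by simpa using h)
  rw [σ.map_eq_zero_of_eq _ (i := i) (j := j) (by simp only [hI]) hij, mul_zero, zero_smul]

/-- A 1-form as a covector. -/
def cov {n : ℕ} (β : Form n 1) : T n →L[ℝ] ℝ :=
  (ContinuousAlternatingMap.ofSubsingleton ℝ (T n) ℝ (0 : Fin 1)).symm β

theorem cov_apply {n : ℕ} (β : Form n 1) (X : T n) : cov β X = β (fun _ => X) := rfl

@[simp] theorem cov_oneForm {n : ℕ} (a : T n →L[ℝ] ℝ) : cov (oneForm a) = a :=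
  (ContinuousAlternatingMap.ofSubsingleton ℝ (T n) ℝ (0 : Fin 1)).symm_apply_apply a

@[simp] theorem oneForm_cov {n : ℕ} (β : Form n 1) : oneForm (cov β) = β :=
  (ContinuousAlternatingMap.ofSubsingleton ℝ (T n) ℝ (0 : Fin 1)).apply_symm_apply β

theorem oneForm_apply {n : ℕ} (a : T n →L[ℝ] ℝ) (v : Fin 1 → T n) : oneForm a v = a (v 0) := rfl

theorem ins_one_apply {n : ℕ} (X : T n) (β : Form n 1) (v : Fin 0 → T n) :
    ins X β v = cov β X := by
  rw [ins_apply, cov_apply]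
  congr 1
  funext i
  obtain rfl : i = 0 := Fin.fin_one_eq_zero i
  rfl

theorem cov_add {n : ℕ} (β γ : Form n 1) : cov (β + γ) = cov β + cov γ := rfl
theorem cov_smul {n : ℕ} (c : ℝ) (β : Form n 1) : cov (c • β) = c • cov β := rfl

/-- The product `β ∧ b` with a covector. -/
def ext1 {n k : ℕ} (β : T n →L[ℝ] ℝ) (b : Form n k) : Form n (k + 1) :=
  ContinuousAlternatingMap.alternatizeUncurryFin (β.smulRight b)

theorem ext1_apply {n k : ℕ} (β : T n →L[ℝ] ℝ) (b : Form n k) (v : Fin (k + 1) → T n) :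
    ext1 β b v = ∑ i : Fin (k + 1), (-1 : ℝ) ^ (i : ℕ) * (β (v i) * b (i.removeNth v)) := by
  simp [ext1, ContinuousAlternatingMap.alternatizeUncurryFin_apply]

/-- `ext1` as a bilinear map. -/
def ext1L (n k : ℕ) : (T n →L[ℝ] ℝ) →ₗ[ℝ] Form n k →ₗ[ℝ] Form n (k + 1) :=
  LinearMap.mk₂ ℝ ext1
    (fun a b c => by ext v; simp [ext1_apply, add_mul, mul_add, Finset.sum_add_distrib])
    (fun r b c => by
      ext v; simp only [ext1_apply, ContinuousAlternatingMap.smul_apply, Finset.smul_sum]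
      exact Finset.sum_congr rfl fun i _ => by simp; ring)
    (fun a b c => by ext v; simp [ext1_apply, mul_add, Finset.sum_add_distrib])
    (fun r b c => by
      ext v; simp only [ext1_apply, ContinuousAlternatingMap.smul_apply, Finset.smul_sum]
      exact Finset.sum_congr rfl fun i _ => by simp; ring)

theorem ext1L_apply {n k : ℕ} (β : T n →L[ℝ] ℝ) (b : Form n k) : ext1L n k β b = ext1 β b := rfl

theorem removeNth_succ_cons {V : Type*} {k : ℕ} (i : Fin (k + 1)) (X : V) (v : Fin (k + 1) → V) :
    (i.succ.removeNth (Fin.cons X v : Fin (k + 2) → V)) = Fin.cons X (i.removeNth v) := by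
  funext j
  refine Fin.cases ?_ (fun j => ?_) j <;> simp [Fin.removeNth]

theorem ins_ext1 {n k : ℕ} (X : T n) (β : T n →L[ℝ] ℝ) (b : Form n (k + 1)) :
    ins X (ext1 β b) = β X • b - ext1 β (ins X b) := by
  ext v
  rw [ins_apply, ext1_apply, Fin.sum_univ_succ]
  simp only [removeNth_succ_cons, Fin.cons_succ, ContinuousAlternatingMap.sub_apply,
    ContinuousAlternatingMap.smul_apply, ext1_apply, ins_apply, Fin.cons_zero, Fin.val_zero,
    Fin.val_succ, pow_succ, smul_eq_mul, pow_zero, one_mul, Fin.removeNth_zero, Fin.tail_cons]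
  rw [sub_eq_add_neg, ← Finset.sum_neg_distrib]
  congr 1
  exact Finset.sum_congr rfl fun i _ => by ring

theorem ins_ext1_zero {n : ℕ} (X : T n) (β : T n →L[ℝ] ℝ) (b : Form n 0) :
    ins X (ext1 β b) = β X • b := by
  ext v
  rw [ins_apply, ext1_apply, Fin.sum_univ_succ]
  simp

theorem wedge_one_apply {n : ℕ} (β : T n →L[ℝ] ℝ) : ∀ {k : ℕ} (b : Form n k)
    (v : Fin (1 + k) → T n),
    wedge (oneForm β) b v = ext1 β b (fun i => v (Fin.cast (by omega) i))
  | 0, b, v => by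
    rw [wedge_zeroForm_right, ext1_apply]
    simp [oneForm_apply, mul_comm]
    left
    exact congrArg b (Subsingleton.elim _ _)
  | k + 1, b, v => by
    obtain ⟨X, w, rfl⟩ : ∃ (X : T n) (w : Fin (0 + 1 + k) → T n),
        v = (Fin.cons X w : Fin (0 + 1 + k + 1) → T n) :=
      ⟨v 0, _, (Fin.cons_self_tail (n := 0 + 1 + k) v).symm⟩
    have h1 := ins_wedge_apply (k := 0) X (oneForm β) b w
    rw [ins_apply] at h1
    refine h1.trans ?_
    refine Eq.trans ?_ (congrArg (ext1 β b)
      (cons_cast (N := k + 1) (N' := 0 + 1 + k) (by omega) X w).symm)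
    rw [← ins_apply, ins_ext1, wedge_zeroForm_left, ins_one_apply, cov_oneForm]
    simp only [ContinuousAlternatingMap.sub_apply, ContinuousAlternatingMap.smul_apply]
    have := wedge_one_apply β (ins X b) w
    simp only [Nat.reduceAdd, zero_add, pow_one, neg_mul, one_mul, smul_eq_mul]
    rw [sub_eq_add_neg]
    congr 1
    exact congrArg Neg.neg this

end

/-! ### The wedge product with degrees up to equality, and contraction identities -/

section

/-- The wedge product as a bilinear map, with the degree of the result given up to an equation. -/
def wd {n k l m : ℕ} (h : k + l = m) : Form n k →ₗ[ℝ] Form n l →ₗ[ℝ] Form n m :=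
  Eq.rec (motive := fun m _ => Form n k →ₗ[ℝ] Form n l →ₗ[ℝ] Form n m) (wedgeL n k l) h

theorem wd_apply {n k l m : ℕ} (h : k + l = m) (a : Form n k) (b : Form n l) (v : Fin m → T n) :
    wd h a b v = wedge a b (fun i => v (Fin.cast h i)) := by
  subst h; rfl

theorem ins_wd {n k l m : ℕ} (h : k + 1 + (l + 1) = m + 1) (X : T n) (a : Form n (k + 1))
    (b : Form n (l + 1)) :
    ins X (wd h a b) = wd (show k + (l + 1) = m by omega) (ins X a) b
      + (-1 : ℝ) ^ (k + 1) • wd (show k + 1 + l = m by omega) a (ins X b) := by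
  obtain rfl : k + 1 + l = m := by omega
  ext v
  rw [ContinuousAlternatingMap.add_apply, ContinuousAlternatingMap.smul_apply, wd_apply, wd_apply]
  exact ins_wedge_apply X a b v

theorem wd_zero_left {n l : ℕ} (h : 0 + l = l) (a : Form n 0) (b : Form n l) :
    wd h a b = a ![] • b := by
  ext v
  rw [wd_apply, wedge_zeroForm_left]; rfl

theorem wd_zero_right {n k : ℕ} (h : k + 0 = k) (a : Form n k) (b : Form n 0) :
    wd h a b = b ![] • a := by
  ext v
  rw [wd_apply, wedge_zeroForm_right]; rfl

theorem ins_wd_one_left {n l : ℕ} (h : 1 + (l + 1) = l + 1 + 1) (X : T n) (β : Form n 1)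
    (b : Form n (l + 1)) :
    ins X (wd h β b) = cov β X • b - wd (show 1 + l = l + 1 by omega) β (ins X b) := by
  have := ins_wd (k := 0) (l := l) h X β b
  rw [this, wd_zero_left, ins_one_apply, sub_eq_add_neg]
  refine congrArg _ (Eq.trans ?_ (neg_one_smul ℝ _))
  exact congrArg (fun c : ℝ => c • wd (show 1 + l = l + 1 by omega) β (ins X b)) (by norm_num)

theorem wd_comm {n k l m : ℕ} (h : k + l = m) (a : Form n k) (b : Form n l) :
    wd h a b = (-1 : ℝ) ^ (k * l) • wd (show l + k = m by omega) b a := by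
  ext v
  rw [wd_apply, wedge_comm_apply, ContinuousAlternatingMap.smul_apply, wd_apply]; rfl

theorem wd_assoc {n k l m p q r : ℕ} (h : k + l = p) (h' : p + m = r) (h'' : l + m = q)
    (a : Form n k) (b : Form n l) (c : Form n m) :
    wd h' (wd h a b) c = wd (show k + q = r by omega) a (wd h'' b c) := by
  subst h h'' h'
  ext v
  rw [wd_apply, wd_apply]
  exact wedge_assoc_apply a b c v

theorem wd_oneForm {n k : ℕ} (h : 1 + k = k + 1) (β : T n →L[ℝ] ℝ) (b : Form n k) :
    wd h (oneForm β) b = ext1 β b := by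
  ext v
  rw [wd_apply, wedge_one_apply]; rfl

/-- Moving a 1-form to the front. -/
theorem wd_wd_one {n k l : ℕ} {p q : ℕ} (h : 1 + l = p) (h' : k + p = q) (a : Form n k)
    (β : Form n 1) (b : Form n l) :
    wd h' a (wd h β b) = (-1 : ℝ) ^ k • wd (show 1 + (k + l) = q by omega) β (wd rfl a b) := by
  rw [← wd_assoc (show k + 1 = 1 + k by omega) (show 1 + k + l = q by omega),
    wd_comm (show k + 1 = 1 + k by omega), map_smul, LinearMap.smul_apply, mul_one,
    wd_assoc (show 1 + k = 1 + k by omega) _ rfl]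

/-- Natural pullback of the wedge product. -/
theorem wd_compContinuousLinearMap {n k l m : ℕ} (h : k + l = m) (a : Form n k) (b : Form n l)
    (g : T n →L[ℝ] T n) :
    (wd h a b).compContinuousLinearMap g
      = wd h (a.compContinuousLinearMap g) (b.compContinuousLinearMap g) := by
  have hdet : ∀ {k : ℕ} (α : Fin k → T n →L[ℝ] ℝ),
      (detForm α).compContinuousLinearMap g = detForm fun i => (α i).comp g := by
    intro k α
    ext v
    rw [ContinuousAlternatingMap.compContinuousLinearMap_apply, detForm_apply, detForm_apply]
    rfl
  have hadd : ∀ {k : ℕ} (x y : Form n k), (x + y).compContinuousLinearMap g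
      = x.compContinuousLinearMap g + y.compContinuousLinearMap g := fun x y => rfl
  have hsmul : ∀ {k : ℕ} (c : ℝ) (y : Form n k), (c • y).compContinuousLinearMap g
      = c • y.compContinuousLinearMap g := fun x y => rfl
  subst h
  induction a using form_induction with
  | hadd a a' h h' => simp only [map_add, LinearMap.add_apply, hadd, h, h']
  | hsmul r a h => simp only [map_smul, LinearMap.smul_apply, hsmul, h]
  | hdet α =>
  induction b using form_induction with
  | hadd a a' h h' => simp only [map_add, hadd, h, h']
  | hsmul r a h => simp only [map_smul, hsmul, h]
  | hdet β =>
  rw [hdet, hdet]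
  refine (congrArg (fun z : Form n (k + l) => z.compContinuousLinearMap g)
    (wedge_detForm α β)).trans ((hdet _).trans (Eq.trans ?_ (wedge_detForm _ _).symm))
  congr 1
  funext i
  refine Fin.addCases (fun i => ?_) (fun i => ?_) i <;> simp

/-- Euler's identity: contracting with eᵢ and multiplying back by eⁱ counts each of the k + 1 slots
once. -/
theorem sum_ext1_ins {n k : ℕ} (σ : Form n (k + 1)) :
    ∑ i, ext1 (EuclideanSpace.proj i) (ins (vec i) σ) = ((k : ℝ) + 1) • σ := by
  have h := ContinuousAlternatingMap.alternatizeUncurryFin_curryLeft σ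
  have : σ.curryLeft = ∑ i, (EuclideanSpace.proj i : T n →L[ℝ] ℝ).smulRight (ins (vec i) σ) := by
    ext1 X
    rw [sum_apply]
    conv_lhs => rw [← (EuclideanSpace.basisFun (Fin n) ℝ).sum_repr X]
    rw [map_sum]
    exact Finset.sum_congr rfl fun i _ => by simp [ins, vec]
  have h2 : ∀ s : Finset (Fin n), ContinuousAlternatingMap.alternatizeUncurryFin
      (∑ i ∈ s, (EuclideanSpace.proj i : T n →L[ℝ] ℝ).smulRight (ins (vec i) σ))
      = ∑ i ∈ s, ext1 (EuclideanSpace.proj i) (ins (vec i) σ) := fun s =>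
    map_sum (ContinuousAlternatingMap.alternatizeUncurryFinCLM ℝ (T n) ℝ) _ s
  rw [← h2, ← this, h, ← Nat.cast_smul_eq_nsmul ℝ]
  push_cast; rfl

/-- The alternatisation of a family of forms, in terms of the dual basis. -/
theorem alternatizeUncurryFin_eq_sum {n k : ℕ} (f : T n →L[ℝ] Form n k) :
    ContinuousAlternatingMap.alternatizeUncurryFin f
      = ∑ i, ext1 (EuclideanSpace.proj i) (f (vec i)) := by
  have : f = ∑ i, (EuclideanSpace.proj i : T n →L[ℝ] ℝ).smulRight (f (vec i)) := by
    ext1 X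
    rw [sum_apply]
    conv_lhs => rw [← (EuclideanSpace.basisFun (Fin n) ℝ).sum_repr X]
    rw [map_sum]
    exact Finset.sum_congr rfl fun i _ => by simp [vec]
  conv_lhs => rw [this]
  exact map_sum (ContinuousAlternatingMap.alternatizeUncurryFinCLM ℝ (T n) ℝ) _ _

theorem ins_ins_same {n k : ℕ} (X : T n) (σ : Form n (k + 2)) : ins X (ins X σ) = 0 :=
  ContinuousAlternatingMap.curryLeft_same σ X

theorem ins_add_left {n k : ℕ} (X Y : T n) (σ : Form n (k + 1)) :
    ins (X + Y) σ = ins X σ + ins Y σ := by simp [ins]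
theorem ins_add_right {n k : ℕ} (X : T n) (σ τ : Form n (k + 1)) :
    ins X (σ + τ) = ins X σ + ins X τ := by simp [ins]
theorem ins_sub_right {n k : ℕ} (X : T n) (σ τ : Form n (k + 1)) :
    ins X (σ - τ) = ins X σ - ins X τ := map_sub (insL n k X) σ τ
theorem ins_neg_right {n k : ℕ} (X : T n) (σ : Form n (k + 1)) :
    ins X (-σ) = -ins X σ := map_neg (insL n k X) σ
theorem ins_smul_left {n k : ℕ} (c : ℝ) (X : T n) (σ : Form n (k + 1)) :
    ins (c • X) σ = c • ins X σ := by simp [ins]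
theorem ins_smul_right {n k : ℕ} (c : ℝ) (X : T n) (σ : Form n (k + 1)) :
    ins X (c • σ) = c • ins X σ := by simp [ins]
theorem ins_zero_right {n k : ℕ} (X : T n) : ins X (0 : Form n (k + 1)) = 0 := by simp [ins]
theorem ins_zero_left {n k : ℕ} (σ : Form n (k + 1)) : ins 0 σ = 0 := by simp [ins]

theorem ins_swap {n k : ℕ} (X Y : T n) (σ : Form n (k + 2)) :
    ins X (ins Y σ) = -ins Y (ins X σ) := by
  have h := ins_ins_same (X + Y) σ
  simp only [ins_add_left, ins_add_right, ins_ins_same, zero_add, add_zero] at h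
  exact eq_neg_of_add_eq_zero_left (by rw [add_comm]; exact h)

end

section

/-! ## Infinitesimal symmetries -/

theorem glAct_ins {n k : ℕ} (B : T n →L[ℝ] T n) (X : T n) (σ : Form n (k + 1)) :
    glAct B (ins X σ) = ins (B X) σ + ins X (glAct B σ) := by
  ext v
  simp only [glAct, ContinuousAlternatingMap.neg_apply, ContinuousAlternatingMap.add_apply,
    ins_apply, ContinuousAlternatingMap.fderivCompContinuousLinearMap_apply, Fin.sum_univ_succ]
  rw [neg_add, ← add_assoc]
  have h0 : (fun j : Fin (k + 1) => (Function.update (fun _ => ContinuousLinearMap.id ℝ (T n)) 0 B j)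
      ((Fin.cons X v : Fin (k + 1) → T n) j)) = Fin.cons (B X) v := by
    funext j
    refine Fin.cases ?_ (fun j => ?_) j
    · simp
    · simp
  rw [h0, add_neg_cancel, zero_add]
  congr 1
  refine Finset.sum_congr rfl fun i _ => congrArg σ ?_
  funext j
  refine Fin.cases ?_ (fun j => ?_) j
  · simp [Function.update_of_ne (Fin.succ_ne_zero i).symm]
  · by_cases h : j = i
    · subst h; simp
    · simp [Function.update_of_ne h, Function.update_of_ne (fun e => h (Fin.succ_injective _ e))]

/-- The natural action is minus the derivative of the pullback along id + tB. This transfers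
naturality of pullback to the Lie algebra. -/
theorem hasDerivAt_compContinuousLinearMap {n k : ℕ} (B : T n →L[ℝ] T n) (σ : Form n k) :
    HasDerivAt (fun t : ℝ => σ.compContinuousLinearMap (ContinuousLinearMap.id ℝ (T n) + t • B))
      (-glAct B σ) 0 := by
  have h1 : HasDerivAt (fun t : ℝ => ContinuousLinearMap.id ℝ (T n) + t • B) B 0 := by
    simpa using ((hasDerivAt_id (0 : ℝ)).smul_const B).const_add (ContinuousLinearMap.id ℝ (T n))
  have h2 := (hasFDerivAt_const σ (0 : ℝ)).continuousAlternatingMapCompContinuousLinearMap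
    h1.hasFDerivAt
  have e0 : ContinuousLinearMap.id ℝ (T n) + (0 : ℝ) • B = ContinuousLinearMap.id ℝ (T n) := by
    rw [zero_smul, add_zero]
  rw [e0] at h2
  convert! h2.hasDerivAt using 1
  simp [glAct]

/-- Pullback commutes with the wedge product; the Leibniz rule is the derivative of that statement
at t = 0. -/
theorem glAct_wd {n k l m : ℕ} (h : k + l = m) (B : T n →L[ℝ] T n) (a : Form n k) (b : Form n l) :
    glAct B (wd h a b) = wd h (glAct B a) b + wd h a (glAct B b) := by
  have h1 := hasDerivAt_compContinuousLinearMap B (wd h a b)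
  simp only [wd_compContinuousLinearMap] at h1
  have h2 := (LinearMap.toContinuousBilinearMap (wd h)).hasFDerivAt_of_bilinear
    (hasDerivAt_compContinuousLinearMap B a).hasFDerivAt
    (hasDerivAt_compContinuousLinearMap B b).hasFDerivAt
  have h3 := h1.unique h2.hasDerivAt
  have e : ∀ {k : ℕ} (σ : Form n k), σ.compContinuousLinearMap
      (ContinuousLinearMap.id ℝ (T n) + (0 : ℝ) • B) = σ := fun σ => by
    rw [zero_smul, add_zero]; rfl
  simp only [e] at h3
  rw [← neg_inj, h3]
  simp

instance instFiniteDimensionalNMod (n : ℕ) : FiniteDimensional ℝ (NMod n) := inferInstance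


theorem prodN_eq {n : ℕ} (u v : EMod n) : prodN u v =
    (ins u.1 v.2.1 + ins v.1 u.2.1,
     ins u.1 v.2.2 + ins v.1 u.2.2 - wd (rfl : 2 + 2 = 4) u.2.1 v.2.1,
     jWedge u.2.1 v.2.2 + jWedge v.2.1 u.2.2) := rfl

theorem jWedge_apply {n : ℕ} (s : Form n 2) (t : Form n 5) (Y : T n) :
    jWedge s t Y = wd (rfl : 1 + 5 = 6) (ins Y s) t := rfl

theorem jWedge_add_left {n : ℕ} (s s' : Form n 2) (t : Form n 5) :
    jWedge (s + s') t = jWedge s t + jWedge s' t := by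
  ext1 Y; simp [jWedge_apply, ins_add_right]

theorem jWedge_add_right {n : ℕ} (s : Form n 2) (t t' : Form n 5) :
    jWedge s (t + t') = jWedge s t + jWedge s t' := by
  ext1 Y; simp [jWedge_apply]

theorem jWedge_smul_left {n : ℕ} (c : ℝ) (s : Form n 2) (t : Form n 5) :
    jWedge (c • s) t = c • jWedge s t := by
  ext1 Y; simp [jWedge_apply, ins_smul_right]

theorem jWedge_smul_right {n : ℕ} (c : ℝ) (s : Form n 2) (t : Form n 5) :
    jWedge s (c • t) = c • jWedge s t := by
  ext1 Y; simp [jWedge_apply]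

/-- `prodN` as a bilinear map. -/
def prodNL (n : ℕ) : EMod n →ₗ[ℝ] EMod n →ₗ[ℝ] NMod n :=
  LinearMap.mk₂ ℝ prodN
    (fun u u' v => by
      simp only [prodN_eq, Prod.fst_add, Prod.snd_add, ins_add_left, ins_add_right, map_add,
        LinearMap.add_apply, jWedge_add_left, jWedge_add_right, Prod.mk_add_mk, Prod.mk.injEq]
      refine ⟨?_, ?_, ?_⟩ <;> abel)
    (fun c u v => by
      simp only [prodN_eq, Prod.smul_fst, Prod.smul_snd, ins_smul_left, ins_smul_right, map_smul,
        LinearMap.smul_apply, jWedge_smul_left, jWedge_smul_right, Prod.smul_mk, smul_add, smul_sub])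
    (fun u v v' => by
      simp only [prodN_eq, Prod.fst_add, Prod.snd_add, ins_add_left, ins_add_right, map_add,
        jWedge_add_left, jWedge_add_right, Prod.mk_add_mk, Prod.mk.injEq]
      refine ⟨?_, ?_, ?_⟩ <;> abel)
    (fun c u v => by
      simp only [prodN_eq, Prod.smul_fst, Prod.smul_snd, ins_smul_left, ins_smul_right, map_smul,
        jWedge_smul_left, jWedge_smul_right, Prod.smul_mk, smul_add, smul_sub])

theorem prodNL_apply {n : ℕ} (u v : EMod n) : prodNL n u v = prodN u v := rfl

/-- The infinitesimal symmetries: an element of the Lie algebra together with its action on `N`. -/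
def infPairs (n : ℕ) : Submodule ℝ ((EMod n →L[ℝ] EMod n) × (NMod n →L[ℝ] NMod n)) where
  carrier := {p | p.1 ∈ excLieAlg n ∧ ∀ u v, p.2 (prodN u v) = prodN (p.1 u) v + prodN u (p.1 v)}
  zero_mem' := ⟨zero_mem _, fun u v => by simp [← prodNL_apply]⟩
  add_mem' := by
    rintro p q ⟨hp, hp'⟩ ⟨hq, hq'⟩
    refine ⟨add_mem hp hq, fun u v => ?_⟩
    simp only [Prod.fst_add, Prod.snd_add, add_apply, hp', hq']
    simp only [← prodNL_apply, map_add, LinearMap.add_apply]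
    abel
  smul_mem' := by
    rintro c p ⟨hp, hp'⟩
    refine ⟨Submodule.smul_mem _ c hp, fun u v => ?_⟩
    simp only [Prod.smul_fst, Prod.smul_snd, smul_apply, hp']
    simp only [← prodNL_apply, map_smul, LinearMap.smul_apply, smul_add]

/-- The pairing into N is quadratic, so scalars act on N with weight two. -/
theorem id_mem_infPairs (n : ℕ) :
    (ContinuousLinearMap.id ℝ (EMod n), ContinuousLinearMap.id ℝ (NMod n) + ContinuousLinearMap.id ℝ (NMod n)) ∈ infPairs n := by
  refine ⟨Submodule.subset_span ?_, fun u v => ?_⟩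
  · exact Or.inl (Or.inl (Or.inl (Or.inl (Or.inl rfl))))
  · rw [add_apply]
    simp only [ContinuousLinearMap.id_apply]

/-- The action of `gl(T)` on `E`. -/
def glE {n : ℕ} (B : T n →L[ℝ] T n) : EMod n →L[ℝ] EMod n :=
  LinearMap.toContinuousLinearMap
    { toFun := fun u => (B u.1, glAct B u.2.1, glAct B u.2.2)
      map_add' := fun u v => by
        simp only [glAct, Prod.fst_add, Prod.snd_add, map_add, Prod.mk_add_mk, ←
          ContinuousAlternatingMap.fderivCompContinuousLinearMapCLM_apply,
          add_apply, neg_add]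
      map_smul' := fun c u => by
        simp only [glAct, Prod.smul_fst, Prod.smul_snd, map_smul, Prod.smul_mk, ←
          ContinuousAlternatingMap.fderivCompContinuousLinearMapCLM_apply,
          smul_apply, smul_neg, RingHom.id_apply] }

theorem glE_apply {n : ℕ} (B : T n →L[ℝ] T n) (u : EMod n) :
    glE B u = (B u.1, glAct B u.2.1, glAct B u.2.2) := rfl

/-- The action of `gl(T)` on forms, as a bilinear map. -/
def glActL (n k : ℕ) : (T n →L[ℝ] T n) →ₗ[ℝ] Form n k →ₗ[ℝ] Form n k :=
  LinearMap.mk₂ ℝ glAct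
    (fun B C σ => by simp only [glAct, map_add, neg_add])
    (fun c B σ => by simp only [glAct, map_smul, smul_neg])
    (fun B σ τ => by
      simp only [glAct, ← ContinuousAlternatingMap.fderivCompContinuousLinearMapCLM_apply, map_add,
        add_apply, neg_add])
    (fun c B σ => by
      simp only [glAct, ← ContinuousAlternatingMap.fderivCompContinuousLinearMapCLM_apply, map_smul,
        smul_apply, smul_neg])

theorem glActL_apply {n k : ℕ} (B : T n →L[ℝ] T n) (σ : Form n k) : glActL n k B σ = glAct B σ := rfl

/-- The action of `gl(T)` on `N`. -/
def glN {n : ℕ} (B : T n →L[ℝ] T n) : NMod n →L[ℝ] NMod n :=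
  LinearMap.toContinuousLinearMap
    { toFun := fun k => (glActL n 1 B k.1, glActL n 4 B k.2.1,
        (LinearMap.toContinuousLinearMap (glActL n 6 B)).comp k.2.2 - k.2.2.comp B)
      map_add' := fun u v => by
        simp only [Prod.fst_add, Prod.snd_add, map_add, Prod.mk_add_mk, ContinuousLinearMap.comp_add,
          ContinuousLinearMap.add_comp, Prod.mk.injEq, true_and]
        abel
      map_smul' := fun c u => by
        simp only [Prod.smul_fst, Prod.smul_snd, map_smul, Prod.smul_mk, RingHom.id_apply,
          ContinuousLinearMap.comp_smul, ContinuousLinearMap.smul_comp, smul_sub] }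

theorem glN_apply {n : ℕ} (B : T n →L[ℝ] T n) (k : NMod n) :
    (glN B k).1 = glAct B k.1 ∧ (glN B k).2.1 = glAct B k.2.1 ∧
      ∀ Y, (glN B k).2.2 Y = glAct B (k.2.2 Y) - k.2.2 (B Y) := ⟨rfl, rfl, fun _ => rfl⟩

theorem prodN_snd_snd_apply {n : ℕ} (u v : EMod n) (Y : T n) : (prodN u v).2.2 Y =
    wd (rfl : 1 + 5 = 6) (ins Y u.2.1) v.2.2 + wd (rfl : 1 + 5 = 6) (ins Y v.2.1) u.2.2 := rfl

theorem gl_mem_infPairs {n : ℕ} (B : T n →L[ℝ] T n) : (glE B, glN B) ∈ infPairs n := by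
  refine ⟨Submodule.subset_span ?_, fun u v => ?_⟩
  · exact Or.inl (Or.inl (Or.inl (Or.inl (Or.inr ⟨B, fun u => rfl⟩))))
  · rw [Prod.ext_iff, Prod.ext_iff]
    refine ⟨?_, ?_, ?_⟩
    · show glActL n 1 B (ins u.1 v.2.1 + ins v.1 u.2.1) = _
      rw [map_add, glActL_apply, glActL_apply, glAct_ins, glAct_ins]
      show _ = (ins (B u.1) v.2.1 + ins v.1 (glAct B u.2.1)) + (ins u.1 (glAct B v.2.1) + ins (B v.1) u.2.1)
      abel
    · show glActL n 4 B (ins u.1 v.2.2 + ins v.1 u.2.2 - wd (rfl : 2 + 2 = 4) u.2.1 v.2.1) = _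
      rw [map_sub, map_add, glActL_apply, glActL_apply, glActL_apply, glAct_ins, glAct_ins, glAct_wd]
      show _ = (ins (B u.1) v.2.2 + ins v.1 (glAct B u.2.2) - wd (rfl : 2 + 2 = 4) (glAct B u.2.1) v.2.1)
        + (ins u.1 (glAct B v.2.2) + ins (B v.1) u.2.2 - wd (rfl : 2 + 2 = 4) u.2.1 (glAct B v.2.1))
      abel
    · ext1 Y
      rw [(glN_apply B _).2.2, Prod.snd_add, Prod.snd_add, add_apply,
        prodN_snd_snd_apply, prodN_snd_snd_apply, prodN_snd_snd_apply, prodN_snd_snd_apply]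
      simp only [glE_apply]
      rw [← glActL_apply, map_add, glActL_apply, glActL_apply, glAct_wd, glAct_wd, glAct_ins, glAct_ins]
      simp only [map_add, LinearMap.add_apply]
      abel

end

/-! ### 3-forms, trivectors and 6-vectors act compatibly on E and N -/

section

theorem ins_wd_even {n k l m : ℕ} (hk : Even (k + 1)) (h : k + 1 + (l + 1) = m + 1) (X : T n)
    (a : Form n (k + 1)) (b : Form n (l + 1)) :
    ins X (wd h a b) = wd (show k + (l + 1) = m by omega) (ins X a) b
      + wd (show k + 1 + l = m by omega) a (ins X b) := by
  rw [ins_wd, hk.neg_one_pow, one_smul]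

theorem ins_wd_odd {n k l m : ℕ} (hk : Odd (k + 1)) (h : k + 1 + (l + 1) = m + 1) (X : T n)
    (a : Form n (k + 1)) (b : Form n (l + 1)) :
    ins X (wd h a b) = wd (show k + (l + 1) = m by omega) (ins X a) b
      - wd (show k + 1 + l = m by omega) a (ins X b) := by
  rw [ins_wd, hk.neg_one_pow, neg_one_smul, sub_eq_add_neg]

theorem wd_comm_even {n k l m : ℕ} (hk : Even (k * l)) (h : k + l = m) (a : Form n k) (b : Form n l) :
    wd h a b = wd (show l + k = m by omega) b a := by
  rw [wd_comm, hk.neg_one_pow, one_smul]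

theorem ins_eq_zero {n k : ℕ} (X : T n) {σ : Form n (k + 1)} (h : σ = 0) : ins X σ = 0 := by
  subst h; exact ins_zero_right X

theorem prodN_fst {n : ℕ} (u v : EMod n) : (prodN u v).1 = ins u.1 v.2.1 + ins v.1 u.2.1 := rfl

theorem prodN_snd_fst {n : ℕ} (u v : EMod n) : (prodN u v).2.1 =
    ins u.1 v.2.2 + ins v.1 u.2.2 - wd (rfl : 2 + 2 = 4) u.2.1 v.2.1 := rfl

/-- The action of a 3-form on `E`. -/
def formE {n : ℕ} (a : Form n 3) : EMod n →L[ℝ] EMod n :=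
  LinearMap.toContinuousLinearMap
    { toFun := fun u => (0, ins u.1 a, wd (rfl : 3 + 2 = 5) a u.2.1)
      map_add' := fun u v => by
        simp only [Prod.fst_add, Prod.snd_add, map_add, Prod.mk_add_mk, ins_add_left, add_zero]
      map_smul' := fun c u => by
        simp only [Prod.smul_fst, Prod.smul_snd, map_smul, Prod.smul_mk, ins_smul_left, smul_zero,
          RingHom.id_apply] }

theorem formE_apply {n : ℕ} (a : Form n 3) (u : EMod n) :
    formE a u = (0, ins u.1 a, wd (rfl : 3 + 2 = 5) a u.2.1) := rfl

theorem formE_apply' {n : ℕ} (a : Form n 3) (u : EMod n) :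
    formE a u = (0, ins u.1 a, (wedge a u.2.1 : Form n 5)) := rfl

/-- The map `T → Λ⁶T*`, `Y ↦ (i_Y a) ∧ κ`. -/
def insWedge {n : ℕ} (a : Form n 3) (κ : Form n 4) : T n →L[ℝ] Form n 6 :=
  LinearMap.toContinuousLinearMap
    { toFun := fun Y => wd (rfl : 2 + 4 = 6) (ins Y a) κ
      map_add' := fun Y Z => by simp only [ins_add_left, map_add, LinearMap.add_apply]
      map_smul' := fun c Y => by
        simp only [ins_smul_left, map_smul, LinearMap.smul_apply, RingHom.id_apply] }

theorem insWedge_apply {n : ℕ} (a : Form n 3) (κ : Form n 4) (Y : T n) :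
    insWedge a κ Y = wd (rfl : 2 + 4 = 6) (ins Y a) κ := rfl

/-- The action of a 3-form on `N`. -/
def formN {n : ℕ} (a : Form n 3) : NMod n →L[ℝ] NMod n :=
  LinearMap.toContinuousLinearMap
    { toFun := fun k => (0, wd (rfl : 1 + 3 = 4) k.1 a, insWedge a k.2.1)
      map_add' := fun u v => by
        simp only [Prod.fst_add, Prod.snd_add, map_add, LinearMap.add_apply, Prod.mk_add_mk, add_zero,
          Prod.mk.injEq, true_and]
        ext1 Y
        rw [add_apply]
        simp only [insWedge_apply, map_add]
      map_smul' := fun c u => by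
        simp only [Prod.smul_fst, Prod.smul_snd, map_smul, LinearMap.smul_apply, Prod.smul_mk,
          smul_zero, RingHom.id_apply, Prod.mk.injEq, true_and]
        ext1 Y
        rw [smul_apply]
        simp only [insWedge_apply, map_smul] }

theorem formN_apply {n : ℕ} (a : Form n 3) (k : NMod n) : formN a k =
    (0, wd (rfl : 1 + 3 = 4) k.1 a, insWedge a k.2.1) := rfl

/-- The action of a decomposable trivector on `E`. -/
def triE {n : ℕ} (w : Fin 3 → T n) : EMod n →L[ℝ] EMod n :=
  LinearMap.toContinuousLinearMap
    { toFun := fun u =>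
        (u.2.1 ![w 1, w 2] • w 0 + u.2.1 ![w 2, w 0] • w 1 + u.2.1 ![w 0, w 1] • w 2,
          ins (w 2) (ins (w 1) (ins (w 0) u.2.2)), 0)
      map_add' := fun u v => by
        simp only [Prod.fst_add, Prod.snd_add, Prod.mk_add_mk, ins_add_right, add_zero,
          ContinuousAlternatingMap.add_apply, add_smul, Prod.mk.injEq, and_true]
        abel
      map_smul' := fun c u => by
        simp only [Prod.smul_fst, Prod.smul_snd, Prod.smul_mk, ins_smul_right, smul_zero,
          RingHom.id_apply, ContinuousAlternatingMap.smul_apply, smul_eq_mul, mul_smul, smul_add] }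

theorem triE_apply {n : ℕ} (w : Fin 3 → T n) (u : EMod n) : triE w u =
    (u.2.1 ![w 1, w 2] • w 0 + u.2.1 ![w 2, w 0] • w 1 + u.2.1 ![w 0, w 1] • w 2,
      ins (w 2) (ins (w 1) (ins (w 0) u.2.2)), 0) := rfl

/-- The action of a decomposable trivector on `N`. -/
def triN {n : ℕ} (w : Fin 3 → T n) : NMod n →L[ℝ] NMod n :=
  LinearMap.toContinuousLinearMap
    { toFun := fun k =>
        (-ins (w 2) (ins (w 1) (ins (w 0) k.2.1)),
          ins (w 2) (ins (w 1) (k.2.2 (w 0))) + ins (w 0) (ins (w 2) (k.2.2 (w 1)))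
            + ins (w 1) (ins (w 0) (k.2.2 (w 2))), 0)
      map_add' := fun u v => by
        simp only [Prod.fst_add, Prod.snd_add, Prod.mk_add_mk, ins_add_right, add_zero,
          add_apply, Prod.mk.injEq, and_true]
        constructor <;> abel
      map_smul' := fun c u => by
        simp only [Prod.smul_fst, Prod.smul_snd, Prod.smul_mk, ins_smul_right, smul_zero,
          RingHom.id_apply, smul_apply, smul_add, smul_neg] }

theorem triN_apply {n : ℕ} (w : Fin 3 → T n) (k : NMod n) : triN w k =
    (-ins (w 2) (ins (w 1) (ins (w 0) k.2.1)),
      ins (w 2) (ins (w 1) (k.2.2 (w 0))) + ins (w 0) (ins (w 2) (k.2.2 (w 1)))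
        + ins (w 1) (ins (w 0) (k.2.2 (w 2))), 0) := rfl

/-- The action of a decomposable 6-vector on `E`. -/
def sixE {n : ℕ} (w : Fin 6 → T n) : EMod n →L[ℝ] EMod n :=
  LinearMap.toContinuousLinearMap
    { toFun := fun u => (-∑ i : Fin 6, ((-1 : ℝ) ^ (i : ℕ) * u.2.2 (i.removeNth w)) • w i, 0, 0)
      map_add' := fun u v => by
        simp only [Prod.snd_add, Prod.mk_add_mk, add_zero, ContinuousAlternatingMap.add_apply,
          mul_add, add_smul, Finset.sum_add_distrib, neg_add]
      map_smul' := fun c u => by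
        simp only [Prod.smul_snd, Prod.smul_mk, smul_zero, RingHom.id_apply, smul_neg,
          ContinuousAlternatingMap.smul_apply, smul_eq_mul, Finset.smul_sum, smul_smul]
        simp only [mul_left_comm] }

theorem sixE_apply {n : ℕ} (w : Fin 6 → T n) (u : EMod n) : sixE w u =
    (-∑ i : Fin 6, ((-1 : ℝ) ^ (i : ℕ) * u.2.2 (i.removeNth w)) • w i, 0, 0) := rfl

/-- The action of a decomposable 6-vector on `N`. -/
def sixN {n : ℕ} (w : Fin 6 → T n) : NMod n →L[ℝ] NMod n :=
  LinearMap.toContinuousLinearMap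
    { toFun := fun k => (oneForm (LinearMap.toContinuousLinearMap
        { toFun := fun Y => k.2.2 Y w
          map_add' := fun Y Z => by rw [map_add]; rfl
          map_smul' := fun c Y => by rw [map_smul]; rfl }), 0, 0)
      map_add' := fun u v => by
        simp only [Prod.mk_add_mk, add_zero, Prod.mk.injEq, and_true]
        ext Y
        rfl
      map_smul' := fun c u => by
        simp only [Prod.smul_mk, smul_zero, RingHom.id_apply, Prod.mk.injEq, and_true]
        ext Y
        rfl }

theorem sixN_apply {n : ℕ} (w : Fin 6 → T n) (k : NMod n) :
    cov (sixN w k).1 = (fun Y => k.2.2 Y w) ∧ (sixN w k).2 = 0 := ⟨rfl, rfl⟩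

theorem cov_ins_apply {n : ℕ} (X Y : T n) (σ : Form n 2) : cov (ins X σ) Y = σ ![X, Y] :=
  congrArg σ (by ext i : 1; fin_cases i <;> rfl)

theorem ins_ins_apply {n : ℕ} (X Y : T n) (σ : Form n 2) (v : Fin 0 → T n) :
    ins Y (ins X σ) v = σ ![X, Y] := by
  rw [ins_one_apply, cov_ins_apply]

attribute [local irreducible] ins wd wedge

/-- The components in T* and Λ⁴T* are the antiderivation rule. The component in T* ⊗ Λ⁶T* holds
because the contraction of a vanishing 7-form is zero, which moves the contractions from one factor
to another. -/
theorem form_mem_infPairs {n : ℕ} (hn : n ≤ 6) (a : Form n 3) : (formE a, formN a) ∈ infPairs n := by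
  refine ⟨Submodule.subset_span ?_, fun u v => ?_⟩
  · exact Or.inl (Or.inl (Or.inl (Or.inr ⟨a, formE_apply' a⟩)))
  · rw [formN_apply, Prod.ext_iff, Prod.ext_iff]
    obtain ⟨X, σ, σ₅⟩ := u
    obtain ⟨Y, τ, τ₅⟩ := v
    simp only [formE_apply, Prod.fst_add, Prod.snd_add, prodN_fst, prodN_snd_fst]
    refine ⟨?_, ?_, ?_⟩
    · rw [ins_zero_left, ins_zero_left, ins_swap X Y]; simp
    · rw [ins_zero_left, ins_zero_left, ins_wd_odd (by decide) _ X a, ins_wd_odd (by decide) _ Y a,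
        wd_comm_even (by decide) _ σ (ins Y a), map_add, LinearMap.add_apply, wd_comm _ a (ins X τ),
        wd_comm _ a (ins Y σ)]
      norm_num
      abel
    · ext1 Z
      rw [add_apply, prodN_snd_snd_apply, prodN_snd_snd_apply, insWedge_apply]
      have h7 : ∀ η : Form n 7, η = 0 := form_eq_zero_of_lt (by omega)
      -- Contract the zero 7-form i_Z a ∧ τ₅ with X.
      have e1 : ∀ (X : T n) (τ₅ : Form n 5), wd (rfl : 1 + 5 = 6) (ins Z (ins X a)) τ₅
          = wd (rfl : 2 + 4 = 6) (ins Z a) (ins X τ₅) := by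
        intro X τ₅
        have h0 : wd (rfl : 2 + 5 = 7) (ins Z a) τ₅ = 0 := h7 _
        have := ins_eq_zero (k := 6) X h0
        rw [ins_wd_even (by decide)] at this
        have e := ins_swap X Z a
        simp only [e, map_neg, LinearMap.neg_apply] at this
        exact neg_add_eq_zero.1 this
      -- Contract the zero 7-form a ∧ σ ∧ τ with Z, then bring the resulting 1-forms to the front.
      have e2 : wd (rfl : 2 + 4 = 6) (ins Z a) (wd (rfl : 2 + 2 = 4) σ τ)
          = -(wd (rfl : 1 + 5 = 6) (ins Z τ) (wd (rfl : 3 + 2 = 5) a σ)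
            + wd (rfl : 1 + 5 = 6) (ins Z σ) (wd (rfl : 3 + 2 = 5) a τ)) := by
        have h0 : wd (rfl : 3 + 4 = 7) a (wd (rfl : 2 + 2 = 4) σ τ) = 0 := h7 _
        have := ins_eq_zero (k := 6) Z h0
        rw [ins_wd_odd (by decide), ins_wd_even (k := 1) (l := 1) (m := 3) (by decide) _ Z σ τ,
          wd_comm_even (by decide) _ σ (ins Z τ), map_add, wd_wd_one _ _ a (ins Z τ) σ,
          wd_wd_one _ _ a (ins Z σ) τ, sub_eq_zero] at this
        rw [this]
        norm_num
      dsimp only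
      rw [e1, e1, map_sub, map_add, e2]
      abel

/-- If all 7-forms vanish, contraction with 4 vectors gives a skew pairing on 5-forms. -/
theorem ins4_wd_add {n : ℕ} (hn : n ≤ 6) (a b c d : T n) (σ τ : Form n 5) :
    wd (rfl : 1 + 5 = 6) (ins a (ins b (ins c (ins d σ)))) τ
      + wd (rfl : 1 + 5 = 6) (ins a (ins b (ins c (ins d τ)))) σ = 0 := by
  have h7 : ∀ η : Form n 7, η = 0 := form_eq_zero_of_lt (by omega)
  -- Each of the four equations moves one contraction from σ to τ. After the fourth the contractions
  -- are in reverse order, an even permutation of four, and exchanging the 5-form with the 1-form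
  -- gives the sign.
  have e1 := ins_eq_zero (k := 6) a (h7 (wd (rfl : 2 + 5 = 7) (ins b (ins c (ins d σ))) τ))
  have e2 := ins_eq_zero (k := 6) b (h7 (wd (rfl : 3 + 4 = 7) (ins c (ins d σ)) (ins a τ)))
  have e3 := ins_eq_zero (k := 6) c (h7 (wd (rfl : 4 + 3 = 7) (ins d σ) (ins b (ins a τ))))
  have e4 := ins_eq_zero (k := 6) d (h7 (wd (rfl : 5 + 2 = 7) σ (ins c (ins b (ins a τ)))))
  rw [ins_wd_even (by decide)] at e1 e3
  rw [ins_wd_odd (by decide)] at e2 e4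
  have e5 : ins d (ins c (ins b (ins a τ))) = ins a (ins b (ins c (ins d τ))) := by
    rw [ins_swap b a, ins_neg_right, ins_swap c a, ins_neg_right, ins_neg_right, ins_swap d a,
      ins_swap c b, ins_neg_right, ins_swap d b, ins_swap d c]
    simp only [ins_neg_right, neg_neg]
  rw [e5, wd_comm (rfl : 5 + 1 = 6) σ] at e4
  rw [show (-1 : ℝ) ^ (5 * 1) = -1 by norm_num, neg_one_smul, sub_neg_eq_add] at e4
  linear_combination (norm := module) e1 - e2 - e3 + e4

theorem ins_ins_wd_ins {n : ℕ} (a b c : T n) (σ : Form n 2) (τ : Form n 5) :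
    ins c (ins b (wd (rfl : 1 + 5 = 6) (ins a σ) τ)) = σ ![a, b] • ins c τ - σ ![a, c] • ins b τ
      + wd (rfl : 1 + 3 = 4) (ins a σ) (ins c (ins b τ)) := by
  rw [ins_wd_one_left (l := 4), ins_sub_right, ins_smul_right, ins_wd_one_left (l := 3),
    cov_ins_apply, cov_ins_apply]
  abel

theorem apply_pair_swap {n : ℕ} (a b : T n) (σ : Form n 2) : σ ![a, b] = -σ ![b, a] := by
  rw [← ins_ins_apply a b σ ![], ← ins_ins_apply b a σ ![], ins_swap]; rfl

/-- Three contractions of the 7-form σ ∧ τ, which vanishes, sorted by how many vectors meet σ. -/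
theorem ins3_wd_five {n : ℕ} (hn : n ≤ 6) (a b c : T n) (σ : Form n 2) (τ : Form n 5) :
    (σ ![b, c] • ins a τ + σ ![c, a] • ins b τ + σ ![a, b] • ins c τ)
      + (wd (rfl : 1 + 3 = 4) (ins a σ) (ins c (ins b τ))
        + wd (rfl : 1 + 3 = 4) (ins b σ) (ins a (ins c τ))
        + wd (rfl : 1 + 3 = 4) (ins c σ) (ins b (ins a τ)))
      + wd (rfl : 2 + 2 = 4) σ (ins c (ins b (ins a τ))) = 0 := by
  have h := ins_eq_zero (k := 6) a
    (form_eq_zero_of_lt (by omega) (wd (rfl : 2 + 5 = 7) σ τ))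
  have h := ins_eq_zero (k := 4) c (ins_eq_zero (k := 5) b h)
  rw [ins_wd_even (k := 1) (by decide), ins_add_right, ins_add_right, ins_ins_wd_ins,
    ins_wd_even (k := 1) (l := 3) (m := 5) (by decide), ins_add_right,
    ins_wd_one_left (l := 3), ins_wd_even (k := 1) (l := 2) (m := 4) (by decide), cov_ins_apply,
    apply_pair_swap a c, ins_swap c a, map_neg] at h
  linear_combination (norm := module) h

theorem ins3_wd_two {n : ℕ} (a b c : T n) (σ τ : Form n 2) :
    ins c (ins b (ins a (wd (rfl : 2 + 2 = 4) σ τ))) =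
      (σ ![b, c] • ins a τ + σ ![c, a] • ins b τ + σ ![a, b] • ins c τ)
      + (τ ![b, c] • ins a σ + τ ![c, a] • ins b σ + τ ![a, b] • ins c σ) := by
  have hz : ∀ (X Y : T n) (β : Form n 1), wd (rfl : 1 + 0 = 1) β (ins X (ins Y τ)) =
      τ ![Y, X] • β := by
    intro X Y β
    rw [wd_zero_right, ins_ins_apply]
  have hz' : ∀ (X Y : T n), wd (rfl : 2 + 0 = 2) σ (ins X (ins Y τ)) =
      τ ![Y, X] • σ := by
    intro X Y
    rw [wd_zero_right, ins_ins_apply]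
  rw [ins_wd_even (k := 1) (l := 1) (m := 3) (by decide), ins_add_right, ins_add_right,
    ins_wd_one_left (l := 1), ins_sub_right, ins_smul_right, ins_wd_one_left (l := 0),
    ins_wd_even (k := 1) (l := 0) (m := 2) (by decide), ins_add_right, ins_wd_one_left (l := 0),
    hz, hz, hz', ins_smul_right,
    cov_ins_apply, cov_ins_apply, cov_ins_apply, apply_pair_swap a c, apply_pair_swap a c]
  module

/-- The three components amount to three contraction identities: three vectors on the 4-form σ ∧ τ,
three vectors on a zero 7-form, and the skew pairing of 5-forms by four contractions. -/
theorem tri_mem_infPairs {n : ℕ} (hn : n ≤ 6) (w : Fin 3 → T n) :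
    (triE w, triN w) ∈ infPairs n := by
  refine ⟨Submodule.subset_span ?_, fun u v => ?_⟩
  · exact Or.inl (Or.inr ⟨w, triE_apply w⟩)
  · rw [triN_apply, Prod.ext_iff, Prod.ext_iff]
    simp only [triE_apply, Prod.fst_add, Prod.snd_add, prodN_fst, prodN_snd_fst]
    refine ⟨?_, ?_, ?_⟩
    · have e : ∀ (X : T n) (τ : Form n 5), -ins (w 2) (ins (w 1) (ins (w 0) (ins X τ))) =
          ins X (ins (w 2) (ins (w 1) (ins (w 0) τ))) := by
        intro X τ
        rw [ins_swap (w 0) X, ins_neg_right, ins_swap (w 1) X, ins_neg_right, ins_neg_right,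
          ins_swap (w 2) X]
        simp
      rw [ins_sub_right, ins_sub_right, ins_sub_right, ins_add_right, ins_add_right, ins_add_right,
        neg_sub, ins3_wd_two, ← e, ← e]
      simp only [ins_add_left, ins_smul_left]
      module
    · simp only [prodN_snd_snd_apply, ins_add_right, ins_ins_wd_ins, ins_add_left, ins_smul_left,
        ins_zero_right]
      have e1 := ins3_wd_five hn (w 0) (w 1) (w 2) u.2.1 v.2.2
      have e2 := ins3_wd_five hn (w 0) (w 1) (w 2) v.2.1 u.2.2
      rw [wd_comm_even (by decide) _ (ins (w 2) (ins (w 1) (ins (w 0) u.2.2))) v.2.1]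
      have s := apply_pair_swap (n := n)
      rw [s (w 0) (w 2), s (w 1) (w 0), s (w 2) (w 1), s (w 0) (w 2), s (w 1) (w 0), s (w 2) (w 1)]
      linear_combination (norm := module) e1 + e2
    · ext1 Z
      rw [add_apply, prodN_snd_snd_apply, prodN_snd_snd_apply]
      have := ins4_wd_add hn Z (w 2) (w 1) (w 0) u.2.2 v.2.2
      simp only [map_zero, add_zero, zero_add]
      rw [this]
      rfl

/-- Pairing the action of a 6-vector with a covector turns it into an evaluation of β ∧ σ₅; read
backwards this is the expansion of that product along β. -/
theorem cov_sixE {n : ℕ} (w : Fin 6 → T n) (β : Form n 1) (u : EMod n) :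
    cov β (sixE w u).1 = -wd (rfl : 1 + 5 = 6) β u.2.2 w := by
  obtain ⟨β, rfl⟩ : ∃ b, β = oneForm b := ⟨cov β, (oneForm_cov β).symm⟩
  rw [wd_oneForm, ext1_apply, sixE_apply, cov_oneForm, map_neg, map_sum]
  simp only [map_smul, smul_eq_mul]
  congr 1
  exact Finset.sum_congr rfl fun i _ => by ring

theorem form_one_ext {n : ℕ} {β γ : Form n 1} (h : ∀ X, cov β X = cov γ X) : β = γ := by
  rw [← oneForm_cov β, ← oneForm_cov γ]
  congr 1
  ext1 X
  exact h X

/-- Only the first two components are nontrivial. The first is the formula for `sixE` paired with a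
covector, the second is the skew pairing of 5-forms by four contractions. -/
theorem six_mem_infPairs {n : ℕ} (hn : n ≤ 6) (w : Fin 6 → T n) :
    (sixE w, sixN w) ∈ infPairs n := by
  refine ⟨Submodule.subset_span ?_, fun u v => ?_⟩
  · exact Or.inr ⟨w, sixE_apply w⟩
  · have hs : ∀ u, sixE w u = ((sixE w u).1, 0, 0) := fun u => rfl
    obtain ⟨h1, h2⟩ := sixN_apply w (prodN u v)
    rw [Prod.ext_iff, h2, Prod.ext_iff]
    have hc : ∀ (X Y : T n) (σ : Form n 2), cov (ins X σ) Y = -cov (ins Y σ) X := by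
      intro X Y σ
      rw [cov_ins_apply, cov_ins_apply, apply_pair_swap]
    refine ⟨?_, ?_, ?_⟩
    · refine form_one_ext fun Z => ?_
      rw [h1, Prod.fst_add, prodN_fst, prodN_fst, cov_add, cov_add, cov_add, hs u, hs v]
      simp only [add_apply, prodN_snd_snd_apply, ins_zero_right, hc _ Z, cov_sixE,
        ContinuousAlternatingMap.add_apply]
      have h0 : ∀ X : T n, cov (0 : Form n 1) X = 0 := fun X => rfl
      rw [h0]
      ring
    · rw [Prod.snd_add, Prod.fst_add, prodN_snd_fst, prodN_snd_fst, hs u, hs v]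
      simp only [ins_zero_right, map_zero, LinearMap.zero_apply, add_zero, zero_add, sub_zero]
      refine form_ext_ins fun a => form_ext_ins fun b => form_ext_ins fun c => form_one_ext fun d => ?_
      -- Moving X past a, b and c and exchanging it with d takes four transpositions, so no sign
      -- appears.
      have e : ∀ (X : T n) (τ : Form n 5), cov (ins c (ins b (ins a (ins X τ)))) d =
          cov (ins d (ins c (ins b (ins a τ)))) X := by
        intro X τ
        rw [ins_swap a X, ins_neg_right, ins_neg_right, ins_swap b X, ins_neg_right, ins_swap c X,
          hc d]
        simp only [neg_neg]
        rfl
      rw [ins_add_right, ins_add_right, ins_add_right, cov_add, add_apply, e, e, cov_sixE, cov_sixE]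
      have := congrArg (fun η => η w) (ins4_wd_add hn d c b a v.2.2 u.2.2)
      simp only [ContinuousAlternatingMap.add_apply] at this
      rw [← neg_add, this]
      rw [Prod.fst_zero, ins_zero_right, ins_zero_right, ins_zero_right]
      exact (neg_zero (G := ℝ)).symm
    · ext1 Z
      rw [Prod.snd_add, Prod.snd_add, add_apply, prodN_snd_snd_apply, prodN_snd_snd_apply, hs u, hs v]
      simp only [ins_zero_right, map_zero, LinearMap.zero_apply, add_zero, Prod.snd_zero, zero_apply]

end

/-! ### Exponentials of infinitesimal symmetries lie in the group -/

section

theorem exp_apply_exp_neg_apply {V : Type*} [NormedAddCommGroup V] [NormedSpace ℝ V]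
    [CompleteSpace V] (x : V →L[ℝ] V) (v : V) :
    NormedSpace.exp x (NormedSpace.exp (-x) v) = v := by
  let _ : NormedAlgebra ℚ (V →L[ℝ] V) := NormedAlgebra.restrictScalars ℚ ℝ _
  rw [← mul_apply_eq_comp, ← NormedSpace.exp_add_of_commute
    (Commute.neg_right (Commute.refl x)), add_neg_cancel, NormedSpace.exp_zero]
  rfl

theorem exp_neg_apply_exp_apply {V : Type*} [NormedAddCommGroup V] [NormedSpace ℝ V]
    [CompleteSpace V] (x : V →L[ℝ] V) (v : V) :
    NormedSpace.exp (-x) (NormedSpace.exp x v) = v := by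
  simpa using exp_apply_exp_neg_apply (-x) v

/-- The curve exp(-ty) B(exp(tx)u, exp(tx)v) has zero derivative, so its values at 0 and 1 agree. -/
theorem exp_bilinear {V W : Type*} [NormedAddCommGroup V] [NormedSpace ℝ V] [CompleteSpace V]
    [NormedAddCommGroup W] [NormedSpace ℝ W] [CompleteSpace W] (B : V →L[ℝ] V →L[ℝ] W)
    {x : V →L[ℝ] V} {y : W →L[ℝ] W} (h : ∀ u v, y (B u v) = B (x u) v + B u (x v)) (u v : V) :
    NormedSpace.exp y (B u v) = B (NormedSpace.exp x u) (NormedSpace.exp x v) := by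
  have hx : ∀ (u : V) (t : ℝ), HasDerivAt (fun s : ℝ => NormedSpace.exp (s • x) u)
      (x (NormedSpace.exp (t • x) u)) t := fun u t =>
    (hasDerivAt_exp_smul_const' x t).clm_apply (hasDerivAt_const t u) |>.congr_deriv (by simp)
  have hy : ∀ t : ℝ, HasDerivAt (fun s : ℝ => NormedSpace.exp (s • -y))
      (NormedSpace.exp (t • -y) * -y) t := fun t => hasDerivAt_exp_smul_const (-y) t
  have hB : ∀ t : ℝ, HasDerivAt (fun s : ℝ => B (NormedSpace.exp (s • x) u)
      (NormedSpace.exp (s • x) v)) (y (B (NormedSpace.exp (t • x) u)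
      (NormedSpace.exp (t • x) v))) t := fun t =>
    ((B.hasFDerivAt.comp_hasDerivAt t (hx u t)).clm_apply (hx v t)).congr_deriv (by
      rw [h]; rfl)
  have hd : ∀ t : ℝ, HasDerivAt (fun s : ℝ => NormedSpace.exp (s • -y)
      (B (NormedSpace.exp (s • x) u) (NormedSpace.exp (s • x) v))) 0 t := fun t =>
    ((hy t).clm_apply (hB t)).congr_deriv (by simp)
  have hc := is_const_of_deriv_eq_zero (fun t => (hd t).differentiableAt) (fun t => (hd t).deriv) 1 0
  simp only [one_smul, zero_smul, NormedSpace.exp_zero, one_apply_eq_self] at hc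
  rw [← hc, exp_apply_exp_neg_apply]

/-- The exponential of an endomorphism, as an automorphism. -/
def expEquiv {V : Type*} [NormedAddCommGroup V] [NormedSpace ℝ V] [CompleteSpace V]
    (x : V →L[ℝ] V) : V ≃L[ℝ] V :=
  ContinuousLinearEquiv.equivOfInverse (NormedSpace.exp x) (NormedSpace.exp (-x))
    (exp_neg_apply_exp_apply x) (exp_apply_exp_neg_apply x)

theorem coe_expEquiv {V : Type*} [NormedAddCommGroup V] [NormedSpace ℝ V] [CompleteSpace V]
    (x : V →L[ℝ] V) : (expEquiv x : V →L[ℝ] V) = NormedSpace.exp x := rfl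

attribute [local irreducible] ins wd wedge prodN

/-- `(u, v) ↦ (u ⊗ v)_N` as a continuous bilinear map. -/
def prodNC (n : ℕ) : EMod n →L[ℝ] EMod n →L[ℝ] NMod n :=
  LinearMap.toContinuousBilinearMap (prodNL n)

instance instCompleteSpaceEMod (n : ℕ) : CompleteSpace (EMod n) := FiniteDimensional.complete ℝ _

instance instCompleteSpaceNMod (n : ℕ) : CompleteSpace (NMod n) := FiniteDimensional.complete ℝ _

theorem exp_mem_excPairs {n : ℕ} {x : EMod n →L[ℝ] EMod n} {y : NMod n →L[ℝ] NMod n}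
    (h : (x, y) ∈ infPairs n) : (expEquiv x, expEquiv y) ∈ excPairs n := by
  refine ⟨Subgroup.subset_closure ⟨x, h.1, coe_expEquiv x⟩, fun u v => ?_⟩
  exact exp_bilinear (prodNC n) h.2 u v

theorem trans_mem_excPairs {n : ℕ} {p q : (EMod n ≃L[ℝ] EMod n) × (NMod n ≃L[ℝ] NMod n)}
    (hp : p ∈ excPairs n) (hq : q ∈ excPairs n) :
    (p.1.trans q.1, p.2.trans q.2) ∈ excPairs n := by
  refine ⟨(excGroup n).mul_mem hq.1 hp.1, fun u v => ?_⟩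
  show q.2 (p.2 (prodN u v)) = prodN (q.1 (p.1 u)) (q.1 (p.1 v))
  rw [hp.2, hq.2]

theorem symm_mem_excPairs {n : ℕ} {p : (EMod n ≃L[ℝ] EMod n) × (NMod n ≃L[ℝ] NMod n)}
    (hp : p ∈ excPairs n) : (p.1.symm, p.2.symm) ∈ excPairs n := by
  refine ⟨(excGroup n).inv_mem hp.1, fun u v => ?_⟩
  show p.2.symm _ = _
  rw [ContinuousLinearEquiv.symm_apply_eq, hp.2]
  simp

theorem refl_mem_excPairs (n : ℕ) :
    (ContinuousLinearEquiv.refl ℝ (EMod n), ContinuousLinearEquiv.refl ℝ (NMod n)) ∈ excPairs n :=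
  ⟨(excGroup n).one_mem, fun _ _ => rfl⟩

end

/-! ### Nilpotent exponentials, and multivectors as functionals on forms -/

section

theorem hasDerivAt_exp_smul_apply {V : Type*} [NormedAddCommGroup V] [NormedSpace ℝ V]
    [CompleteSpace V] (x : V →L[ℝ] V) (u : V) (t : ℝ) :
    HasDerivAt (fun s : ℝ => NormedSpace.exp (s • x) u) (x (NormedSpace.exp (t • x) u)) t :=
  (hasDerivAt_exp_smul_const' x t).clm_apply (hasDerivAt_const t u) |>.congr_deriv (by simp)

theorem map_exp_of_comp_eq_zero {V W : Type*} [NormedAddCommGroup V] [NormedSpace ℝ V]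
    [CompleteSpace V] [NormedAddCommGroup W] [NormedSpace ℝ W] (f : V →L[ℝ] W) {x : V →L[ℝ] V}
    (h : ∀ u, f (x u) = 0) (u : V) : f (NormedSpace.exp x u) = f u := by
  have hd : ∀ t : ℝ, HasDerivAt (fun s : ℝ => f (NormedSpace.exp (s • x) u)) 0 t := fun t =>
    (f.hasFDerivAt.comp_hasDerivAt t (hasDerivAt_exp_smul_apply x u t)).congr_deriv (h _)
  have hc := is_const_of_deriv_eq_zero (fun t => (hd t).differentiableAt) (fun t => (hd t).deriv) 1 0
  simpa [NormedSpace.exp_zero] using hc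

theorem exp_apply_of_sq_eq_zero {V : Type*} [NormedAddCommGroup V] [NormedSpace ℝ V]
    [CompleteSpace V] {x : V →L[ℝ] V} {u : V} (h : x (x u) = 0) :
    NormedSpace.exp x u = u + x u := by
  -- This curve runs from u + x u at s = 0 to exp(x) u at s = 1, and its derivative contains only x
  -- (x u).
  have hd : ∀ t : ℝ, HasDerivAt (fun s : ℝ => NormedSpace.exp (s • x) (u + (1 - s) • x u)) 0 t := by
    intro t
    have h1 : HasDerivAt (fun s : ℝ => u + (1 - s) • x u) (-x u) t := by
      have := (((hasDerivAt_id t).const_sub 1).smul_const (x u)).const_add u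
      simpa using this
    refine ((hasDerivAt_exp_smul_const x t).clm_apply h1).congr_deriv ?_
    simp [mul_apply_eq_comp, h]
  have hc := is_const_of_deriv_eq_zero (fun t => (hd t).differentiableAt) (fun t => (hd t).deriv) 1 0
  simpa [NormedSpace.exp_zero] using hc

theorem exp_apply_of_cube_eq_zero {V : Type*} [NormedAddCommGroup V] [NormedSpace ℝ V]
    [CompleteSpace V] {x : V →L[ℝ] V} {u : V} (h : x (x (x u)) = 0) :
    NormedSpace.exp x u = u + x u + (1 / 2 : ℝ) • x (x u) := by
  -- The Taylor polynomial of exp((1 - s)x)u is transported by exp(sx); the derivative involves only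
  -- the third power of x on u.
  have hd : ∀ t : ℝ, HasDerivAt (fun s : ℝ => NormedSpace.exp (s • x)
      (u + (1 - s) • x u + ((1 - s) ^ 2 / 2) • x (x u))) 0 t := by
    intro t
    have h1 : HasDerivAt (fun s : ℝ => u + (1 - s) • x u + ((1 - s) ^ 2 / 2) • x (x u))
        (-x u + (-(1 - t)) • x (x u)) t := by
      have h0 := (hasDerivAt_id t).const_sub 1
      have := ((h0.smul_const (x u)).const_add u).add
        (((h0.pow 2).div_const 2).smul_const (x (x u)))
      refine this.congr_deriv ?_
      simp
      ring_nf
    refine ((hasDerivAt_exp_smul_const x t).clm_apply h1).congr_deriv ?_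
    simp [mul_apply_eq_comp, h]
    module
  have hc := is_const_of_deriv_eq_zero (fun t => (hd t).differentiableAt) (fun t => (hd t).deriv) 1 0
  simpa [NormedSpace.exp_zero] using hc

theorem eq_sum_proj {n : ℕ} (α : T n →L[ℝ] ℝ) :
    α = ∑ i, α (vec i) • (EuclideanSpace.proj i : T n →L[ℝ] ℝ) := by
  ext X
  have hX : X = ∑ i, X i • vec i := by
    have := (EuclideanSpace.basisFun (Fin n) ℝ).sum_repr X
    simpa [vec] using this.symm
  conv_lhs => rw [hX]
  simp [mul_comm]

/-- Every functional on k-forms is a combination of evaluations at basis vectors. Multivectors can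
therefore be prescribed as functionals, with no choice of decomposition. -/
theorem map_eq_sum_detForm {n k : ℕ} (W : Form n k →L[ℝ] ℝ) (σ : Form n k) :
    W σ = ∑ I : Fin k → Fin n, ((k.factorial : ℝ)⁻¹ * W (detForm fun j => EuclideanSpace.proj (I j))) *
      σ fun j => vec (I j) := by
  conv_lhs => rw [form_eq_sum_detForm σ]
  rw [map_sum]
  refine Finset.sum_congr rfl fun I _ => ?_
  rw [map_smul, smul_eq_mul]
  ring

/-- Pairs of endomorphisms of `E` and `N`. -/
abbrev EndPair (n : ℕ) : Type := (EMod n →L[ℝ] EMod n) × (NMod n →L[ℝ] NMod n)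

/-- The linear extension of `w ↦ c w` to functionals on forms, where the multivector `w` acts by
evaluation. -/
def functionalSum {n k : ℕ} {V : Type*} [NormedAddCommGroup V] [NormedSpace ℝ V]
    (c : (Fin k → Fin n) → V) : (Form n k →L[ℝ] ℝ) →L[ℝ] V :=
  LinearMap.toContinuousLinearMap
    { toFun := fun W => ∑ I : Fin k → Fin n,
        ((k.factorial : ℝ)⁻¹ * W (detForm fun j => EuclideanSpace.proj (I j))) • c I
      map_add' := fun W W' => by
        simp only [add_apply, mul_add, add_smul, Finset.sum_add_distrib]
      map_smul' := fun r W => by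
        simp only [smul_apply, smul_eq_mul, Finset.smul_sum, smul_smul, RingHom.id_apply]
        simp only [mul_left_comm] }

/-- The action of a trivector, viewed as a functional on 3-forms, on `E` and `N`. -/
def triPair (n : ℕ) : (Form n 3 →L[ℝ] ℝ) →L[ℝ] EndPair n :=
  functionalSum fun I => (triE fun j => vec (I j), triN fun j => vec (I j))

theorem triPair_apply {n : ℕ} (W : Form n 3 →L[ℝ] ℝ) : triPair n W = ∑ I : Fin 3 → Fin n,
    ((Nat.factorial 3 : ℝ)⁻¹ * W (detForm fun j => EuclideanSpace.proj (I j))) •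
      (triE fun j => vec (I j), triN fun j => vec (I j)) := rfl

/-- The action of a 6-vector, viewed as a functional on 6-forms, on `E` and `N`. -/
def sixPair (n : ℕ) : (Form n 6 →L[ℝ] ℝ) →L[ℝ] EndPair n :=
  functionalSum fun I => (sixE fun j => vec (I j), sixN fun j => vec (I j))

theorem sixPair_apply {n : ℕ} (W : Form n 6 →L[ℝ] ℝ) : sixPair n W = ∑ I : Fin 6 → Fin n,
    ((Nat.factorial 6 : ℝ)⁻¹ * W (detForm fun j => EuclideanSpace.proj (I j))) •
      (sixE fun j => vec (I j), sixN fun j => vec (I j)) := rfl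

attribute [local irreducible] ins wd wedge prodN

theorem triPair_mem {n : ℕ} (hn : n ≤ 6) (W : Form n 3 →L[ℝ] ℝ) : triPair n W ∈ infPairs n := by
  rw [triPair_apply]
  exact Submodule.sum_mem _ fun I _ => Submodule.smul_mem _ _ (tri_mem_infPairs hn _)

theorem sixPair_mem {n : ℕ} (hn : n ≤ 6) (W : Form n 6 →L[ℝ] ℝ) : sixPair n W ∈ infPairs n := by
  rw [sixPair_apply]
  exact Submodule.sum_mem _ fun I _ => Submodule.smul_mem _ _ (six_mem_infPairs hn _)

theorem form_three_cyclic {n : ℕ} (β : Form n 1) (σ : Form n 2) (w : Fin 3 → T n) :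
    wd (rfl : 1 + 2 = 3) β σ w = cov β (w 0) * σ ![w 1, w 2] + cov β (w 1) * σ ![w 2, w 0]
      + cov β (w 2) * σ ![w 0, w 1] := by
  obtain ⟨β, rfl⟩ : ∃ b, β = oneForm b := ⟨cov β, (oneForm_cov β).symm⟩
  have e0 : (0 : Fin 3).removeNth w = ![w 1, w 2] := by ext j : 1; fin_cases j <;> rfl
  have e1 : (1 : Fin 3).removeNth w = ![w 0, w 2] := by ext j : 1; fin_cases j <;> rfl
  have e2 : (2 : Fin 3).removeNth w = ![w 0, w 1] := by ext j : 1; fin_cases j <;> rfl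
  rw [wd_oneForm, ext1_apply, cov_oneForm, Fin.sum_univ_three, e0, e1, e2, apply_pair_swap (w 2)]
  simp

theorem cov_triE {n : ℕ} (β : Form n 1) (w : Fin 3 → T n) (u : EMod n) :
    cov β (triE w u).1 = wd (rfl : 1 + 2 = 3) β u.2.1 w := by
  rw [form_three_cyclic, triE_apply]
  simp only [map_add, map_smul, smul_eq_mul]
  ring

theorem triPair_fst_apply {n : ℕ} (W : Form n 3 →L[ℝ] ℝ) (u : EMod n) :
    (triPair n W).1 u = ∑ I : Fin 3 → Fin n,
      ((Nat.factorial 3 : ℝ)⁻¹ * W (detForm fun j => EuclideanSpace.proj (I j))) •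
        triE (fun j => vec (I j)) u := by
  rw [triPair_apply, Prod.fst_sum, sum_apply]
  rfl

theorem sixPair_fst_apply {n : ℕ} (W : Form n 6 →L[ℝ] ℝ) (u : EMod n) :
    (sixPair n W).1 u = ∑ I : Fin 6 → Fin n,
      ((Nat.factorial 6 : ℝ)⁻¹ * W (detForm fun j => EuclideanSpace.proj (I j))) •
        sixE (fun j => vec (I j)) u := by
  rw [sixPair_apply, Prod.fst_sum, sum_apply]
  rfl

/-- A trivector acts on 2-forms by the duality ⟨β, W · σ⟩ = W(β ∧ σ). The straightening arguments
use the action on 2-forms only through this formula, and the analogous one for 6-vectors. -/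
theorem cov_triPair {n : ℕ} (W : Form n 3 →L[ℝ] ℝ) (β : Form n 1) (u : EMod n) :
    cov β ((triPair n W).1 u).1 = W (wd (rfl : 1 + 2 = 3) β u.2.1) := by
  rw [triPair_fst_apply, Prod.fst_sum, map_sum, map_eq_sum_detForm W]
  refine Finset.sum_congr rfl fun I _ => ?_
  rw [Prod.smul_fst, map_smul, cov_triE, smul_eq_mul]

theorem cov_sixPair {n : ℕ} (W : Form n 6 →L[ℝ] ℝ) (β : Form n 1) (u : EMod n) :
    cov β ((sixPair n W).1 u).1 = -W (wd (rfl : 1 + 5 = 6) β u.2.2) := by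
  rw [sixPair_fst_apply, Prod.fst_sum, map_sum, map_eq_sum_detForm W, ← Finset.sum_neg_distrib]
  refine Finset.sum_congr rfl fun I _ => ?_
  rw [Prod.smul_fst, map_smul, cov_sixE, smul_eq_mul, mul_neg]

theorem sixPair_snd {n : ℕ} (W : Form n 6 →L[ℝ] ℝ) (u : EMod n) : ((sixPair n W).1 u).2 = 0 := by
  rw [sixPair_fst_apply, Prod.snd_sum]
  exact Finset.sum_eq_zero fun I _ => smul_zero _

theorem triPair_snd_snd {n : ℕ} (W : Form n 3 →L[ℝ] ℝ) (u : EMod n) :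
    ((triPair n W).1 u).2.2 = 0 := by
  rw [triPair_fst_apply, Prod.snd_sum, Prod.snd_sum]
  exact Finset.sum_eq_zero fun I _ => smul_zero _

theorem triPair_snd_fst {n : ℕ} (W : Form n 3 →L[ℝ] ℝ) {u : EMod n} (h : u.2.2 = 0) :
    ((triPair n W).1 u).2.1 = 0 := by
  rw [triPair_fst_apply, Prod.snd_sum, Prod.fst_sum]
  refine Finset.sum_eq_zero fun I _ => ?_
  rw [Prod.smul_snd, Prod.smul_fst, triE_apply, h]
  dsimp only
  rw [ins_zero_right, ins_zero_right, ins_zero_right, smul_zero]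

theorem eq_of_cov_eq {n : ℕ} {X Y : T n} (h : ∀ β : Form n 1, cov β X = cov β Y) : X = Y := by
  ext i
  have := h (oneForm (EuclideanSpace.proj i))
  rw [cov_oneForm] at this
  simpa using this

theorem triPair_fst {n : ℕ} (W : Form n 3 →L[ℝ] ℝ) {u : EMod n} (h : u.2.1 = 0) :
    ((triPair n W).1 u).1 = 0 :=
  eq_of_cov_eq fun β => by rw [cov_triPair, h, map_zero, map_zero, map_zero]

theorem sixPair_eq_zero {n : ℕ} (W : Form n 6 →L[ℝ] ℝ) {u : EMod n} (h : u.2.2 = 0) :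
    (sixPair n W).1 u = 0 := by
  refine Prod.ext (eq_of_cov_eq fun β => ?_) (sixPair_snd W u)
  rw [cov_sixPair, h, map_zero, map_zero, Prod.fst_zero, map_zero, neg_zero]

end

/-! ### Good anchors: isotropy, straight covectors, and the trivector step -/

section

theorem prodE_fst {n : ℕ} (ξ : EMod n →L[ℝ] ℝ) (k : NMod n) : (prodE ξ k).1 =
    ∑ i, (ξ (0, wd (rfl : 1 + 1 = 2) (covec i) k.1, 0)
      + ξ (0, 0, wd (rfl : 1 + 4 = 5) (covec i) k.2.1)) • vec i := rfl

theorem prodE_two {n : ℕ} (ξ : EMod n →L[ℝ] ℝ) (k : NMod n) : (prodE ξ k).2.1 =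
    wd (rfl : 1 + 1 = 2) (oneForm (ξ.comp (ContinuousLinearMap.inl ℝ (T n) (Form n 2 × Form n 5)))) k.1
     - (1 / 2 : ℝ) • ∑ i, ∑ j,
        ξ (0, ins (vec j) (ins (vec i) k.2.1), 0) • (wedge (covec i) (covec j) : Form n 2)
     + ∑ i, ∑ j, ξ (0, 0, ins (vec j) (k.2.2 (vec i))) • (wedge (covec i) (covec j) : Form n 2) :=
  rfl

set_option maxRecDepth 20000 in
theorem prodE_five {n : ℕ} (ξ : EMod n →L[ℝ] ℝ) (k : NMod n) : (prodE ξ k).2.2 =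
    wd (rfl : 1 + 4 = 5) (oneForm (ξ.comp (ContinuousLinearMap.inl ℝ (T n) (Form n 2 × Form n 5))))
      k.2.1 + ∑ i, ∑ j, ξ (0, wedge (covec i) (covec j), 0) • (ins (vec j) (k.2.2 (vec i)) : Form n 5) :=
  rfl

attribute [local irreducible] ins wd wedge prodN prodE

theorem EMod.eq_add {n : ℕ} (u : EMod n) : u = (u.1, 0, 0) + (0, u.2.1, 0) + (0, 0, u.2.2) := by
  simp

theorem apply_zero_zero {n : ℕ} (ξ : EMod n →L[ℝ] ℝ) : ξ (0, 0, 0) = 0 := map_zero ξ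

/-- The restriction of a functional on `E` to `T`. -/
def partT {n : ℕ} (ξ : EMod n →L[ℝ] ℝ) : T n →L[ℝ] ℝ :=
  ξ.comp (ContinuousLinearMap.inl ℝ (T n) (Form n 2 × Form n 5))

theorem partT_apply {n : ℕ} (ξ : EMod n →L[ℝ] ℝ) (X : T n) : partT ξ X = ξ (X, 0, 0) := rfl

theorem sum_covec {n : ℕ} (α : T n →L[ℝ] ℝ) : ∑ i, α (vec i) • covec i = oneForm α := by
  refine form_one_ext fun X => ?_
  have hc : ∀ β : Form n 1, cov β X = (LinearMap.toContinuousLinearMap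
    { toFun := fun β : Form n 1 => cov β X
      map_add' := fun a b => by rw [cov_add]; rfl
      map_smul' := fun a b => by rw [cov_smul]; rfl }) β := fun _ => rfl
  rw [hc, map_sum, cov_oneForm]
  conv_rhs => rw [eq_sum_proj α]
  rw [sum_apply]
  refine Finset.sum_congr rfl fun i _ => ?_
  rw [map_smul, ← hc, covec, cov_oneForm]
  rfl

/-- The expression is symmetric in ξ and ξ', because N → S²E is dual to a symmetric pairing; for k
in T* each term couples a T*-part to a 2-form part. -/
theorem apply_prodE_one {n : ℕ} (ξ ξ' : EMod n →L[ℝ] ℝ) (β : Form n 1) :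
    ξ' (prodE ξ (β, 0, 0)) = ξ (0, wd (rfl : 1 + 1 = 2) (oneForm (partT ξ')) β, 0)
      + ξ' (0, wd (rfl : 1 + 1 = 2) (oneForm (partT ξ)) β, 0) := by
  have h1 : (prodE ξ (β, 0, 0)).2.1 = wd (rfl : 1 + 1 = 2) (oneForm (partT ξ)) β := by
    rw [prodE_two]
    simp [ins_zero_right, apply_zero_zero]
    rfl
  have h2 : (prodE ξ (β, 0, 0)).2.2 = 0 := by
    rw [prodE_five]
    simp [ins_zero_right]
  have h3 : ξ' ((prodE ξ (β, 0, 0)).1, 0, 0)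
      = ξ (0, wd (rfl : 1 + 1 = 2) (oneForm (partT ξ')) β, 0) := by
    rw [← partT_apply, prodE_fst, map_sum, ← sum_covec (partT ξ')]
    have e : ∀ a : Form n 1, ξ (0, wd (rfl : 1 + 1 = 2) a β, 0) = (LinearMap.toContinuousLinearMap
      { toFun := fun a : Form n 1 => ξ (0, wd (rfl : 1 + 1 = 2) a β, 0)
        map_add' := fun a b => by rw [← map_add]; simp
        map_smul' := fun a b => by
          rw [RingHom.id_apply, ← map_smul]; simp }) a := fun _ => rfl
    rw [e, map_sum]
    refine Finset.sum_congr rfl fun i _ => ?_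
    rw [map_smul, map_smul, ← e]
    simp [apply_zero_zero, mul_comm]
  rw [EMod.eq_add (prodE ξ (β, 0, 0)), map_add, map_add, h3, h1, h2, apply_zero_zero, add_zero]

/-- For k in Λ⁴T* there is also a term bilinear in the 2-form parts of ξ and ξ'. It disappears
because ξ is assumed to have none, leaving the coupling of T*-parts to 5-form parts. -/
theorem apply_prodE_four {n : ℕ} {ξ : EMod n →L[ℝ] ℝ} (hξ : ∀ σ, ξ (0, σ, 0) = 0)
    (ξ' : EMod n →L[ℝ] ℝ) (κ : Form n 4) :
    ξ' (prodE ξ (0, κ, 0)) = ξ (0, 0, wd (rfl : 1 + 4 = 5) (oneForm (partT ξ')) κ)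
      + ξ' (0, 0, wd (rfl : 1 + 4 = 5) (oneForm (partT ξ)) κ) := by
  have h1 : (prodE ξ (0, κ, 0)).2.1 = 0 := by
    rw [prodE_two]
    simp [ins_zero_right, hξ]
  have h2 : (prodE ξ (0, κ, 0)).2.2 = wd (rfl : 1 + 4 = 5) (oneForm (partT ξ)) κ := by
    rw [prodE_five]
    simp [ins_zero_right]
    rfl
  have h3 : ξ' ((prodE ξ (0, κ, 0)).1, 0, 0)
      = ξ (0, 0, wd (rfl : 1 + 4 = 5) (oneForm (partT ξ')) κ) := by
    rw [← partT_apply, prodE_fst, map_sum, ← sum_covec (partT ξ')]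
    have e : ∀ a : Form n 1, ξ (0, 0, wd (rfl : 1 + 4 = 5) a κ) = (LinearMap.toContinuousLinearMap
      { toFun := fun a : Form n 1 => ξ (0, 0, wd (rfl : 1 + 4 = 5) a κ)
        map_add' := fun a b => by rw [← map_add]; simp
        map_smul' := fun a b => by
          rw [RingHom.id_apply, ← map_smul]; simp }) a := fun _ => rfl
    rw [e, map_sum]
    refine Finset.sum_congr rfl fun i _ => ?_
    rw [map_smul, map_smul, ← e]
    simp [apply_zero_zero, mul_comm]
  rw [EMod.eq_add (prodE ξ (0, κ, 0)), map_add, map_add, h3, h1, h2, apply_zero_zero, add_zero]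

/-- The anchor is surjective and its transpose is isotropic in every frame of the orbit. -/
def IsGoodAnchor {n : ℕ} (l : EMod n →L[ℝ] T n) : Prop :=
  Function.Surjective l ∧ ∀ p ∈ excPairs n, ∀ (α : T n →L[ℝ] ℝ) (k : NMod n),
    l (p.1 (prodE (α.comp (l.comp (p.1 : EMod n →L[ℝ] EMod n))) k)) = 0

theorem IsGoodAnchor.comp {n : ℕ} {l : EMod n →L[ℝ] T n} (h : IsGoodAnchor l)
    {p : (EMod n ≃L[ℝ] EMod n) × (NMod n ≃L[ℝ] NMod n)} (hp : p ∈ excPairs n) :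
    IsGoodAnchor (l.comp (p.1 : EMod n →L[ℝ] EMod n)) :=
  ⟨h.1.comp p.1.surjective, fun _ hq α k => h.2 _ (trans_mem_excPairs hq hp) α k⟩

theorem IsGoodAnchor.isotropic {n : ℕ} {l : EMod n →L[ℝ] T n} (h : IsGoodAnchor l)
    (α α' : T n →L[ℝ] ℝ) (k : NMod n) : (α'.comp l) (prodE (α.comp l) k) = 0 := by
  have := h.2 _ (refl_mem_excPairs n) α k
  show α' (l (prodE (α.comp l) k)) = 0
  have e : l (prodE (α.comp l) k) = 0 := this
  rw [e, map_zero]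

/-- The covectors whose pullback by the anchor lies in `T* ⊆ E*`. -/
def straight {n : ℕ} (l : EMod n →L[ℝ] T n) : Submodule ℝ (T n →L[ℝ] ℝ) where
  carrier := {α | ∀ u : EMod n, u.1 = 0 → α (l u) = 0}
  add_mem' := fun ha hb u hu => by rw [add_apply, ha u hu, hb u hu, add_zero]
  zero_mem' := fun u _ => rfl
  smul_mem' := fun c a ha u hu => by rw [smul_apply, ha u hu, smul_zero]

/-- The `T*`-part of the pullback of a covector by the anchor. -/
def pullT {n : ℕ} (l : EMod n →L[ℝ] T n) : (T n →L[ℝ] ℝ) →ₗ[ℝ] (T n →L[ℝ] ℝ) where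
  toFun := fun α => partT (α.comp l)
  map_add' := fun _ _ => rfl
  map_smul' := fun _ _ => rfl

theorem pullT_apply {n : ℕ} (l : EMod n →L[ℝ] T n) (α : T n →L[ℝ] ℝ) (X : T n) :
    pullT l α X = α (l (X, 0, 0)) := rfl

theorem apply_of_mem_straight {n : ℕ} {l : EMod n →L[ℝ] T n} {α : T n →L[ℝ] ℝ}
    (h : α ∈ straight l) (u : EMod n) : α (l u) = pullT l α u.1 := by
  have := h (u - (u.1, 0, 0)) (by simp)
  rw [map_sub, map_sub, sub_eq_zero] at this
  rw [this, pullT_apply]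

theorem exists_vector_of_notMem {n : ℕ} {R : Submodule ℝ (T n →L[ℝ] ℝ)} {a : T n →L[ℝ] ℝ}
    (h : a ∉ R) : ∃ v, a v = 1 ∧ ∀ r ∈ R, r v = 0 := by
  obtain ⟨f, hf, hR⟩ := Submodule.exists_le_ker_of_notMem h
  have e : ∀ β : T n →L[ℝ] ℝ, β (∑ i, f (EuclideanSpace.proj i) • vec i) = f β := by
    intro β
    conv_rhs => rw [eq_sum_proj β]
    rw [map_sum, map_sum]
    refine Finset.sum_congr rfl fun i _ => ?_
    rw [map_smul, map_smul, smul_eq_mul, smul_eq_mul, mul_comm]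
  refine ⟨(f a)⁻¹ • ∑ i, f (EuclideanSpace.proj i) • vec i, ?_, fun r hr => ?_⟩
  · rw [map_smul, e, smul_eq_mul, inv_mul_cancel₀ hf]
  · rw [map_smul, e, show f r = 0 from hR hr, smul_zero]

section

variable {n : ℕ} {l : EMod n →L[ℝ] T n}

/-- In the isotropy relation for β and α, one of the two symmetric terms involves the 2-form part of
β and vanishes. Since α is arbitrary, l kills the ideal generated by the T*-part of β in degree two.
-/
theorem IsGoodAnchor.straight_wd_one (h : IsGoodAnchor l) {β : T n →L[ℝ] ℝ} (hβ : β ∈ straight l)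
    (α : T n →L[ℝ] ℝ) (γ : Form n 1) :
    α (l (0, wd (rfl : 1 + 1 = 2) (oneForm (pullT l β)) γ, 0)) = 0 := by
  have := h.isotropic β α (γ, 0, 0)
  rw [apply_prodE_one] at this
  have e : (β.comp l) (0, wd (rfl : 1 + 1 = 2) (oneForm (partT (α.comp l))) γ, 0) = 0 :=
    hβ _ rfl
  rw [e, zero_add] at this
  exact this

theorem IsGoodAnchor.straight_wd_four (h : IsGoodAnchor l) {β : T n →L[ℝ] ℝ} (hβ : β ∈ straight l)
    (α : T n →L[ℝ] ℝ) (κ : Form n 4) :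
    α (l (0, 0, wd (rfl : 1 + 4 = 5) (oneForm (pullT l β)) κ)) = 0 := by
  have := h.isotropic β α (0, κ, 0)
  rw [apply_prodE_four (fun σ => hβ _ rfl)] at this
  have e : (β.comp l) (0, 0, wd (rfl : 1 + 4 = 5) (oneForm (partT (α.comp l))) κ) = 0 :=
    hβ _ rfl
  rw [e, zero_add] at this
  exact this

/-- For α paired with itself the two terms of the isotropy relation coincide. No straightness is
needed, but only the α-component of l is controlled. -/
theorem IsGoodAnchor.self_wd_one (h : IsGoodAnchor l) (α : T n →L[ℝ] ℝ) (γ : Form n 1) :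
    α (l (0, wd (rfl : 1 + 1 = 2) (oneForm (pullT l α)) γ, 0)) = 0 := by
  have := h.isotropic α α (γ, 0, 0)
  rw [apply_prodE_one, ← two_mul, mul_eq_zero] at this
  exact this.resolve_left two_ne_zero

theorem IsGoodAnchor.self_wd_four (h : IsGoodAnchor l) {α : T n →L[ℝ] ℝ}
    (hα : ∀ σ, α (l (0, σ, 0)) = 0) (κ : Form n 4) :
    α (l (0, 0, wd (rfl : 1 + 4 = 5) (oneForm (pullT l α)) κ)) = 0 := by
  have := h.isotropic α α (0, κ, 0)
  rw [apply_prodE_four hα, ← two_mul, mul_eq_zero] at this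
  exact this.resolve_left two_ne_zero

/-- The functional `φ ↦ c α(l(i_v φ))` on 3-forms. -/
def triFun (l : EMod n →L[ℝ] T n) (α : T n →L[ℝ] ℝ) (v : T n) : Form n 3 →L[ℝ] ℝ :=
  LinearMap.toContinuousLinearMap
    { toFun := fun φ => -α (l (0, ins v φ, 0))
      map_add' := fun a b => by
        rw [ins_add_right, ← neg_add, ← map_add, ← map_add]; simp
      map_smul' := fun c a => by
        rw [ins_smul_right, RingHom.id_apply, smul_neg, ← map_smul, ← map_smul]; simp }

theorem triFun_apply (α : T n →L[ℝ] ℝ) (v : T n) (φ : Form n 3) :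
    triFun l α v φ = -α (l (0, ins v φ, 0)) := rfl

/-- The functional `φ ↦ α(l(i_v φ))` on 6-forms. -/
def sixFun (l : EMod n →L[ℝ] T n) (α : T n →L[ℝ] ℝ) (v : T n) : Form n 6 →L[ℝ] ℝ :=
  LinearMap.toContinuousLinearMap
    { toFun := fun φ => α (l (0, 0, ins v φ))
      map_add' := fun a b => by
        rw [ins_add_right, ← map_add, ← map_add]; simp
      map_smul' := fun c a => by
        rw [ins_smul_right, RingHom.id_apply, ← map_smul, ← map_smul]; simp }

theorem sixFun_apply (α : T n →L[ℝ] ℝ) (v : T n) (φ : Form n 6) :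
    sixFun l α v φ = α (l (0, 0, ins v φ)) := rfl

/-- Contract b ∧ σ with v: the term b ∧ i_v σ is removed by h. If b v = 1 and b is the T*-part of α,
the functional reproduces the 2-form part of α with the opposite sign, as required for cancelling
it. -/
theorem triFun_wd (α : T n →L[ℝ] ℝ) (v : T n) (b : T n →L[ℝ] ℝ) (σ : Form n 2)
    (h : ∀ γ, α (l (0, wd (rfl : 1 + 1 = 2) (oneForm b) γ, 0)) = 0) :
    triFun l α v (wd (rfl : 1 + 2 = 3) (oneForm b) σ) = -(b v * α (l (0, σ, 0))) := by
  rw [triFun_apply, ins_wd_one_left (l := 1), cov_oneForm]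
  have e : ((0, b v • σ - wd (rfl : 1 + 1 = 2) (oneForm b) (ins v σ), 0) : EMod n)
      = b v • (0, σ, 0) - (0, wd (rfl : 1 + 1 = 2) (oneForm b) (ins v σ), 0) := by simp
  rw [e, map_sub, map_sub, h, map_smul, map_smul, sub_zero, smul_eq_mul]

theorem sixFun_wd (α : T n →L[ℝ] ℝ) (v : T n) (b : T n →L[ℝ] ℝ) (σ : Form n 5)
    (h : ∀ γ, α (l (0, 0, wd (rfl : 1 + 4 = 5) (oneForm b) γ)) = 0) :
    sixFun l α v (wd (rfl : 1 + 5 = 6) (oneForm b) σ) = b v * α (l (0, 0, σ)) := by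
  rw [sixFun_apply, ins_wd_one_left (l := 4), cov_oneForm]
  have e : ((0, 0, b v • σ - wd (rfl : 1 + 4 = 5) (oneForm b) (ins v σ)) : EMod n)
      = b v • (0, 0, σ) - (0, 0, wd (rfl : 1 + 4 = 5) (oneForm b) (ins v σ)) := by simp
  rw [e, map_sub, map_sub, h, map_smul, map_smul, sub_zero, smul_eq_mul]

theorem apply_eq_cov (b : T n →L[ℝ] ℝ) (X : T n) : b X = cov (oneForm b) X := by
  rw [cov_oneForm]

theorem apply_exp_of_apply_eq_zero {β : T n →L[ℝ] ℝ} {x : EMod n →L[ℝ] EMod n}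
    (h : ∀ u, β (l (x u)) = 0) (u : EMod n) : β (l (NormedSpace.exp x u)) = β (l u) :=
  map_exp_of_comp_eq_zero (β.comp l) h u

theorem straight_le_of_eq {l' : EMod n →L[ℝ] T n} (h : ∀ β ∈ straight l, ∀ u, β (l' u) = β (l u)) :
    straight l ≤ straight l' :=
  fun β hβ u hu => (h β hβ u).trans (hβ u hu)

theorem straight_lt_of_eq {l' : EMod n →L[ℝ] T n} (h : ∀ β ∈ straight l, ∀ u, β (l' u) = β (l u))
    {α : T n →L[ℝ] ℝ} (hα : α ∉ straight l) (hα' : ∀ u : EMod n, u.1 = 0 → α (l' u) = 0) :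
    straight l < straight l' :=
  lt_of_le_of_ne (straight_le_of_eq h) fun he => hα (he ▸ hα')

theorem exists_straight_lt_of_comp {q : (EMod n ≃L[ℝ] EMod n) × (NMod n ≃L[ℝ] NMod n)}
    (hq : q ∈ excPairs n)
    (h : ∃ p ∈ excPairs n, straight l < straight ((l.comp (q.1 : EMod n →L[ℝ] EMod n)).comp
      (p.1 : EMod n →L[ℝ] EMod n))) :
    ∃ p ∈ excPairs n, straight l < straight (l.comp (p.1 : EMod n →L[ℝ] EMod n)) :=
  let ⟨_, hp, h⟩ := h
  ⟨_, trans_mem_excPairs hp hq, h⟩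

/-- If some covector has pullback with `T*`-part not among those of the straight ones, then it can
be made straight. -/
theorem IsGoodAnchor.exists_straight_lt_of_pullT (hn : n ≤ 6) (h : IsGoodAnchor l)
    {α : T n →L[ℝ] ℝ} (hα : pullT l α ∉ (straight l).map (pullT l)) :
    ∃ p ∈ excPairs n, straight l < straight (l.comp (p.1 : EMod n →L[ℝ] EMod n)) := by
  -- The vector v detects the new T*-part and annihilates the old ones; multivectors built with v
  -- therefore do not disturb the straight covectors.
  obtain ⟨v, hv, hR⟩ := exists_vector_of_notMem hα
  replace hR : ∀ β ∈ straight l, pullT l β v = 0 := fun β hβ => hR _ (Submodule.mem_map_of_mem hβ)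
  -- First a trivector cancels the 2-form part of α. It may change the 5-form part, so the 6-vector
  -- is defined afterwards from the new anchor.
  obtain ⟨x, hx⟩ : ∃ x, x = triPair n (triFun l α v) := ⟨_, rfl⟩
  have hxm : (x.1, x.2) ∈ infPairs n := hx ▸ triPair_mem hn _
  have h₁ := h.comp (exp_mem_excPairs hxm)
  have hl : ∀ u, l.comp (expEquiv x.1 : EMod n →L[ℝ] EMod n) u = l (NormedSpace.exp x.1 u) :=
    fun _ => rfl
  refine exists_straight_lt_of_comp (exp_mem_excPairs hxm) ?_
  generalize l.comp (expEquiv x.1 : EMod n →L[ℝ] EMod n) = l₁ at h₁ hl ⊢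
  have hβ₁ : ∀ β ∈ straight l, ∀ u, β (l₁ u) = β (l u) := by
    intro β hβ u
    rw [hl]
    refine apply_exp_of_apply_eq_zero (fun u => ?_) u
    rw [apply_of_mem_straight hβ, apply_eq_cov, hx, cov_triPair,
      triFun_wd _ _ _ _ (h.straight_wd_one hβ α), hR β hβ, zero_mul, neg_zero]
  have hx0 : ∀ X : T n, x.1 (X, 0, 0) = 0 := fun X =>
    Prod.ext (by rw [hx]; exact triPair_fst _ rfl) (Prod.ext (by rw [hx]; exact triPair_snd_fst _ rfl)
      (by rw [hx]; exact triPair_snd_snd _ _))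
  have hX₁ : ∀ X, l₁ (X, 0, 0) = l (X, 0, 0) := by
    intro X
    rw [hl, exp_apply_of_sq_eq_zero (by rw [hx0, map_zero]), hx0, add_zero]
  have hσ₁ : ∀ σ, α (l₁ (0, σ, 0)) = 0 := by
    intro σ
    have e : x.1 (0, σ, 0) = ((x.1 (0, σ, 0)).1, 0, 0) :=
      Prod.ext rfl (Prod.ext (by rw [hx]; exact triPair_snd_fst _ rfl)
      (by rw [hx]; exact triPair_snd_snd _ _))
    rw [hl, exp_apply_of_sq_eq_zero (by rw [e, hx0]), map_add, map_add, e, ← pullT_apply,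
      apply_eq_cov (pullT l α), hx, cov_triPair, triFun_wd _ _ _ _ (h.self_wd_one α), hv, one_mul, add_neg_cancel]
  have hp₁ : pullT l₁ α = pullT l α := by
    ext1 X
    rw [pullT_apply, pullT_apply, hX₁]
  have hpβ₁ : ∀ β ∈ straight l, β ∈ straight l₁ ∧ pullT l₁ β = pullT l β := by
    intro β hβ
    refine ⟨fun u hu => ?_, ?_⟩
    · rw [hβ₁ β hβ]; exact hβ u hu
    · ext1 X
      rw [pullT_apply, pullT_apply, hX₁]
  -- Now the 5-form part. Isotropy of α with itself in degree five is available because its 2-form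
  -- part is already zero.
  obtain ⟨y, hy⟩ : ∃ y, y = sixPair n (sixFun l₁ α v) := ⟨_, rfl⟩
  have hym : (y.1, y.2) ∈ infPairs n := hy ▸ sixPair_mem hn _
  have hβ₂ : ∀ β ∈ straight l, ∀ u, β (l₁ (NormedSpace.exp y.1 u)) = β (l₁ u) := by
    intro β hβ u
    refine apply_exp_of_apply_eq_zero (fun u => ?_) u
    rw [apply_of_mem_straight (hpβ₁ β hβ).1, apply_eq_cov, hy, cov_sixPair,
      sixFun_wd _ _ _ _ (h₁.straight_wd_four (hpβ₁ β hβ).1 α), (hpβ₁ β hβ).2, hR β hβ, zero_mul,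
      neg_zero]
  refine ⟨_, exp_mem_excPairs hym, ?_⟩
  refine straight_lt_of_eq (α := α) (l' := l₁.comp (expEquiv y.1 : EMod n →L[ℝ] EMod n))
    (fun β hβ u => (hβ₂ β hβ u).trans (hβ₁ β hβ u))
    (fun h => hα (Submodule.mem_map_of_mem h)) (fun u hu => ?_)
  · change α (l₁ (NormedSpace.exp y.1 u)) = 0
    have e : y.1 u = ((y.1 u).1, 0, 0) := Prod.ext rfl (by rw [hy]; exact sixPair_snd _ _)
    have e0 : y.1 (y.1 u) = 0 := by rw [e, hy]; exact sixPair_eq_zero _ rfl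
    rw [exp_apply_of_sq_eq_zero e0, map_add, map_add, e, ← pullT_apply,
      apply_eq_cov (pullT l₁ α), hy, cov_sixPair,
      sixFun_wd _ _ _ _ (h₁.self_wd_four hσ₁), hp₁, hv, one_mul, EMod.eq_add u, hu]
    rw [map_add, map_add, map_add, map_add, hσ₁]
    have hz : α (l₁ ((0 : T n), 0, 0)) = 0 := map_zero (α.comp l₁)
    rw [zero_add, hσ₁, zero_add]
    exact add_neg_eq_zero.2 (by simp)

end

end

/-! ### Straightening the anchor at a point -/

section

attribute [local irreducible] ins wd wedge prodN prodE

theorem ext1_ext1_comm {n : ℕ} (β γ : T n →L[ℝ] ℝ) : ∀ {k : ℕ} (φ : Form n k),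
    ext1 β (ext1 γ φ) = -ext1 γ (ext1 β φ)
  | 0, φ => by
    refine form_ext_ins fun X => ?_
    rw [ins_neg_right, ins_ext1, ins_ext1, ins_ext1_zero, ins_ext1_zero]
    simp only [← ext1L_apply, map_smul]
    abel
  | k + 1, φ => by
    refine form_ext_ins fun X => ?_
    rw [ins_neg_right, ins_ext1, ins_ext1, ins_ext1, ins_ext1]
    have ih := ext1_ext1_comm β γ (ins X φ)
    simp only [← ext1L_apply, map_smul, map_sub] at ih ⊢
    rw [ih]
    abel

theorem form_eq_sum_ext1 {n k : ℕ} (σ : Form n (k + 1)) :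
    σ = ((k : ℝ) + 1)⁻¹ • ∑ i, ext1 (EuclideanSpace.proj i) (ins (vec i) σ) := by
  rw [sum_ext1_ins, smul_smul, inv_mul_cancel₀ (by positivity), one_smul]

section

variable {n : ℕ} {l : EMod n →L[ℝ] T n}

/-- A 3-form raises T to Λ²T*, then to Λ⁵T*, then kills, so the exponential series stops at second
order. -/
theorem formE_comp_apply (a : Form n 3) (X : T n) :
    NormedSpace.exp (formE a) (X, 0, 0) =
      (X, ins X a, (1 / 2 : ℝ) • wd (rfl : 3 + 2 = 5) a (ins X a)) := by
  have h1 : formE a ((X, 0, 0) : EMod n) = (0, ins X a, 0) := by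
    rw [formE_apply]; simp
  have h2 : formE a (0, ins X a, 0) = (0, 0, wd (rfl : 3 + 2 = 5) a (ins X a)) := by
    rw [formE_apply]; simp [ins_zero_left]
  have h3 : formE a (0, 0, wd (rfl : 3 + 2 = 5) a (ins X a)) = 0 := by
    rw [formE_apply]; simp [ins_zero_left]
  rw [exp_apply_of_cube_eq_zero (by rw [h1, h2, h3]), h1, h2]
  simp

theorem exp_formE_two (a : Form n 3) (σ : Form n 2) :
    NormedSpace.exp (formE a) (0, σ, 0) = (0, σ, wd (rfl : 3 + 2 = 5) a σ) := by
  have h2 : formE a (0, σ, 0) = (0, 0, wd (rfl : 3 + 2 = 5) a σ) := by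
    rw [formE_apply]; simp [ins_zero_left]
  have h3 : formE a (0, 0, wd (rfl : 3 + 2 = 5) a σ) = 0 := by
    rw [formE_apply]; simp [ins_zero_left]
  rw [exp_apply_of_sq_eq_zero (by rw [h2, h3]), h2]
  simp

/-- Acting by a 3-form, or the straightening step after it, increases the straight covectors, or
it keeps them and their `T*`-parts. -/
theorem IsGoodAnchor.formE_cases (hn : n ≤ 6) (h : IsGoodAnchor l) (a : Form n 3) :
    (∃ p ∈ excPairs n, straight l < straight (l.comp (p.1 : EMod n →L[ℝ] EMod n))) ∨
      ∃ p ∈ excPairs n, ∃ l', l' = l.comp (p.1 : EMod n →L[ℝ] EMod n) ∧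
        (∀ u, l' u = l (NormedSpace.exp (formE a) u)) ∧ IsGoodAnchor l' ∧
        straight l' = straight l ∧ (∀ β ∈ straight l, pullT l' β = pullT l β) ∧
        ∀ α, ∃ β ∈ straight l, pullT l' β = pullT l' α := by
  have hm := exp_mem_excPairs (form_mem_infPairs hn a)
  have h₁ := h.comp hm
  have hl : ∀ u, l.comp (expEquiv (formE a) : EMod n →L[ℝ] EMod n) u
      = l (NormedSpace.exp (formE a) u) := fun _ => rfl
  by_cases hex : ∃ p ∈ excPairs n, straight l < straight (l.comp (p.1 : EMod n →L[ℝ] EMod n))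
  · exact Or.inl hex
  refine Or.inr ⟨_, hm, _, rfl, hl, h₁, ?_⟩
  have hlt : ¬ straight l < straight (l.comp (expEquiv (formE a) : EMod n →L[ℝ] EMod n)) :=
    fun h => hex ⟨_, hm, h⟩
  have hlt' : ¬ ∃ p ∈ excPairs n, straight l < straight
      ((l.comp (expEquiv (formE a) : EMod n →L[ℝ] EMod n)).comp (p.1 : EMod n →L[ℝ] EMod n)) :=
    fun h => hex (exists_straight_lt_of_comp hm h)
  generalize l.comp (expEquiv (formE a) : EMod n →L[ℝ] EMod n) = l₁ at h₁ hl hlt hlt' ⊢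
  have hβ : ∀ β ∈ straight l, ∀ u, β (l₁ u) = β (l u) := by
    intro β hβ u
    rw [hl]
    refine apply_exp_of_apply_eq_zero (fun u => ?_) u
    rw [apply_of_mem_straight hβ, formE_apply]
    exact map_zero _
  have hle := straight_le_of_eq hβ
  have heq : straight l₁ = straight l := (not_lt_iff_le_imp_ge.1 hlt hle).antisymm hle
  refine ⟨heq, fun β hb => ?_, fun α => ?_⟩
  · ext1 X
    rw [pullT_apply, pullT_apply, hβ β hb]
  -- A T*-part of α that is new after the action of the 3-form would allow the trivector step and a
  -- larger straight space, which is excluded here.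
  · by_contra hα
    refine hlt' ?_
    rw [← heq]
    refine h₁.exists_straight_lt_of_pullT hn (α := α) fun hmem => hα ?_
    obtain ⟨β, hb, he⟩ := hmem
    exact ⟨β, heq ▸ hb, he⟩

/-- The straight covectors have corank at least three. -/
def CorankThree (l : EMod n →L[ℝ] T n) : Prop :=
  ∀ γ δ : T n →L[ℝ] ℝ, ∃ z : T n, z ≠ 0 ∧ (∀ β ∈ straight l, pullT l β z = 0) ∧ γ z = 0 ∧ δ z = 0

theorem exists_covector_apply_eq_one {z : T n} (hz : z ≠ 0) : ∃ ε : T n →L[ℝ] ℝ, ε z = 1 := by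
  obtain ⟨i, hi⟩ : ∃ i, z i ≠ 0 := by
    by_contra! h
    exact hz (by ext i; simpa using h i)
  refine ⟨(z i)⁻¹ • EuclideanSpace.proj i, ?_⟩
  rw [smul_apply]
  exact inv_mul_cancel₀ hi

theorem ins_ext1_ext1 {z : T n} {γ δ ε : T n →L[ℝ] ℝ} (hγ : γ z = 0) (hδ : δ z = 0) (hε : ε z = 1) :
    ins z (ext1 ε (ext1 γ (oneForm δ))) = ext1 γ (oneForm δ) := by
  have h0 : ins z (oneForm δ) = 0 := by
    ext v
    rw [ins_one_apply, cov_oneForm, hδ]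
    rfl
  have h1 : ext1 γ (0 : Form n 0) = 0 := map_zero (ext1L n 0 γ)
  have h2 : ext1 ε (0 : Form n 1) = 0 := map_zero (ext1L n 1 ε)
  rw [ins_ext1, ins_ext1, h0, h1, hγ, hε, zero_smul, sub_zero, one_smul, h2, sub_zero]

/-- A 3-form a changes the T*-part of α at z by α(l(i_z a)) plus a quadratic term. Corank three
provides z killed by all straight T*-parts and by γ, δ, so that i_z a can be any chosen γ ∧ δ seen
by α. A nonzero value at z then cannot be the value of a straight T*-part. -/
theorem IsGoodAnchor.exists_straight_lt_of_two (hn : n ≤ 6) (h : IsGoodAnchor l)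
    (h3 : CorankThree l) {α : T n →L[ℝ] ℝ} (hα : pullT l α = 0) {σ : Form n 2}
    (hσ : α (l (0, σ, 0)) ≠ 0) :
    ∃ p ∈ excPairs n, straight l < straight (l.comp (p.1 : EMod n →L[ℝ] EMod n)) := by
  obtain ⟨γ, δ, hγδ⟩ : ∃ γ δ, α (l (0, ext1 γ (oneForm δ), 0)) ≠ 0 := by
    by_contra! hc
    refine hσ ?_
    let f : Form n 2 →L[ℝ] ℝ := (α.comp l).comp
      ((ContinuousLinearMap.inr ℝ (T n) (Form n 2 × Form n 5)).comp
        (ContinuousLinearMap.inl ℝ (Form n 2) (Form n 5)))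
    have hf : ∀ σ, α (l (0, σ, 0)) = f σ := fun _ => rfl
    rw [hf, form_eq_sum_ext1 σ, map_smul, map_sum, Finset.sum_eq_zero, smul_zero]
    intro i _
    rw [← hf, ← oneForm_cov (ins (vec i) σ), hc]
  obtain ⟨z, hz, hR, hγ, hδ⟩ := h3 γ δ
  obtain ⟨ε, hε⟩ := exists_covector_apply_eq_one hz
  have key : ∀ a : Form n 3, α (l (0, ins z a, 0))
      + (1 / 2 : ℝ) * α (l (0, 0, wd (rfl : 3 + 2 = 5) a (ins z a))) ≠ 0 →
      ∃ p ∈ excPairs n, straight l < straight (l.comp (p.1 : EMod n →L[ℝ] EMod n)) := by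
    intro a ha
    refine (h.formE_cases hn a).resolve_right ?_
    rintro ⟨p, hp, l', -, hl', -, -, hpull, hall⟩
    obtain ⟨β, hβ, he⟩ := hall α
    have he := congrArg (fun f => f z) he
    simp only [hpull β hβ, hR β hβ] at he
    refine ha ?_
    rw [pullT_apply, hl', formE_comp_apply, EMod.eq_add (z, _, _), map_add, map_add, map_add,
      map_add, ← pullT_apply, hα] at he
    have e : ((0, 0, (1 / 2 : ℝ) • wd (rfl : 3 + 2 = 5) a (ins z a)) : EMod n)
      = (1 / 2 : ℝ) • (0, 0, wd (rfl : 3 + 2 = 5) a (ins z a)) := by simp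
    dsimp only at he
    rw [e, map_smul, map_smul, zero_apply, zero_add, smul_eq_mul] at he
    exact he.symm
  set a := ext1 ε (ext1 γ (oneForm δ)) with hadef
  have ha : ins z a = ext1 γ (oneForm δ) := ins_ext1_ext1 hγ hδ hε
  -- Replacing a by -a flips the linear term and keeps the quadratic one, so the sum is nonzero for
  -- at least one sign.
  by_cases hc : α (l (0, ins z a, 0))
      + (1 / 2 : ℝ) * α (l (0, 0, wd (rfl : 3 + 2 = 5) a (ins z a))) = 0
  · refine key (-a) fun hc' => hγδ ?_
    have e : ((0, -ins z a, 0) : EMod n) = -(0, ins z a, 0) := by simp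
    rw [ins_neg_right, map_neg, map_neg, LinearMap.neg_apply, neg_neg, e, map_neg, map_neg] at hc'
    rw [← ha]
    linarith
  · exact key a hc

/-- The products a ∧ τ span the 5-forms. Acting by a 3-form a with α(l(a ∧ τ)) ≠ 0 creates a 2-form
part on τ, which reduces to the preceding case. -/
theorem IsGoodAnchor.exists_straight_lt_of_five (hn : n ≤ 6) (h : IsGoodAnchor l)
    (h3 : CorankThree l) {α : T n →L[ℝ] ℝ} (hα : ∀ σ, α (l (0, σ, 0)) = 0) {σ : Form n 5}
    (hσ : α (l (0, 0, σ)) ≠ 0) :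
    ∃ p ∈ excPairs n, straight l < straight (l.comp (p.1 : EMod n →L[ℝ] EMod n)) := by
  let f : Form n 5 →L[ℝ] ℝ := (α.comp l).comp
    ((ContinuousLinearMap.inr ℝ (T n) (Form n 2 × Form n 5)).comp
        (ContinuousLinearMap.inr ℝ (Form n 2) (Form n 5)))
  have hf : ∀ σ, α (l (0, 0, σ)) = f σ := fun _ => rfl
  obtain ⟨a, τ, haτ⟩ : ∃ (a : Form n 3) (τ : Form n 2), f (wd (rfl : 3 + 2 = 5) a τ) ≠ 0 := by
    by_contra! hc
    refine hσ ?_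
    rw [hf, form_eq_sum_ext1 σ, map_smul, map_sum, Finset.sum_eq_zero, smul_zero]
    intro i _
    rw [form_eq_sum_ext1 (ins _ _), ← ext1L_apply, map_smul, map_sum, map_smul, map_sum, Finset.sum_eq_zero,
      smul_zero]
    intro j _
    rw [ext1L_apply, ← wd_oneForm (rfl : 1 + 4 = 5), ← wd_oneForm (rfl : 1 + 3 = 4),
      ← wd_assoc (rfl : 1 + 1 = 2) (rfl : 2 + 3 = 5), wd_comm, map_smul, hc, smul_zero]
  refine (h.formE_cases hn a).elim id ?_
  rintro ⟨p, hp, l', hll', hl', hg, hst, hpull, hall⟩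
  obtain ⟨β, hβ, he⟩ := hall α
  subst hll'
  rw [← hst] at hβ
  refine exists_straight_lt_of_comp hp ?_
  generalize l.comp (p.1 : EMod n →L[ℝ] EMod n) = l' at *
  rw [← hst]
  -- The action of a may have given α a T*-part, which equals that of a straight β. Subtracting β
  -- removes it and does not affect the 2-form part.
  refine hg.exists_straight_lt_of_two hn ?_ (α := α - β) (σ := τ) ?_ ?_
  · intro γ δ
    obtain ⟨z, hz, hR, h12⟩ := h3 γ δ
    exact ⟨z, hz, fun β hβ => by rw [hst] at hβ; rw [hpull β hβ, hR β hβ], h12⟩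
  · rw [map_sub, he, sub_self]
  · rw [sub_apply, hβ _ rfl, sub_zero, hl', exp_formE_two, EMod.eq_add (0, _, _), map_add, map_add,
      map_add, map_add]
    dsimp only
    have hz : α (l ((0 : T n), 0, 0)) = 0 := map_zero (α.comp l)
    rw [hz, hα, zero_add, zero_add, hf]
    exact haτ

/-- If γ and δ complete the straight T*-parts to all of T*, the aim is a nonzero α with no T*-part
and no component on γ ∧ δ. When γ, δ are dependent modulo the straight part, any difference of a
non-straight and a suitable straight covector serves, the condition on γ ∧ δ being automatic later.
When they are independent, the kernel of `pullT` is at least two-dimensional and one linear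
condition can be imposed. -/
theorem exists_mem_ker_of_not_corankThree (h3 : ¬ CorankThree l) (hs : straight l ≠ ⊤)
    (hall : ∀ α, ∃ β ∈ straight l, pullT l β = pullT l α) :
    ∃ γ δ, (∀ ε, ∃ β ∈ straight l, ∃ a b : ℝ, ε = pullT l β + a • γ + b • δ) ∧
      ∃ α, α ≠ 0 ∧ pullT l α = 0 ∧ ((∃ a b : ℝ, (a ≠ 0 ∨ b ≠ 0) ∧ ∃ β ∈ straight l,
        pullT l β = a • γ + b • δ) ∨ α (l (0, ext1 γ (oneForm δ), 0)) = 0) := by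
  unfold CorankThree at h3
  push Not at h3
  obtain ⟨γ, δ, hγδ⟩ := h3
  set R := (straight l).map (pullT l) with hR
  have hspan : ∀ ε, ε ∈ R ⊔ Submodule.span ℝ {γ, δ} := by
    intro ε
    by_contra hε
    obtain ⟨z, hz, hz'⟩ := exists_vector_of_notMem hε
    have hz0 : z ≠ 0 := by
      rintro rfl
      rw [map_zero] at hz
      exact zero_ne_one hz
    refine hγδ z hz0 (fun β hβ => hz' _ (Submodule.mem_sup_left (Submodule.mem_map_of_mem hβ)))
      (hz' _ (Submodule.mem_sup_right (Submodule.subset_span (by simp))))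
      (hz' _ (Submodule.mem_sup_right (Submodule.subset_span (by simp))))
  have hrange : LinearMap.range (pullT l) = R := by
    refine le_antisymm ?_ (LinearMap.map_le_range)
    rintro _ ⟨α, rfl⟩
    obtain ⟨β, hβ, he⟩ := hall α
    exact ⟨β, hβ, he⟩
  have hrank := LinearMap.finrank_range_add_finrank_ker (pullT l)
  rw [hrange] at hrank
  refine ⟨γ, δ, fun ε => ?_, ?_⟩
  · obtain ⟨_, ⟨β, hβ, rfl⟩, s, hs, rfl⟩ := Submodule.mem_sup.1 (hspan ε)
    obtain ⟨a, b, rfl⟩ := Submodule.mem_span_pair.1 hs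
    exact ⟨β, hβ, a, b, by abel⟩
  by_cases hdep : ∃ a b : ℝ, (a ≠ 0 ∨ b ≠ 0) ∧ ∃ β ∈ straight l, pullT l β = a • γ + b • δ
  · obtain ⟨α₀, hα₀⟩ : ∃ α₀, α₀ ∉ straight l := by
      by_contra! hc
      exact hs (eq_top_iff.2 fun α _ => hc α)
    obtain ⟨β, hβ, he⟩ := hall α₀
    refine ⟨α₀ - β, fun h0 => hα₀ (by rwa [sub_eq_zero.1 h0]), ?_, Or.inl hdep⟩
    rw [map_sub, he, sub_self]
  -- Independence modulo R embeds R ⊕ ℝ² into T*, so R, which is the range of `pullT`, has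
  -- codimension at least two.
  · have hd2 : Module.finrank ℝ R + 2 ≤ Module.finrank ℝ (T n →L[ℝ] ℝ) := by
      let g : (R × (Fin 2 → ℝ)) →ₗ[ℝ] (T n →L[ℝ] ℝ) :=
        LinearMap.coprod R.subtype (Fintype.linearCombination ℝ ![γ, δ])
      have hg : Function.Injective g := by
        rw [← LinearMap.ker_eq_bot, LinearMap.ker_eq_bot']
        rintro ⟨⟨_, β, hβ, rfl⟩, c⟩ h0
        have h0' : pullT l β + (c 0 • γ + c 1 • δ) = 0 := by
          simpa [g, Fintype.linearCombination_apply, Fin.sum_univ_two] using h0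
        have hc : c = 0 := by
          by_contra hc
          refine hdep ⟨-c 0, -c 1, ?_, β, hβ, ?_⟩
          · by_contra! hcc
            exact hc (by ext i; fin_cases i <;> simp_all)
          · rw [eq_neg_of_add_eq_zero_left h0']
            module
        subst hc
        simp at h0'
        ext1
        · exact Subtype.ext h0'
        · rfl
      have := LinearMap.finrank_le_finrank_of_injective hg
      simpa using this
    let f : LinearMap.ker (pullT l) →ₗ[ℝ] ℝ :=
      { toFun := fun α => α.1 (l (0, ext1 γ (oneForm δ), 0))
        map_add' := fun _ _ => rfl
        map_smul' := fun _ _ => rfl }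
    have hf : 0 < Module.finrank ℝ (LinearMap.ker f) := by
      have h1 := LinearMap.finrank_range_add_finrank_ker f
      have h2 : Module.finrank ℝ (LinearMap.range f) ≤ 1 := by
        simpa using Submodule.finrank_le (LinearMap.range f)
      omega
    obtain ⟨⟨α, hα⟩, hne⟩ := Module.finrank_pos_iff_exists_ne_zero.1 hf
    exact ⟨α.1, fun h => hne (Subtype.ext (Subtype.ext h)), α.2, Or.inr hα⟩

/-- By isotropy α ∘ l kills the ideal generated by the straight T*-parts. If the quotient of T* by
these is at most two-dimensional, modulo the ideal a 2-form is a multiple of γ ∧ δ and a 5-form is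
zero. The covector α found above then has α ∘ l = 0, which contradicts surjectivity of l. -/
theorem IsGoodAnchor.corankThree (h : IsGoodAnchor l) (hs : straight l ≠ ⊤)
    (hall : ∀ α, ∃ β ∈ straight l, pullT l β = pullT l α) : CorankThree l := by
  by_contra h3
  obtain ⟨γ, δ, hspan, α, hα0, hα, hor⟩ := exists_mem_ker_of_not_corankThree h3 hs hall
  let f : Form n 2 →L[ℝ] ℝ := (α.comp l).comp
    ((ContinuousLinearMap.inr ℝ (T n) (Form n 2 × Form n 5)).comp
      (ContinuousLinearMap.inl ℝ (Form n 2) (Form n 5)))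
  let g : Form n 5 →L[ℝ] ℝ := (α.comp l).comp
    ((ContinuousLinearMap.inr ℝ (T n) (Form n 2 × Form n 5)).comp
      (ContinuousLinearMap.inr ℝ (Form n 2) (Form n 5)))
  have hf : ∀ β ∈ straight l, ∀ τ : Form n 1, f (ext1L n 1 (pullT l β) τ) = 0 := by
    intro β hβ τ
    rw [ext1L_apply, ← wd_oneForm (rfl : 1 + 1 = 2)]
    exact h.straight_wd_one hβ α τ
  have hg : ∀ β ∈ straight l, ∀ τ : Form n 4, g (ext1L n 4 (pullT l β) τ) = 0 := by
    intro β hβ τ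
    rw [ext1L_apply, ← wd_oneForm (rfl : 1 + 4 = 5)]
    exact h.straight_wd_four hβ α τ
  have hone : ∀ ε : T n →L[ℝ] ℝ, oneForm ε = ext1L n 0 ε (detForm Fin.elim0) := by
    intro ε
    refine form_ext_ins fun X => ?_
    rw [ext1L_apply, ins_ext1_zero, zeroForm_eq (ins X _), ins_one_apply, cov_oneForm]
  have hsk : ∀ {k : ℕ} (β γ : T n →L[ℝ] ℝ) (φ : Form n k),
      ext1L n (k + 1) β (ext1L n k γ φ) = -ext1L n (k + 1) γ (ext1L n k β φ) :=
    fun β γ φ => ext1_ext1_comm β γ φ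
  have hself : ∀ {k : ℕ} (β : T n →L[ℝ] ℝ) (φ : Form n k),
      ext1L n (k + 1) β (ext1L n k β φ) = 0 := by
    intro k β φ
    have h2 : (2 : ℝ) • ext1L n (k + 1) β (ext1L n k β φ) = 0 := by
      rw [two_smul]
      exact add_eq_zero_iff_eq_neg.2 (hsk β β φ)
    exact (smul_eq_zero.1 h2).resolve_left two_ne_zero
  set o : Form n 0 := detForm Fin.elim0
  -- If aγ + bδ is a straight T*-part, multiply it by δ or by γ: isotropy gives a or b times the
  -- value on γ ∧ δ.
  have hq : f (ext1L n 1 γ (ext1L n 0 δ o)) = 0 := by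
    rcases hor with ⟨a, b, hab, β, hβ, he⟩ | hor
    · have h1 := hf β hβ (ext1L n 0 δ o)
      have h2 := hf β hβ (ext1L n 0 γ o)
      rw [he, map_add, map_smul, map_smul, LinearMap.add_apply, LinearMap.smul_apply,
        LinearMap.smul_apply, map_add, map_smul, map_smul] at h1 h2
      rw [hself, map_zero, smul_zero, add_zero] at h1
      rw [hself, hsk, map_neg, map_zero, smul_zero, zero_add] at h2
      rcases hab with ha | hb
      · exact (smul_eq_zero.1 h1).resolve_left ha
      · exact neg_eq_zero.1 ((smul_eq_zero.1 h2).resolve_left hb)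
    · rw [← hone]
      exact hor
  have hf0 : ∀ ε ε', f (ext1L n 1 ε (ext1L n 0 ε' o)) = 0 := by
    have h1 : ∀ ε', f (ext1L n 1 γ (ext1L n 0 ε' o)) = 0 := by
      intro ε'
      obtain ⟨β, hβ, a, b, rfl⟩ := hspan ε'
      rw [hsk, map_neg, neg_eq_zero]
      simp only [map_add, map_smul, LinearMap.add_apply, LinearMap.smul_apply]
      rw [hf β hβ, hself, map_zero, hsk δ γ, map_neg, hq]
      simp
    intro ε ε'
    obtain ⟨β, hβ, a, b, rfl⟩ := hspan ε
    simp only [map_add, map_smul, LinearMap.add_apply, LinearMap.smul_apply]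
    rw [hf β hβ, h1, hsk δ ε', map_neg]
    obtain ⟨β', hβ', a', b', rfl⟩ := hspan ε'
    simp only [map_add, map_smul, LinearMap.add_apply, LinearMap.smul_apply]
    rw [hf β' hβ', h1, hself]
    simp
  -- A third factor is, modulo the straight part, a combination of γ and δ; either repeats a factor.
  have hg1 : ∀ (φ : Form n 2) ε, g (ext1L n 4 γ (ext1L n 3 δ (ext1L n 2 ε φ))) = 0 := by
    intro φ ε
    obtain ⟨β, hβ, a, b, rfl⟩ := hspan ε
    simp only [map_add, map_smul, LinearMap.add_apply, LinearMap.smul_apply]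
    rw [hself, hsk δ γ, map_neg (ext1L n 4 γ), hself, hsk δ (pullT l β), map_neg (ext1L n 4 γ),
      hsk γ (pullT l β), neg_neg, hg β hβ]
    simp
  have hg2 : ∀ φ : Form n 3, g (ext1L n 4 γ (ext1L n 3 δ φ)) = 0 := by
    intro φ
    rw [form_eq_sum_ext1 φ, map_smul, map_smul, map_smul, map_sum, map_sum, map_sum,
      Finset.sum_eq_zero, smul_zero]
    exact fun i _ => hg1 _ _
  have hg3 : ∀ (φ : Form n 3) ε ε', g (ext1L n 4 ε (ext1L n 3 ε' φ)) = 0 := by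
    intro φ
    have h1 : ∀ ε', g (ext1L n 4 γ (ext1L n 3 ε' φ)) = 0 := by
      intro ε'
      obtain ⟨β, hβ, a, b, rfl⟩ := hspan ε'
      rw [hsk, map_neg, neg_eq_zero]
      simp only [map_add, map_smul, LinearMap.add_apply, LinearMap.smul_apply]
      rw [hg β hβ, hself, map_zero, hsk δ γ, map_neg, hg2]
      simp
    intro ε ε'
    obtain ⟨β, hβ, a, b, rfl⟩ := hspan ε
    simp only [map_add, map_smul, LinearMap.add_apply, LinearMap.smul_apply]
    rw [hg β hβ, h1, hsk δ ε', map_neg]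
    obtain ⟨β', hβ', a', b', rfl⟩ := hspan ε'
    simp only [map_add, map_smul, LinearMap.add_apply, LinearMap.smul_apply]
    rw [hg β' hβ', h1, hself]
    simp
  have hf2 : ∀ σ, f σ = 0 := by
    intro σ
    rw [form_eq_sum_ext1 σ, map_smul, map_sum, Finset.sum_eq_zero, smul_zero]
    intro i _
    rw [← oneForm_cov (ins (vec i) σ), hone, ← ext1L_apply, hf0]
  have hg5 : ∀ σ, g σ = 0 := by
    intro σ
    rw [form_eq_sum_ext1 σ, map_smul, map_sum, Finset.sum_eq_zero, smul_zero]
    intro i _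
    rw [form_eq_sum_ext1 (ins (vec i) σ), ← ext1L_apply, map_smul, map_sum, map_smul, map_sum,
      Finset.sum_eq_zero, smul_zero]
    exact fun j _ => hg3 _ _ _
  refine hα0 ?_
  ext1 X
  obtain ⟨u, rfl⟩ := h.1 X
  rw [EMod.eq_add u, map_add, map_add, map_add, map_add, ← pullT_apply, hα]
  have e1 := hf2 u.2.1
  have e2 := hg5 u.2.2
  have e1' : α (l (0, u.2.1, 0)) = 0 := e1
  have e2' : α (l (0, 0, u.2.2)) = 0 := e2
  rw [e1', e2']
  simp

/-- Either some T*-part is new, or a non-straight covector can be corrected to have T*-part zero;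
then its 2-form part or its 5-form part is nonzero. -/
theorem IsGoodAnchor.exists_straight_lt (hn : n ≤ 6) (h : IsGoodAnchor l) (hs : straight l ≠ ⊤) :
    ∃ p ∈ excPairs n, straight l < straight (l.comp (p.1 : EMod n →L[ℝ] EMod n)) := by
  by_cases hall : ∀ α, ∃ β ∈ straight l, pullT l β = pullT l α
  · have h3 := h.corankThree hs hall
    obtain ⟨α₀, hα₀⟩ : ∃ α₀, α₀ ∉ straight l := by
      by_contra! hc
      exact hs (eq_top_iff.2 fun α _ => hc α)
    obtain ⟨β, hβ, he⟩ := hall α₀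
    have hp : pullT l (α₀ - β) = 0 := by rw [map_sub, he, sub_self]
    have hne : α₀ - β ∉ straight l := fun h => hα₀ (by simpa using Submodule.add_mem _ h hβ)
    by_cases h2 : ∃ σ, (α₀ - β) (l (0, σ, 0)) ≠ 0
    · obtain ⟨σ, hσ⟩ := h2
      exact h.exists_straight_lt_of_two hn h3 hp hσ
    push Not at h2
    by_cases h5 : ∃ σ, (α₀ - β) (l (0, 0, σ)) ≠ 0
    · obtain ⟨σ, hσ⟩ := h5
      exact h.exists_straight_lt_of_five hn h3 h2 hσ
    push Not at h5
    refine absurd (fun u hu => ?_) hne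
    have hz : (α₀ - β) (l ((0 : T n), 0, 0)) = 0 := map_zero ((α₀ - β).comp l)
    rw [EMod.eq_add u, hu, map_add, map_add, map_add, map_add, hz, h2, h5]
    simp
  · push Not at hall
    obtain ⟨α, hα⟩ := hall
    refine h.exists_straight_lt_of_pullT hn (α := α) ?_
    rintro ⟨β, hβ, he⟩
    exact hα β hβ he

/-- A good anchor is, in a suitable frame, the projection to `T` up to an isomorphism. -/
theorem IsGoodAnchor.exists_straight_eq_top (hn : n ≤ 6) (h : IsGoodAnchor l) :
    ∃ p ∈ excPairs n, straight (l.comp (p.1 : EMod n →L[ℝ] EMod n)) = ⊤ := by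
  -- The straight space grows in a finite-dimensional space, so the enlargement terminates.
  induction hS : straight l using WellFoundedGT.induction generalizing l with
  | ind S ih =>
    subst hS
    by_cases hs : straight l = ⊤
    · exact ⟨_, refl_mem_excPairs n, hs⟩
    · obtain ⟨p, hp, hlt⟩ := h.exists_straight_lt hn hs
      obtain ⟨q, hq, hq'⟩ := ih _ hlt (h.comp hp) rfl
      exact ⟨_, trans_mem_excPairs hq hp, hq'⟩

end

end

/-! ### Smooth frames of vector bundles -/

section

section FrameSmooth

variable {m : ℕ} {M : Type*} [TopologicalSpace M] [ChartedSpace (EuclideanSpace ℝ (Fin m)) M]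
  {F : Type*} [NormedAddCommGroup F] [NormedSpace ℝ F] [FiniteDimensional ℝ F]
  {V : M → Type*} [∀ x, AddCommGroup (V x)] [∀ x, Module ℝ (V x)] [∀ x, TopologicalSpace (V x)]
  [TopologicalSpace (TotalSpace F V)] [FiberBundle F V] [VectorBundle ℝ F V]

theorem contMDiffOn_frame_apply {U : Set M} {G : ∀ x, F →L[ℝ] V x}
    (hG : ∀ a, ContMDiffOn (𝓡 m) ((𝓡 m).prod 𝓘(ℝ, F)) ∞
      (fun x => (⟨x, G x a⟩ : TotalSpace F V)) U) {f : M → F}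
    (hf : ContMDiffOn (𝓡 m) 𝓘(ℝ, F) ∞ f U) :
    ContMDiffOn (𝓡 m) ((𝓡 m).prod 𝓘(ℝ, F)) ∞ (fun x => (⟨x, G x (f x)⟩ : TotalSpace F V)) U := by
  let b := Module.finBasis ℝ F
  have hc : ∀ i, ContMDiffOn (𝓡 m) 𝓘(ℝ, ℝ) ∞ (fun x => b.coord i (f x)) U := fun i =>
    ((LinearMap.toContinuousLinearMap (b.coord i)).contMDiff.comp_contMDiffOn hf)
  have h := ContMDiffOn.sum_section (s := Finset.univ) (t := fun i x => b.coord i (f x) • G x (b i))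
    fun i _ => (hc i).smul_section (hG (b i))
  refine h.congr fun x _ => ?_
  congr 1
  conv_lhs => rw [← b.sum_repr (f x)]
  rw [map_sum]
  exact Finset.sum_congr rfl fun i _ => map_smul _ _ _

theorem contMDiffOn_clm {W : Type*} [NormedAddCommGroup W] [NormedSpace ℝ W] {U : Set M}
    {A : M → F →L[ℝ] W} (hA : ∀ a, ContMDiffOn (𝓡 m) 𝓘(ℝ, W) ∞ (fun x => A x a) U) :
    ContMDiffOn (𝓡 m) 𝓘(ℝ, F →L[ℝ] W) ∞ A U := by
  let b := Module.finBasis ℝ F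
  have hs : ∀ x, A x = ∑ i, ContinuousLinearMap.smulRightL ℝ F W
      (LinearMap.toContinuousLinearMap (b.coord i)) (A x (b i)) := by
    intro x
    ext a
    conv_lhs => rw [← b.sum_repr a]
    rw [map_sum, sum_apply]
    exact Finset.sum_congr rfl fun i _ => map_smul _ _ _
  refine ContMDiffOn.congr (f := fun x => ∑ i, ContinuousLinearMap.smulRightL ℝ F W
      (LinearMap.toContinuousLinearMap (b.coord i)) (A x (b i))) ?_ fun x _ => hs x
  exact contMDiffOn_finsetSum fun i _ => (ContinuousLinearMap.contMDiff _).comp_contMDiffOn (hA (b i))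

/-- In a local trivialisation the frame is a smooth family of invertible operators, and inversion is
smooth. -/
theorem contMDiffOn_frame_symm [ContMDiffVectorBundle ∞ F V (𝓡 m)] {U : Set M} (hU : IsOpen U) {G : ∀ x, F ≃L[ℝ] V x}
    (hG : ∀ a, ContMDiffOn (𝓡 m) ((𝓡 m).prod 𝓘(ℝ, F)) ∞
      (fun x => (⟨x, G x a⟩ : TotalSpace F V)) U) {u : ∀ x, V x}
    (hu : ContMDiffOn (𝓡 m) ((𝓡 m).prod 𝓘(ℝ, F)) ∞ (fun x => (⟨x, u x⟩ : TotalSpace F V)) U) :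
    ContMDiffOn (𝓡 m) 𝓘(ℝ, F) ∞ (fun x => (G x).symm (u x)) U := by
  intro x₀ hx₀
  classical
  have : CompleteSpace F := FiniteDimensional.complete ℝ F
  set t := trivializationAt F V x₀ with ht
  have hmem : x₀ ∈ t.baseSet := mem_baseSet_trivializationAt F V x₀
  set U' := U ∩ t.baseSet
  have hU' : IsOpen U' := hU.inter t.open_baseSet
  let N : ∀ x, F →L[ℝ] F := fun x =>
    if hx : x ∈ t.baseSet then ((G x).trans (t.continuousLinearEquivAt ℝ x hx) : F →L[ℝ] F) else 0
  have hN : ∀ x ∈ U', ∀ a, N x a = (t ⟨x, G x a⟩).2 := by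
    intro x hx a
    simp only [N, dif_pos hx.2]
    rfl
  have key : ∀ s : ∀ x, V x, ContMDiffOn (𝓡 m) ((𝓡 m).prod 𝓘(ℝ, F)) ∞
      (fun x => (⟨x, s x⟩ : TotalSpace F V)) U →
      ContMDiffOn (𝓡 m) 𝓘(ℝ, F) ∞ (fun x => (t ⟨x, s x⟩).2) U' := by
    intro s hs
    exact (t.contMDiffOn_section_iff hU' Set.inter_subset_right).1 (hs.mono Set.inter_subset_left)
  have hNs : ContMDiffOn (𝓡 m) 𝓘(ℝ, F →L[ℝ] F) ∞ N U' :=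
    contMDiffOn_clm fun a => (key _ (hG a)).congr fun x hx => hN x hx a
  have hinv : ContMDiffWithinAt (𝓡 m) 𝓘(ℝ, F →L[ℝ] F) ∞ (fun x => (N x).inverse) U' x₀ := by
    have e : N x₀ = ((G x₀).trans (t.continuousLinearEquivAt ℝ x₀ hmem) : F →L[ℝ] F) := by
      simp only [N, dif_pos hmem]
    have h1 : ContDiffAt ℝ ∞ (ContinuousLinearMap.inverse : (F →L[ℝ] F) → _) (N x₀) := by
      rw [e]
      exact contDiffAt_map_inverse _
    exact h1.contMDiffAt.comp_contMDiffWithinAt x₀ (hNs x₀ ⟨hx₀, hmem⟩)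
  have h2 := hinv.clm_apply (key u hu x₀ ⟨hx₀, hmem⟩)
  have h3 : ContMDiffWithinAt (𝓡 m) 𝓘(ℝ, F) ∞ (fun x => (G x).symm (u x)) U' x₀ := by
    refine h2.congr_of_mem (fun x hx => ?_) ⟨hx₀, hmem⟩
    simp only [N, dif_pos hx.2]
    rw [ContinuousLinearMap.inverse_equiv]
    show _ = (G x).symm ((t.continuousLinearEquivAt ℝ x hx.2).symm (t ⟨x, u x⟩).2)
    congr 1
    rw [ContinuousLinearEquiv.eq_symm_apply]
    rfl
  exact (h3.contMDiffAt (hU'.mem_nhds ⟨hx₀, hmem⟩)).contMDiffWithinAt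

end FrameSmooth

end

/-! ### Normal frames and the map to E for covectors on the base -/

section

attribute [local irreducible] ins wd wedge prodN prodE

/-- `(β ⊗ k)_E` for `β ∈ T*`. -/
def prodT {n : ℕ} (β : T n →L[ℝ] ℝ) (k : NMod n) : EMod n :=
  (0, wd (rfl : 1 + 1 = 2) (oneForm β) k.1, wd (rfl : 1 + 4 = 5) (oneForm β) k.2.1)

/-- When ξ has no form parts all its contractions in the definition vanish, and only multiplication
by the covector remains. In a normal frame this computes (ρᵗdf ⊗ k)_E. -/
theorem prodE_comp_fst {n : ℕ} (β : T n →L[ℝ] ℝ) (k : NMod n) :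
    prodE (β.comp (ContinuousLinearMap.fst ℝ (T n) (Form n 2 × Form n 5))) k = prodT β k := by
  have h0 : ∀ σ : Form n 2 × Form n 5,
      (β.comp (ContinuousLinearMap.fst ℝ (T n) (Form n 2 × Form n 5))) (0, σ) = 0 := by
    intro σ
    exact map_zero β
  have hp : partT (β.comp (ContinuousLinearMap.fst ℝ (T n) (Form n 2 × Form n 5))) = β := rfl
  refine Prod.ext ?_ (Prod.ext ?_ ?_)
  · rw [prodE_fst]
    simp only [h0]
    simp [prodT]
  · rw [prodE_two]
    simp only [h0]
    simp [prodT]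
    rfl
  · rw [prodE_five]
    simp only [h0]
    simp [prodT]
    rfl

theorem prodT_eq_ext1 {n : ℕ} (β : T n →L[ℝ] ℝ) (k : NMod n) :
    prodT β k = (0, ext1 β k.1, ext1 β k.2.1) := by
  rw [prodT, wd_oneForm (rfl : 1 + 1 = 2), wd_oneForm (rfl : 1 + 4 = 5)]

/-- `(β, k) ↦ (β ⊗ k)_E` as a bilinear map. -/
def prodTL (n : ℕ) : (T n →L[ℝ] ℝ) →ₗ[ℝ] NMod n →ₗ[ℝ] EMod n :=
  LinearMap.mk₂ ℝ prodT
    (fun β γ k => by simp only [prodT_eq_ext1, ← ext1L_apply]; simp)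
    (fun c β k => by simp only [prodT_eq_ext1, ← ext1L_apply]; simp)
    (fun β k k' => by simp only [prodT_eq_ext1, ← ext1L_apply]; simp)
    (fun c β k => by simp only [prodT_eq_ext1, ← ext1L_apply]; simp)

theorem prodTL_apply {n : ℕ} (β : T n →L[ℝ] ℝ) (k : NMod n) : prodTL n β k = prodT β k := rfl

section

variable {n : ℕ} {M : Type*} [TopologicalSpace M]
  [ChartedSpace (EuclideanSpace ℝ (Fin n)) M] [IsManifold (𝓡 n) ∞ M]

theorem exists_bump [T2Space M] {x : M} {U : Set M} (hU : U ∈ 𝓝 x) : ∃ f : C^∞⟮𝓡 n, M; 𝓘(ℝ, ℝ), ℝ⟯,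
    (∀ᶠ y in 𝓝 x, f y = 1) ∧ tsupport f ⊆ U := by
  obtain ⟨f, -, hf⟩ := (SmoothBumpFunction.nhds_basis_tsupport (I := 𝓡 n) x).mem_iff.1 hU
  exact ⟨⟨f, f.contMDiff⟩, f.eventuallyEq_one, hf⟩

theorem dirDeriv_eq_fderiv {W : Type*} [NormedAddCommGroup W] [NormedSpace ℝ W]
    {e : OpenPartialHomeomorph M (T n)} (he : ContMDiffOn (𝓡 n) (𝓡 n) ∞ e e.source)
    (he' : ContMDiffOn (𝓡 n) (𝓡 n) ∞ e.symm e.target) {f : M → W} {x : M} (hx : x ∈ e.source)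
    (hf : MDifferentiableAt (𝓡 n) 𝓘(ℝ, W) f x) (X : TangentSpace (𝓡 n) x) :
    dirDeriv f x X = fderiv ℝ (fun y => f (e.symm y)) (e x) (dirDeriv e x X) := by
  have h1 : MDifferentiableAt (𝓡 n) (𝓡 n) e x :=
    ((he x hx).contMDiffAt (e.open_source.mem_nhds hx)).mdifferentiableAt (by simp)
  have h2 : MDifferentiableAt (𝓡 n) (𝓡 n) e.symm (e x) :=
    ((he' _ (e.map_source hx)).contMDiffAt
      (e.open_target.mem_nhds (e.map_source hx))).mdifferentiableAt (by simp)
  have h3 : MDifferentiableAt (𝓡 n) 𝓘(ℝ, W) (fun y => f (e.symm y)) (e x) := by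
    refine MDifferentiableAt.comp (e x) ?_ h2
    rw [e.left_inv hx]
    exact hf
  have h4 : f =ᶠ[𝓝 x] (fun y => f (e.symm y)) ∘ e := by
    filter_upwards [e.open_source.mem_nhds hx] with y hy
    simp [e.left_inv hy]
  rw [dirDeriv, h4.mfderiv_eq, mfderiv_comp x h3 h1, mfderiv_eq_fderiv]
  rfl

end

section

variable {n : ℕ} {M : Type*} [TopologicalSpace M]
  [ChartedSpace (EuclideanSpace ℝ (Fin n)) M] [IsManifold (𝓡 n) ∞ M]
  {E : M → Type*} [∀ x, AddCommGroup (E x)] [∀ x, Module ℝ (E x)] [∀ x, TopologicalSpace (E x)]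
  [TopologicalSpace (TotalSpace (EMod n) E)] [FiberBundle (EMod n) E] [VectorBundle ℝ (EMod n) E]
  [ContMDiffVectorBundle ∞ (EMod n) E (𝓡 n)]
  {N : M → Type*} [∀ x, AddCommGroup (N x)] [∀ x, Module ℝ (N x)] [∀ x, TopologicalSpace (N x)]
  [TopologicalSpace (TotalSpace (NMod n) N)] [FiberBundle (NMod n) N] [VectorBundle ℝ (NMod n) N]
  [ContMDiffVectorBundle ∞ (NMod n) N (𝓡 n)]

theorem Frame.prodN_trans {x : M} (F : Frame n E N x)
    {p : (EMod n ≃L[ℝ] EMod n) × (NMod n ≃L[ℝ] NMod n)} (hp : p ∈ excPairs n) (u v : E x) :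
    Frame.prodN (p.1.trans F.1, p.2.trans F.2) u v = F.prodN u v := by
  show F.2 (p.2 (Elg.prodN (p.1.symm (F.1.symm u)) (p.1.symm (F.1.symm v)))) = _
  rw [hp.2]
  simp [Frame.prodN]

theorem Elgebroid.prodN_eq (A : Elgebroid n n M E N) {x : M} {F F' : Frame n E N x}
    (hF : F ∈ A.frames x) (hF' : F' ∈ A.frames x) (u v : E x) : F.prodN u v = F'.prodN u v := by
  obtain ⟨F₀, -, h⟩ := A.frames_orbit x
  rw [h] at hF hF'
  obtain ⟨p, hp, rfl⟩ := hF
  obtain ⟨q, hq, rfl⟩ := hF'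
  rw [Frame.prodN_trans F₀ hp, Frame.prodN_trans F₀ hq]

theorem contMDiff_prodN : ContDiff ℝ ∞ (fun p : EMod n × EMod n => prodN p.1 p.2) :=
  (prodNC n).isBoundedBilinearMap.contDiff

/-- The section `(u ⊗ v)_N` of `N`. -/
theorem Elgebroid.exists_prodN (A : Elgebroid n n M E N) (u v : Sec n (EMod n) E) :
    ∃ k : Sec n (NMod n) N, ∀ x, ∀ F ∈ A.frames x, k x = F.prodN (u x) (v x) := by
  choose F₀ hF₀ _ using A.frames_orbit
  refine ⟨⟨fun x => (F₀ x).prodN (u x) (v x), fun x => ?_⟩,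
    fun x F hF => A.prodN_eq (hF₀ x) hF _ _⟩
  obtain ⟨U, hU, hx, F, hF, hFf⟩ := A.frames_smooth x
  have hu := contMDiffOn_frame_symm hU hF.1 (u := u) u.contMDiff.contMDiffOn
  have hv := contMDiffOn_frame_symm hU hF.1 (u := v) v.contMDiff.contMDiffOn
  have h := contMDiffOn_frame_apply (G := fun x => ((F x).2 : NMod n →L[ℝ] N x)) hF.2
    (contMDiff_prodN.contMDiff.comp_contMDiffOn (hu.prodMk_space hv))
  refine ((h x hx).congr_of_mem (fun y hy => ?_) hx).contMDiffAt (hU.mem_nhds hx)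
  rw [A.prodN_eq (hF₀ y) (hFf y hy)]
  rfl

/-- `e` is a chart and `F` a `G`-frame over its domain in which the anchor is the projection
`E → T`. -/
structure IsNormalFrame (A : Elgebroid n n M E N) (e : OpenPartialHomeomorph M (T n))
    (F : ∀ x, Frame n E N x) : Prop where
  smooth : ContMDiffOn (𝓡 n) (𝓡 n) ∞ e e.source
  smooth_symm : ContMDiffOn (𝓡 n) (𝓡 n) ∞ e.symm e.target
  smooth_fiber : IsSmoothFrameOn n e.source F
  frames : ∀ x ∈ e.source, F x ∈ A.frames x
  anchor : ∀ x ∈ e.source, ∀ a, dirDeriv e x (A.anchor x ((F x).1 a)) = a.1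

/-- Cutting off with `χ` the sections that are constant in a frame. -/
def cutSec {G : Type*} [NormedAddCommGroup G] [NormedSpace ℝ G]
    {V : M → Type*} [∀ x, AddCommGroup (V x)] [∀ x, Module ℝ (V x)] [∀ x, TopologicalSpace (V x)]
    [TopologicalSpace (TotalSpace G V)] [FiberBundle G V] [VectorBundle ℝ G V]
    {U : Set M} (hU : IsOpen U) {F : ∀ x, G ≃L[ℝ] V x}
    (hF : ∀ a, ContMDiffOn (𝓡 n) ((𝓡 n).prod 𝓘(ℝ, G)) ∞
      (fun x => (⟨x, F x a⟩ : TotalSpace G V)) U)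
    {χ : C^∞⟮𝓡 n, M; 𝓘(ℝ, ℝ), ℝ⟯} (hχ : tsupport χ ⊆ U) : G →ₗ[ℝ] Sec n G V where
  toFun := fun a => ⟨fun x => χ x • F x a,
    ContMDiffOn.smul_section_of_tsupport χ.contMDiff.contMDiffOn hU hχ (hF a)⟩
  map_add' := fun a b => by
    ext x
    show χ x • F x (a + b) = χ x • F x a + χ x • F x b
    rw [map_add, smul_add]
  map_smul' := fun c a => by
    ext x
    show χ x • F x (c • a) = c • χ x • F x a
    rw [map_smul, smul_comm]

end

end

/-! ### Components in a normal frame: extension, locality, and the operator 𝓓 -/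

section

attribute [local irreducible] ins wd wedge prodN prodE

/-- The bracket of the exceptional tangent bundle deformed by the tensor `Γ`, in a form that is
bilinear in the first derivatives. -/
def twistedBracket {n : ℕ} (Γ : T n → EMod n →ₗ[ℝ] EMod n →ₗ[ℝ] EMod n) (u v : T n → EMod n)
    (y : T n) : EMod n :=
  fderiv ℝ v y (u y).1 - fderiv ℝ u y (v y).1
    + ∑ j, prodT (EuclideanSpace.proj j) (prodN (fderiv ℝ u y (vec j)) (v y)) + Γ y (u y) (v y)

/-- The tensors `Γ` and `Δ` have the properties that the axioms of an elgebroid impose on the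
deformation of the exceptional tangent bundle that they define. -/
structure IsTwist {n : ℕ} (V : Set (T n)) (Γ : T n → EMod n →ₗ[ℝ] EMod n →ₗ[ℝ] EMod n)
    (Δ : T n → NMod n →ₗ[ℝ] EMod n) : Prop where
  smooth : ∀ a b, ContDiffOn ℝ ∞ (fun y => Γ y a b) V
  mem : ∀ y ∈ V, ∀ a, ∃ A ∈ excLieAlg n, ∀ b, Γ y a b = A b
  fst : ∀ y ∈ V, ∀ a b, (Γ y a b).1 = 0
  symm : ∀ y ∈ V, ∀ a b, Γ y a b + Γ y b a = Δ y (prodN a b)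
  jacobi : ∀ y ∈ V, ∀ a b c,
    twistedBracket Γ (fun _ => a) (fun z => Γ z b c) y
      = twistedBracket Γ (fun z => Γ z a b) (fun _ => c) y
        + twistedBracket Γ (fun _ => b) (fun z => Γ z a c) y

section

variable {n : ℕ} {M : Type*} [TopologicalSpace M]
  [ChartedSpace (EuclideanSpace ℝ (Fin n)) M] [IsManifold (𝓡 n) ∞ M]
  {E : M → Type*} [∀ x, AddCommGroup (E x)] [∀ x, Module ℝ (E x)] [∀ x, TopologicalSpace (E x)]
  [TopologicalSpace (TotalSpace (EMod n) E)] [FiberBundle (EMod n) E] [VectorBundle ℝ (EMod n) E]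
  [ContMDiffVectorBundle ∞ (EMod n) E (𝓡 n)]
  {N : M → Type*} [∀ x, AddCommGroup (N x)] [∀ x, Module ℝ (N x)] [∀ x, TopologicalSpace (N x)]
  [TopologicalSpace (TotalSpace (NMod n) N)] [FiberBundle (NMod n) N] [VectorBundle ℝ (NMod n) N]
  [ContMDiffVectorBundle ∞ (NMod n) N (𝓡 n)]
  {A : Elgebroid n n M E N} {e : OpenPartialHomeomorph M (T n)} {F : ∀ x, Frame n E N x}

/-- The components of a section of `E` in the frame `F` and the chart `e`. -/
def compE (e : OpenPartialHomeomorph M (T n)) (F : ∀ x, Frame n E N x) (u : Sec n (EMod n) E) :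
    T n → EMod n :=
  push e (fun x => (F x).1.symm) u

/-- The components of a section of `N` in the frame `F` and the chart `e`. -/
def compN (e : OpenPartialHomeomorph M (T n)) (F : ∀ x, Frame n E N x) (k : Sec n (NMod n) N) :
    T n → NMod n :=
  push e (fun x => (F x).2.symm) k

theorem compE_apply (u : Sec n (EMod n) E) {x : M} (hx : x ∈ e.source) :
    compE e F u (e x) = (F x).1.symm (u x) := by
  have : ∀ z, z = x → (F z).1.symm (u z) = (F x).1.symm (u x) := by rintro _ rfl; rfl
  exact this _ (e.left_inv hx)

theorem compN_apply (k : Sec n (NMod n) N) {x : M} (hx : x ∈ e.source) :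
    compN e F k (e x) = (F x).2.symm (k x) := by
  have : ∀ z, z = x → (F z).2.symm (k z) = (F x).2.symm (k x) := by rintro _ rfl; rfl
  exact this _ (e.left_inv hx)

theorem IsNormalFrame.contDiffOn_compE (h : IsNormalFrame A e F) (u : Sec n (EMod n) E) :
    ContDiffOn ℝ ∞ (compE e F u) e.target := by
  rw [← contMDiffOn_iff_contDiffOn]
  exact (contMDiffOn_frame_symm e.open_source h.smooth_fiber.1 u.contMDiff.contMDiffOn).comp
    h.smooth_symm e.mapsTo_symm

theorem IsNormalFrame.contDiffOn_compN (h : IsNormalFrame A e F) (k : Sec n (NMod n) N) :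
    ContDiffOn ℝ ∞ (compN e F k) e.target := by
  rw [← contMDiffOn_iff_contDiffOn]
  exact (contMDiffOn_frame_symm e.open_source h.smooth_fiber.2 k.contMDiff.contMDiffOn).comp
    h.smooth_symm e.mapsTo_symm

theorem IsNormalFrame.restr (h : IsNormalFrame A e F) {O : Set M} (hO : IsOpen O) :
    IsNormalFrame A (e.restrOpen O hO) F where
  smooth := h.smooth.mono Set.inter_subset_left
  smooth_symm := h.smooth_symm.mono Set.inter_subset_left
  smooth_fiber := ⟨fun a => (h.smooth_fiber.1 a).mono Set.inter_subset_left,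
    fun a => (h.smooth_fiber.2 a).mono Set.inter_subset_left⟩
  frames := fun x hx => h.frames x hx.1
  anchor := fun x hx => h.anchor x hx.1

theorem IsNormalFrame.dirDeriv_anchor (h : IsNormalFrame A e F) (u : Sec n (EMod n) E) {x : M}
    (hx : x ∈ e.source) : dirDeriv e x (A.anchor x (u x)) = (compE e F u (e x)).1 := by
  rw [compE_apply u hx, ← h.anchor x hx]
  simp

theorem IsNormalFrame.dirDeriv_anchor_apply (h : IsNormalFrame A e F) (u : Sec n (EMod n) E) {x : M}
    (hx : x ∈ e.source) {W : Type*} [NormedAddCommGroup W] [NormedSpace ℝ W] {f : M → W}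
    (hf : MDifferentiableAt (𝓡 n) 𝓘(ℝ, W) f x) : dirDeriv f x (A.anchor x (u x))
      = fderiv ℝ (fun y => f (e.symm y)) (e x) (compE e F u (e x)).1 := by
  rw [dirDeriv_eq_fderiv h.smooth h.smooth_symm hx hf, h.dirDeriv_anchor u hx]

theorem IsNormalFrame.exists_bracket_eq (h : IsNormalFrame A e F) (u : Sec n (EMod n) E) {x : M}
    (hx : x ∈ e.source) : ∃ B ∈ excLieAlg n, ∀ v, compE e F (A.bracket u v) (e x)
      = fderiv ℝ (compE e F v) (e x) (compE e F u (e x)).1 + B (compE e F v (e x)) := by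
  obtain ⟨B, hB, h'⟩ := A.preserves e.source F e.open_source h.smooth_fiber h.frames u x hx
  refine ⟨B, hB, fun v => ?_⟩
  have hd : MDifferentiableAt (𝓡 n) 𝓘(ℝ, EMod n) (fun y => (F y).1.symm (v y)) x :=
    ((contMDiffOn_frame_symm e.open_source h.smooth_fiber.1 v.contMDiff.contMDiffOn x
      hx).contMDiffAt (e.open_source.mem_nhds hx)).mdifferentiableAt (by simp)
  rw [compE_apply _ hx, h' v, compE_apply v hx, h.dirDeriv_anchor_apply u hx hd]
  rfl

/-- Local sections that are constant in the frame, and the components of sections and the coordinates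
of the chart, extend to global sections and functions. -/
structure HasExtensions (e : OpenPartialHomeomorph M (T n)) (F : ∀ x, Frame n E N x)
    (S : EMod n →ₗ[ℝ] Sec n (EMod n) E) (K : NMod n →ₗ[ℝ] Sec n (NMod n) N) : Prop where
  constE : ∀ a, ∀ x ∈ e.source, S a x = (F x).1 a
  constN : ∀ c, ∀ x ∈ e.source, K c x = (F x).2 c
  compN : ∀ (k : Sec n (NMod n) N) (ℓ : NMod n →L[ℝ] ℝ), ∃ f : C^∞⟮𝓡 n, M; 𝓘(ℝ, ℝ), ℝ⟯,
    ∀ x ∈ e.source, f x = ℓ ((F x).2.symm (k x))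
  coord : ∀ j, ∃ f : C^∞⟮𝓡 n, M; 𝓘(ℝ, ℝ), ℝ⟯, ∀ x ∈ e.source, f x = e x j

/-- Everything is multiplied by a bump function supported in the chart domain, and the chart is
restricted to where that function equals one. -/
theorem IsNormalFrame.exists_extensions [T2Space M] (h : IsNormalFrame A e F) {p : M}
    (hp : p ∈ e.source) {O₀ : Set M} (hO₀ : O₀ ∈ 𝓝 p) : ∃ O : Set M, ∃ hO : IsOpen O, p ∈ O ∧ O ⊆ O₀ ∧
      ∃ S K, HasExtensions (e.restrOpen O hO) F S K := by
  obtain ⟨χ, hχ, hsupp⟩ := exists_bump (n := n) (e.open_source.mem_nhds hp)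
  obtain ⟨O, hOχ, hO, hpO⟩ := eventually_nhds_iff.1 (hχ.and hO₀)
  refine ⟨O, hO, hpO, fun x hx => (hOχ x hx).2, cutSec e.open_source h.smooth_fiber.1 hsupp,
    cutSec e.open_source h.smooth_fiber.2 hsupp, ?_, ?_, ?_, ?_⟩
  · intro a x hx
    show χ x • (F x).1 a = (F x).1 a
    rw [(hOχ x hx.2).1, one_smul]
  · intro a x hx
    show χ x • (F x).2 a = (F x).2 a
    rw [(hOχ x hx.2).1, one_smul]
  · intro k ℓ
    have hk := contMDiffOn_frame_symm e.open_source h.smooth_fiber.2 (u := k)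
      k.contMDiff.contMDiffOn
    refine ⟨⟨fun x => χ x • ℓ ((F x).2.symm (k x)), ?_⟩, ?_⟩
    · refine contMDiff_of_contMDiffOn_union_of_isOpen
        (χ.contMDiff.contMDiffOn.smul (ℓ.contMDiff.comp_contMDiffOn hk))
        ((contMDiffOn_const (c := (0 : ℝ))).congr fun x hx => ?_)
        (Set.compl_subset_iff_union.mp (Set.compl_subset_compl.mpr hsupp)) e.open_source
        (isOpen_compl_iff.mpr (isClosed_tsupport χ))
      rw [image_eq_zero_of_notMem_tsupport hx, zero_smul]
    · intro x hx
      show χ x • ℓ ((F x).2.symm (k x)) = _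
      rw [(hOχ x hx.2).1, one_smul]
  · intro j
    have hk : ContMDiffOn (𝓡 n) 𝓘(ℝ, ℝ) ∞ (fun x => (e x) j) e.source :=
      (EuclideanSpace.proj j : T n →L[ℝ] ℝ).contMDiff.comp_contMDiffOn
        h.smooth
    refine ⟨⟨fun x => χ x • e x j, ?_⟩, ?_⟩
    · refine contMDiff_of_contMDiffOn_union_of_isOpen
        (χ.contMDiff.contMDiffOn.smul hk)
        ((contMDiffOn_const (c := (0 : ℝ))).congr fun x hx => ?_)
        (Set.compl_subset_iff_union.mp (Set.compl_subset_compl.mpr hsupp)) e.open_source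
        (isOpen_compl_iff.mpr (isClosed_tsupport χ))
      rw [image_eq_zero_of_notMem_tsupport hx, zero_smul]
    · intro x hx
      show χ x • e x j = e x j
      rw [(hOχ x hx.2).1, one_smul]

theorem Frame.prodE_zero {x : M} (F : Frame n E N x) (ξ : E x →L[ℝ] ℝ) : F.prodE ξ 0 = 0 := by
  have h : ∀ ζ : EMod n →L[ℝ] ℝ, Elg.prodE ζ 0 = 0 := by
    intro ζ
    refine Prod.ext ?_ (Prod.ext ?_ ?_)
    · rw [prodE_fst]; simp [apply_zero_zero]
    · rw [prodE_two]; simp [apply_zero_zero, ins_zero_right]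
    · rw [prodE_five]; simp [ins_zero_right]
  rw [Frame.prodE, map_zero, h, map_zero]

/-- Locality of 𝓓 follows from its Leibniz rule, applied to a factor that vanishes at x and is one
wherever k is nonzero. -/
theorem Elgebroid.D_eq_zero [T2Space M] (A : Elgebroid n n M E N) {k : Sec n (NMod n) N} {x : M}
    (hk : ∀ᶠ y in 𝓝 x, k y = 0) : A.D k x = 0 := by
  obtain ⟨O, hO, hOo, hx⟩ := eventually_nhds_iff.1 hk
  obtain ⟨ψ, hψ, hsupp⟩ := exists_bump (n := n) (hOo.mem_nhds hx)
  obtain ⟨F, hF, -⟩ := A.frames_orbit x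
  -- Here ψ is one near x and supported where k vanishes, so multiplication by 1 - ψ does not change
  -- k.
  have e : k = smulSec (1 - ψ) k := by
    ext y
    show k y = (1 - ψ y) • k y
    by_cases hy : y ∈ O
    · rw [hO y hy, smul_zero]
    · rw [image_eq_zero_of_notMem_tsupport fun h => hy (hsupp h), sub_zero, one_smul]
  rw [e, A.diff _ _ x F hF, hO x hx, F.prodE_zero, add_zero]
  have : (1 - ψ : C^∞⟮𝓡 n, M; 𝓘(ℝ, ℝ), ℝ⟯) x = 0 := by
    show 1 - ψ x = 0
    rw [hψ.self_of_nhds, sub_self]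
  rw [this, zero_smul]

variable {S : EMod n →ₗ[ℝ] Sec n (EMod n) E} {K : NMod n →ₗ[ℝ] Sec n (NMod n) N}

theorem IsNormalFrame.prodE_covDeriv (h : IsNormalFrame A e F) {x : M} (hx : x ∈ e.source)
    (f : C^∞⟮𝓡 n, M; 𝓘(ℝ, ℝ), ℝ⟯) (k : N x) :
    (F x).1.symm ((F x).prodE ((covDeriv f x).comp (A.anchor x)) k)
      = prodT (fderiv ℝ (fun y => f (e.symm y)) (e x)) ((F x).2.symm k) := by
  have e1 : ((covDeriv f x).comp (A.anchor x)).comp ((F x).1 : EMod n →L[ℝ] E x)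
      = (fderiv ℝ (fun y => f (e.symm y)) (e x)).comp
        (ContinuousLinearMap.fst ℝ (T n) (Form n 2 × Form n 5)) := by
    refine ContinuousLinearMap.ext fun a => ?_
    show dirDeriv f x (A.anchor x ((F x).1 a)) = _
    rw [dirDeriv_eq_fderiv h.smooth h.smooth_symm hx (f.contMDiff.mdifferentiableAt (by simp)),
      h.anchor x hx]
    rfl
  rw [Frame.prodE, e1, prodE_comp_fst]
  simp

/-- The value of sections at a point, as a linear map. -/
def secEval {G : Type*} [NormedAddCommGroup G] [NormedSpace ℝ G]
    {V : M → Type*} [∀ x, AddCommGroup (V x)] [∀ x, Module ℝ (V x)] [∀ x, TopologicalSpace (V x)]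
    [TopologicalSpace (TotalSpace G V)] [FiberBundle G V] [VectorBundle ℝ G V] (x : M) :
    Sec n G V →ₗ[ℝ] V x where
  toFun := fun s => s x
  map_add' := fun _ _ => rfl
  map_smul' := fun _ _ => rfl

theorem secEval_apply {G : Type*} [NormedAddCommGroup G] [NormedSpace ℝ G]
    {V : M → Type*} [∀ x, AddCommGroup (V x)] [∀ x, Module ℝ (V x)] [∀ x, TopologicalSpace (V x)]
    [TopologicalSpace (TotalSpace G V)] [FiberBundle G V] [VectorBundle ℝ G V] (x : M)
    (s : Sec n G V) : secEval x s = s x := rfl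

/-- The components of `𝓓` on the sections `K c`. -/
def compDL (A : Elgebroid n n M E N) (F : ∀ x, Frame n E N x)
    (K : NMod n →ₗ[ℝ] Sec n (NMod n) N) (x : M) : NMod n →ₗ[ℝ] EMod n :=
  (((F x).1.symm : E x →L[ℝ] EMod n) : E x →ₗ[ℝ] EMod n).comp
    ((secEval (n := n) (G := EMod n) (V := E) x).comp (A.D.comp K))

theorem compDL_apply (x : M) (c : NMod n) :
    compDL A F K x c = (F x).1.symm (A.D (K c) x) := rfl

theorem exists_dual_basis (W : Type*) [NormedAddCommGroup W] [NormedSpace ℝ W]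
    [FiniteDimensional ℝ W] : ∃ (d : ℕ) (ℓ : Fin d → W →L[ℝ] ℝ) (b : Fin d → W),
      ∀ c, ∑ i, ℓ i c • b i = c :=
  ⟨_, fun i => LinearMap.toContinuousLinearMap ((Module.finBasis ℝ W).coord i),
    Module.finBasis ℝ W, fun c => (Module.finBasis ℝ W).sum_repr c⟩

/-- Expanding the differentials in coordinate covectors replaces the sum over a basis of N by a sum
over the directions of T. -/
theorem sum_prodT_comp {ι : Type*} [Fintype ι] {ℓ : ι → NMod n →L[ℝ] ℝ} {b : ι → NMod n}
    (hsum : ∀ c, ∑ i, ℓ i c • b i = c) (L : T n →L[ℝ] NMod n) :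
    ∑ i, prodT ((ℓ i).comp L) (b i) = ∑ j, prodT (EuclideanSpace.proj j) (L (vec j)) := by
  have h5 : ∀ i, prodT ((ℓ i).comp L) (b i)
      = ∑ j, prodTL n (EuclideanSpace.proj j) (ℓ i (L (vec j)) • b i) := by
    intro i
    rw [eq_sum_proj ((ℓ i).comp L), ← prodTL_apply, map_sum, LinearMap.sum_apply]
    refine Finset.sum_congr rfl fun j _ => ?_
    rw [map_smul, map_smul, LinearMap.smul_apply]
    rfl
  rw [Finset.sum_congr rfl fun i _ => h5 i, Finset.sum_comm]
  refine Finset.sum_congr rfl fun j _ => ?_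
  rw [← map_sum, hsum, prodTL_apply]

theorem HasExtensions.eventually_eq_sum (hS : HasExtensions e F S K) (k : Sec n (NMod n) N) {x : M}
    (hx : x ∈ e.source) {d : ℕ} {ℓ : Fin d → NMod n →L[ℝ] ℝ} {b : Fin d → NMod n}
    (hsum : ∀ c, ∑ i, ℓ i c • b i = c) {f : Fin d → C^∞⟮𝓡 n, M; 𝓘(ℝ, ℝ), ℝ⟯}
    (hf : ∀ i, ∀ x ∈ e.source, f i x = ℓ i ((F x).2.symm (k x))) :
    ∀ᶠ y in 𝓝 x, (k - ∑ i, smulSec (f i) (K (b i))) y = 0 := by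
  filter_upwards [e.open_source.mem_nhds hx] with y hy
  rw [← secEval_apply, map_sub, map_sum, secEval_apply, sub_eq_zero,
    ← (F y).2.apply_symm_apply (k y)]
  conv_lhs => rw [← hsum ((F y).2.symm (k y))]
  rw [map_sum]
  refine Finset.sum_congr rfl fun i _ => ?_
  rw [map_smul]
  show _ = f i y • K (b i) y
  rw [hf i y hy, hS.constN _ y hy]

/-- Near x the section k is a combination of extended constant sections with smooth coefficients.
The Leibniz rule of 𝓓 gives the first order part, the values on constants give the rest. -/
theorem IsNormalFrame.compE_D [T2Space M] (h : IsNormalFrame A e F) (hS : HasExtensions e F S K)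
    (k : Sec n (NMod n) N) {x : M} (hx : x ∈ e.source) : compE e F (A.D k) (e x)
      = ∑ j, prodT (EuclideanSpace.proj j) (fderiv ℝ (compN e F k) (e x) (vec j))
        + compDL A F K x (compN e F k (e x)) := by
  obtain ⟨d, ℓ, b, hsum⟩ := exists_dual_basis (NMod n)
  choose f hf using fun i => hS.compN k (ℓ i)
  have h0 := A.D_eq_zero (hS.eventually_eq_sum k hx hsum hf)
  rw [← secEval_apply, map_sub, map_sub, sub_eq_zero, map_sum, map_sum] at h0
  have h2 : ∀ i, (F x).1.symm (A.D (smulSec (f i) (K (b i))) x)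
      = prodT (fderiv ℝ (fun y => f i (e.symm y)) (e x)) (b i)
        + f i x • compDL A F K x (b i) := by
    intro i
    rw [A.diff _ _ x (F x) (h.frames x hx), map_add, map_smul, h.prodE_covDeriv hx,
      hS.constN _ x hx, ContinuousLinearEquiv.symm_apply_apply, add_comm, compDL_apply]
  have h3 : ∀ i, fderiv ℝ (fun y => f i (e.symm y)) (e x)
      = (ℓ i).comp (fderiv ℝ (compN e F k) (e x)) := by
    intro i
    have hd : DifferentiableAt ℝ (compN e F k) (e x) :=
      ((h.contDiffOn_compN k).contDiffAt (e.open_target.mem_nhds (e.map_source hx))).differentiableAt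
        (by simp)
    have : (fun y => f i (e.symm y)) =ᶠ[𝓝 (e x)] fun y => ℓ i (compN e F k y) := by
      filter_upwards [e.open_target.mem_nhds (e.map_source hx)] with y hy
      exact hf i _ (e.map_target hy)
    rw [this.fderiv_eq]
    exact ((ℓ i).hasFDerivAt.comp _ hd.hasFDerivAt).fderiv
  rw [compE_apply _ hx, compN_apply _ hx, ← secEval_apply, h0, map_sum]
  simp only [secEval_apply, h2, Finset.sum_add_distrib]
  congr 1
  · simp only [h3]
    exact sum_prodT_comp hsum _
  · conv_rhs => rw [← hsum ((F x).2.symm (k x)), map_sum]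
    exact Finset.sum_congr rfl fun i _ => by rw [map_smul, hf i x hx]

end

end

/-! ### The bracket in a normal frame: derivative terms and the tensor part -/

section

attribute [local irreducible] ins wd wedge prodN prodE

theorem twistedBracket_congr {n : ℕ} {Γ : T n → EMod n →ₗ[ℝ] EMod n →ₗ[ℝ] EMod n}
    {u u' v v' : T n → EMod n} {y : T n} (hu : u =ᶠ[𝓝 y] u') (hv : v =ᶠ[𝓝 y] v') :
    twistedBracket Γ u v y = twistedBracket Γ u' v' y := by
  simp only [twistedBracket, hu.fderiv_eq, hv.fderiv_eq, hu.eq_of_nhds, hv.eq_of_nhds]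

section

variable {n : ℕ} {M : Type*} [TopologicalSpace M]
  [ChartedSpace (EuclideanSpace ℝ (Fin n)) M] [IsManifold (𝓡 n) ∞ M]
  {E : M → Type*} [∀ x, AddCommGroup (E x)] [∀ x, Module ℝ (E x)] [∀ x, TopologicalSpace (E x)]
  [TopologicalSpace (TotalSpace (EMod n) E)] [FiberBundle (EMod n) E] [VectorBundle ℝ (EMod n) E]
  [ContMDiffVectorBundle ∞ (EMod n) E (𝓡 n)]
  {N : M → Type*} [∀ x, AddCommGroup (N x)] [∀ x, Module ℝ (N x)] [∀ x, TopologicalSpace (N x)]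
  [TopologicalSpace (TotalSpace (NMod n) N)] [FiberBundle (NMod n) N] [VectorBundle ℝ (NMod n) N]
  [ContMDiffVectorBundle ∞ (NMod n) N (𝓡 n)]
  {A : Elgebroid n n M E N} {e : OpenPartialHomeomorph M (T n)} {F : ∀ x, Frame n E N x}
  {S : EMod n →ₗ[ℝ] Sec n (EMod n) E} {K : NMod n →ₗ[ℝ] Sec n (NMod n) N}

/-- The components of the brackets of the sections `S a`. -/
def compBL (A : Elgebroid n n M E N) (F : ∀ x, Frame n E N x)
    (S : EMod n →ₗ[ℝ] Sec n (EMod n) E) (x : M) : EMod n →ₗ[ℝ] EMod n →ₗ[ℝ] EMod n :=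
  (A.bracket.compl₁₂ S S).compr₂ ((((F x).1.symm : E x →L[ℝ] EMod n) : E x →ₗ[ℝ] EMod n).comp
    (secEval (n := n) (G := EMod n) (V := E) x))

theorem compBL_apply (x : M) (a b : EMod n) :
    compBL A F S x a b = (F x).1.symm (A.bracket (S a) (S b) x) := rfl

theorem HasExtensions.compE_eventuallyEq (hS : HasExtensions e F S K) (a : EMod n) {x : M}
    (hx : x ∈ e.source) : compE e F (S a) =ᶠ[𝓝 (e x)] fun _ => a := by
  filter_upwards [e.open_target.mem_nhds (e.map_source hx)] with y hy
  rw [compE, push, hS.constE a _ (e.map_target hy), ContinuousLinearEquiv.symm_apply_apply]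

/-- As [u, ·] is a derivative plus an endomorphism, replacing v by the constant section with the
same value costs exactly the derivative of v along the anchor of u. -/
theorem IsNormalFrame.bracket_left (h : IsNormalFrame A e F) (hS : HasExtensions e F S K)
    (u v : Sec n (EMod n) E) {x : M} (hx : x ∈ e.source) :
    compE e F (A.bracket u v) (e x) = fderiv ℝ (compE e F v) (e x) (compE e F u (e x)).1
      + compE e F (A.bracket u (S (compE e F v (e x)))) (e x) := by
  obtain ⟨B, -, hB⟩ := h.exists_bracket_eq u hx
  rw [hB, hB, (hS.compE_eventuallyEq _ hx).fderiv_eq, (hS.compE_eventuallyEq _ hx).eq_of_nhds]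
  simp

theorem IsNormalFrame.compE_symm [T2Space M] (h : IsNormalFrame A e F)
    (hS : HasExtensions e F S K) (u v : Sec n (EMod n) E) {x : M} (hx : x ∈ e.source) :
    compE e F (A.bracket u v) (e x) + compE e F (A.bracket v u) (e x)
      = ∑ j, prodT (EuclideanSpace.proj j)
        (fderiv ℝ (fun y => prodN (compE e F u y) (compE e F v y)) (e x) (vec j))
        + compDL A F K x (prodN (compE e F u (e x)) (compE e F v (e x))) := by
  obtain ⟨k, hk⟩ := A.exists_prodN u v
  have hk' : compN e F k =ᶠ[𝓝 (e x)] fun y => prodN (compE e F u y) (compE e F v y) := by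
    filter_upwards [e.open_target.mem_nhds (e.map_source hx)] with y hy
    rw [compN, push, hk _ _ (h.frames _ (e.map_target hy)), Frame.prodN,
      ContinuousLinearEquiv.symm_apply_apply]
    rfl
  have hD := h.compE_D hS k hx
  rw [← A.symm u v k hk, hk'.fderiv_eq, hk'.eq_of_nhds] at hD
  rw [← hD, compE_apply _ hx, compE_apply _ hx, compE_apply _ hx, ← map_add]
  rfl

theorem fderiv_prodN_const {n : ℕ} {u : T n → EMod n} {y : T n} (hu : DifferentiableAt ℝ u y)
    (b : EMod n) (X : T n) :
    fderiv ℝ (fun z => prodN (u z) b) y X = prodN (fderiv ℝ u y X) b :=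
  congrArg (· X) ((((prodNC n).flip b).hasFDerivAt.comp y hu.hasFDerivAt).fderiv)

/-- Dependence on derivatives of the second argument is known from the structure-preserving axiom.
For the first argument, exchange the two by the symmetry axiom, use the known dependence, and
exchange back on constants; the two symmetric parts leave the term with (∂ⱼu ⊗ v)_N. -/
theorem IsNormalFrame.compE_bracket [T2Space M] (h : IsNormalFrame A e F)
    (hS : HasExtensions e F S K) (u v : Sec n (EMod n) E) {x : M} (hx : x ∈ e.source) :
    compE e F (A.bracket u v) (e x)
      = twistedBracket (fun y => compBL A F S (e.symm y)) (compE e F u) (compE e F v) (e x) := by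
  have hu : DifferentiableAt ℝ (compE e F u) (e x) :=
    ((h.contDiffOn_compE u).contDiffAt (e.open_target.mem_nhds (e.map_source hx))).differentiableAt
      (by simp)
  have h1 := h.bracket_left hS u v hx
  obtain ⟨b, hb⟩ : ∃ b, compE e F v (e x) = b := ⟨_, rfl⟩
  obtain ⟨a, ha⟩ : ∃ a, compE e F u (e x) = a := ⟨_, rfl⟩
  have h2 := h.compE_symm hS u (S b) hx
  have h3 := h.bracket_left hS (S b) u hx
  have h4 := h.compE_symm hS (S a) (S b) hx
  have hSa := hS.compE_eventuallyEq a hx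
  have hSb := hS.compE_eventuallyEq b hx
  have e2 : (fun y => prodN (compE e F u y) (compE e F (S b) y)) =ᶠ[𝓝 (e x)]
      fun y => prodN (compE e F u y) b := by
    filter_upwards [hSb] with y hy
    rw [hy]
  have e4 : (fun y => prodN (compE e F (S a) y) (compE e F (S b) y)) =ᶠ[𝓝 (e x)]
      fun _ => prodN a b := by
    filter_upwards [hSa, hSb] with y hy hy'
    rw [hy, hy']
  have e5 : ∀ j : Fin n, prodT (EuclideanSpace.proj j) (0 : NMod n) = 0 := fun j =>
    map_zero (prodTL n (EuclideanSpace.proj j))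
  rw [e2.fderiv_eq, hSb.eq_of_nhds] at h2
  rw [e4.fderiv_eq, hSa.eq_of_nhds, hSb.eq_of_nhds] at h4
  simp only [fderiv_fun_const, Pi.zero_apply, zero_apply, e5, Finset.sum_const_zero, zero_add] at h4
  simp only [fderiv_prodN_const hu] at h2
  rw [hSb.eq_of_nhds, ha] at h3
  rw [ha] at h2
  have hg : compBL A F S (e.symm (e x)) a b = compE e F (A.bracket (S a) (S b)) (e x) := rfl
  rw [twistedBracket, ha, hb, hg, h1, ha, hb]
  generalize compE e F (A.bracket u (S b)) (e x) = t₁ at *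
  generalize compE e F (A.bracket (S b) u) (e x) = t₂ at *
  generalize compE e F (A.bracket (S a) (S b)) (e x) = t₃ at *
  generalize compE e F (A.bracket (S b) (S a)) (e x) = t₄ at *
  subst h3
  rw [eq_sub_of_add_eq h2, ← h4]
  abel

theorem IsNormalFrame.leibniz_coord (h : IsNormalFrame A e F) {j : Fin n}
    {f : C^∞⟮𝓡 n, M; 𝓘(ℝ, ℝ), ℝ⟯} (hf : ∀ x ∈ e.source, f x = e x j) (u v : Sec n (EMod n) E) {z : M}
    (hz : z ∈ e.source) : compE e F (A.bracket u (smulSec f v)) (e z)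
      = e z j • compE e F (A.bracket u v) (e z) + (compE e F u (e z)).1 j • compE e F v (e z) := by
  have hd : (fun y => f (e.symm y)) =ᶠ[𝓝 (e z)]
      fun y => (EuclideanSpace.proj j : T n →L[ℝ] ℝ) y := by
    filter_upwards [e.open_target.mem_nhds (e.map_source hz)] with y hy
    rw [hf _ (e.map_target hy), e.right_inv hy]
    rfl
  rw [compE_apply _ hz, A.leibniz, map_add, map_smul, map_smul, hf z hz,
    h.dirDeriv_anchor_apply u hz (f.contMDiff.mdifferentiableAt (by simp)), hd.fderiv_eq,
    ContinuousLinearMap.fderiv, compE_apply _ hz, compE_apply _ hz, compE_apply v hz]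
  rfl

theorem fderiv_coord_smul_add {n : ℕ} {W : Type*} [NormedAddCommGroup W] [NormedSpace ℝ W]
    {g : T n → W} {y : T n} (hg : DifferentiableAt ℝ g y) (j : Fin n) (c : W) (X : T n) :
    fderiv ℝ (fun y => y j • g y + c) y X = y j • fderiv ℝ g y X + X j • g y :=
  congrArg (· X) ((((EuclideanSpace.proj j : T n →L[ℝ] ℝ).hasFDerivAt.smul
    hg.hasFDerivAt).add_const c).fderiv)

theorem IsNormalFrame.bracket_bracket_coord (h : IsNormalFrame A e F) (hS : HasExtensions e F S K)
    {j : Fin n} {f : C^∞⟮𝓡 n, M; 𝓘(ℝ, ℝ), ℝ⟯} (hf : ∀ x ∈ e.source, f x = e x j) (a b c : EMod n)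
    {x : M} (hx : x ∈ e.source) :
    compE e F (A.bracket (S a) (A.bracket (S b) (smulSec f (S c)))) (e x)
      = e x j • compE e F (A.bracket (S a) (A.bracket (S b) (S c))) (e x)
        + a.1 j • compE e F (A.bracket (S b) (S c)) (e x)
        + b.1 j • compE e F (A.bracket (S a) (S c)) (e x) := by
  have hd : DifferentiableAt ℝ (compE e F (A.bracket (S b) (S c))) (e x) :=
    ((h.contDiffOn_compE _).contDiffAt
      (e.open_target.mem_nhds (e.map_source hx))).differentiableAt (by simp)
  obtain ⟨B, -, hB⟩ := h.exists_bracket_eq (S a) hx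
  have e1 : compE e F (A.bracket (S b) (smulSec f (S c))) =ᶠ[𝓝 (e x)] fun y =>
      y j • compE e F (A.bracket (S b) (S c)) y + b.1 j • c := by
    filter_upwards [e.open_target.mem_nhds (e.map_source hx)] with y hy
    have hy' := e.map_target hy
    have := h.leibniz_coord hf (S b) (S c) hy'
    rw [(hS.compE_eventuallyEq _ hy').eq_of_nhds, (hS.compE_eventuallyEq _ hy').eq_of_nhds,
      e.right_inv hy] at this
    exact this
  rw [hB, hB, hB, (hS.compE_eventuallyEq a hx).eq_of_nhds, e1.fderiv_eq,
    fderiv_coord_smul_add hd, e1.eq_of_nhds,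
    (hS.compE_eventuallyEq c hx).eq_of_nhds, (hS.compE_eventuallyEq c hx).fderiv_eq, map_add,
    map_smul, map_smul]
  simp only [fderiv_fun_const, Pi.zero_apply, zero_apply, zero_add]
  module

theorem compE_add (s t : Sec n (EMod n) E) (y : T n) :
    compE e F (s + t) y = compE e F s y + compE e F t y :=
  map_add (F (e.symm y)).1.symm _ _

/-- The usual argument that the anchor preserves brackets: in the Jacobi identity for a, b and yʲc,
the terms with one coordinate derivative cancel between the two orders, leaving the j-th anchor
component of [a, b] times c. -/
theorem IsNormalFrame.compE_bracket_fst (h : IsNormalFrame A e F)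
    (hS : HasExtensions e F S K) (a b : EMod n) {x : M} (hx : x ∈ e.source) (j : Fin n) :
    (compE e F (A.bracket (S a) (S b)) (e x)).1 j = 0 := by
  obtain ⟨f, hf⟩ := hS.coord j
  obtain ⟨c, hc⟩ : ∃ c : EMod n, c ≠ 0 := ⟨(vec j, 0), fun h0 => by
    have := congrArg (fun u : EMod n => u.1 j) h0
    simp [vec] at this⟩
  have hj := fun w => congrArg (fun s : Sec n (EMod n) E => compE e F s (e x)) (A.jacobi (S a) (S b) w)
  simp only [compE_add] at hj
  have h1 := hj (smulSec f (S c))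
  rw [h.bracket_bracket_coord hS hf a b c hx, h.bracket_bracket_coord hS hf b a c hx,
    h.leibniz_coord hf _ _ hx, (hS.compE_eventuallyEq c hx).eq_of_nhds, hj (S c)] at h1
  have h3 : (compE e F (A.bracket (S a) (S b)) (e x)).1 j • c = 0 := by
    linear_combination (norm := module) -h1
  exact (smul_eq_zero.1 h3).resolve_right hc

theorem IsNormalFrame.isTwist [T2Space M] (h : IsNormalFrame A e F)
    (hS : HasExtensions e F S K) : IsTwist e.target (fun y => compBL A F S (e.symm y))
      (fun y => compDL A F K (e.symm y)) where
  smooth := fun a b => h.contDiffOn_compE _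
  mem := fun y hy a => by
    have hx := e.map_target hy
    obtain ⟨B, hB, hB'⟩ := h.exists_bracket_eq (S a) hx
    refine ⟨B, hB, fun b => ?_⟩
    have := hB' (S b)
    rw [(hS.compE_eventuallyEq b hx).eq_of_nhds, (hS.compE_eventuallyEq b hx).fderiv_eq,
      compE_apply _ hx] at this
    rw [compBL_apply, this]
    simp
  fst := fun y hy a b => by
    have hx := e.map_target hy
    refine PiLp.ext fun j => ?_
    have := h.compE_bracket_fst hS a b hx j
    rwa [compE_apply _ hx] at this
  symm := fun y hy a b => by
    have hx := e.map_target hy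
    have h4 := h.compE_symm hS (S a) (S b) hx
    have hSa := hS.compE_eventuallyEq a hx
    have hSb := hS.compE_eventuallyEq b hx
    have e4 : (fun y => prodN (compE e F (S a) y) (compE e F (S b) y)) =ᶠ[𝓝 (e (e.symm y))]
        fun _ => prodN a b := by
      filter_upwards [hSa, hSb] with y hy hy'
      rw [hy, hy']
    have e5 : ∀ j : Fin n, prodT (EuclideanSpace.proj j) (0 : NMod n) = 0 := fun j =>
      map_zero (prodTL n (EuclideanSpace.proj j))
    rw [e4.fderiv_eq, hSa.eq_of_nhds, hSb.eq_of_nhds, compE_apply _ hx, compE_apply _ hx] at h4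
    simp only [fderiv_fun_const, Pi.zero_apply, zero_apply, e5, Finset.sum_const_zero,
      zero_add] at h4
    exact h4
  jacobi := fun y hy a b c => by
    have hx := e.map_target hy
    have hj := congrArg (fun s : Sec n (EMod n) E => compE e F s (e (e.symm y)))
      (A.jacobi (S a) (S b) (S c))
    have hy' := e.right_inv hy
    have hh := fun a => hS.compE_eventuallyEq a hx
    simp only [compE_add, h.compE_bracket hS _ _ hx] at hj
    rw [hy'] at hj hh
    have h1 := twistedBracket_congr (Γ := fun y => compBL A F S (e.symm y)) (hh a)
      (Filter.EventuallyEq.refl _ (compE e F (A.bracket (S b) (S c))))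
    have h2 := twistedBracket_congr (Γ := fun y => compBL A F S (e.symm y)) (hh b)
      (Filter.EventuallyEq.refl _ (compE e F (A.bracket (S a) (S c))))
    have h3 := twistedBracket_congr (Γ := fun y => compBL A F S (e.symm y))
      (Filter.EventuallyEq.refl _ (compE e F (A.bracket (S a) (S b)))) (hh c)
    rw [h1, h2, h3] at hj
    exact hj

end

end

/-! ### Elements of the Lie algebra in components -/

section

theorem glAct_id {n k : ℕ} (σ : Form n k) :
    glAct (ContinuousLinearMap.id ℝ (T n)) σ = -((k : ℝ) • σ) := by
  ext v
  simp only [glAct, ContinuousAlternatingMap.neg_apply, ContinuousAlternatingMap.smul_apply,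
    ContinuousAlternatingMap.fderivCompContinuousLinearMap_apply]
  simp

attribute [local irreducible] ins wd wedge prodN prodE

/-- Evaluation of forms, as a linear map. -/
def formEval {n k : ℕ} (w : Fin k → T n) : Form n k →ₗ[ℝ] ℝ where
  toFun := fun φ => φ w
  map_add' := fun _ _ => rfl
  map_smul' := fun _ _ => rfl

theorem ins_three_apply {n : ℕ} (a b c : T n) (φ : Form n 3) (v : Fin 0 → T n) :
    ins c (ins b (ins a φ)) v = φ ![a, b, c] := by
  rw [ins_apply, ins_apply, ins_apply]
  congr 1
  funext i
  fin_cases i <;> rfl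

theorem ins_ins_ins_apply_pair {n : ℕ} (w : Fin 3 → T n) (x y : T n) (s : Form n 5) :
    ins (w 2) (ins (w 1) (ins (w 0) s)) ![x, y] = ins y (ins x s) w := by
  have e : w = ![w 0, w 1, w 2] := by ext i : 1; fin_cases i <;> rfl
  rw [← ins_ins_apply x y _ ![]]
  conv_rhs => rw [e, ← ins_three_apply _ _ _ _ ![]]
  simp only [ins_swap x (w 2), ins_swap x (w 1), ins_swap x (w 0), ins_swap y (w 2),
    ins_swap y (w 1), ins_swap y (w 0), ins_neg_right, neg_neg]

/-- Multivectors enter as functionals W₃, W₆, so sums of decomposables need no separate treatment in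
the induction over the span. -/
theorem exists_components_of_mem_excLieAlg {n : ℕ} {A : EMod n →L[ℝ] EMod n} (hA : A ∈ excLieAlg n) :
    ∃ (c₀ : ℝ) (B : T n →L[ℝ] T n) (a₃ : Form n 3) (a₆ : Form n 6) (W₃ : Form n 3 →ₗ[ℝ] ℝ)
      (W₆ : Form n 6 →ₗ[ℝ] ℝ), ∀ u,
      (∀ β, cov β (A u).1 = c₀ * cov β u.1 + cov β (B u.1) + W₃ (wd (rfl : 1 + 2 = 3) β u.2.1)
        + W₆ (wd (rfl : 1 + 5 = 6) β u.2.2)) ∧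
      (∀ x y, (A u).2.1 ![x, y] = c₀ * u.2.1 ![x, y] + glAct B u.2.1 ![x, y] + ins u.1 a₃ ![x, y]
        + W₃ (ins y (ins x u.2.2))) ∧
      (A u).2.2 = c₀ • u.2.2 + glAct B u.2.2 + wd (rfl : 3 + 2 = 5) a₃ u.2.1 + ins u.1 a₆ := by
  induction hA using Submodule.span_induction with
  | mem x hx =>
    rcases hx with ((((h | h) | h) | h) | h) | h
    · refine ⟨1, 0, 0, 0, 0, 0, fun u => ⟨fun β => ?_, fun x y => ?_, ?_⟩⟩
      · rw [h]; simp
      · rw [h, ← glActL_apply]; simp [ins_zero_right]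
      · rw [h, ← glActL_apply]; simp [ins_zero_right]
    · obtain ⟨B, h⟩ := h
      refine ⟨0, B, 0, 0, 0, 0, fun u => ⟨fun β => ?_, fun x y => ?_, ?_⟩⟩
      · rw [h]; simp
      · rw [h]; simp [ins_zero_right]
      · rw [h]; simp [ins_zero_right]
    · obtain ⟨a, h⟩ := h
      refine ⟨0, 0, a, 0, 0, 0, fun u => ⟨fun β => ?_, fun x y => ?_, ?_⟩⟩
      · rw [h]; simp
      · rw [h, ← glActL_apply]; simp
      · rw [h, ← glActL_apply]
        simp only [zero_smul, map_zero, LinearMap.zero_apply, ins_zero_right, add_zero, zero_add]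
        ext v
        rw [wd_apply]
        rfl
    · obtain ⟨a, h⟩ := h
      refine ⟨0, 0, 0, a, 0, 0, fun u => ⟨fun β => ?_, fun x y => ?_, ?_⟩⟩
      · rw [h]; simp
      · rw [h, ← glActL_apply]; simp [ins_zero_right]
      · rw [h, ← glActL_apply]; simp
    · obtain ⟨w, h⟩ := h
      have e : ∀ u, x u = triE w u := fun u => (h u).trans (triE_apply w u).symm
      refine ⟨0, 0, 0, 0, formEval w, 0, fun u => ⟨fun β => ?_, fun x y => ?_, ?_⟩⟩
      · rw [e, cov_triE]; simp [formEval]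
      · rw [h, ← glActL_apply]; simp [ins_zero_right, formEval, ins_ins_ins_apply_pair]
      · rw [h, ← glActL_apply]; simp [ins_zero_right]
    · obtain ⟨w, h⟩ := h
      have e : ∀ u, x u = sixE w u := fun u => (h u).trans (sixE_apply w u).symm
      refine ⟨0, 0, 0, 0, 0, -formEval w, fun u => ⟨fun β => ?_, fun x y => ?_, ?_⟩⟩
      · rw [e, cov_sixE]; simp [formEval]
      · rw [h, ← glActL_apply]; simp [ins_zero_right]
      · rw [h, ← glActL_apply]; simp [ins_zero_right]
  | zero =>
    refine ⟨0, 0, 0, 0, 0, 0, fun u => ⟨fun β => ?_, fun x y => ?_, ?_⟩⟩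
    · simp
    · rw [← glActL_apply]; simp [ins_zero_right]
    · rw [← glActL_apply]; simp [ins_zero_right]
  | add x y _ _ hx hy =>
    obtain ⟨c, B, a, b, W, V, h⟩ := hx
    obtain ⟨c', B', a', b', W', V', h'⟩ := hy
    refine ⟨c + c', B + B', a + a', b + b', W + W', V + V', fun u => ⟨fun β => ?_, fun x y => ?_, ?_⟩⟩
    · rw [add_apply, Prod.fst_add, map_add, (h u).1, (h' u).1]
      simp only [add_apply, map_add, LinearMap.add_apply]
      ring
    · rw [add_apply, Prod.snd_add, Prod.fst_add, ContinuousAlternatingMap.add_apply, (h u).2.1,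
        (h' u).2.1]
      simp only [← glActL_apply, map_add, LinearMap.add_apply, ins_add_right,
        ContinuousAlternatingMap.add_apply]
      ring
    · rw [add_apply, Prod.snd_add, Prod.snd_add, (h u).2.2, (h' u).2.2]
      simp only [← glActL_apply, map_add, LinearMap.add_apply, ins_add_right]
      module
  | smul r x _ hx =>
    obtain ⟨c, B, a, b, W, V, h⟩ := hx
    refine ⟨r * c, r • B, r • a, r • b, r • W, r • V, fun u => ⟨fun β => ?_, fun x y => ?_, ?_⟩⟩
    · rw [smul_apply, Prod.smul_fst, map_smul, (h u).1]
      simp only [smul_apply, map_smul, LinearMap.smul_apply, smul_eq_mul]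
      ring
    · rw [smul_apply, Prod.smul_snd, Prod.smul_fst, ContinuousAlternatingMap.smul_apply, (h u).2.1]
      simp only [← glActL_apply, map_smul, LinearMap.smul_apply, ins_smul_right,
        ContinuousAlternatingMap.smul_apply, smul_eq_mul]
      ring
    · rw [smul_apply, Prod.smul_snd, Prod.smul_snd, (h u).2.2]
      simp only [← glActL_apply, map_smul, LinearMap.smul_apply, ins_smul_right]
      module

theorem eq_zero_of_wd_one {n : ℕ} {W : Form n 3 →ₗ[ℝ] ℝ}
    (h : ∀ β σ, W (wd (rfl : 1 + 2 = 3) β σ) = 0) : W = 0 := by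
  refine LinearMap.ext fun φ => ?_
  rw [form_eq_sum_ext1 φ, map_smul, map_sum, LinearMap.zero_apply]
  rw [Finset.sum_eq_zero, smul_zero]
  intro i _
  rw [← wd_oneForm (rfl : 1 + 2 = 3), h]

/-- The elements of the Lie algebra with image in `Λ²T* ⊕ Λ⁵T*`. -/
theorem exists_of_fst_eq_zero {n : ℕ} {A : EMod n →L[ℝ] EMod n} (hA : A ∈ excLieAlg n)
    (h0 : ∀ u, (A u).1 = 0) : ∃ (c : ℝ) (a₃ : Form n 3) (a₆ : Form n 6), ∀ u,
      A u = (0, c • u.2.1 + ins u.1 a₃,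
        (2 * c) • u.2.2 + wd (rfl : 3 + 2 = 5) a₃ u.2.1 + ins u.1 a₆) := by
  obtain ⟨c, B, a₃, a₆, W₃, W₆, h⟩ := exists_components_of_mem_excLieAlg hA
  -- Vanishing of the T-component on vectors makes gl(T) cancel the scalar.
  have hB : B = -(c • ContinuousLinearMap.id ℝ (T n)) := by
    refine ContinuousLinearMap.ext fun X => eq_of_cov_eq fun β => ?_
    have := (h (X, 0, 0)).1 β
    rw [h0] at this
    simp only [map_zero, add_zero] at this
    rw [neg_apply, smul_apply, map_neg, map_smul, smul_eq_mul]
    simp only [ContinuousLinearMap.id_apply]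
    linarith
  have hW : W₃ = 0 := by
    refine eq_zero_of_wd_one fun β σ => ?_
    have := (h (0, σ, 0)).1 β
    rw [h0] at this
    simpa using this.symm
  have hg : ∀ {k : ℕ} (σ : Form n k), glAct B σ = (c * k) • σ := by
    intro k σ
    rw [hB, ← glActL_apply, map_neg, map_smul, LinearMap.neg_apply, LinearMap.smul_apply,
      glActL_apply, glAct_id]
    module
  -- With B = -c id, a k-form is scaled by c + kc: 3c in degree two and 6c in degree five. The
  -- weights are thus in ratio 1 : 2.
  refine ⟨3 * c, a₃, a₆, fun u => Prod.ext (h0 u) (Prod.ext ?_ ?_)⟩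
  · ext v
    have e : v = ![v 0, v 1] := by ext i : 1; fin_cases i <;> rfl
    rw [e, (h u).2.1, hW, hg]
    simp only [LinearMap.zero_apply, ContinuousAlternatingMap.add_apply,
      ContinuousAlternatingMap.smul_apply, smul_eq_mul]
    push_cast
    ring
  · rw [(h u).2.2, hg]
    push_cast
    module

end

/-! ### Pointwise conditions on the tensor, and extension from products -/

section

attribute [local irreducible] ins wd wedge prodN prodE

theorem proj_vec {n : ℕ} (i j : Fin n) :
    (EuclideanSpace.proj i : T n →L[ℝ] ℝ) (vec j) = if i = j then 1 else 0 := by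
  simp [vec]

theorem exists_form_two_apply_eq_one {n : ℕ} (hn : 2 ≤ n) :
    ∃ (σ : Form n 2) (w : Fin 2 → T n), σ w = 1 := by
  let i : Fin n := ⟨0, by omega⟩
  let j : Fin n := ⟨1, by omega⟩
  have hij : i ≠ j := by simp [i, j]
  refine ⟨ext1 (EuclideanSpace.proj i) (oneForm (EuclideanSpace.proj j)), ![vec i, vec j], ?_⟩
  rw [ext1_apply, Fin.sum_univ_two]
  simp [oneForm_apply, vec, Fin.removeNth, hij, hij.symm]

/-- The algebraic axioms of an elgebroid on the zeroth order part of the bracket and of `𝓓` at a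
point, for a frame in which the anchor is the projection. -/
structure IsPointTwist {n : ℕ} (G : EMod n →ₗ[ℝ] EMod n →ₗ[ℝ] EMod n) (D : NMod n →ₗ[ℝ] EMod n) :
    Prop where
  mem : ∀ a, ∃ A ∈ excLieAlg n, ∀ b, G a b = A b
  fst : ∀ a b, (G a b).1 = 0
  symm : ∀ a b, G a b + G b a = D (prodN a b)

variable {n : ℕ} {G : EMod n →ₗ[ℝ] EMod n →ₗ[ℝ] EMod n} {D : NMod n →ₗ[ℝ] EMod n}

/-- For each u the scalar and the two forms can be read off from values of G u, which makes them
unique and hence linear in u. A nonzero 2-form, which exists for n ≥ 2, is needed to see the scalar.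
-/
theorem IsPointTwist.exists_components (h : IsPointTwist G D) (hn : 2 ≤ n) :
    ∃ (c : EMod n →ₗ[ℝ] ℝ) (a₃ : EMod n →ₗ[ℝ] Form n 3) (a₆ : EMod n →ₗ[ℝ] Form n 6), ∀ u v,
      G u v = (0, c u • v.2.1 + ins v.1 (a₃ u),
        (2 * c u) • v.2.2 + wd (rfl : 3 + 2 = 5) (a₃ u) v.2.1 + ins v.1 (a₆ u)) := by
  have key : ∀ u, ∃ (c : ℝ) (a₃ : Form n 3) (a₆ : Form n 6), ∀ v, G u v = (0, c • v.2.1 + ins v.1 a₃,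
        (2 * c) • v.2.2 + wd (rfl : 3 + 2 = 5) a₃ v.2.1 + ins v.1 a₆) := by
    intro u
    obtain ⟨A, hA, hA'⟩ := h.mem u
    obtain ⟨c, a₃, a₆, h'⟩ := exists_of_fst_eq_zero hA fun v => by rw [← hA', h.fst]
    exact ⟨c, a₃, a₆, fun v => by rw [hA', h']⟩
  choose c a₃ a₆ hG using key
  obtain ⟨σ, w, hσ⟩ := exists_form_two_apply_eq_one hn
  have hc : ∀ u, c u = (G u (0, σ, 0)).2.1 w := by
    intro u
    rw [hG, ins_zero_left, add_zero, ContinuousAlternatingMap.smul_apply, hσ, smul_eq_mul, mul_one]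
  have h3 : ∀ u X, ins X (a₃ u) = (G u (X, 0, 0)).2.1 := by
    intro u X
    rw [hG, smul_zero, zero_add]
  have h6 : ∀ u X, ins X (a₆ u) = (G u (X, 0, 0)).2.2 := by
    intro u X
    rw [hG]
    simp
  refine ⟨⟨⟨c, fun u v => ?_⟩, fun r u => ?_⟩, ⟨⟨a₃, fun u v => ?_⟩, fun r u => ?_⟩,
    ⟨⟨a₆, fun u v => ?_⟩, fun r u => ?_⟩, hG⟩
  · rw [hc, hc, hc, map_add]; rfl
  · show c (r • u) = r • c u
    rw [hc, hc, map_smul]; rfl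
  · refine form_ext_ins fun X => ?_
    rw [ins_add_right, h3, h3, h3, map_add]; rfl
  · refine form_ext_ins fun X => ?_
    show ins X (a₃ (r • u)) = ins X (r • a₃ u)
    rw [ins_smul_right, h3, h3, map_smul]; rfl
  · refine form_ext_ins fun X => ?_
    rw [ins_add_right, h6, h6, h6, map_add]; rfl
  · refine form_ext_ins fun X => ?_
    show ins X (a₆ (r • u)) = ins X (r • a₆ u)
    rw [ins_smul_right, h6, h6, map_smul]; rfl

/-- Skewness in X and the first slot makes f the contraction of a form. By the antiderivation rule
and Euler's identity, contracting the sum of eⁱ ∧ f(eᵢ) with X gives k + 2 copies of f X. -/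
theorem exists_eq_ins {k : ℕ} {f : T n →ₗ[ℝ] Form n (k + 1)}
    (hf : ∀ X Y, ins Y (f X) = -ins X (f Y)) : ∃ φ : Form n (k + 2), ∀ X, f X = ins X φ := by
  refine ⟨((k : ℝ) + 2)⁻¹ • ∑ i, ext1 (EuclideanSpace.proj i) (f (vec i)), fun X => ?_⟩
  have h1 : ins X (∑ i, ext1 (EuclideanSpace.proj i) (f (vec i)))
      = f X + ∑ i, ext1 (EuclideanSpace.proj i) (ins (vec i) (f X)) := by
    have h2 : f X = ∑ i, (EuclideanSpace.proj i : T n →L[ℝ] ℝ) X • f (vec i) := by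
      have hX : X = ∑ i, (EuclideanSpace.proj i : T n →L[ℝ] ℝ) X • (vec i : T n) := by
        ext j
        simp [vec, Pi.single_apply]
      conv_lhs => rw [hX, map_sum]
      exact Finset.sum_congr rfl fun i _ => map_smul _ _ _
    conv_rhs => enter [1]; rw [h2]
    rw [← insL_apply, map_sum, ← Finset.sum_add_distrib]
    refine Finset.sum_congr rfl fun i _ => ?_
    rw [insL_apply, ins_ext1, hf X (vec i), ← ext1L_apply, ← ext1L_apply, map_neg]
    abel
  rw [ins_smul_right, h1, sum_ext1_ins]
  have : (k : ℝ) + 2 ≠ 0 := by positivity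
  rw [show f X + ((k : ℝ) + 1) • f X = ((k : ℝ) + 2) • f X by module, smul_smul,
    inv_mul_cancel₀ this, one_smul]

theorem form_ext_vec {k : ℕ} {σ τ : Form n (k + 1)} (h : ∀ i, ins (vec i) σ = ins (vec i) τ) :
    σ = τ := by
  rw [form_eq_sum_ext1 σ, form_eq_sum_ext1 τ]
  simp only [h]

theorem ins_vec_covec (i j : Fin n) (v : Fin 0 → T n) :
    ins (vec j) (covec i : Form n 1) v = if i = j then 1 else 0 := by
  rw [ins_one_apply, covec, cov_oneForm, proj_vec]

theorem form_one_eq_sum (β : Form n 1) : β = ∑ i, cov β (vec i) • covec i := by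
  rw [sum_covec, oneForm_cov]

theorem ins_ext1_covec {i j : Fin n} (hij : i ≠ j) :
    ins (vec j) (ext1 (EuclideanSpace.proj j) (covec i) : Form n 2) = covec i := by
  rw [ins_ext1, proj_vec, if_pos rfl, one_smul, ← ext1L_apply]
  have : ins (vec j) (covec i : Form n 1) = 0 := by
    ext v
    rw [ins_vec_covec, if_neg hij]
    rfl
  rw [this, map_zero, sub_zero]

/-- Applying i_X twice gives i_X Q(i_X σ) = 0. For j ≠ i, eⁱ is the contraction of eʲ ∧ eⁱ with eⱼ,
so i_{eⱼ} Q(eⁱ) = 0. Only the contraction with eᵢ could survive, and it dies after one further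
contraction because Q(eⁱ) has degree at least two. -/
theorem eq_zero_of_ins_eq {k : ℕ} {Q : Form n 1 →ₗ[ℝ] Form n (k + 2)}
    {t : Form n 2 →ₗ[ℝ] Form n (k + 3)} (h : ∀ X σ, ins X (t σ) = Q (ins X σ)) :
    t = 0 ∧ Q = 0 := by
  have h0 : ∀ X σ, ins X (Q (ins X σ)) = 0 := fun X σ => by rw [← h, ins_ins_same]
  have h1 : ∀ i j, i ≠ j → ins (vec j) (Q (covec i)) = 0 := by
    intro i j hij
    have := h0 (vec j) (ext1 (EuclideanSpace.proj j) (covec i))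
    rwa [ins_ext1_covec hij] at this
  have hQ : Q = 0 := by
    refine LinearMap.ext fun β => ?_
    rw [form_one_eq_sum β, map_sum, LinearMap.zero_apply]
    refine Finset.sum_eq_zero fun i _ => ?_
    rw [map_smul]
    have : Q (covec i) = 0 := by
      refine form_ext_vec fun j => ?_
      rw [ins_zero_right]
      by_cases hij : i = j
      · subst hij
        refine form_ext_vec fun l => ?_
        rw [ins_zero_right]
        by_cases hil : i = l
        · subst hil; exact ins_ins_same _ _
        · rw [ins_swap, h1 i l hil, ins_zero_right, neg_zero]
      · exact h1 i j hij
    rw [this, smul_zero]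
  refine ⟨LinearMap.ext fun σ => form_ext_ins fun X => ?_, hQ⟩
  rw [h, hQ, LinearMap.zero_apply, LinearMap.zero_apply, ins_zero_right]

theorem ext1_self (β : T n →L[ℝ] ℝ) {k : ℕ} (φ : Form n k) : ext1 β (ext1 β φ) = 0 := by
  have h := ext1_ext1_comm β β φ
  generalize ext1 β (ext1 β φ) = ψ at h
  ext v
  have := congrArg (fun χ : Form n (k + 1 + 1) => χ v) h
  simp only [ContinuousAlternatingMap.neg_apply] at this
  show ψ v = 0
  linarith

theorem wd_ext1_two (α β : T n →L[ℝ] ℝ) (τ : Form n 2) :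
    wd (rfl : 2 + 2 = 4) (ext1 α (oneForm β)) τ = ext1 α (ext1 β τ) := by
  rw [← wd_oneForm (rfl : 1 + 1 = 2), wd_assoc rfl (rfl : 2 + 2 = 4) (rfl : 1 + 2 = 3), wd_oneForm,
    wd_oneForm]

theorem wd_ext1_self (α β : T n →L[ℝ] ℝ) :
    wd (rfl : 2 + 2 = 4) (ext1 α (oneForm β)) (ext1 α (oneForm β)) = 0 := by
  rw [wd_ext1_two, ext1_ext1_comm β α, ← ext1L_apply, map_neg, ext1L_apply, ext1_self, neg_zero]

theorem form_two_eq_sum (σ : Form n 2) : σ = ((1 : ℝ) + 1)⁻¹ • ∑ i, ext1 (EuclideanSpace.proj i)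
    (oneForm (cov (ins (vec i) σ))) := by
  conv_lhs => rw [form_eq_sum_ext1 σ]
  simp only [oneForm_cov, Nat.cast_one]

theorem eq_zero_of_wd_two {W : Type*} [AddCommGroup W] [Module ℝ W] {f : Form n 4 →ₗ[ℝ] W}
    (h : ∀ σ τ, f (wd (rfl : 2 + 2 = 4) σ τ) = 0) : f = 0 := by
  refine LinearMap.ext fun φ => ?_
  rw [form_eq_sum_ext1 φ, map_smul, map_sum, LinearMap.zero_apply]
  rw [Finset.sum_eq_zero, smul_zero]
  intro i _
  rw [form_eq_sum_ext1 (ins (vec i) φ), ← ext1L_apply, map_smul, map_smul, map_sum, map_sum]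
  rw [Finset.sum_eq_zero, smul_zero]
  intro j _
  rw [ext1L_apply, ← wd_ext1_two, h]

theorem IsPointTwist.apply_self (h : IsPointTwist G D) (u : EMod n) :
    (2 : ℝ) • G u u = D (prodN u u) := by
  rw [← h.symm, two_smul]

theorem jWedge_zero_left (t : Form n 5) : jWedge (0 : Form n 2) t = 0 := by
  rw [← zero_smul ℝ (0 : Form n 2), jWedge_smul_left, zero_smul]

theorem jWedge_zero_right (s : Form n 2) : jWedge s (0 : Form n 5) = 0 := by
  rw [← zero_smul ℝ (0 : Form n 5), jWedge_smul_right, zero_smul]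

theorem prodN_T_T (X Y : T n) : prodN (X, 0, 0) (Y, 0, 0) = 0 := by
  rw [prodN_eq]
  simp [ins_zero_right, jWedge_zero_left]

theorem prodN_T_two (X : T n) (σ : Form n 2) : prodN (X, 0, 0) (0, σ, 0) = (ins X σ, 0, 0) := by
  rw [prodN_eq]
  simp [ins_zero_right, jWedge_zero_right]

theorem prodN_T_five (X : T n) (s : Form n 5) : prodN (X, 0, 0) (0, 0, s) = (0, ins X s, 0) := by
  rw [prodN_eq]
  simp [ins_zero_right, jWedge_zero_left]

theorem prodN_two_two (σ τ : Form n 2) :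
    prodN (0, σ, 0) (0, τ, 0) = (0, -wd (rfl : 2 + 2 = 4) σ τ, 0) := by
  rw [prodN_eq]
  simp [ins_zero_right, ins_zero_left, jWedge_zero_right]

theorem prodN_two_five (σ : Form n 2) (s : Form n 5) :
    prodN (0, σ, 0) (0, 0, s) = (0, 0, jWedge σ s) := by
  rw [prodN_eq]
  simp [ins_zero_right, ins_zero_left, jWedge_zero_right]

theorem prodN_five_five (s t : Form n 5) : prodN (0, 0, s) (0, 0, t) = 0 := by
  rw [prodN_eq]
  simp [ins_zero_right, ins_zero_left, jWedge_zero_left]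

theorem IsPointTwist.exists_ins (h : IsPointTwist G D) (X Y : T n) :
    (G (X, 0, 0) (Y, 0, 0)) = -G (Y, 0, 0) (X, 0, 0) := by
  rw [eq_neg_iff_add_eq_zero, h.symm, prodN_T_T, map_zero]

/-- Contracting the zero 7-form eˡ ∧ φ with eⱼ gives eˡ ∧ i_{eⱼ}φ = δ_{lj} φ. The result exhibits
every eⁱ ⊗ φ as a value of `jWedge`, so these values span T* ⊗ Λ⁶T*. -/
theorem jWedge_ext1_ins (hn : n ≤ 6) {i j : Fin n} (hij : i ≠ j) (φ : Form n 6) :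
    jWedge (ext1 (EuclideanSpace.proj j) (covec i) : Form n 2) (ins (vec j) φ)
      = -(EuclideanSpace.proj i : T n →L[ℝ] ℝ).smulRight φ := by
  have key : ∀ l, wd (rfl : 1 + 5 = 6) (covec l : Form n 1) (ins (vec j) φ)
      = (if l = j then (1 : ℝ) else 0) • φ := by
    intro l
    have h := ins_wd_one_left (rfl : 1 + 6 = 7) (vec j) (covec l) φ
    rw [ins_eq_zero _ (form_eq_zero_of_lt (by omega) _), covec, cov_oneForm, proj_vec] at h
    exact (sub_eq_zero.1 h.symm).symm
  refine ContinuousLinearMap.ext fun Y => ?_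
  have hz : ins Y (covec i : Form n 1)
      = (EuclideanSpace.proj i : T n →L[ℝ] ℝ) Y • detForm Fin.elim0 := by
    rw [zeroForm_eq (ins Y (covec i))]
    rw [ins_one_apply, covec, cov_oneForm]
  have hd : ext1 (EuclideanSpace.proj j : T n →L[ℝ] ℝ) (detForm Fin.elim0 : Form n 0) = covec j := by
    ext v
    rw [ext1_apply]
    simp [detForm_apply, covec, oneForm_apply]
  rw [jWedge_apply, ins_ext1, hz, ← ext1L_apply, map_smul, ext1L_apply, hd, map_sub, map_smul,
    map_smul, LinearMap.sub_apply, LinearMap.smul_apply, LinearMap.smul_apply, key, key, if_neg hij,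
    if_pos rfl, neg_apply, ContinuousLinearMap.smulRight_apply]
  simp

theorem eq_zero_of_jWedge {W : Type*} [AddCommGroup W] [Module ℝ W]
    {f : (T n →L[ℝ] Form n 6) →ₗ[ℝ] W} (hn : 2 ≤ n) (hn' : n ≤ 6)
    (h : ∀ σ s, f (jWedge σ s) = 0) : f = 0 := by
  refine LinearMap.ext fun κ => ?_
  have hκ : κ = ∑ i, (EuclideanSpace.proj i : T n →L[ℝ] ℝ).smulRight (κ (vec i)) := by
    refine ContinuousLinearMap.ext fun X => ?_
    have hX : X = ∑ i, (EuclideanSpace.proj i : T n →L[ℝ] ℝ) X • (vec i : T n) := by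
      ext j
      simp [vec, Pi.single_apply]
    conv_lhs => rw [hX, map_sum]
    rw [sum_apply]
    exact Finset.sum_congr rfl fun i _ => map_smul _ _ _
  rw [hκ, map_sum, LinearMap.zero_apply]
  refine Finset.sum_eq_zero fun i _ => ?_
  obtain ⟨j, hj⟩ : ∃ j : Fin n, j ≠ i :=
    haveI : Nontrivial (Fin n) := Fin.nontrivial_iff_two_le.2 hn
    exists_ne i
  rw [← neg_neg ((EuclideanSpace.proj i : T n →L[ℝ] ℝ).smulRight (κ (vec i))),
    ← jWedge_ext1_ins hn' hj.symm, map_neg, h, neg_zero]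

end

/-! ### The tensor at a point is determined by a covector and a 4-form -/

section

attribute [local irreducible] ins wd wedge prodN prodE

variable {n : ℕ} {G : EMod n →ₗ[ℝ] EMod n →ₗ[ℝ] EMod n} {D : NMod n →ₗ[ℝ] EMod n}
  {c : EMod n →ₗ[ℝ] ℝ} {a₃ : EMod n →ₗ[ℝ] Form n 3} {a₆ : EMod n →ₗ[ℝ] Form n 6}

/-- The components of the bracket at a point. -/
def HasComponents (G : EMod n →ₗ[ℝ] EMod n →ₗ[ℝ] EMod n) (c : EMod n →ₗ[ℝ] ℝ)
    (a₃ : EMod n →ₗ[ℝ] Form n 3) (a₆ : EMod n →ₗ[ℝ] Form n 6) : Prop :=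
  ∀ u v, G u v = (0, c u • v.2.1 + ins v.1 (a₃ u),
    (2 * c u) • v.2.2 + wd (rfl : 3 + 2 = 5) (a₃ u) v.2.1 + ins v.1 (a₆ u))

theorem HasComponents.apply_T (hG : HasComponents G c a₃ a₆) (u : EMod n) (X : T n) :
    G u (X, 0, 0) = (0, ins X (a₃ u), ins X (a₆ u)) := by
  rw [hG]; simp

theorem HasComponents.apply_two (hG : HasComponents G c a₃ a₆) (u : EMod n) (σ : Form n 2) :
    G u (0, σ, 0) = (0, c u • σ, wd (rfl : 3 + 2 = 5) (a₃ u) σ) := by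
  rw [hG]; simp [ins_zero_left]

theorem HasComponents.apply_five (hG : HasComponents G c a₃ a₆) (u : EMod n) (s : Form n 5) :
    G u (0, 0, s) = (0, 0, (2 * c u) • s) := by
  rw [hG]; simp [ins_zero_left]

/-- Since (s ⊗ s)_N = 0, symmetry forces G(s, s) = 0, and this is 2c(s) s. -/
theorem IsPointTwist.comp_five (h : IsPointTwist G D) (hG : HasComponents G c a₃ a₆) (s : Form n 5) :
    c (0, 0, s) = 0 := by
  by_cases hs : s = 0
  · subst hs; exact map_zero c
  · have := h.apply_self (0, 0, s)
    rw [prodN_five_five, map_zero, hG.apply_five] at this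
    have := congrArg (fun u : EMod n => u.2.2) this
    simpa [hs] using this

/-- For decomposable σ one has σ ∧ σ = 0, hence G(σ, σ) = 0, whose 2-form part is c(σ)σ.
Decomposables span. -/
theorem IsPointTwist.comp_two (h : IsPointTwist G D) (hG : HasComponents G c a₃ a₆) (σ : Form n 2) :
    c (0, σ, 0) = 0 := by
  have key : ∀ α β : T n →L[ℝ] ℝ, c (0, ext1 α (oneForm β), 0) = 0 := by
    intro α β
    have h1 := h.apply_self (0, ext1 α (oneForm β), 0)
    have h2 := wd_ext1_self α β
    generalize (ext1 α (oneForm β) : Form n 2) = σ at h1 h2 ⊢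
    by_cases hs : σ = 0
    · subst hs; exact map_zero c
    · rw [prodN_two_two, h2, neg_zero] at h1
      rw [show ((0, 0, 0) : NMod n) = 0 from rfl, map_zero, hG.apply_two] at h1
      have := congrArg (fun u : EMod n => u.2.1) h1
      simpa [hs] using this
  obtain ⟨f, hf⟩ : ∃ f : Form n 2 →ₗ[ℝ] ℝ, ∀ σ, c (0, σ, 0) = f σ :=
    ⟨c.comp ((LinearMap.inr ℝ (T n) (Form n 2 × Form n 5)).comp
      (LinearMap.inl ℝ (Form n 2) (Form n 5))), fun σ => rfl⟩
  rw [hf, form_two_eq_sum σ, map_smul, map_sum]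
  rw [Finset.sum_eq_zero, smul_zero]
  intro i _
  rw [← hf, key]

theorem IsPointTwist.comp_eq (h : IsPointTwist G D) (hG : HasComponents G c a₃ a₆) (u : EMod n) :
    c u = c (u.1, 0, 0) := by
  conv_lhs => rw [EMod.eq_add u]
  rw [map_add, map_add, h.comp_two hG, h.comp_five hG, add_zero, add_zero]

/-- The inclusion of the 4-forms in `N`. -/
def inclFour (n : ℕ) : Form n 4 →ₗ[ℝ] NMod n :=
  (LinearMap.inr ℝ (Form n 1) (Form n 4 × (T n →L[ℝ] Form n 6))).comp
      (LinearMap.inl ℝ (Form n 4) (T n →L[ℝ] Form n 6))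

/-- The inclusion of the 2-forms in `E`. -/
def inclTwo (n : ℕ) : Form n 2 →ₗ[ℝ] EMod n :=
  (LinearMap.inr ℝ (T n) (Form n 2 × Form n 5)).comp (LinearMap.inl ℝ (Form n 2) (Form n 5))

theorem inclFour_apply (k : Form n 4) : inclFour n k = (0, k, 0) := rfl

/-- The projection of `E` to the 2-forms. -/
def projTwo (n : ℕ) : EMod n →ₗ[ℝ] Form n 2 :=
  (LinearMap.fst ℝ (Form n 2) (Form n 5)).comp (LinearMap.snd ℝ (T n) (Form n 2 × Form n 5))

/-- The projection of `E` to the 5-forms. -/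
def projFive (n : ℕ) : EMod n →ₗ[ℝ] Form n 5 :=
  (LinearMap.snd ℝ (Form n 2) (Form n 5)).comp (LinearMap.snd ℝ (T n) (Form n 2 × Form n 5))

theorem projTwo_apply (u : EMod n) : projTwo n u = u.2.1 := rfl
theorem projFive_apply (u : EMod n) : projFive n u = u.2.2 := rfl

/-- On σ ∧ τ, D is minus the symmetrised G(σ, τ), and the scalars c(σ), c(τ) in its 2-form part are
zero. -/
theorem IsPointTwist.D_four_two (h : IsPointTwist G D) (hG : HasComponents G c a₃ a₆)
    (k : Form n 4) : (D (0, k, 0)).2.1 = 0 := by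
  have : (projTwo n).comp (D.comp (inclFour n)) = 0 := by
    refine eq_zero_of_wd_two fun σ τ => ?_
    have h1 := h.symm (0, σ, 0) (0, τ, 0)
    rw [prodN_two_two, ← inclFour_apply, map_neg, map_neg, hG.apply_two, hG.apply_two,
      h.comp_two hG, h.comp_two hG] at h1
    have h2 := congrArg (projTwo n) h1
    rw [map_neg] at h2
    refine neg_eq_zero.1 (h2.symm.trans ?_)
    simp [projTwo_apply]
  exact LinearMap.congr_fun this k

theorem IsPointTwist.three_five (h : IsPointTwist G D) (hG : HasComponents G c a₃ a₆)
    (s : Form n 5) : a₃ (0, 0, s) = 0 := by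
  refine form_ext_ins fun X => ?_
  have h1 := h.symm (X, 0, 0) (0, 0, s)
  rw [prodN_T_five, hG.apply_five, hG.apply_T] at h1
  have h2 := congrArg (projTwo n) h1
  rw [projTwo_apply, projTwo_apply, h.D_four_two hG] at h2
  simpa [ins_zero_right] using h2

/-- The symmetry axiom for X and σ says that γ(X)σ + i_X a₃(σ) depends only on i_X σ. Adding γ ∧ σ
to a₃(σ) absorbs the first term up to γ ∧ i_X σ, so the sum satisfies the hypothesis of
`eq_zero_of_ins_eq`. -/
theorem IsPointTwist.three_two (h : IsPointTwist G D) (hG : HasComponents G c a₃ a₆)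
    {γ : T n →L[ℝ] ℝ} (hγ : ∀ X, c (X, 0, 0) = γ X) (σ : Form n 2) :
    a₃ (0, σ, 0) = -ext1 γ σ := by
  have h1 := (eq_zero_of_ins_eq (k := 0)
    (Q := (projTwo n).comp (D.comp (LinearMap.inl ℝ (Form n 1) _)) - ext1L n 1 γ)
    (t := a₃.comp (inclTwo n) + ext1L n 2 γ) fun X σ => ?_).1
  · have := LinearMap.congr_fun h1 σ
    exact eq_neg_of_add_eq_zero_left this
  · have h1 := h.symm (X, 0, 0) (0, σ, 0)
    rw [prodN_T_two, hG.apply_two, hG.apply_T, hγ] at h1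
    have h2 := congrArg (projTwo n) h1
    have h3 : γ X • σ + ins X (a₃ (0, σ, 0)) = (D (ins X σ, 0, 0)).2.1 := h2
    show ins X (a₃ (0, σ, 0) + ext1 γ σ) = (D (ins X σ, 0, 0)).2.1 - ext1 γ (ins X σ)
    rw [ins_add_right, ins_ext1, ← h3]
    abel

theorem IsPointTwist.exists_four (h : IsPointTwist G D) (hG : HasComponents G c a₃ a₆) :
    ∃ F : Form n 4, ∀ X, a₃ (X, 0, 0) = ins X F :=
  exists_eq_ins (f := a₃.comp (LinearMap.inl ℝ (T n) (Form n 2 × Form n 5))) fun X Y => by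
    have h1 := h.exists_ins X Y
    rw [hG.apply_T, hG.apply_T] at h1
    exact congrArg (projTwo n) h1

/-- Skewness in two vectors would make this part the contraction of a 7-form. -/
theorem IsPointTwist.six_T (h : IsPointTwist G D) (hG : HasComponents G c a₃ a₆) (hn : n ≤ 6)
    (X : T n) : a₆ (X, 0, 0) = 0 := by
  obtain ⟨F, hF⟩ : ∃ F : Form n 7, ∀ X, a₆ (X, 0, 0) = ins X F :=
    exists_eq_ins (f := a₆.comp (LinearMap.inl ℝ (T n) (Form n 2 × Form n 5))) fun X Y => by
      have h1 := h.exists_ins X Y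
      rw [hG.apply_T, hG.apply_T] at h1
      exact congrArg (projFive n) h1
  rw [hF, ins_eq_zero _ (form_eq_zero_of_lt (by omega) _)]

theorem eq_zero_of_ins {W : Type*} [AddCommGroup W] [Module ℝ W] {f : Form n 1 →ₗ[ℝ] W}
    (hn : 2 ≤ n) (h : ∀ X σ, f (ins X σ) = 0) : f = 0 := by
  refine LinearMap.ext fun β => ?_
  rw [form_one_eq_sum β, map_sum, LinearMap.zero_apply]
  refine Finset.sum_eq_zero fun i _ => ?_
  obtain ⟨j, hj⟩ : ∃ j : Fin n, j ≠ i :=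
    haveI : Nontrivial (Fin n) := Fin.nontrivial_iff_two_le.2 hn
    exists_ne i
  rw [map_smul, ← ins_ext1_covec hj.symm, h, smul_zero]

/-- With c and a₃ gone, D vanishes on 4-forms; the symmetry axiom then removes a₆ on 2-forms by
`eq_zero_of_ins_eq` and on 5-forms through D. Finally G = 0 forces D = 0, as products span N. -/
theorem IsPointTwist.eq_zero (h : IsPointTwist G D) (hG : HasComponents G c a₃ a₆) (hn : 2 ≤ n)
    (hn' : n ≤ 6) (hc : ∀ X, c (X, 0, 0) = 0) (hF : ∀ X, a₃ (X, 0, 0) = 0) : G = 0 ∧ D = 0 := by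
  have hc0 : c = 0 := LinearMap.ext fun u => by rw [h.comp_eq hG, hc, LinearMap.zero_apply]
  have h32 := fun σ => h.three_two hG (γ := 0) hc σ
  have ha3 : a₃ = 0 := by
    refine LinearMap.ext fun u => ?_
    rw [EMod.eq_add u, map_add, map_add, hF, h32, h.three_five hG, ← ext1L_apply, map_zero]
    simp
  subst hc0 ha3
  have h1 := eq_zero_of_ins_eq (k := 3)
    (Q := (projFive n).comp (D.comp (LinearMap.inl ℝ (Form n 1) _))) (t := a₆.comp (inclTwo n))
    fun X σ => by
      have h1 := h.symm (X, 0, 0) (0, σ, 0)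
      rw [prodN_T_two, hG.apply_two, hG.apply_T] at h1
      have h2 := congrArg (projFive n) h1
      have h3 : (wd (rfl : 3 + 2 = 5) ((0 : EMod n →ₗ[ℝ] Form n 3) (X, 0, 0)) σ)
        + ins X (a₆ (0, σ, 0)) = (D (ins X σ, 0, 0)).2.2 := h2
      rw [LinearMap.zero_apply, map_zero, LinearMap.zero_apply, zero_add] at h3
      exact h3
  have hD4 : D.comp (inclFour n) = 0 := by
    refine eq_zero_of_wd_two fun σ τ => ?_
    have h1 := h.symm (0, σ, 0) (0, τ, 0)
    rw [prodN_two_two, ← inclFour_apply, map_neg, map_neg, hG.apply_two, hG.apply_two] at h1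
    refine neg_eq_zero.1 (h1.symm.trans ?_)
    simp
  have ha65 : ∀ s, a₆ (0, 0, s) = 0 := by
    intro s
    refine form_ext_ins fun X => ?_
    have h1 := h.symm (X, 0, 0) (0, 0, s)
    rw [prodN_T_five, hG.apply_five, hG.apply_T, ← inclFour_apply, ← LinearMap.comp_apply, hD4] at h1
    have h2 := congrArg (projFive n) h1
    simpa [projFive_apply, ins_zero_right] using h2
  have ha6 : a₆ = 0 := by
    refine LinearMap.ext fun u => ?_
    rw [EMod.eq_add u, map_add, map_add, h.six_T hG hn', ha65,
      show a₆ (0, u.2.1, 0) = 0 from LinearMap.congr_fun h1.1 u.2.1]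
    simp
  subst ha6
  have hG0 : G = 0 := by
    refine LinearMap.ext fun u => LinearMap.ext fun v => ?_
    rw [hG]
    simp [ins_zero_right]
  subst hG0
  refine ⟨rfl, ?_⟩
  have hD : ∀ u v, D (prodN u v) = 0 := fun u v => by rw [← h.symm]; simp
  have h7 : D.comp ((LinearMap.inr ℝ (Form n 1) (Form n 4 × (T n →L[ℝ] Form n 6))).comp
      (LinearMap.inr ℝ (Form n 4) (T n →L[ℝ] Form n 6))) = 0 :=
    eq_zero_of_jWedge hn hn' fun σ s => by
      rw [← hD (0, σ, 0) (0, 0, s), prodN_two_five]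
      rfl
  have h8 : D.comp (LinearMap.inl ℝ (Form n 1) (Form n 4 × (T n →L[ℝ] Form n 6))) = 0 := by
    refine eq_zero_of_ins hn fun X σ => ?_
    have h1 := hD (X, 0, 0) (0, σ, 0)
    rw [prodN_T_two] at h1
    exact h1
  refine LinearMap.ext fun k => ?_
  have hk : k = LinearMap.inl ℝ (Form n 1) (Form n 4 × (T n →L[ℝ] Form n 6)) k.1
      + inclFour n k.2.1 + (LinearMap.inr ℝ (Form n 1) (Form n 4 × (T n →L[ℝ] Form n 6))).comp
      (LinearMap.inr ℝ (Form n 4) (T n →L[ℝ] Form n 6)) k.2.2 := by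
    refine Prod.ext ?_ (Prod.ext ?_ ?_) <;> simp [inclFour_apply]
  rw [hk, map_add, map_add]
  have e1 := LinearMap.congr_fun h8 k.1
  have e2 := LinearMap.congr_fun hD4 k.2.1
  have e3 := LinearMap.congr_fun h7 k.2.2
  rw [LinearMap.comp_apply] at e1 e2 e3
  rw [e1, e2, e3]
  simp

/-- The 2-form components of the bracket at a point are given by a covector `γ` and a 4-form `F`, and
everything vanishes if these do. -/
theorem IsPointTwist.exists_connection (h : IsPointTwist G D) (hn : 2 ≤ n) (hn' : n ≤ 6) :
    ∃ (γ : T n →L[ℝ] ℝ) (F : Form n 4), (∀ u v, (G u v).2.1 = γ u.1 • v.2.1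
      + ins v.1 (ins u.1 F - ext1 γ u.2.1)) ∧ (γ = 0 → F = 0 → G = 0 ∧ D = 0) := by
  obtain ⟨c, a₃, a₆, hG⟩ := h.exists_components hn
  obtain ⟨F, hF⟩ := h.exists_four hG
  let γ : T n →L[ℝ] ℝ :=
    LinearMap.toContinuousLinearMap (c.comp (LinearMap.inl ℝ (T n) (Form n 2 × Form n 5)))
  have hγ : ∀ X, c (X, 0, 0) = γ X := fun X => rfl
  refine ⟨γ, F, fun u v => ?_, fun h1 h2 => ?_⟩
  · rw [hG, h.comp_eq hG, hγ, EMod.eq_add u, map_add, map_add, hF, h.three_two hG hγ,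
      h.three_five hG]
    simp [sub_eq_add_neg]
  · refine h.eq_zero hG hn hn' (fun X => by rw [hγ, h1]; rfl) fun X => by
      rw [hF, h2, ins_zero_right]

end

/-! ### Poincaré lemmas -/

section

section

variable {E : Type} [NormedAddCommGroup E] [NormedSpace ℝ E] [FiniteDimensional ℝ E]

theorem hasFDerivAt_intervalIntegral {W : Type*} [NormedAddCommGroup W] [NormedSpace ℝ W]
    {f : E × ℝ → W} (hf : ContDiff ℝ 1 f) (x : E) :
    HasFDerivAt (fun x => ∫ t in (0 : ℝ)..1, f (x, t))
      (∫ t in (0 : ℝ)..1, (fderiv ℝ f (x, t)).comp (ContinuousLinearMap.inl ℝ E ℝ)) x := by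
  have : ProperSpace E := FiniteDimensional.proper_real E
  have hc : Continuous fun p : E × ℝ => (fderiv ℝ f p).comp (ContinuousLinearMap.inl ℝ E ℝ) :=
    (hf.continuous_fderiv one_ne_zero).clm_comp continuous_const
  obtain ⟨C, hC⟩ := ((isCompact_closedBall x 1).prod (isCompact_uIcc (a := (0 : ℝ)) (b := 1))
    ).exists_bound_of_continuousOn hc.continuousOn
  refine intervalIntegral.hasFDerivAt_integral_of_dominated_of_fderiv_le
    (F := fun x t => f (x, t)) (bound := fun _ => C)
    (F' := fun x t => (fderiv ℝ f (x, t)).comp (ContinuousLinearMap.inl ℝ E ℝ))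
    (Metric.closedBall_mem_nhds x one_pos) ?_ ?_ ?_ ?_ ?_ ?_
  · exact Filter.Eventually.of_forall fun y =>
      (hf.continuous.comp (by fun_prop : Continuous fun t : ℝ => (y, t))).aestronglyMeasurable
  · exact (hf.continuous.comp (by fun_prop : Continuous fun t : ℝ => (x, t))).intervalIntegrable _ _
  · exact (hc.comp (by fun_prop : Continuous fun t : ℝ => (x, t))).aestronglyMeasurable
  · exact Filter.Eventually.of_forall fun t ht y hy =>
      hC (y, t) ⟨hy, Set.uIoc_subset_uIcc ht⟩
  · exact intervalIntegrable_const
  · refine Filter.Eventually.of_forall fun t _ y _ => ?_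
    have h1 : HasFDerivAt f (fderiv ℝ f (y, t)) (y, t) :=
      (hf.differentiable one_ne_zero _).hasFDerivAt
    exact h1.comp y (hasFDerivAt_prodMk_left y t)

/-- Induction on the order, over all target spaces at once: the derivative is again an integral of a
smooth function, with values in a space of linear maps. -/
theorem contDiff_intervalIntegral {W : Type} [NormedAddCommGroup W] [NormedSpace ℝ W]
    {f : E × ℝ → W} (hf : ContDiff ℝ ∞ f) :
    ContDiff ℝ ∞ (fun x => ∫ t in (0 : ℝ)..1, f (x, t)) := by
  rw [contDiff_infty]
  intro k
  induction k generalizing W with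
  | zero =>
    rw [Nat.cast_zero, contDiff_zero]
    exact intervalIntegral.continuous_parametric_intervalIntegral_of_continuous'
      (f := fun x t => f (x, t)) hf.continuous _ _
  | succ k ih =>
    rw [Nat.cast_succ, contDiff_succ_iff_fderiv]
    have h1 := fun x => hasFDerivAt_intervalIntegral (hf.of_le (by simp)) x
    refine ⟨fun x => (h1 x).differentiableAt, by simp, ?_⟩
    have h2 := ih (f := fun p => (fderiv ℝ f p).comp (ContinuousLinearMap.inl ℝ E ℝ))
      ((hf.fderiv_right (by simp)).clm_comp contDiff_const)
    rwa [show fderiv ℝ (fun x => ∫ t in (0 : ℝ)..1, f (x, t)) = _ from funext fun x => (h1 x).fderiv]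

end

variable {n : ℕ}

theorem extDeriv_eq_sum {k : ℕ} (σ : T n → Form n k) (y : T n) :
    extDeriv σ y = ∑ i, ext1 (EuclideanSpace.proj i) (fderiv ℝ σ y (vec i)) :=
  alternatizeUncurryFin_eq_sum _

/-- The integrand of the homotopy operator. -/
def homotopyIntegrand {k : ℕ} (q : T n) (F : T n → Form n (k + 1)) (p : T n × ℝ) : Form n k :=
  p.2 ^ k • ins (p.1 - q) (F (q + p.2 • (p.1 - q)))

/-- `ins` as a bilinear continuous map. -/
def insC (n k : ℕ) : T n →L[ℝ] Form n (k + 1) →L[ℝ] Form n k :=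
  LinearMap.toContinuousLinearMap
    ((LinearMap.toContinuousLinearMap : (Form n (k + 1) →ₗ[ℝ] Form n k) ≃ₗ[ℝ] _).toLinearMap.comp
      (insL n k))

theorem insC_apply {k : ℕ} (X : T n) (σ : Form n (k + 1)) : insC n k X σ = ins X σ := rfl

theorem contDiff_homotopyIntegrand {k : ℕ} (q : T n) {F : T n → Form n (k + 1)}
    (hF : ContDiff ℝ ∞ F) : ContDiff ℝ ∞ (homotopyIntegrand q F) := by
  have h1 : ContDiff ℝ ∞ fun p : T n × ℝ => insC n k (p.1 - q) :=
    (insC n k).contDiff.comp (contDiff_fst.sub contDiff_const)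
  have h2 : ContDiff ℝ ∞ fun p : T n × ℝ => F (q + p.2 • (p.1 - q)) :=
    hF.comp (contDiff_const.add (contDiff_snd.smul (contDiff_fst.sub contDiff_const)))
  exact (contDiff_snd.pow k).smul (h1.clm_apply h2)

theorem fderiv_homotopyIntegrand {k : ℕ} (q : T n) {F : T n → Form n (k + 1)}
    (hF : ContDiff ℝ ∞ F) (y X : T n) (t : ℝ) :
    fderiv ℝ (homotopyIntegrand q F) (y, t) (X, 0)
      = t ^ k • ins X (F (q + t • (y - q)))
        + t ^ (k + 1) • ins (y - q) (fderiv ℝ F (q + t • (y - q)) X) := by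
  have h0 : HasFDerivAt (fun x : T n => (x, t)) (ContinuousLinearMap.inl ℝ (T n) ℝ) y :=
    hasFDerivAt_prodMk_left y t
  have h1 : HasFDerivAt (homotopyIntegrand q F) (fderiv ℝ (homotopyIntegrand q F) (y, t)) (y, t) :=
    ((contDiff_homotopyIntegrand q hF).differentiable (by simp) _).hasFDerivAt
  have h2 := (h1.comp y h0).fderiv
  have h3 : HasFDerivAt (fun x : T n => q + t • (x - q)) (t • ContinuousLinearMap.id ℝ (T n)) y :=
    (((hasFDerivAt_id y).sub_const q).const_smul t).const_add q
  have h4 : HasFDerivAt F (fderiv ℝ F (q + t • (y - q))) (q + t • (y - q)) :=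
    (hF.differentiable (by simp) _).hasFDerivAt
  have h5 := ((insC n k).hasFDerivAt_of_bilinear ((hasFDerivAt_id y).sub_const q)
    (h4.comp y h3)).const_smul (t ^ k)
  have h6 := congrArg (· X) (h2.symm.trans h5.fderiv)
  refine h6.trans ?_
  show t ^ k • (ins (y - q) (fderiv ℝ F (q + t • (y - q)) (t • X)) + ins X (F (q + t • (y - q)))) = _
  rw [map_smul, ins_smul_right, smul_add, smul_smul, pow_succ, add_comm]

theorem sum_proj_smul {W : Type*} [NormedAddCommGroup W] [NormedSpace ℝ W] (L : T n →L[ℝ] W)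
    (X : T n) : ∑ i, (EuclideanSpace.proj i : T n →L[ℝ] ℝ) X • L (vec i) = L X := by
  have hX : X = ∑ i, (EuclideanSpace.proj i : T n →L[ℝ] ℝ) X • (vec i : T n) := by
    ext j
    simp [vec, Pi.single_apply]
  conv_rhs => rw [hX, map_sum]
  exact Finset.sum_congr rfl fun i _ => (map_smul _ _ _).symm

/-- The Poincaré lemma. -/
theorem extDeriv_homotopy {k : ℕ} (q : T n) {F : T n → Form n (k + 1)}
    (hF : ContDiff ℝ ∞ F) {y : T n} (hd : ∀ t ∈ Set.Icc (0 : ℝ) 1, extDeriv F (q + t • (y - q)) = 0) :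
    extDeriv (fun x => ∫ t in (0 : ℝ)..1, homotopyIntegrand q F (x, t)) y = F y := by
  have hs := contDiff_homotopyIntegrand q hF
  have hs1 : ContDiff ℝ 1 (homotopyIntegrand q F) := hs.of_le (by simp)
  have hcont : Continuous fun t : ℝ =>
      (fderiv ℝ (homotopyIntegrand q F) (y, t)).comp (ContinuousLinearMap.inl ℝ (T n) ℝ) :=
    ((hs1.continuous_fderiv one_ne_zero).comp
      (by fun_prop : Continuous fun t : ℝ => (y, t))).clm_comp continuous_const
  rw [extDeriv, (hasFDerivAt_intervalIntegral hs1 y).fderiv]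
  have h1 := (ContinuousAlternatingMap.alternatizeUncurryFinCLM ℝ (T n) ℝ (n := k)
    ).intervalIntegral_comp_comm (hcont.intervalIntegrable (μ := MeasureTheory.volume) 0 1)
  rw [ContinuousAlternatingMap.alternatizeUncurryFinCLM_apply] at h1
  rw [← h1]
  -- Cartan's formula along the ray: as dF vanishes there, the exterior derivative of the integrand
  -- is the t-derivative of t^(k+1) F(q + t(y - q)), and the integral telescopes to F(y).
  have h2 : ∀ t ∈ Set.uIcc (0 : ℝ) 1, HasDerivAt (fun t : ℝ => t ^ (k + 1) • F (q + t • (y - q)))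
      (ContinuousAlternatingMap.alternatizeUncurryFinCLM ℝ (T n) ℝ
        ((fderiv ℝ (homotopyIntegrand q F) (y, t)).comp (ContinuousLinearMap.inl ℝ (T n) ℝ))) t := by
    intro t ht
    have ht' : t ∈ Set.Icc (0 : ℝ) 1 := by rwa [Set.uIcc_of_le zero_le_one] at ht
    have h3 : HasFDerivAt F (fderiv ℝ F (q + t • (y - q))) (q + t • (y - q)) :=
      (hF.differentiable (by simp) _).hasFDerivAt
    have h4 : HasDerivAt (fun t : ℝ => q + t • (y - q)) (y - q) t := by
      simpa using ((hasDerivAt_id t).smul_const (y - q)).const_add q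
    have h5 := (hasDerivAt_pow (k + 1) t).smul (h3.comp_hasDerivAt t h4)
    refine h5.congr_deriv ?_
    rw [ContinuousAlternatingMap.alternatizeUncurryFinCLM_apply, alternatizeUncurryFin_eq_sum]
    have h6 : ∀ i : Fin n, ((fderiv ℝ (homotopyIntegrand q F) (y, t)).comp
        (ContinuousLinearMap.inl ℝ (T n) ℝ)) (vec i) = t ^ k • ins (vec i) (F (q + t • (y - q)))
        + t ^ (k + 1) • ins (y - q) (fderiv ℝ F (q + t • (y - q)) (vec i)) := fun i =>
      fderiv_homotopyIntegrand q hF y (vec i) t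
    have h7 := congrArg (ins (y - q)) (hd t ht')
    rw [extDeriv_eq_sum, ← insL_apply, map_sum, ins_zero_right] at h7
    simp only [insL_apply, ins_ext1, Finset.sum_sub_distrib] at h7
    rw [sum_proj_smul, sub_eq_zero] at h7
    simp only [h6, ← ext1L_apply, map_add, map_smul, Finset.sum_add_distrib, ← Finset.smul_sum]
    simp only [ext1L_apply]
    rw [sum_ext1_ins, ← h7]
    simp only [Function.comp_apply, Nat.cast_add, Nat.cast_one, add_tsub_cancel_right]
    rw [smul_smul, mul_comm (t ^ k)]
    abel
  have h9 := intervalIntegral.integral_eq_sub_of_hasDerivAt h2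
    (((ContinuousLinearMap.continuous _).comp hcont).intervalIntegrable (μ := MeasureTheory.volume) 0 1)
  rw [h9]
  simp

/-- A cutoff makes F globally smooth, so that integrals depending on a parameter can be
differentiated without domain conditions. -/
theorem exists_contDiff_eq_on_ball {W : Type*} [NormedAddCommGroup W] [NormedSpace ℝ W]
    {V : Set (T n)} (hV : IsOpen V) {q : T n} (hq : q ∈ V) {F : T n → W} (hF : ContDiffOn ℝ ∞ F V) :
    ∃ r > 0, Metric.ball q r ⊆ V ∧ ∃ F' : T n → W, ContDiff ℝ ∞ F' ∧
      ∀ y ∈ Metric.ball q r, F' y = F y := by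
  obtain ⟨ε, hε, hεV⟩ := Metric.isOpen_iff.1 hV q hq
  let f : ContDiffBump q := ⟨ε / 4, ε / 2, by positivity, by linarith⟩
  have hf : tsupport f ⊆ V := by
    rw [f.tsupport_eq]
    exact (Metric.closedBall_subset_ball (half_lt_self hε)).trans hεV
  refine ⟨ε / 4, by positivity, (Metric.ball_subset_ball (by linarith)).trans hεV,
    fun y => f y • F y, contDiff_iff_contDiffAt.2 fun y => ?_, fun y hy => ?_⟩
  · by_cases hy : y ∈ V
    · exact f.contDiffAt.smul (hF.contDiffAt (hV.mem_nhds hy))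
    · have : (fun y => f y • F y) =ᶠ[𝓝 y] fun _ => 0 := by
        filter_upwards [(isClosed_tsupport f).isOpen_compl.mem_nhds fun h => hy (hf h)] with z hz
        rw [image_eq_zero_of_notMem_tsupport hz, zero_smul]
      exact contDiffAt_const.congr_of_eventuallyEq this
  · show f y • F y = F y
    rw [f.one_of_mem_closedBall (Metric.ball_subset_closedBall hy), one_smul]

/-- The ball is star-shaped about q, so the homotopy formula uses the cutoff form only where it
agrees with F and is closed. -/
theorem exists_extDeriv_eq {k : ℕ} {V : Set (T n)} (hV : IsOpen V) {q : T n} (hq : q ∈ V)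
    {F : T n → Form n (k + 1)} (hF : ContDiffOn ℝ ∞ F V) (hd : ∀ y ∈ V, extDeriv F y = 0) :
    ∃ r > 0, Metric.ball q r ⊆ V ∧ ∃ C : T n → Form n k, ContDiff ℝ ∞ C ∧
      ∀ y ∈ Metric.ball q r, extDeriv C y = F y := by
  obtain ⟨r, hr, hrV, F', hF', he⟩ := exists_contDiff_eq_on_ball hV hq hF
  refine ⟨r, hr, hrV, fun x => ∫ t in (0 : ℝ)..1, homotopyIntegrand q F' (x, t),
    contDiff_intervalIntegral (contDiff_homotopyIntegrand q hF'), fun y hy => ?_⟩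
  rw [extDeriv_homotopy q hF', he y hy]
  intro t ht
  have hz : q + t • (y - q) ∈ Metric.ball q r := by
    rw [Metric.mem_ball, dist_eq_norm] at hy ⊢
    rw [add_sub_cancel_left, norm_smul, Real.norm_of_nonneg ht.1]
    exact (mul_le_of_le_one_left (norm_nonneg _) ht.2).trans_lt hy
  have h1 : F' =ᶠ[𝓝 (q + t • (y - q))] F := by
    filter_upwards [Metric.isOpen_ball.mem_nhds hz] with z hz
    exact he z hz
  rw [h1.extDeriv_eq, hd _ (hrV hz)]

theorem exists_fderiv_eq {V : Set (T n)} (hV : IsOpen V) {q : T n} (hq : q ∈ V)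
    {γ : T n → T n →L[ℝ] ℝ} (hγ : ContDiffOn ℝ ∞ γ V)
    (hd : ∀ y ∈ V, ∀ X Y, fderiv ℝ γ y X Y = fderiv ℝ γ y Y X) :
    ∃ r > 0, Metric.ball q r ⊆ V ∧ ∃ f : T n → ℝ, ContDiffOn ℝ ∞ f (Metric.ball q r) ∧
      ∀ y ∈ Metric.ball q r, HasFDerivAt f (γ y) y := by
  obtain ⟨r, hr, hrV⟩ := Metric.isOpen_iff.1 hV q hq
  obtain ⟨f, hf⟩ := (convex_ball q r).exists_forall_hasFDerivAt_of_fderiv_symmetric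
    Metric.isOpen_ball ((hγ.mono hrV).differentiableOn (by simp)) fun y hy => hd y (hrV hy)
  refine ⟨r, hr, hrV, f, ?_, hf⟩
  rw [contDiffOn_infty_iff_fderiv_of_isOpen Metric.isOpen_ball]
  exact ⟨fun y hy => (hf y hy).differentiableAt.differentiableWithinAt,
    (hγ.mono hrV).congr fun y hy => (hf y hy).fderiv⟩

end

/-! ### Closedness of the connection, and its change under a change of frame -/

section

attribute [local irreducible] ins wd wedge prodN prodE

variable {n : ℕ} {V : Set (T n)} {Γ : T n → EMod n →ₗ[ℝ] EMod n →ₗ[ℝ] EMod n}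
  {Δ : T n → NMod n →ₗ[ℝ] EMod n}

theorem IsTwist.isPointTwist (h : IsTwist V Γ Δ) {y : T n} (hy : y ∈ V) :
    IsPointTwist (Γ y) (Δ y) :=
  ⟨h.mem y hy, h.fst y hy, h.symm y hy⟩

/-- The 2-form components of `Γ` are given by the covectors `γ` and the 4-forms `F`. -/
structure IsConnection (V : Set (T n)) (Γ : T n → EMod n →ₗ[ℝ] EMod n →ₗ[ℝ] EMod n)
    (γ : T n → T n →L[ℝ] ℝ) (F : T n → Form n 4) : Prop where
  smooth_one : ContDiffOn ℝ ∞ γ V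
  smooth_four : ContDiffOn ℝ ∞ F V
  two : ∀ y ∈ V, ∀ u v, (Γ y u v).2.1 = γ y u.1 • v.2.1 + ins v.1 (ins u.1 (F y) - ext1 (γ y) u.2.1)

/-- The projection of `E` to the 2-forms. -/
def projTwoC (n : ℕ) : EMod n →L[ℝ] Form n 2 :=
  (ContinuousLinearMap.fst ℝ (Form n 2) (Form n 5)).comp
    (ContinuousLinearMap.snd ℝ (T n) (Form n 2 × Form n 5))

theorem IsTwist.exists_isConnection (h : IsTwist V Γ Δ) (hn : 2 ≤ n) (hn' : n ≤ 6) :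
    ∃ γ F, IsConnection V Γ γ F ∧ ∀ y ∈ V, γ y = 0 → F y = 0 → Γ y = 0 ∧ Δ y = 0 := by
  classical
  have key : ∀ y, ∃ (γ : T n →L[ℝ] ℝ) (F : Form n 4), y ∈ V → (∀ u v, (Γ y u v).2.1 = γ u.1 • v.2.1
      + ins v.1 (ins u.1 F - ext1 γ u.2.1)) ∧ (γ = 0 → F = 0 → Γ y = 0 ∧ Δ y = 0) := by
    intro y
    by_cases hy : y ∈ V
    · obtain ⟨γ, F, h'⟩ := (h.isPointTwist hy).exists_connection hn hn'
      exact ⟨γ, F, fun _ => h'⟩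
    · exact ⟨0, 0, fun hy' => absurd hy' hy⟩
  choose γ F h' using key
  have h2 : ∀ a b, ContDiffOn ℝ ∞ (fun y => (Γ y a b).2.1) V := fun a b =>
    (projTwoC n).contDiff.comp_contDiffOn (h.smooth a b)
  obtain ⟨σ, w, hσ⟩ := exists_form_two_apply_eq_one hn
  refine ⟨γ, F, ⟨?_, ?_, fun y hy => (h' y hy).1⟩, fun y hy => (h' y hy).2⟩
  · rw [contDiffOn_clm_apply]
    intro X
    refine ((LinearMap.toContinuousLinearMap (formEval w)).contDiff.comp_contDiffOn
      (h2 (X, 0, 0) (0, σ, 0))).congr fun y hy => ?_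
    show _ = (Γ y (X, 0, 0) (0, σ, 0)).2.1 w
    rw [(h' y hy).1]
    dsimp only
    rw [ins_zero_left, add_zero, ContinuousAlternatingMap.smul_apply, hσ, smul_eq_mul, mul_one]
  -- Two applications of Euler's identity, in degrees four and three, recover F from its double
  -- contractions, which are the brackets of coordinate vectors.
  · have hF : ∀ y ∈ V, F y = ∑ i, ∑ j, (((3 : ℕ) : ℝ) + 1)⁻¹ • (((2 : ℕ) : ℝ) + 1)⁻¹ •
        ext1L n 3 (EuclideanSpace.proj i) (ext1L n 2 (EuclideanSpace.proj j)
          (Γ y (vec i, 0, 0) (vec j, 0, 0)).2.1) := by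
      intro y hy
      conv_lhs => rw [form_eq_sum_ext1 (F y), Finset.smul_sum]
      refine Finset.sum_congr rfl fun i _ => ?_
      conv_lhs => rw [form_eq_sum_ext1 (ins (vec i) (F y))]
      rw [← ext1L_apply, map_smul, map_sum, Finset.smul_sum, Finset.smul_sum]
      refine Finset.sum_congr rfl fun j _ => ?_
      rw [(h' y hy).1]
      dsimp only
      rw [smul_zero, zero_add, ← ext1L_apply, ← ext1L_apply (γ y), map_zero, sub_zero]
    refine ContDiffOn.congr ?_ hF
    refine ContDiffOn.sum fun i _ => ContDiffOn.sum fun j _ => ?_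
    exact ((((LinearMap.toContinuousLinearMap (ext1L n 3 (EuclideanSpace.proj i))).comp
      (LinearMap.toContinuousLinearMap (ext1L n 2 (EuclideanSpace.proj j)))).contDiff.comp_contDiffOn
        (h2 _ _)).const_smul _).const_smul _

theorem twistedBracket_two (u v : T n → EMod n) (y : T n) :
    (twistedBracket Γ u v y).2.1 = (fderiv ℝ v y (u y).1).2.1 - (fderiv ℝ u y (v y).1).2.1
      + ∑ j, ext1 (EuclideanSpace.proj j) (ins (fderiv ℝ u y (vec j)).1 (v y).2.1
        + ins (v y).1 (fderiv ℝ u y (vec j)).2.1) + (Γ y (u y) (v y)).2.1 := by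
  rw [twistedBracket]
  simp only [Prod.snd_add, Prod.fst_add, Prod.snd_sub, Prod.fst_sub, Prod.snd_sum, Prod.fst_sum,
    prodT_eq_ext1, prodN_eq]

theorem fderiv_two {u : T n → EMod n} {y : T n} (hu : DifferentiableAt ℝ u y) (X : T n) :
    (fderiv ℝ u y X).2.1 = fderiv ℝ (fun z => (u z).2.1) y X :=
  congrArg (· X) ((projTwoC n).hasFDerivAt.comp y hu.hasFDerivAt).fderiv.symm

theorem fderiv_fst {u : T n → EMod n} {y : T n} (hu : DifferentiableAt ℝ u y) (X : T n) :
    (fderiv ℝ u y X).1 = fderiv ℝ (fun z => (u z).1) y X :=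
  congrArg (· X) ((ContinuousLinearMap.fst ℝ (T n) (Form n 2 × Form n 5)).hasFDerivAt.comp y
    hu.hasFDerivAt).fderiv.symm

theorem ext1_zero {k : ℕ} (β : T n →L[ℝ] ℝ) : ext1 β (0 : Form n k) = 0 := map_zero (ext1L n k β)

theorem zero_ext1 {k : ℕ} (σ : Form n k) : ext1 (0 : T n →L[ℝ] ℝ) σ = 0 := by
  rw [← ext1L_apply, map_zero, LinearMap.zero_apply]

section

variable {γ : T n → T n →L[ℝ] ℝ} {F : T n → Form n 4}

theorem IsTwist.differentiableAt (h : IsTwist V Γ Δ) (hV : IsOpen V) {y : T n} (hy : y ∈ V)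
    (a b : EMod n) : DifferentiableAt ℝ (fun z => Γ z a b) y :=
  ((h.smooth a b).contDiffAt (hV.mem_nhds hy)).differentiableAt (by simp)

theorem IsTwist.fderiv_fst (h : IsTwist V Γ Δ) (hV : IsOpen V) {y : T n} (hy : y ∈ V)
    (a b : EMod n) (X : T n) : (fderiv ℝ (fun z => Γ z a b) y X).1 = 0 := by
  rw [Elg.fderiv_fst (h.differentiableAt hV hy a b)]
  have : (fun z => (Γ z a b).1) =ᶠ[𝓝 y] fun _ => 0 := by
    filter_upwards [hV.mem_nhds hy] with z hz
    exact h.fst z hz a b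
  rw [this.fderiv_eq]
  simp

/-- The 2-form part of the Jacobi identity for X, Y, σ: the products γ(X)γ(Y) cancel and Γ(X, Y)
does not act on σ in this degree, so only dγ(X, Y)σ is left. -/
theorem IsTwist.fderiv_symm (h : IsTwist V Γ Δ) (hV : IsOpen V) (hn : 2 ≤ n)
    (hc : IsConnection V Γ γ F) {y : T n} (hy : y ∈ V) (X Y : T n) :
    fderiv ℝ γ y X Y = fderiv ℝ γ y Y X := by
  obtain ⟨σ, w, hσ⟩ := exists_form_two_apply_eq_one hn
  have hγ : DifferentiableAt ℝ γ y := (hc.smooth_one.contDiffAt (hV.mem_nhds hy)).differentiableAt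
    (by simp)
  have h1 : ∀ X Y : T n, (fderiv ℝ (fun z => Γ z (Y, 0, 0) (0, σ, 0)) y X).2.1
      = fderiv ℝ γ y X Y • σ := by
    intro X Y
    rw [fderiv_two (h.differentiableAt hV hy _ _)]
    have e : (fun z => (Γ z (Y, 0, 0) (0, σ, 0)).2.1) =ᶠ[𝓝 y] fun z => γ z Y • σ := by
      filter_upwards [hV.mem_nhds hy] with z hz
      rw [hc.two z hz]
      dsimp only
      rw [ins_zero_left, add_zero]
    rw [e.fderiv_eq]
    rw [((hγ.hasFDerivAt.clm_apply (hasFDerivAt_const Y y)).smul_const σ).fderiv]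
    simp
  have h2 := congrArg (fun u : EMod n => u.2.1 w) (h.jacobi y hy (X, 0, 0) (Y, 0, 0) (0, σ, 0))
  simp only [Prod.snd_add, Prod.fst_add, twistedBracket_two, h1, h.fderiv_fst hV hy] at h2
  simp only [hc.two y hy, h.fst y hy, fderiv_fun_const, Pi.zero_apply, zero_apply, Prod.fst_zero,
    Prod.snd_zero, ins_zero_left, ins_zero_right, add_zero, ext1_zero, Finset.sum_const_zero, map_zero,
    zero_smul, sub_zero, zero_add] at h2
  simp only [ContinuousAlternatingMap.add_apply, ContinuousAlternatingMap.smul_apply, hσ,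
    smul_eq_mul, mul_one] at h2
  linarith

theorem fderiv_ins {k : ℕ} {C : T n → Form n (k + 1)} {y : T n} (hC : DifferentiableAt ℝ C y)
    (Y X : T n) : fderiv ℝ (fun z => ins Y (C z)) y X = ins Y (fderiv ℝ C y X) :=
  congrArg (· X) ((insC n k Y).hasFDerivAt.comp y hC.hasFDerivAt).fderiv

theorem sum_ext1_ins_ins {k : ℕ} {C : T n → Form n (k + 2)} (y X Y : T n) :
    ins Y (ins X (extDeriv C y)) = ins Y (fderiv ℝ C y X) - ins X (fderiv ℝ C y Y)
      + ∑ j, ext1 (EuclideanSpace.proj j) (ins Y (ins X (fderiv ℝ C y (vec j)))) := by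
  have h1 : ∀ {l : ℕ} (X : T n) (f : T n →L[ℝ] Form n (l + 1)),
      ins X (∑ i, ext1 (EuclideanSpace.proj i) (f (vec i)))
        = f X - ∑ i, ext1 (EuclideanSpace.proj i) (ins X (f (vec i))) := by
    intro l X f
    rw [← insL_apply, map_sum]
    simp only [insL_apply, ins_ext1, Finset.sum_sub_distrib]
    rw [sum_proj_smul]
  rw [extDeriv_eq_sum, h1, ins_sub_right]
  have h2 := h1 Y ((insC n (k + 1) X).comp (fderiv ℝ C y))
  simp only [ContinuousLinearMap.comp_apply, insC_apply] at h2
  rw [h2]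
  abel

/-- With γ = 0, the 2-form part of the Jacobi identity for three constant vectors is the threefold
contraction of dF. -/
theorem IsTwist.extDeriv_eq_zero (h : IsTwist V Γ Δ) (hV : IsOpen V)
    (hc : IsConnection V Γ γ F) (hγ : ∀ y ∈ V, γ y = 0) {y : T n} (hy : y ∈ V) :
    extDeriv F y = 0 := by
  have hF : DifferentiableAt ℝ F y := (hc.smooth_four.contDiffAt (hV.mem_nhds hy)).differentiableAt
    (by simp)
  have two : ∀ y ∈ V, ∀ u v, (Γ y u v).2.1 = ins v.1 (ins u.1 (F y)) := by
    intro y hy u v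
    rw [hc.two y hy, hγ y hy, zero_ext1, sub_zero, zero_apply, zero_smul, zero_add]
  have h1 : ∀ X Y Z : T n, (fderiv ℝ (fun z => Γ z (Y, 0, 0) (Z, 0, 0)) y X).2.1
      = ins Z (ins Y (fderiv ℝ F y X)) := by
    intro X Y Z
    rw [fderiv_two (h.differentiableAt hV hy _ _)]
    have e : (fun z => (Γ z (Y, 0, 0) (Z, 0, 0)).2.1) =ᶠ[𝓝 y] fun z => ins Z (ins Y (F z)) := by
      filter_upwards [hV.mem_nhds hy] with z hz
      rw [two z hz]
    rw [e.fderiv_eq, fderiv_ins (C := fun z => ins Y (F z))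
      ((insC n 3 Y).differentiableAt.comp y hF), fderiv_ins hF]
  refine form_ext_ins fun X => form_ext_ins fun Y => form_ext_ins fun Z => ?_
  rw [sum_ext1_ins_ins]
  have h2 := congrArg (fun u : EMod n => u.2.1) (h.jacobi y hy (X, 0, 0) (Y, 0, 0) (Z, 0, 0))
  simp only [Prod.snd_add, Prod.fst_add, twistedBracket_two, h1, h.fderiv_fst hV hy] at h2
  simp only [two y hy, h.fst y hy, fderiv_fun_const, Pi.zero_apply, zero_apply, Prod.fst_zero,
    Prod.snd_zero, ins_zero_left, ins_zero_right, add_zero, ext1_zero, Finset.sum_const_zero,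
    sub_zero, zero_add] at h2
  have h3 : ins Z (∑ j, ext1 (EuclideanSpace.proj j) (ins Y (ins X (fderiv ℝ F y (vec j)))))
      = ins Y (ins X (fderiv ℝ F y Z))
        - ∑ j, ext1 (EuclideanSpace.proj j) (ins Z (ins Y (ins X (fderiv ℝ F y (vec j))))) := by
    rw [← insL_apply, map_sum]
    simp only [insL_apply, ins_ext1, Finset.sum_sub_distrib]
    congr 1
    exact sum_proj_smul ((insC n 2 Y).comp ((insC n 3 X).comp (fderiv ℝ F y))) Z
  rw [ins_add_right, ins_sub_right, h3, h2, ins_zero_right, ins_zero_right, ins_zero_right]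
  abel

/-- The change of the connection under a change of frame. -/
theorem IsConnection.gauge {Γ' : T n → EMod n →ₗ[ℝ] EMod n →ₗ[ℝ] EMod n}
    {γ' : T n → T n →L[ℝ] ℝ} {F' : T n → Form n 4} (hV : IsOpen V) (hn : 2 ≤ n)
    (hc : IsConnection V Γ γ F) (hc' : IsConnection V Γ' γ' F') {g : T n → EMod n →L[ℝ] EMod n}
    (hfst : ∀ y ∈ V, ∀ a b, (Γ' y a b).1 = 0)
    (hg : ∀ a, DifferentiableOn ℝ (fun y => g y a) V)
    (hΓ : ∀ y ∈ V, ∀ a b, g y (Γ' y a b) = twistedBracket Γ (fun z => g z a) (fun z => g z b) y)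
    {φ : T n → ℝ} {C : T n → Form n 3} (hφ : DifferentiableOn ℝ φ V) (hC : DifferentiableOn ℝ C V)
    (h1 : ∀ y ∈ V, ∀ u, (g y u).1 = u.1)
    (h2 : ∀ y ∈ V, ∀ u, (g y u).2.1 = φ y • u.2.1 + ins u.1 (C y)) {y : T n} (hy : y ∈ V) :
    φ y • γ' y = φ y • γ y + fderiv ℝ φ y ∧
      (γ y = 0 → φ y • F' y = F y + extDeriv C y) := by
  have hg' : ∀ a, DifferentiableAt ℝ (fun y => g y a) y := fun a =>
    (hg a).differentiableAt (hV.mem_nhds hy)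
  have hφ' : DifferentiableAt ℝ φ y := hφ.differentiableAt (hV.mem_nhds hy)
  have hC' : DifferentiableAt ℝ C y := hC.differentiableAt (hV.mem_nhds hy)
  have d1 : ∀ a X, (fderiv ℝ (fun y => g y a) y X).1 = 0 := by
    intro a X
    rw [Elg.fderiv_fst (hg' a)]
    have : (fun z => (g z a).1) =ᶠ[𝓝 y] fun _ => a.1 := by
      filter_upwards [hV.mem_nhds hy] with z hz
      exact h1 z hz a
    rw [this.fderiv_eq]
    simp
  have d2 : ∀ a X, (fderiv ℝ (fun y => g y a) y X).2.1
      = fderiv ℝ φ y X • a.2.1 + ins a.1 (fderiv ℝ C y X) := by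
    intro a X
    rw [fderiv_two (hg' a)]
    have : (fun z => (g z a).2.1) =ᶠ[𝓝 y] fun z => φ z • a.2.1 + ins a.1 (C z) := by
      filter_upwards [hV.mem_nhds hy] with z hz
      exact h2 z hz a
    rw [this.fderiv_eq]
    exact congrArg (· X) ((hφ'.hasFDerivAt.smul_const a.2.1).add
      ((insC n 2 a.1).hasFDerivAt.comp y hC'.hasFDerivAt)).fderiv
  -- Compare 2-form parts of the bracket in the two frames. A vector and a 2-form isolate γ'; two
  -- vectors isolate F'.
  have key : ∀ a b, φ y • (Γ' y a b).2.1
      = (fderiv ℝ φ y a.1 • b.2.1 + ins b.1 (fderiv ℝ C y a.1))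
        - (fderiv ℝ φ y b.1 • a.2.1 + ins a.1 (fderiv ℝ C y b.1))
        + ∑ j, ext1 (EuclideanSpace.proj j)
          (ins b.1 (fderiv ℝ φ y (vec j) • a.2.1 + ins a.1 (fderiv ℝ C y (vec j))))
        + (γ y a.1 • (φ y • b.2.1 + ins b.1 (C y))
          + ins b.1 (ins a.1 (F y) - ext1 (γ y) (φ y • a.2.1 + ins a.1 (C y)))) := by
    intro a b
    have h3 := congrArg (fun u : EMod n => u.2.1) (hΓ y hy a b)
    simp only [twistedBracket_two, d1, d2, h2 y hy, h1 y hy, hc.two y hy, hfst y hy, ins_zero_left,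
      zero_add, add_zero] at h3
    exact h3
  constructor
  · obtain ⟨σ, w, hσ⟩ := exists_form_two_apply_eq_one hn
    refine ContinuousLinearMap.ext fun X => ?_
    have h3 := congrArg (fun s : Form n 2 => s w) (key (X, 0, 0) (0, σ, 0))
    simp only [hc'.two y hy, ins_zero_left, ins_zero_right, smul_zero, add_zero, map_zero, sub_zero,
      ext1_zero, Finset.sum_const_zero, ContinuousAlternatingMap.add_apply,
      ContinuousAlternatingMap.smul_apply, hσ, smul_eq_mul, mul_one, zero_add] at h3
    simp only [smul_apply, add_apply, smul_eq_mul]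
    linarith
  · intro hγ
    refine form_ext_ins fun X => form_ext_ins fun Y => ?_
    have h3 := key (X, 0, 0) (Y, 0, 0)
    simp only [hc'.two y hy, smul_zero, zero_add, ext1_zero, sub_zero, hγ, zero_apply, zero_smul,
      zero_ext1] at h3
    rw [ins_add_right, ins_add_right, sum_ext1_ins_ins, ins_smul_right, ins_smul_right, h3]
    abel

end

end

/-! ### Smooth gauge transformations: gl(T), 3-forms and the grading -/

section

attribute [local irreducible] ins wd wedge prodN prodE

theorem contDiff_exp {V : Type*} [NormedAddCommGroup V] [NormedSpace ℝ V] [CompleteSpace V] :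
    ContDiff ℝ ∞ (NormedSpace.exp : (V →L[ℝ] V) → V →L[ℝ] V) :=
  contDiff_iff_contDiffAt.2 fun x => (NormedSpace.exp_analytic (𝕂 := ℝ) x).contDiffAt

theorem map_exp_of_comp_eq_smul {V W : Type*} [NormedAddCommGroup V] [NormedSpace ℝ V]
    [CompleteSpace V] [NormedAddCommGroup W] [NormedSpace ℝ W] (L : V →L[ℝ] W) {x : V →L[ℝ] V}
    {c : ℝ} (h : ∀ u, L (x u) = c • L u) (u : V) :
    L (NormedSpace.exp x u) = Real.exp c • L u := by
  have hd : ∀ t : ℝ, HasDerivAt (fun s : ℝ => Real.exp (-c * s) • L (NormedSpace.exp (s • x) u))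
      0 t := by
    intro t
    have h1 : HasDerivAt (fun s : ℝ => Real.exp (-c * s)) (Real.exp (-c * t) * -c) t := by
      simpa using ((hasDerivAt_id t).const_mul (-c)).exp
    refine (h1.smul (L.hasFDerivAt.comp_hasDerivAt t (hasDerivAt_exp_smul_apply x u t))).congr_deriv ?_
    rw [h]
    simp only [Function.comp_apply]
    module
  have hc := is_const_of_deriv_eq_zero (fun t => (hd t).differentiableAt) (fun t => (hd t).deriv) 1 0
  simp only [one_smul, zero_smul, NormedSpace.exp_zero, mul_one, mul_zero, Real.exp_zero,
    one_apply_eq_self] at hc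
  rw [← hc, smul_smul, ← Real.exp_add]
  simp

variable {n : ℕ}

/-- The action of 3-forms on `E` and `N`. -/
def formPair (n : ℕ) : Form n 3 →L[ℝ] EndPair n :=
  LinearMap.toContinuousLinearMap
    { toFun := fun a => (formE a, formN a)
      map_add' := fun a b => by
        refine Prod.ext (ContinuousLinearMap.ext fun u => ?_) (ContinuousLinearMap.ext fun k => ?_)
        · show formE (a + b) u = formE a u + formE b u
          simp only [formE_apply, ins_add_right, map_add, LinearMap.add_apply, Prod.mk_add_mk,
            add_zero]
        · show formN (a + b) k = formN a k + formN b k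
          simp only [formN_apply, map_add, Prod.mk_add_mk, add_zero]
          refine Prod.ext rfl (Prod.ext rfl (ContinuousLinearMap.ext fun Y => ?_))
          show insWedge (a + b) k.2.1 Y = insWedge a k.2.1 Y + insWedge b k.2.1 Y
          simp only [insWedge_apply, ins_add_right, map_add, LinearMap.add_apply]
      map_smul' := fun c a => by
        refine Prod.ext (ContinuousLinearMap.ext fun u => ?_) (ContinuousLinearMap.ext fun k => ?_)
        · show formE (c • a) u = c • formE a u
          simp only [formE_apply, ins_smul_right, map_smul, LinearMap.smul_apply, Prod.smul_mk,
            smul_zero]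
        · show formN (c • a) k = c • formN a k
          simp only [formN_apply, map_smul, Prod.smul_mk, smul_zero]
          refine Prod.ext rfl (Prod.ext rfl (ContinuousLinearMap.ext fun Y => ?_))
          show insWedge (c • a) k.2.1 Y = c • insWedge a k.2.1 Y
          simp only [insWedge_apply, ins_smul_right, map_smul, LinearMap.smul_apply] }

/-- The action of `gl(T)` on `E` and `N`. -/
def glPair (n : ℕ) : (T n →L[ℝ] T n) →L[ℝ] EndPair n :=
  LinearMap.toContinuousLinearMap
    { toFun := fun B => (glE B, glN B)
      map_add' := fun a b => by
        refine Prod.ext (ContinuousLinearMap.ext fun u => ?_) (ContinuousLinearMap.ext fun k => ?_)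
        · show glE (a + b) u = glE a u + glE b u
          simp only [glE_apply, ← glActL_apply, map_add, LinearMap.add_apply, Prod.mk_add_mk,
            add_apply]
        · show glN (a + b) k = glN a k + glN b k
          refine Prod.ext ?_ (Prod.ext ?_ (ContinuousLinearMap.ext fun Y => ?_))
          · simp only [(glN_apply _ k).1, Prod.fst_add, ← glActL_apply, map_add, LinearMap.add_apply]
          · simp only [(glN_apply _ k).2.1, Prod.fst_add, Prod.snd_add, ← glActL_apply, map_add,
              LinearMap.add_apply]
          · simp only [(glN_apply _ k).2.2, Prod.snd_add, ← glActL_apply, map_add,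
              LinearMap.add_apply, add_apply]
            abel
      map_smul' := fun c a => by
        refine Prod.ext (ContinuousLinearMap.ext fun u => ?_) (ContinuousLinearMap.ext fun k => ?_)
        · show glE (c • a) u = c • glE a u
          simp only [glE_apply, ← glActL_apply, map_smul, LinearMap.smul_apply, Prod.smul_mk,
            smul_apply]
        · show glN (c • a) k = c • glN a k
          refine Prod.ext ?_ (Prod.ext ?_ (ContinuousLinearMap.ext fun Y => ?_))
          · simp only [(glN_apply _ k).1, Prod.smul_fst, ← glActL_apply, map_smul,
              LinearMap.smul_apply]
          · simp only [(glN_apply _ k).2.1, Prod.smul_fst, Prod.smul_snd, ← glActL_apply, map_smul,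
              LinearMap.smul_apply]
          · simp only [(glN_apply _ k).2.2, Prod.smul_snd, ← glActL_apply, map_smul,
              LinearMap.smul_apply, smul_apply, smul_sub] }

/-- The grading element, acting by `0`, `1`, `2` on the three summands of `E`. -/
def degPair (n : ℕ) : EndPair n :=
  (3⁻¹ : ℝ) • ((ContinuousLinearMap.id ℝ (EMod n),
    ContinuousLinearMap.id ℝ (NMod n) + ContinuousLinearMap.id ℝ (NMod n))
      - (glE (ContinuousLinearMap.id ℝ (T n)), glN (ContinuousLinearMap.id ℝ (T n))))

theorem degPair_mem (n : ℕ) : degPair n ∈ infPairs n :=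
  Submodule.smul_mem _ _ (Submodule.sub_mem _ (id_mem_infPairs n) (gl_mem_infPairs _))

theorem degPair_apply (u : EMod n) : ((degPair n).1 u).1 = 0 ∧ ((degPair n).1 u).2.1 = u.2.1 := by
  have : (degPair n).1 u = (3⁻¹ : ℝ) • (u - (u.1, glAct (ContinuousLinearMap.id ℝ (T n)) u.2.1,
      glAct (ContinuousLinearMap.id ℝ (T n)) u.2.2)) := rfl
  rw [this, glAct_id, glAct_id]
  constructor
  · simp
  · simp only [Prod.smul_snd, Prod.snd_sub, Prod.smul_fst, Prod.fst_sub]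
    push_cast
    module

/-- Only the components in T and Λ²T* are recorded, since γ and F are read off from them. -/
theorem exp_degPair (f : ℝ) (u : EMod n) :
    (NormedSpace.exp (f • (degPair n).1) u).1 = u.1 ∧
      (NormedSpace.exp (f • (degPair n).1) u).2.1 = Real.exp f • u.2.1 := by
  constructor
  · refine map_exp_of_comp_eq_zero (ContinuousLinearMap.fst ℝ (T n) (Form n 2 × Form n 5))
      (fun v => ?_) u
    show f • ((degPair n).1 v).1 = 0
    rw [(degPair_apply v).1, smul_zero]
  · refine map_exp_of_comp_eq_smul (projTwoC n) (fun v => ?_) u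
    show f • ((degPair n).1 v).2.1 = f • v.2.1
    rw [(degPair_apply v).2]

theorem exp_formE (a : Form n 3) (u : EMod n) : (NormedSpace.exp (formE a) u).1 = u.1 ∧
    (NormedSpace.exp (formE a) u).2.1 = u.2.1 + ins u.1 a := by
  have h5 : NormedSpace.exp (formE a) (0, 0, u.2.2) = (0, 0, u.2.2) := by
    have h : formE a (0, 0, u.2.2) = 0 := by
      rw [formE_apply]; simp [ins_zero_left]
    rw [exp_apply_of_sq_eq_zero (by rw [h, map_zero]), h, add_zero]
  rw [EMod.eq_add u, map_add, map_add, formE_comp_apply, exp_formE_two, h5]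
  simp [add_comm]

end

/-! ### Removing the tensor by a change of normal frame -/

section

attribute [local irreducible] ins wd wedge prodN prodE

section

variable {n : ℕ} {M : Type*} [TopologicalSpace M]
  [ChartedSpace (EuclideanSpace ℝ (Fin n)) M] [IsManifold (𝓡 n) ∞ M]
  {E : M → Type*} [∀ x, AddCommGroup (E x)] [∀ x, Module ℝ (E x)] [∀ x, TopologicalSpace (E x)]
  [TopologicalSpace (TotalSpace (EMod n) E)] [FiberBundle (EMod n) E] [VectorBundle ℝ (EMod n) E]
  [ContMDiffVectorBundle ∞ (EMod n) E (𝓡 n)]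
  {N : M → Type*} [∀ x, AddCommGroup (N x)] [∀ x, Module ℝ (N x)] [∀ x, TopologicalSpace (N x)]
  [TopologicalSpace (TotalSpace (NMod n) N)] [FiberBundle (NMod n) N] [VectorBundle ℝ (NMod n) N]
  [ContMDiffVectorBundle ∞ (NMod n) N (𝓡 n)]
  {A : Elgebroid n n M E N} {e : OpenPartialHomeomorph M (T n)} {F : ∀ x, Frame n E N x}
  {S : EMod n →ₗ[ℝ] Sec n (EMod n) E} {K : NMod n →ₗ[ℝ] Sec n (NMod n) N}

theorem HasExtensions.restr (hS : HasExtensions e F S K) {O : Set M} (hO : IsOpen O) :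
    HasExtensions (e.restrOpen O hO) F S K where
  constE := fun a x hx => hS.constE a x hx.1
  constN := fun a x hx => hS.constN a x hx.1
  compN := fun k ℓ => by
    obtain ⟨f, hf⟩ := hS.compN k ℓ
    exact ⟨f, fun x hx => hf x hx.1⟩
  coord := fun j => by
    obtain ⟨f, hf⟩ := hS.coord j
    exact ⟨f, fun x hx => hf x hx.1⟩

/-- A normal frame with extensions and connection near `p`. -/
structure IsNormalAt (A : Elgebroid n n M E N) (p : M) (e : OpenPartialHomeomorph M (T n))
    (F : ∀ x, Frame n E N x) (S : EMod n →ₗ[ℝ] Sec n (EMod n) E)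
    (K : NMod n →ₗ[ℝ] Sec n (NMod n) N) (γ : T n → T n →L[ℝ] ℝ) (F₄ : T n → Form n 4) : Prop where
  mem : p ∈ e.source
  normal : IsNormalFrame A e F
  ext : HasExtensions e F S K
  conn : IsConnection e.target (fun y => compBL A F S (e.symm y)) γ F₄
  vanish : ∀ y ∈ e.target, γ y = 0 → F₄ y = 0 →
    compBL A F S (e.symm y) = 0 ∧ compDL A F K (e.symm y) = 0

theorem IsNormalFrame.exists_isNormalAt [T2Space M] (hn : 2 ≤ n) (hn' : n ≤ 6)
    (h : IsNormalFrame A e F) {p : M} (hp : p ∈ e.source) :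
    ∃ (O : Set M) (hO : IsOpen O) (S : _) (K : _) (γ : _) (F₄ : _),
      IsNormalAt A p (e.restrOpen O hO) F S K γ F₄ := by
  obtain ⟨O, hO, hpO, -, S, K, hS⟩ := h.exists_extensions hp Filter.univ_mem
  obtain ⟨γ, F₄, hc, hv⟩ := ((h.restr hO).isTwist hS).exists_isConnection hn hn'
  exact ⟨O, hO, S, K, γ, F₄, ⟨hp, hpO⟩, h.restr hO, hS, hc, hv⟩

theorem Elgebroid.trans_mem_frames (A : Elgebroid n n M E N) {x : M} {F : Frame n E N x}
    (hF : F ∈ A.frames x) {p : (EMod n ≃L[ℝ] EMod n) × (NMod n ≃L[ℝ] NMod n)}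
    (hp : p ∈ excPairs n) : (p.1.trans F.1, p.2.trans F.2) ∈ A.frames x := by
  obtain ⟨F₀, -, h⟩ := A.frames_orbit x
  rw [h] at hF ⊢
  obtain ⟨q, hq, rfl⟩ := hF
  exact ⟨_, trans_mem_excPairs hp hq, rfl⟩

theorem IsSmoothFrameOn.trans {U : Set M} (hF : IsSmoothFrameOn n U F)
    {g₁ : M → EMod n ≃L[ℝ] EMod n} {g₂ : M → NMod n ≃L[ℝ] NMod n}
    (h₁ : ∀ a, ContMDiffOn (𝓡 n) 𝓘(ℝ, EMod n) ∞ (fun x => g₁ x a) U)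
    (h₂ : ∀ a, ContMDiffOn (𝓡 n) 𝓘(ℝ, NMod n) ∞ (fun x => g₂ x a) U) :
    IsSmoothFrameOn n U fun x => ((g₁ x).trans (F x).1, (g₂ x).trans (F x).2) :=
  ⟨fun a => contMDiffOn_frame_apply (G := fun x => ((F x).1 : EMod n →L[ℝ] E x)) hF.1 (h₁ a),
    fun a => contMDiffOn_frame_apply (G := fun x => ((F x).2 : NMod n →L[ℝ] N x)) hF.2 (h₂ a)⟩

/-- The frame obtained from `F` by acting with the exponential of `x`. -/
def gaugeFrame (e : OpenPartialHomeomorph M (T n)) (F : ∀ x, Frame n E N x) (x : T n → EndPair n)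
    (p : M) : Frame n E N p :=
  ((expEquiv (x (e p)).1).trans (F p).1, (expEquiv (x (e p)).2).trans (F p).2)

theorem contMDiffOn_exp_apply {V : Type*} [NormedAddCommGroup V] [NormedSpace ℝ V] [CompleteSpace V]
    {U : Set M} {x : M → V →L[ℝ] V} (hx : ContMDiffOn (𝓡 n) 𝓘(ℝ, V →L[ℝ] V) ∞ x U) (a : V) :
    ContMDiffOn (𝓡 n) 𝓘(ℝ, V) ∞ (fun p => NormedSpace.exp (x p) a) U :=
  (contDiff_exp.contMDiff.comp_contMDiffOn hx).clm_apply contMDiffOn_const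

theorem contMDiffOn_exp_comp_apply {V : Type*} [NormedAddCommGroup V] [NormedSpace ℝ V]
    [CompleteSpace V] (he : ContMDiffOn (𝓡 n) (𝓡 n) ∞ e e.source) {x : T n → V →L[ℝ] V}
    (hx : ContDiffOn ℝ ∞ x e.target) (a : V) :
    ContMDiffOn (𝓡 n) 𝓘(ℝ, V) ∞ (fun p => expEquiv (x (e p)) a) e.source :=
  contMDiffOn_exp_apply (hx.contMDiffOn.comp he e.mapsTo) a

theorem IsSmoothFrameOn.gaugeFrame (h : IsSmoothFrameOn n e.source F)
    (he : ContMDiffOn (𝓡 n) (𝓡 n) ∞ e e.source) {x : T n → EndPair n}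
    (hx : ContDiffOn ℝ ∞ x e.target) : IsSmoothFrameOn n e.source (gaugeFrame e F x) :=
  IsSmoothFrameOn.trans h (contMDiffOn_exp_comp_apply he hx.fst)
    (contMDiffOn_exp_comp_apply he hx.snd)

/-- `e` is a chart and `F` a `G`-frame over its domain. -/
structure IsChartFrame (A : Elgebroid n n M E N) (e : OpenPartialHomeomorph M (T n))
    (F : ∀ x, Frame n E N x) : Prop where
  smooth : ContMDiffOn (𝓡 n) (𝓡 n) ∞ e e.source
  smooth_symm : ContMDiffOn (𝓡 n) (𝓡 n) ∞ e.symm e.target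
  smooth_fiber : IsSmoothFrameOn n e.source F
  frames : ∀ x ∈ e.source, F x ∈ A.frames x

theorem IsChartFrame.gaugeFrame (h : IsChartFrame A e F) {x : T n → EndPair n}
    (hx : ContDiffOn ℝ ∞ x e.target) (hm : ∀ z, x z ∈ infPairs n) :
    IsChartFrame A e (gaugeFrame e F x) where
  smooth := h.smooth
  smooth_symm := h.smooth_symm
  smooth_fiber := h.smooth_fiber.gaugeFrame h.smooth hx
  frames := fun p hp => A.trans_mem_frames (h.frames p hp) (exp_mem_excPairs (hm (e p)))

theorem IsNormalFrame.isChartFrame (h : IsNormalFrame A e F) : IsChartFrame A e F :=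
  ⟨h.smooth, h.smooth_symm, h.smooth_fiber, h.frames⟩

theorem IsNormalFrame.gaugeFrame (h : IsNormalFrame A e F) {x : T n → EndPair n}
    (hx : ContDiffOn ℝ ∞ x e.target) (hm : ∀ z, x z ∈ infPairs n)
    (h1 : ∀ z u, (NormedSpace.exp (x z).1 u).1 = u.1) : IsNormalFrame A e (gaugeFrame e F x) :=
  have h' := h.isChartFrame.gaugeFrame hx hm
  ⟨h'.smooth, h'.smooth_symm, h'.smooth_fiber, h'.frames,
    fun p hp _ => (h.anchor p hp _).trans (h1 _ _)⟩

/-- Sections constant in the new frame have components g a, g b in the old one, where their bracket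
is known. -/
theorem IsNormalFrame.apply_compBL [T2Space M] (h : IsNormalFrame A e F) (hS : HasExtensions e F S K)
    {F' : ∀ x, Frame n E N x} {S' : EMod n →ₗ[ℝ] Sec n (EMod n) E}
    {K' : NMod n →ₗ[ℝ] Sec n (NMod n) N} (hS' : HasExtensions e F' S' K')
    {g : T n → EMod n →L[ℝ] EMod n} (hg : ∀ p a, (F' p).1 a = (F p).1 (g (e p) a)) {y : T n}
    (hy : y ∈ e.target) (a b : EMod n) : g y (compBL A F' S' (e.symm y) a b)
      = twistedBracket (fun y => compBL A F S (e.symm y)) (fun z => g z a) (fun z => g z b) y := by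
  have hx := e.map_target hy
  have h1 := h.compE_bracket hS (S' a) (S' b) hx
  have hc : ∀ a, compE e F (S' a) =ᶠ[𝓝 (e (e.symm y))] fun z => g z a := by
    intro a
    rw [e.right_inv hy]
    filter_upwards [e.open_target.mem_nhds hy] with z hz
    rw [compE, push, hS'.constE a _ (e.map_target hz), hg, ContinuousLinearEquiv.symm_apply_apply,
      e.right_inv hz]
  rw [twistedBracket_congr (hc a) (hc b), compE_apply _ hx] at h1
  have h2 : A.bracket (S' a) (S' b) (e.symm y)
      = (F (e.symm y)).1 (g (e (e.symm y)) (compBL A F' S' (e.symm y) a b)) := by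
    rw [← hg, compBL_apply, ContinuousLinearEquiv.apply_symm_apply]
  rw [h2, ContinuousLinearEquiv.symm_apply_apply, e.right_inv hy] at h1
  exact h1

theorem IsConnection.mono {V V' : Set (T n)} {Γ : T n → EMod n →ₗ[ℝ] EMod n →ₗ[ℝ] EMod n}
    {γ : T n → T n →L[ℝ] ℝ} {F : T n → Form n 4} (h : IsConnection V Γ γ F) (hV : V' ⊆ V) :
    IsConnection V' Γ γ F :=
  ⟨h.smooth_one.mono hV, h.smooth_four.mono hV, fun y hy => h.two y (hV hy)⟩

theorem IsNormalAt.restr {p : M} {γ : T n → T n →L[ℝ] ℝ} {F₄ : T n → Form n 4}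
    (h : IsNormalAt A p e F S K γ F₄) {O : Set M} (hO : IsOpen O) (hp : p ∈ O) :
    IsNormalAt A p (e.restrOpen O hO) F S K γ F₄ where
  mem := ⟨h.mem, hp⟩
  normal := h.normal.restr hO
  ext := h.ext.restr hO
  conn := h.conn.mono Set.inter_subset_left
  vanish := fun y hy => h.vanish y hy.1

theorem IsNormalAt.exists_restr {p : M} {γ : T n → T n →L[ℝ] ℝ} {F₄ : T n → Form n 4}
    (h : IsNormalAt A p e F S K γ F₄) {B : Set (T n)} (hB : IsOpen B) (hp : e p ∈ B) :
    ∃ e', IsNormalAt A p e' F S K γ F₄ ∧ e'.target ⊆ B ∧ e'.target ⊆ e.target ∧ ∀ x, e' x = e x := by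
  have hO : IsOpen (e.source ∩ e ⁻¹' B) := e.isOpen_inter_preimage hB
  refine ⟨e.restrOpen _ hO, h.restr hO ⟨h.mem, hp⟩, fun y hy => ?_, Set.inter_subset_left,
    fun _ => rfl⟩
  have := hy.2.2
  rwa [Set.mem_preimage, e.right_inv hy.1] at this

set_option maxHeartbeats 400000 in
-- A gauge transformation that preserves T-components keeps the frame normal; after shrinking, new
-- extensions exist and the transformation law applies.
theorem IsNormalAt.exists_gauge [T2Space M] (hn : 2 ≤ n) (hn' : n ≤ 6) {p : M}
    {γ : T n → T n →L[ℝ] ℝ} {F₄ : T n → Form n 4} (h : IsNormalAt A p e F S K γ F₄)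
    {x : T n → EndPair n} {φ : T n → ℝ} {C : T n → Form n 3} (hx : ContDiffOn ℝ ∞ x e.target)
    (hφ : DifferentiableOn ℝ φ e.target) (hC : DifferentiableOn ℝ C e.target)
    (hm : ∀ z, x z ∈ infPairs n)
    (hu : ∀ z u, (NormedSpace.exp (x z).1 u).1 = u.1 ∧
      (NormedSpace.exp (x z).1 u).2.1 = φ z • u.2.1 + ins u.1 (C z)) :
    ∃ e' F' S' K' γ' F₄', IsNormalAt A p e' F' S' K' γ' F₄' ∧ e'.target ⊆ e.target ∧
      ∀ y ∈ e'.target, φ y • γ' y = φ y • γ y + fderiv ℝ φ y ∧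
        (γ y = 0 → φ y • F₄' y = F₄ y + extDeriv C y) := by
  have h' := h.normal.gaugeFrame hx hm fun z u => (hu z u).1
  obtain ⟨O, hO, S', K', γ', F₄', h''⟩ := h'.exists_isNormalAt hn hn' h.mem
  have hr := h.restr hO h''.mem.2
  have hsub : (e.restrOpen O hO).target ⊆ e.target := Set.inter_subset_left
  refine ⟨e.restrOpen O hO, Elg.gaugeFrame e F x, S', K', γ', F₄', h'', hsub, fun y hy => ?_⟩
  refine hr.conn.gauge (e.restrOpen O hO).open_target hn h''.conn
    (g := fun z => NormedSpace.exp (x z).1) (fun z hz a b => ?_) (fun a => ?_) (fun z hz a b => ?_)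
    (hφ.mono hsub) (hC.mono hsub) (fun z _ u => (hu z u).1) (fun z _ u => (hu z u).2) hy
  · exact (h''.normal.isTwist h''.ext).fst z hz a b
  · have h3 : ContDiffOn ℝ ∞ (fun z => NormedSpace.exp (x z).1 a) e.target :=
      (contDiff_exp.comp_contDiffOn (contDiff_fst.comp_contDiffOn hx)).clm_apply contDiffOn_const
    exact (h3.mono hsub).differentiableOn (by simp)
  · exact hr.normal.apply_compBL hr.ext h''.ext (g := fun z => NormedSpace.exp (x z).1)
      (fun _ _ => rfl) hz a b

theorem contDiffOn_smul_const {V W : Type*} [NormedAddCommGroup V] [NormedSpace ℝ V]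
    [NormedAddCommGroup W] [NormedSpace ℝ W] {s : Set V} {f : V → ℝ} (hf : ContDiffOn ℝ ∞ f s)
    (c : W) : ContDiffOn ℝ ∞ (fun z => f z • c) s :=
  hf.smul contDiffOn_const

set_option maxHeartbeats 400000 in
-- With γ = df the scaling φ = exp(-f) satisfies dφ = -φγ, which makes φγ' zero.
theorem IsNormalAt.exists_flat [T2Space M] (hn : 2 ≤ n) (hn' : n ≤ 6) {p : M}
    {γ : T n → T n →L[ℝ] ℝ} {F₄ : T n → Form n 4} (h : IsNormalAt A p e F S K γ F₄) :
    ∃ e' F' S' K' γ' F₄', IsNormalAt A p e' F' S' K' γ' F₄' ∧ ∀ y ∈ e'.target, γ' y = 0 := by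
  obtain ⟨r, hr, -, f, hf, hfd⟩ := exists_fderiv_eq e.open_target (e.map_source h.mem)
    h.conn.smooth_one fun y hy X Y =>
      (h.normal.isTwist h.ext).fderiv_symm e.open_target hn h.conn hy X Y
  obtain ⟨e₁, h₁, hB, -, -⟩ := h.exists_restr Metric.isOpen_ball (Metric.mem_ball_self hr)
  have hf' := hf.mono hB
  obtain ⟨e', F', S', K', γ', F₄', h', hsub, hy'⟩ := h₁.exists_gauge hn hn'
    (x := fun z => (-f z) • degPair n) (φ := fun z => Real.exp (-f z)) (C := fun _ => 0)
    (contDiffOn_smul_const hf'.neg (degPair n))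
    ((hf'.neg.differentiableOn (by simp)).exp) (differentiableOn_const _)
    (fun z => Submodule.smul_mem _ _ (degPair_mem n)) fun z u => by
      have := exp_degPair (-f z) u
      refine ⟨this.1, this.2.trans ?_⟩
      rw [ins_zero_right, add_zero]
  refine ⟨e', F', S', K', γ', F₄', h', fun y hy => ?_⟩
  have h3 := (hy' y hy).1
  have h4 : fderiv ℝ (fun z => Real.exp (-f z)) y = Real.exp (-f y) • -γ y :=
    ((hfd y (hB (hsub hy))).neg.exp).fderiv
  rw [h4, ← smul_add, add_neg_cancel, smul_zero, smul_eq_zero] at h3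
  exact h3.resolve_left (Real.exp_pos _).ne'

set_option maxHeartbeats 400000 in
-- Once γ = 0 the form F₄ is closed, and a primitive C of -F₄ gives F₄' = F₄ + dC = 0. The vanishing
-- criterion then removes the entire tensor and the zeroth order part of 𝓓.
theorem IsNormalAt.exists_trivial [T2Space M] (hn : 2 ≤ n) (hn' : n ≤ 6) {p : M}
    {γ : T n → T n →L[ℝ] ℝ} {F₄ : T n → Form n 4} (h : IsNormalAt A p e F S K γ F₄)
    (hγ : ∀ y ∈ e.target, γ y = 0) :
    ∃ e' F' S' K', p ∈ e'.source ∧ IsNormalFrame A e' F' ∧ HasExtensions e' F' S' K' ∧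
      ∀ y ∈ e'.target, compBL A F' S' (e'.symm y) = 0 ∧ compDL A F' K' (e'.symm y) = 0 := by
  obtain ⟨r, hr, -, C, hC, hCd⟩ := exists_extDeriv_eq e.open_target (e.map_source h.mem)
    h.conn.smooth_four.neg fun y hy => by
      have := (h.normal.isTwist h.ext).extDeriv_eq_zero e.open_target h.conn hγ hy
      have h2 : (fun z => -F₄ z) = (-1 : ℝ) • F₄ := by ext1 z; simp
      rw [h2, extDeriv_smul, this, smul_zero]
  obtain ⟨e₁, h₁, hB, hB', -⟩ := h.exists_restr Metric.isOpen_ball (Metric.mem_ball_self hr)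
  obtain ⟨e', F', S', K', γ', F₄', h', hsub, hy'⟩ := h₁.exists_gauge hn hn'
    (x := fun z => formPair n (C z)) (φ := fun _ => 1) (C := C)
    ((formPair n).contDiff.comp_contDiffOn hC.contDiffOn) (differentiableOn_const _)
    (hC.differentiable (by simp)).differentiableOn
    (fun z => form_mem_infPairs hn' (C z)) fun z u => by
      have := exp_formE (C z) u
      exact ⟨this.1, this.2.trans (by rw [one_smul])⟩
  refine ⟨e', F', S', K', h'.mem, h'.normal, h'.ext, fun y hy => h'.vanish y hy ?_ ?_⟩
  · have h3 := (hy' y hy).1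
    rw [hγ y (hB' (hsub hy))] at h3
    simpa using h3
  · have h3 := (hy' y hy).2 (hγ y (hB' (hsub hy)))
    rw [hCd y (hB (hsub hy))] at h3
    simpa using h3

end

end

/-! ### Explicit straightening of an anchor that is the identity on T -/

section

attribute [local irreducible] ins wd wedge prodN prodE

variable {n : ℕ}

/-- The reconstruction of a totally antisymmetric `f : Λᵏ⁺¹T* → T`. -/
theorem sum_proj_ins_ext1 {k : ℕ} (f : Form n (k + 1) →ₗ[ℝ] T n)
    (hf : ∀ (α : T n →L[ℝ] ℝ) (κ : Form n k), α (f (ext1 α κ)) = 0) (β : T n →L[ℝ] ℝ)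
    (σ : Form n (k + 1)) :
    ∑ i, f (ins (vec i) (ext1 β σ)) i = ((k : ℝ) + 2) * β (f σ) := by
  have h1 : ∀ (i : Fin n) (κ : Form n k),
      f (ext1 β κ) i = -β (f (ext1 (EuclideanSpace.proj i) κ)) := by
    intro i κ
    have h := hf (β + EuclideanSpace.proj i) κ
    rw [← ext1L_apply, map_add, LinearMap.add_apply, map_add, add_apply, map_add, map_add,
      ext1L_apply, ext1L_apply, hf, hf, zero_add, add_zero] at h
    exact eq_neg_of_add_eq_zero_right h
  have h2 : ∀ i, f (ins (vec i) (ext1 β σ)) i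
      = β (vec i) * f σ i + β (f (ext1 (EuclideanSpace.proj i) (ins (vec i) σ))) := by
    intro i
    rw [ins_ext1, map_sub, map_smul]
    show β (vec i) * f σ i - f (ext1 β (ins (vec i) σ)) i = _
    rw [h1, sub_neg_eq_add]
  simp only [h2]
  rw [Finset.sum_add_distrib, ← map_sum, ← map_sum, sum_ext1_ins, map_smul, map_smul, smul_eq_mul]
  have h3 : β (f σ) = ∑ i, β (vec i) * f σ i := by
    conv_lhs => rw [eq_sum_proj β]
    rw [sum_apply]
    rfl
  rw [← h3]
  ring

/-- The functional on 3-forms that straightens the anchor `l` on 2-forms. -/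
def triW (n : ℕ) : (EMod n →L[ℝ] T n) →L[ℝ] Form n 3 →L[ℝ] ℝ :=
  LinearMap.toContinuousLinearMap
    { toFun := fun l => (3⁻¹ : ℝ) • ∑ i, triFun l (EuclideanSpace.proj i) (vec i)
      map_add' := fun l l' => by
        ext φ
        simp only [smul_apply, sum_apply, add_apply, triFun_apply, ← smul_add,
          ← Finset.sum_add_distrib, map_add, neg_add]
      map_smul' := fun c l => by
        ext φ
        simp only [smul_apply, sum_apply, triFun_apply, map_smul, RingHom.id_apply, smul_eq_mul,
          Finset.mul_sum]
        exact Finset.sum_congr rfl fun i _ => by ring }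

theorem triW_apply (l : EMod n →L[ℝ] T n) (φ : Form n 3) :
    triW n l φ = -(3⁻¹ * ∑ i, l (0, ins (vec i) φ, 0) i) := by
  show ((3⁻¹ : ℝ) • ∑ i, triFun l (EuclideanSpace.proj i) (vec i)) φ = _
  rw [smul_apply, sum_apply, smul_eq_mul, ← mul_neg, ← Finset.sum_neg_distrib]
  rfl

/-- The functional on 6-forms that straightens the anchor `l` on 5-forms. -/
def sixW (n : ℕ) : (EMod n →L[ℝ] T n) →L[ℝ] Form n 6 →L[ℝ] ℝ :=
  LinearMap.toContinuousLinearMap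
    { toFun := fun l => (6⁻¹ : ℝ) • ∑ i, sixFun l (EuclideanSpace.proj i) (vec i)
      map_add' := fun l l' => by
        ext φ
        simp only [smul_apply, sum_apply, add_apply, sixFun_apply, ← smul_add,
          ← Finset.sum_add_distrib, map_add]
      map_smul' := fun c l => by
        ext φ
        simp only [smul_apply, sum_apply, sixFun_apply, map_smul, RingHom.id_apply, smul_eq_mul,
          Finset.mul_sum]
        exact Finset.sum_congr rfl fun i _ => by ring }

theorem sixW_apply (l : EMod n →L[ℝ] T n) (φ : Form n 6) :
    sixW n l φ = 6⁻¹ * ∑ i, l (0, 0, ins (vec i) φ) i := by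
  show ((6⁻¹ : ℝ) • ∑ i, sixFun l (EuclideanSpace.proj i) (vec i)) φ = _
  rw [smul_apply, sum_apply, smul_eq_mul]
  rfl

/-- The restriction of `l` to 2-forms. -/
def twoPart (l : EMod n →L[ℝ] T n) : Form n 2 →ₗ[ℝ] T n :=
  (l : EMod n →ₗ[ℝ] T n) ∘ₗ LinearMap.inr ℝ (T n) (Form n 2 × Form n 5) ∘ₗ
    LinearMap.inl ℝ (Form n 2) (Form n 5)

theorem twoPart_apply (l : EMod n →L[ℝ] T n) (σ : Form n 2) : twoPart l σ = l (0, σ, 0) := rfl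

/-- The restriction of `l` to 5-forms. -/
def fivePart (l : EMod n →L[ℝ] T n) : Form n 5 →ₗ[ℝ] T n :=
  (l : EMod n →ₗ[ℝ] T n) ∘ₗ LinearMap.inr ℝ (T n) (Form n 2 × Form n 5) ∘ₗ
    LinearMap.inr ℝ (Form n 2) (Form n 5)

theorem fivePart_apply (l : EMod n →L[ℝ] T n) (σ : Form n 5) : fivePart l σ = l (0, 0, σ) := rfl

variable {l : EMod n →L[ℝ] T n}

/-- Isotropy reads α(l(α ∧ κ)) = 0 when l is the identity on T, so l on 2-forms is contraction with
a trivector. Its trace over a basis recovers the trivector three times, whence the factor 1/3 in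
`triW`. -/
theorem IsGoodAnchor.apply_exp_tri (h : IsGoodAnchor l) (hl : ∀ X, l (X, 0, 0) = X) (X : T n)
    (σ : Form n 2) : l (NormedSpace.exp (triPair n (triW n l)).1 (X, σ, 0)) = X := by
  have hp : ∀ α, pullT l α = α := fun α =>
    ContinuousLinearMap.ext fun X => by rw [pullT_apply, hl]
  obtain ⟨x, hx⟩ : ∃ x, x = (triPair n (triW n l)).1 := ⟨_, rfl⟩
  have hX : ∀ X, x (X, 0, 0) = 0 := fun X => Prod.ext (by rw [hx]; exact triPair_fst _ rfl)
    (Prod.ext (by rw [hx]; exact triPair_snd_fst _ rfl) (by rw [hx]; exact triPair_snd_snd _ _))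
  have h1 : x (0, σ, 0) = (-twoPart l σ, 0, 0) := by
    refine Prod.ext (eq_of_cov_eq fun β => ?_) (Prod.ext (by rw [hx]; exact triPair_snd_fst _ rfl)
      (by rw [hx]; exact triPair_snd_snd _ _))
    obtain ⟨b, rfl⟩ : ∃ b, β = oneForm b := ⟨cov β, (oneForm_cov β).symm⟩
    have h2 := sum_proj_ins_ext1 (twoPart l) (fun α κ => by
      have := h.self_wd_one α κ
      rwa [hp, wd_oneForm] at this) b σ
    rw [hx, cov_triPair, triW_apply, wd_oneForm, cov_oneForm, map_neg, neg_inj]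
    refine (congrArg (3⁻¹ * ·) h2).trans ?_
    push_cast
    ring
  have h3 : x (X, σ, 0) = (-twoPart l σ, 0, 0) := by
    rw [EMod.eq_add (X, σ, 0), map_add, map_add, h1, hX, hX, zero_add, add_zero]
  rw [← hx, exp_apply_of_sq_eq_zero (by rw [h3, hX]), h3, EMod.eq_add (X, σ, 0), map_add, map_add,
    map_add, hl, hl, hl, ← twoPart_apply]
  simp

/-- The same reconstruction in degree five gives 6 copies. Isotropy in that degree requires the
2-form part to have been removed first. -/
theorem IsGoodAnchor.apply_exp_six (h : IsGoodAnchor l) (hl : ∀ X σ, l (X, σ, 0) = X)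
    (u : EMod n) : l (NormedSpace.exp (sixPair n (sixW n l)).1 u) = u.1 := by
  have hp : ∀ α, pullT l α = α := fun α =>
    ContinuousLinearMap.ext fun X => by rw [pullT_apply, hl]
  obtain ⟨x, hx⟩ : ∃ x, x = (sixPair n (sixW n l)).1 := ⟨_, rfl⟩
  have hX : ∀ X σ, x (X, σ, 0) = 0 := fun X σ => by rw [hx]; exact sixPair_eq_zero _ rfl
  have h1 : x (0, 0, u.2.2) = (-fivePart l u.2.2, 0, 0) := by
    refine Prod.ext (eq_of_cov_eq fun β => ?_) (by rw [hx]; exact sixPair_snd _ _)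
    obtain ⟨b, rfl⟩ : ∃ b, β = oneForm b := ⟨cov β, (oneForm_cov β).symm⟩
    have h2 := sum_proj_ins_ext1 (fivePart l) (fun α κ => by
      have := h.self_wd_four (α := α) (fun σ => by rw [hl, map_zero]) κ
      rwa [hp, wd_oneForm] at this) b u.2.2
    rw [hx, cov_sixPair, sixW_apply, wd_oneForm, cov_oneForm, map_neg, neg_inj]
    refine (congrArg (6⁻¹ * ·) h2).trans ?_
    push_cast
    ring
  have hu : u = (u.1, u.2.1, 0) + (0, 0, u.2.2) := by simp
  have h3 : x u = (-fivePart l u.2.2, 0, 0) := by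
    rw [hu, map_add, h1, hX]
    simp
  rw [← hx, exp_apply_of_sq_eq_zero (by rw [h3, hX]), h3, hu, map_add, map_add, hl, hl,
    ← fivePart_apply]
  simp

theorem exp_comm_apply {V W : Type*} [NormedAddCommGroup V] [NormedSpace ℝ V] [CompleteSpace V]
    [NormedAddCommGroup W] [NormedSpace ℝ W] [CompleteSpace W] (j : W →L[ℝ] V) {x : V →L[ℝ] V}
    {B : W →L[ℝ] W} (h : ∀ w, x (j w) = j (B w)) (w : W) :
    NormedSpace.exp x (j w) = j (NormedSpace.exp B w) := by
  have hk : ∀ (k : ℕ) w, (x ^ k) (j w) = j ((B ^ k) w) := by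
    intro k
    induction k with
    | zero => exact fun _ => rfl
    | succ k ih =>
      intro w
      rw [pow_succ, pow_succ, mul_apply_eq_comp, mul_apply_eq_comp, h, ih]
  have h1 := (NormedSpace.exp_series_hasSum_exp' (𝕂 := ℝ) x).mapL
    (ContinuousLinearMap.apply ℝ V (j w))
  have h2 := (NormedSpace.exp_series_hasSum_exp' (𝕂 := ℝ) B).mapL
    (j.comp (ContinuousLinearMap.apply ℝ W w))
  have h3 : (fun k : ℕ => ContinuousLinearMap.apply ℝ V (j w) ((k.factorial : ℝ)⁻¹ • x ^ k))
      = fun k => (j.comp (ContinuousLinearMap.apply ℝ W w)) ((k.factorial : ℝ)⁻¹ • B ^ k) := by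
    funext k
    show (k.factorial : ℝ)⁻¹ • (x ^ k) (j w) = j ((k.factorial : ℝ)⁻¹ • (B ^ k) w)
    rw [hk, map_smul]
  exact (h3 ▸ h1).unique h2

theorem exp_glE_apply (B : T n →L[ℝ] T n) (X : T n) :
    NormedSpace.exp (glE B) (X, 0, 0) = (NormedSpace.exp B X, 0, 0) :=
  exp_comm_apply (ContinuousLinearMap.inl ℝ (T n) (Form n 2 × Form n 5)) (fun w => by
    show glE B (w, 0, 0) = (B w, 0, 0)
    rw [glE_apply, ← glActL_apply, ← glActL_apply, map_zero, map_zero]) X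

/-- A smooth local logarithm. -/
theorem exists_exp_eq (V : Type*) [NormedAddCommGroup V] [NormedSpace ℝ V] [CompleteSpace V] :
    ∃ (U : Set (V →L[ℝ] V)) (L : (V →L[ℝ] V) → V →L[ℝ] V), IsOpen U ∧ 1 ∈ U ∧
      ContDiffOn ℝ ∞ L U ∧ ∀ a ∈ U, NormedSpace.exp (L a) = a := by
  have h0 : ContDiffAt ℝ ω (NormedSpace.exp : (V →L[ℝ] V) → V →L[ℝ] V) 0 :=
    (NormedSpace.exp_analytic (𝕂 := ℝ) 0).contDiffAt
  have h1 : HasFDerivAt (NormedSpace.exp : (V →L[ℝ] V) → V →L[ℝ] V)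
      ((ContinuousLinearEquiv.refl ℝ (V →L[ℝ] V) : (V →L[ℝ] V) →L[ℝ] _)) 0 :=
    hasFDerivAt_exp_zero
  have h2 := h0.to_localInverse h1 (by simp)
  have h3 := (h0.hasStrictFDerivAt' h1 (by simp)).eventually_right_inverse
  rw [NormedSpace.exp_zero] at h2 h3
  obtain ⟨U, hU, hUo, h1U⟩ := eventually_nhds_iff.1 ((h2.eventually (by simp)).and h3)
  exact ⟨U, _, hUo, h1U, fun a ha => ((hU a ha).1.of_le le_top).contDiffWithinAt, fun a ha => (hU a ha).2⟩

end

/-! ### Existence of normal frames -/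

section

attribute [local irreducible] ins wd wedge prodN prodE

section

variable {n : ℕ} {M : Type*} [TopologicalSpace M]
  [ChartedSpace (EuclideanSpace ℝ (Fin n)) M] [IsManifold (𝓡 n) ∞ M]
  {E : M → Type*} [∀ x, AddCommGroup (E x)] [∀ x, Module ℝ (E x)] [∀ x, TopologicalSpace (E x)]
  [TopologicalSpace (TotalSpace (EMod n) E)] [FiberBundle (EMod n) E] [VectorBundle ℝ (EMod n) E]
  [ContMDiffVectorBundle ∞ (EMod n) E (𝓡 n)]
  {N : M → Type*} [∀ x, AddCommGroup (N x)] [∀ x, Module ℝ (N x)] [∀ x, TopologicalSpace (N x)]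
  [TopologicalSpace (TotalSpace (NMod n) N)] [FiberBundle (NMod n) N] [VectorBundle ℝ (NMod n) N]
  [ContMDiffVectorBundle ∞ (NMod n) N (𝓡 n)]
  {A : Elgebroid n n M E N} {e : OpenPartialHomeomorph M (T n)} {F : ∀ x, Frame n E N x}

/-- The anchor in a chart and a frame. -/
def anchorL (A : Elgebroid n n M E N) (e : OpenPartialHomeomorph M (T n))
    (F : ∀ x, Frame n E N x) (x : M) : EMod n →L[ℝ] T n :=
  (mfderiv (𝓡 n) 𝓘(ℝ, T n) e x).comp ((A.anchor x).comp ((F x).1 : EMod n →L[ℝ] E x))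

theorem anchorL_apply (x : M) (u : EMod n) :
    anchorL A e F x u = dirDeriv e x (A.anchor x ((F x).1 u)) := rfl

theorem IsChartFrame.restr (h : IsChartFrame A e F) {O : Set M} (hO : IsOpen O) :
    IsChartFrame A (e.restrOpen O hO) F where
  smooth := h.smooth.mono Set.inter_subset_left
  smooth_symm := h.smooth_symm.mono Set.inter_subset_left
  smooth_fiber := ⟨fun a => (h.smooth_fiber.1 a).mono Set.inter_subset_left,
    fun a => (h.smooth_fiber.2 a).mono Set.inter_subset_left⟩
  frames := fun x hx => h.frames x hx.1

theorem anchorL_gaugeFrame (x : T n → EndPair n) (p : M) (u : EMod n) :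
    anchorL A e (gaugeFrame e F x) p u
      = anchorL A e F p (NormedSpace.exp (x (e p)).1 u) := rfl

theorem IsChartFrame.trans (h : IsChartFrame A e F)
    {q : (EMod n ≃L[ℝ] EMod n) × (NMod n ≃L[ℝ] NMod n)} (hq : q ∈ excPairs n) :
    IsChartFrame A e fun x => (q.1.trans (F x).1, q.2.trans (F x).2) where
  smooth := h.smooth
  smooth_symm := h.smooth_symm
  smooth_fiber := IsSmoothFrameOn.trans (g₁ := fun _ => q.1) (g₂ := fun _ => q.2) h.smooth_fiber
    (fun _ => contMDiffOn_const) (fun _ => contMDiffOn_const)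
  frames := fun _ hp => A.trans_mem_frames (h.frames _ hp) hq

theorem IsChartFrame.mdifferentiable (h : IsChartFrame A e F) :
    e.MDifferentiable (𝓡 n) (𝓡 n) :=
  ⟨h.smooth.mdifferentiableOn (by simp), h.smooth_symm.mdifferentiableOn (by simp)⟩

/-- The image of T*M ⊗ N lies in the kernel of ρ, and the pairing may be computed in any G-frame;
this gives isotropy for every group element. -/
theorem IsChartFrame.isGoodAnchor (hA : A.IsExact) (h : IsChartFrame A e F) {x : M}
    (hx : x ∈ e.source) : IsGoodAnchor (anchorL A e F x) := by
  refine ⟨?_, fun q hq α k => ?_⟩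
  · exact (h.mdifferentiable.mfderiv_surjective hx).comp ((hA x).2.comp (F x).1.surjective)
  · have hF := A.trans_mem_frames (h.frames x hx) hq
    have h1 : (F x).1 (q.1 (prodE (α.comp ((anchorL A e F x).comp
        (q.1 : EMod n →L[ℝ] EMod n))) k)) ∈ A.imageAt x := by
      refine Submodule.subset_span ⟨_, hF, α.comp (mfderiv (𝓡 n) 𝓘(ℝ, T n) e x),
        (F x).2 (q.2 k), ?_⟩
      show _ = (F x).1 (q.1 (prodE _ (q.2.symm ((F x).2.symm ((F x).2 (q.2 k))))))
      rw [ContinuousLinearEquiv.symm_apply_apply, ContinuousLinearEquiv.symm_apply_apply]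
      rfl
    rw [(hA x).1] at h1
    have h2 : A.anchor x ((F x).1 (q.1 (prodE (α.comp ((anchorL A e F x).comp
        (q.1 : EMod n →L[ℝ] EMod n))) k))) = 0 := h1
    rw [anchorL_apply, h2]
    exact map_zero (mfderiv (𝓡 n) 𝓘(ℝ, T n) e x)

theorem IsChartFrame.contMDiffOn_anchorL (h : IsChartFrame A e F) :
    ContMDiffOn (𝓡 n) 𝓘(ℝ, EMod n →L[ℝ] T n) ∞ (anchorL A e F) e.source := by
  refine contMDiffOn_clm fun a => ?_
  have h1 : ContMDiffOn (𝓡 n) (𝓡 n).tangent ∞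
      (fun x => (⟨x, A.anchor x ((F x).1 a)⟩ : TangentBundle (𝓡 n) M)) e.source :=
    A.anchor_smooth.comp_contMDiffOn (h.smooth_fiber.1 a)
  have h2 := h.smooth.contMDiffOn_tangentMapWithin (m := ∞) le_rfl e.open_source.uniqueMDiffOn
  have h3 := (contMDiff_snd_tangentBundle_modelSpace (T n) (𝓡 n) (n := ∞)).comp_contMDiffOn
    (h2.comp h1 fun x hx => hx)
  refine h3.congr fun x hx => ?_
  show mfderiv (𝓡 n) 𝓘(ℝ, T n) e x _ = mfderivWithin (𝓡 n) 𝓘(ℝ, T n) e e.source x _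
  rw [mfderivWithin_of_isOpen e.open_source hx]
  rfl

theorem IsChartFrame.contDiffOn_anchorL (h : IsChartFrame A e F) :
    ContDiffOn ℝ ∞ (fun z => anchorL A e F (e.symm z)) e.target :=
  (h.contMDiffOn_anchorL.comp h.smooth_symm e.mapsTo_symm).contDiffOn

theorem Elgebroid.exists_isChartFrame (A : Elgebroid n n M E N) (p : M) :
    ∃ e F, IsChartFrame A e F ∧ p ∈ e.source := by
  obtain ⟨U, hU, hp, F, hF, hFf⟩ := A.frames_smooth p
  refine ⟨(chartAt (EuclideanSpace ℝ (Fin n)) p).restrOpen U hU, F,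
    ⟨(contMDiffOn_chart (n := ∞)).mono Set.inter_subset_left,
      (contMDiffOn_chart_symm (n := ∞)).mono Set.inter_subset_left,
      ⟨fun a => (hF.1 a).mono Set.inter_subset_right,
        fun a => (hF.2 a).mono Set.inter_subset_right⟩, fun x hx => hFf x hx.2⟩,
    mem_chart_source _ p, hp⟩

theorem IsChartFrame.transHomeomorph (h : IsChartFrame A e F) (Λ : T n ≃L[ℝ] T n) :
    IsChartFrame A (e.transHomeomorph Λ.toHomeomorph) F where
  smooth := Λ.contDiff.contMDiff.comp_contMDiffOn h.smooth
  smooth_symm := h.smooth_symm.comp Λ.symm.contDiff.contMDiff.contMDiffOn fun _ hx => hx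
  smooth_fiber := h.smooth_fiber
  frames := h.frames

theorem IsChartFrame.anchorL_transHomeomorph (h : IsChartFrame A e F) (Λ : T n ≃L[ℝ] T n) {x : M}
    (hx : x ∈ e.source) (u : EMod n) :
    anchorL A (e.transHomeomorph Λ.toHomeomorph) F x u = Λ (anchorL A e F x u) := by
  have h1 : mfderiv (𝓡 n) 𝓘(ℝ, T n) (Λ ∘ e) x
      = (Λ : T n →L[ℝ] T n).comp (mfderiv (𝓡 n) 𝓘(ℝ, T n) e x) := by
    rw [mfderiv_comp x (I' := 𝓘(ℝ, T n)) Λ.differentiable.mdifferentiable.mdifferentiableAt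
      (h.mdifferentiable.mdifferentiableAt hx), mfderiv_eq_fderiv, Λ.fderiv]
    rfl
  exact congrArg (fun f : TangentSpace (𝓡 n) x →L[ℝ] T n => f (A.anchor x ((F x).1 u))) h1

/-- Near every point there is a chart and a frame for which the anchor at the point is the
projection. -/
theorem Elgebroid.exists_isChartFrame_anchorL_eq (hn' : n ≤ 6) (hA : A.IsExact) (p : M) :
    ∃ e F, IsChartFrame A e F ∧ p ∈ e.source ∧ ∀ u, anchorL A e F p u = u.1 := by
  obtain ⟨e, F, h, hp⟩ := A.exists_isChartFrame p
  obtain ⟨q, hq, hs⟩ := (h.isGoodAnchor hA hp).exists_straight_eq_top hn'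
  have h' := h.trans hq
  have hg := (h'.isGoodAnchor hA hp).1
  have hs' : straight (anchorL A e (fun x => (q.1.trans (F x).1, q.2.trans (F x).2)) p) = ⊤ := hs
  generalize (fun x => (q.1.trans (F x).1, q.2.trans (F x).2)) = F' at h' hg hs'
  have h1 : ∀ u, anchorL A e F' p u = anchorL A e F' p (u.1, 0, 0) := by
    intro u
    refine eq_of_cov_eq fun β => ?_
    rw [apply_of_mem_straight (hs' ▸ Submodule.mem_top : cov β ∈ straight _), pullT_apply]
  have h2 : Function.Surjective
      ((anchorL A e F' p).comp (ContinuousLinearMap.inl ℝ (T n) (Form n 2 × Form n 5))) := by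
    intro X
    obtain ⟨u, hu⟩ := hg X
    exact ⟨u.1, (h1 u).symm.trans hu⟩
  obtain ⟨Λ, hΛ⟩ : ∃ Λ : T n ≃L[ℝ] T n, ∀ X, Λ X = anchorL A e F' p (X, 0, 0) :=
    ⟨(LinearEquiv.ofBijective _ ⟨LinearMap.injective_iff_surjective.2 h2,
      h2⟩ : T n ≃ₗ[ℝ] T n).toContinuousLinearEquiv, fun _ => rfl⟩
  refine ⟨_, F', h'.transHomeomorph Λ.symm, hp, fun u => ?_⟩
  rw [h'.anchorL_transHomeomorph _ hp, h1, ← hΛ, ContinuousLinearEquiv.symm_apply_apply]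

set_option maxHeartbeats 400000 in
-- The pointwise straightening depends on choices and need not be smooth, so it is applied at p
-- only. Near p three smooth gauge transformations correct the anchor on T, on 2-forms and on
-- 5-forms, in this order.
theorem Elgebroid.exists_isNormalFrame (hn' : n ≤ 6) (hA : A.IsExact) (p : M) :
    ∃ e F, IsNormalFrame A e F ∧ p ∈ e.source := by
  obtain ⟨e₀, F₀, h₀, hp₀, hl₀⟩ := A.exists_isChartFrame_anchorL_eq hn' hA p
  obtain ⟨U, Lg, hU, h1U, hLg, hexp⟩ := exists_exp_eq (T n)
  obtain ⟨l, hl⟩ : ∃ l : T n → T n →L[ℝ] T n, l = fun z => (anchorL A e₀ F₀ (e₀.symm z)).comp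
    (ContinuousLinearMap.inl ℝ (T n) (Form n 2 × Form n 5)) := ⟨_, rfl⟩
  have hls : ContDiffOn ℝ ∞ l e₀.target := hl ▸ h₀.contDiffOn_anchorL.clm_comp contDiffOn_const
  -- Restrict to where the T-part l of the anchor is close enough to the identity to have a smooth
  -- logarithm.
  have hO : IsOpen (e₀.source ∩ e₀ ⁻¹' (e₀.target ∩ l ⁻¹' U)) :=
    e₀.isOpen_inter_preimage (hls.continuousOn.isOpen_inter_preimage e₀.open_target hU)
  have hlp : l (e₀ p) = 1 := by
    rw [hl]
    refine ContinuousLinearMap.ext fun X => ?_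
    show anchorL A e₀ F₀ (e₀.symm (e₀ p)) (X, 0, 0) = X
    rw [e₀.left_inv hp₀, hl₀]
  obtain ⟨e, h, hp, ht, hlU, hle⟩ : ∃ e, IsChartFrame A e F₀ ∧ p ∈ e.source ∧
      e.target ⊆ e₀.target ∧ (∀ z ∈ e.target, l z ∈ U) ∧ ∀ x ∈ e.source, ∀ X,
        anchorL A e F₀ x (X, 0, 0) = l (e x) X := by
    refine ⟨e₀.restrOpen _ hO, h₀.restr hO, ⟨hp₀, hp₀, e₀.map_source hp₀, ?_⟩,
      Set.inter_subset_left, fun z hz => ?_, fun x hx X => ?_⟩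
    · show l (e₀ p) ∈ U
      rwa [hlp]
    · have h1 : l (e₀ (e₀.symm z)) ∈ U := hz.2.2.2
      rwa [e₀.right_inv hz.1] at h1
    · have h1 : l (e₀ x) X = anchorL A e₀ F₀ (e₀.symm (e₀ x)) (X, 0, 0) := by rw [hl]; rfl
      rw [e₀.left_inv hx.1] at h1
      exact h1.symm
  clear hO hlp hl
  -- Acting with exp(-log l) on T composes l with its inverse.
  have h₁ := h.gaugeFrame (x := fun z => glPair n (-Lg (l z)))
    ((glPair n).contDiff.comp_contDiffOn (hLg.comp (hls.mono ht) hlU).neg)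
    fun z => gl_mem_infPairs _
  have hl₁ : ∀ x ∈ e.source, ∀ X,
      anchorL A e (gaugeFrame e F₀ fun z => glPair n (-Lg (l z))) x (X, 0, 0) = X := by
    intro x hx X
    rw [anchorL_gaugeFrame]
    show anchorL A e F₀ x (NormedSpace.exp (glE (-Lg (l (e x)))) (X, 0, 0)) = X
    rw [exp_glE_apply, hle x hx]
    nth_rw 1 [← hexp _ (hlU _ (e.map_source hx))]
    exact exp_apply_exp_neg_apply _ _
  generalize (gaugeFrame e F₀ fun z => glPair n (-Lg (l z))) = F₁ at h₁ hl₁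
  have h₂ := h₁.gaugeFrame (x := fun z => triPair n (triW n (anchorL A e F₁ (e.symm z))))
    (((triPair n).comp (triW n)).contDiff.comp_contDiffOn h₁.contDiffOn_anchorL)
    fun z => triPair_mem hn' _
  have hl₂ : ∀ x ∈ e.source, ∀ X σ, anchorL A e (gaugeFrame e F₁
      fun z => triPair n (triW n (anchorL A e F₁ (e.symm z)))) x (X, σ, 0) = X := by
    intro x hx X σ
    rw [anchorL_gaugeFrame, e.left_inv hx]
    exact (h₁.isGoodAnchor hA hx).apply_exp_tri (hl₁ x hx) X σ
  generalize (gaugeFrame e F₁ fun z => triPair n (triW n (anchorL A e F₁ (e.symm z)))) = F₂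
    at h₂ hl₂
  have h₃ := h₂.gaugeFrame (x := fun z => sixPair n (sixW n (anchorL A e F₂ (e.symm z))))
    (((sixPair n).comp (sixW n)).contDiff.comp_contDiffOn h₂.contDiffOn_anchorL)
    fun z => sixPair_mem hn' _
  refine ⟨e, _, ⟨h₃.smooth, h₃.smooth_symm, h₃.smooth_fiber, h₃.frames, fun x hx u => ?_⟩, hp⟩
  rw [← anchorL_apply, anchorL_gaugeFrame, e.left_inv hx]
  exact (h₂.isGoodAnchor hA hx).apply_exp_six (hl₂ x hx) u

end

end

/-! ### Comparison with the exceptional tangent bundle -/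

section

theorem wedge_two_three {n : ℕ} (a : Form n 2) (b : Form n 3) :
    (wedge a b : Form n 5) = wd (rfl : 2 + 3 = 5) a b := rfl

attribute [local irreducible] ins wd wedge prodN prodE

section

variable {n : ℕ}

theorem ins_extDeriv {k : ℕ} (σ : T n → Form n (k + 1)) (y X : T n) :
    ins X (extDeriv σ y) = fderiv ℝ σ y X
      - ∑ j, ext1 (EuclideanSpace.proj j) (ins X (fderiv ℝ σ y (vec j))) := by
  rw [extDeriv_eq_sum, ← insL_apply, map_sum]
  simp only [insL_apply, ins_ext1, Finset.sum_sub_distrib]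
  rw [sum_proj_smul]

theorem fderiv_ins_ins {k : ℕ} {X : T n → T n} {τ : T n → Form n (k + 1)} {y : T n}
    (hX : DifferentiableAt ℝ X y) (hτ : DifferentiableAt ℝ τ y) (Z : T n) :
    fderiv ℝ (fun z => ins (X z) (τ z)) y Z
      = ins (X y) (fderiv ℝ τ y Z) + ins (fderiv ℝ X y Z) (τ y) :=
  congrArg (· Z) ((insC n k).hasFDerivAt_of_bilinear hX.hasFDerivAt hτ.hasFDerivAt).fderiv

theorem lieD_eq {k : ℕ} {X : T n → T n} {τ : T n → Form n (k + 1)} {y : T n}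
    (hX : DifferentiableAt ℝ X y) (hτ : DifferentiableAt ℝ τ y) :
    lieD X τ y = fderiv ℝ τ y (X y)
      + ∑ j, ext1 (EuclideanSpace.proj j) (ins (fderiv ℝ X y (vec j)) (τ y)) := by
  rw [lieD, ins_extDeriv, extDeriv_eq_sum]
  simp only [fderiv_ins_ins hX hτ]
  simp only [← ext1L_apply, map_add, Finset.sum_add_distrib]
  abel

theorem sum_ext1_wd (f : T n →L[ℝ] Form n 2) (τ : Form n 2) :
    ∑ j, ext1 (EuclideanSpace.proj j) (wd (rfl : 2 + 2 = 4) (f (vec j)) τ)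
      = wd (rfl : 2 + 3 = 5) τ (∑ j, ext1 (EuclideanSpace.proj j) (f (vec j))) := by
  rw [map_sum]
  refine Finset.sum_congr rfl fun j _ => ?_
  rw [← wd_oneForm (rfl : 1 + 4 = 5), ← wd_oneForm (rfl : 1 + 2 = 3), wd_wd_one,
    wd_comm_even (by decide) (rfl : 2 + 2 = 4)]
  norm_num

/-- The projection of `E` to the 5-forms. -/
def projFiveC (n : ℕ) : EMod n →L[ℝ] Form n 5 :=
  (ContinuousLinearMap.snd ℝ (Form n 2) (Form n 5)).comp
    (ContinuousLinearMap.snd ℝ (T n) (Form n 2 × Form n 5))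

theorem fderiv_five {u : T n → EMod n} {y : T n} (hu : DifferentiableAt ℝ u y) (X : T n) :
    (fderiv ℝ u y X).2.2 = fderiv ℝ (fun z => (u z).2.2) y X :=
  congrArg (· X) ((projFiveC n).hasFDerivAt.comp y hu.hasFDerivAt).fderiv.symm

/-- Expand L_X by Cartan's formula and d in coordinates. The three derivative terms in (∂ⱼu ⊗ v)_N
account for L_X, for i_{X'}d, and for the term σ₂' ∧ dσ₂, where moving eʲ past a 2-form costs no
sign. -/
theorem etbBracket_eq_twistedBracket {u v : T n → EMod n} {y : T n} (hu : DifferentiableAt ℝ u y)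
    (hv : DifferentiableAt ℝ v y) : etbBracket u v y = twistedBracket (fun _ => 0) u v y := by
  have hX : DifferentiableAt ℝ (fun z => (u z).1) y := hu.fst
  have hσ : DifferentiableAt ℝ (fun z => (u z).2.1) y := hu.snd.fst
  have hτ : DifferentiableAt ℝ (fun z => (v z).2.1) y := hv.snd.fst
  have hτ₅ : DifferentiableAt ℝ (fun z => (v z).2.2) y := hv.snd.snd
  refine Prod.ext ?_ (Prod.ext ?_ ?_)
  · show VectorField.lieBracket ℝ (fun z => (u z).1) (fun z => (v z).1) y = _
    rw [VectorField.lieBracket, twistedBracket]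
    simp only [Prod.fst_add, Prod.fst_sub, Prod.fst_sum, prodT_eq_ext1, Finset.sum_const_zero,
      fderiv_fst hu, fderiv_fst hv, LinearMap.zero_apply, add_zero]
  · show lieD (fun z => (u z).1) (fun z => (v z).2.1) y
      - ins (v y).1 (extDeriv (fun z => (u z).2.1) y) = _
    rw [twistedBracket_two, lieD_eq hX hτ, ins_extDeriv]
    simp only [fderiv_two hu, fderiv_two hv, fderiv_fst hu, LinearMap.zero_apply, Prod.snd_zero,
      Prod.fst_zero, ← ext1L_apply, map_add, Finset.sum_add_distrib]
    abel
  · show lieD (fun z => (u z).1) (fun z => (v z).2.2) y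
      - ins (v y).1 (extDeriv (fun z => (u z).2.2) y)
      - (wedge (v y).2.1 (extDeriv (fun z => (u z).2.1) y) : Form n 5) = _
    rw [wedge_two_three, lieD_eq hX hτ₅, ins_extDeriv, extDeriv_eq_sum, ← sum_ext1_wd, twistedBracket]
    simp only [Prod.snd_add, Prod.snd_sub, Prod.snd_sum, prodT_eq_ext1, prodN_eq, fderiv_five hu,
      fderiv_five hv, fderiv_fst hu, fderiv_two hu, LinearMap.zero_apply, Prod.snd_zero,
      ← ext1L_apply, map_add, map_sub, Finset.sum_add_distrib, Finset.sum_sub_distrib]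
    abel

theorem etbD_eq {k : T n → NMod n} {y : T n} (hk : DifferentiableAt ℝ k y) :
    etbD k y = ∑ j, prodT (EuclideanSpace.proj j) (fderiv ℝ k y (vec j)) := by
  have h1 : ∀ X, (fderiv ℝ k y X).1 = fderiv ℝ (fun z => (k z).1) y X := fun X =>
    congrArg (· X) ((ContinuousLinearMap.fst ℝ (Form n 1) _).hasFDerivAt.comp y
      hk.hasFDerivAt).fderiv.symm
  have h4 : ∀ X, (fderiv ℝ k y X).2.1 = fderiv ℝ (fun z => (k z).2.1) y X := fun X =>
    congrArg (· X) (((ContinuousLinearMap.fst ℝ (Form n 4) _).comp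
      (ContinuousLinearMap.snd ℝ (Form n 1) _)).hasFDerivAt.comp y hk.hasFDerivAt).fderiv.symm
  rw [etbD]
  refine Prod.ext ?_ (Prod.ext ?_ ?_)
  · simp only [Prod.fst_sum, prodT_eq_ext1, Finset.sum_const_zero]
  · simp only [Prod.snd_sum, Prod.fst_sum, prodT_eq_ext1, h1, extDeriv_eq_sum]
  · simp only [Prod.snd_sum, prodT_eq_ext1, h4, extDeriv_eq_sum]

end

section

variable {n : ℕ} {M : Type*} [TopologicalSpace M]
  [ChartedSpace (EuclideanSpace ℝ (Fin n)) M] [IsManifold (𝓡 n) ∞ M]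
  {E : M → Type*} [∀ x, AddCommGroup (E x)] [∀ x, Module ℝ (E x)] [∀ x, TopologicalSpace (E x)]
  [TopologicalSpace (TotalSpace (EMod n) E)] [FiberBundle (EMod n) E] [VectorBundle ℝ (EMod n) E]
  [ContMDiffVectorBundle ∞ (EMod n) E (𝓡 n)]
  {N : M → Type*} [∀ x, AddCommGroup (N x)] [∀ x, Module ℝ (N x)] [∀ x, TopologicalSpace (N x)]
  [TopologicalSpace (TotalSpace (NMod n) N)] [FiberBundle (NMod n) N] [VectorBundle ℝ (NMod n) N]
  [ContMDiffVectorBundle ∞ (NMod n) N (𝓡 n)]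
  {A : Elgebroid n n M E N} {e : OpenPartialHomeomorph M (T n)} {F : ∀ x, Frame n E N x}
  {S : EMod n →ₗ[ℝ] Sec n (EMod n) E} {K : NMod n →ₗ[ℝ] Sec n (NMod n) N}

theorem Elgebroid.mem_frames_iff (A : Elgebroid n n M E N) {x : M} {F F' : Frame n E N x}
    (hF : F ∈ A.frames x) :
    F' ∈ A.frames x ↔ (F'.1.trans F.1.symm, F'.2.trans F.2.symm) ∈ excPairs n := by
  constructor
  · intro hF'
    obtain ⟨F₀, -, h⟩ := A.frames_orbit x
    rw [h] at hF hF'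
    obtain ⟨p, hp, rfl⟩ := hF
    obtain ⟨q, hq, rfl⟩ := hF'
    have h1 := trans_mem_excPairs hq (symm_mem_excPairs hp)
    convert h1 using 2
    · refine ContinuousLinearEquiv.ext (funext fun u => ?_)
      exact congrArg p.1.symm (F₀.1.symm_apply_apply (q.1 u))
    · refine ContinuousLinearEquiv.ext (funext fun k => ?_)
      exact congrArg p.2.symm (F₀.2.symm_apply_apply (q.2 k))
  · intro h
    have h1 := A.trans_mem_frames hF h
    convert h1 using 1
    refine Prod.ext ?_ ?_
    · refine ContinuousLinearEquiv.ext (funext fun u => ?_)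
      exact (F.1.apply_symm_apply (F'.1 u)).symm
    · refine ContinuousLinearEquiv.ext (funext fun k => ?_)
      exact (F.2.apply_symm_apply (F'.2 k)).symm

theorem IsNormalFrame.isEtbIso [T2Space M] (h : IsNormalFrame A e F) (hS : HasExtensions e F S K)
    (h0 : ∀ y ∈ e.target, compBL A F S (e.symm y) = 0 ∧ compDL A F K (e.symm y) = 0) :
    IsEtbIso A e (fun x => (F x).1.symm) (fun x => (F x).2.symm) where
  smooth := h.smooth
  smooth_symm := h.smooth_symm
  smooth_fiber := h.smooth_fiber
  frames := fun x hx F' => A.mem_frames_iff (h.frames x hx)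
  anchor := fun x hx a => by
    have h1 := h.anchor x hx ((F x).1.symm a)
    rwa [ContinuousLinearEquiv.apply_symm_apply] at h1
  bracket := fun u v x hx => by
    have hd : ∀ u, DifferentiableAt ℝ (compE e F u) (e x) := fun u =>
      ((h.contDiffOn_compE u).contDiffAt
        (e.open_target.mem_nhds (e.map_source hx))).differentiableAt (by simp)
    have h1 := h.compE_bracket hS u v hx
    have h2 : twistedBracket (fun y => compBL A F S (e.symm y)) (compE e F u) (compE e F v) (e x)
        = twistedBracket (fun _ => 0) (compE e F u) (compE e F v) (e x) := by
      rw [twistedBracket, twistedBracket, (h0 _ (e.map_source hx)).1]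
    rw [h2, ← etbBracket_eq_twistedBracket (hd u) (hd v), compE_apply _ hx] at h1
    exact h1
  map_D := fun k x hx => by
    have h1 := h.compE_D hS k hx
    have h2 : compDL A F K x = 0 := by
      have := (h0 _ (e.map_source hx)).2
      rwa [e.left_inv hx] at this
    rw [h2, LinearMap.zero_apply, add_zero, ← etbD_eq (((h.contDiffOn_compN k).contDiffAt
      (e.open_target.mem_nhds (e.map_source hx))).differentiableAt (by simp)),
      compE_apply _ hx] at h1
    exact h1

theorem Elgebroid.exists_isEtbIso [T2Space M] (hn : 2 ≤ n) (hn' : n ≤ 6)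
    (A : Elgebroid n n M E N) (hA : A.IsExact) (p : M) :
    ∃ (e : OpenPartialHomeomorph M (T n)) (Φ : ∀ x, E x ≃L[ℝ] EMod n)
      (Ψ : ∀ x, N x ≃L[ℝ] NMod n), p ∈ e.source ∧ IsEtbIso A e Φ Ψ := by
  obtain ⟨e, F, h, hp⟩ := A.exists_isNormalFrame hn' hA p
  obtain ⟨O, hO, S, K, γ, F₄, h₁⟩ := h.exists_isNormalAt hn hn' hp
  obtain ⟨e₂, F₂, S₂, K₂, γ₂, F₄', h₂, hγ⟩ := h₁.exists_flat hn hn'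
  obtain ⟨e', F', S', K', hp', h', hS, h0⟩ := h₂.exists_trivial hn hn' hγ
  exact ⟨e', _, _, hp', h'.isEtbIso hS h0⟩

end

end

end Elg

end

theorem mainTheorem1 (n m : ℕ) (hn : 3 ≤ n) (hn' : n ≤ 6)
    (M : Type*) [TopologicalSpace M] [T2Space M]
    [ChartedSpace (EuclideanSpace ℝ (Fin m)) M] [IsManifold (𝓡 m) ∞ M]
    (E : M → Type*) [∀ x, AddCommGroup (E x)] [∀ x, Module ℝ (E x)] [∀ x, TopologicalSpace (E x)]
    [TopologicalSpace (TotalSpace (Elg.EMod n) E)] [FiberBundle (Elg.EMod n) E]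
    [VectorBundle ℝ (Elg.EMod n) E] [ContMDiffVectorBundle ∞ (Elg.EMod n) E (𝓡 m)]
    (N : M → Type*) [∀ x, AddCommGroup (N x)] [∀ x, Module ℝ (N x)] [∀ x, TopologicalSpace (N x)]
    [TopologicalSpace (TotalSpace (Elg.NMod n) N)] [FiberBundle (Elg.NMod n) N]
    [VectorBundle ℝ (Elg.NMod n) N] [ContMDiffVectorBundle ∞ (Elg.NMod n) N (𝓡 m)]
    (A : Elg.Elgebroid n m M E N) (hA : A.IsMExact) (p : M) :
    ∃ (e : OpenPartialHomeomorph M (Elg.T n)) (Φ : ∀ x, E x ≃L[ℝ] Elg.EMod n)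
      (Ψ : ∀ x, N x ≃L[ℝ] Elg.NMod n), p ∈ e.source ∧ Elg.IsEtbIso A e Φ Ψ := by
  obtain ⟨hE, rfl⟩ := hA
  exact A.exists_isEtbIso (by omega) hn' hE p
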